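/- For Schwartz functions $f\in\mathcal S(\mathbb R)$ let $\widehat f(\xi)=\int e^{-ix\xi}f(x)\,dx$, $$e^{it\partial_x^2}f(x)=\frac1{2\pi}\int_{\mathbb R} e^{ix\xi}e^{it\xi^2}\widehat f(\xi)\,d\xi, \qquad \|f\|_{L^p_\gamma(\mathbb R)}=\|(1-\Delta)^{\gamma/2}f\|_{L^p(\mathbb R)},$$ where $(1-\Delta)^{\gamma/2}$ is the Fourier multiplier with symbol $(1+\xi^2)^{\gamma/2}$. For a (positive) Borel measure $\mu$ on $\mathbb R^2$ and $0\le\beta\le3$ let $$[\mu]_{\beta,\mathrm{par}}=\sup_{z\in\mathbb R^2,\ \rho>0}\rho^{-\beta}\,\mu\big((z_1-\rho,z_1+\rho)\times(z_2-\rho^2,z_2+\rho^2)\big).$$ For real $\gamma$ and $1\le p<\infty$, we say that $\mathrm{LS}(\beta,p,\gamma)$ holds if there is a constant $C=C_{\beta,p,\gamma}>0$ such that $$\big\|e^{it\partial_x^2}f\big\|_{L^p(\mathbb R\times[0,1],\,\mu)}\le C\,[\mu]_{\beta,\mathrm{par}}^{1/p}\,\|f\|_{L^p_\gamma(\mathbb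 R)}$$ for all Borel measures $\mu$ on $\mathbb R^2$ with $[\mu]_{\beta,\mathrm{par}}\le1$ and all $f\in\mathcal S(\mathbb R)$. **Theorem.** Let $0\le\beta\le3$ and $\gamma\in\mathbb R$. (i) (Sufficiency) Let $2\le p\le4$. Then $\mathrm{LS}(\beta,p,\gamma)$ holds whenever $$\gamma>\begin{cases}\dfrac{3-\beta}{4}, & \beta\in[1,3],\\[1ex] \dfrac{2-\beta}{2}-\dfrac{1-\beta}{p}, & \beta\in[0,1].\end{cases}$$ (ii) (Necessity) Let $1\le p<\infty$. If $\mathrm{LS}(\beta,p,\gamma)$ holds, then $$\gamma\ge\begin{cases}\max\big\{1-\frac{\beta+1}{p},\ \frac{3-\beta}{2p}\big\}, & \beta\in[1,3],\\[1ex] \max\big\{1-\frac{\beta+1}{p},\ \frac{\beta}{p}\big\}, & \beta\in[0,1].\end{cases}$$ -/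

import Mathlib

open MeasureTheory Set
open scoped ENNReal FourierTransform SchwartzMap

noncomputable section

/-- The Fourier multiplier operator `m(D)`, `D = -i∂ₓ`, on Schwartz functions of one variable:
`m(D) f (x) = (2π)⁻¹ ∫ e^{ixξ} m(ξ) (∫ e^{-iyξ} f(y) dy) dξ`.
Mathlib's transform uses the kernel `e^{-2πiyξ}`, so the angular frequency is `2πξ`. -/
def fourierMult (m : ℝ → ℂ) (f : 𝓢(ℝ, ℂ)) : ℝ → ℂ :=
  𝓕⁻ (fun ξ : ℝ => m (2 * Real.pi * ξ) * 𝓕 (f : ℝ → ℂ) ξ)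

/-- The Schrödinger propagator
`e^{it∂ₓ²} f(x) = (2π)⁻¹ ∫ e^{ixξ} e^{itξ²} f̂(ξ) dξ`, which solves `i ∂ₜ u = ∂ₓ² u`,
as a function of `z = (x, t)`. -/
def schrodinger (f : 𝓢(ℝ, ℂ)) (z : ℝ × ℝ) : ℂ :=
  fourierMult (fun ξ => Complex.exp (Complex.I * ((z.2 * ξ ^ 2 : ℝ) : ℂ))) f z.1

/-- The Sobolev norm `‖f‖_{L^p_γ(ℝ)} = ‖(1 - Δ)^{γ/2} f‖_{L^p(ℝ)}`; the symbol of `1 - Δ`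
is `1 + ξ²`. -/
def sobolevNorm (p γ : ℝ) (f : 𝓢(ℝ, ℂ)) : ℝ≥0∞ :=
  eLpNorm (fourierMult (fun ξ => (((1 + ξ ^ 2) ^ (γ / 2) : ℝ) : ℂ)) f) (ENNReal.ofReal p) volume

/-- The parabolic ball `(z₁ - ρ, z₁ + ρ) × (z₂ - ρ², z₂ + ρ²)`. -/
def parabolicBall (z : ℝ × ℝ) (ρ : ℝ) : Set (ℝ × ℝ) :=
  Ioo (z.1 - ρ) (z.1 + ρ) ×ˢ Ioo (z.2 - ρ ^ 2) (z.2 + ρ ^ 2)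

/-- `[μ]_{β,par} = sup_{z ∈ ℝ², ρ > 0} ρ^{-β} μ(B_{ρ,par}(z))`, as an extended nonnegative real. -/
def parabolicDensity (β : ℝ) (μ : Measure (ℝ × ℝ)) : ℝ≥0∞ :=
  ⨆ (z : ℝ × ℝ) (ρ : ℝ) (_ : 0 < ρ), ENNReal.ofReal (ρ ^ (-β)) * μ (parabolicBall z ρ)

/-- The fractal local smoothing estimate with exponents `β, p, γ`: there is a constant `C` such that
`‖e^{it∂ₓ²} f‖_{L^p(ℝ × [0,1], μ)} ≤ C [μ]_{β,par}^{1/p} ‖f‖_{L^p_γ(ℝ)}`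
for all Borel measures `μ` on `ℝ²` with `[μ]_{β,par} ≤ 1` and all Schwartz functions `f`. -/
def FractalLocalSmoothing (β p γ : ℝ) : Prop :=
  ∃ C : ℝ, 0 < C ∧ ∀ μ : Measure (ℝ × ℝ), parabolicDensity β μ ≤ 1 → ∀ f : 𝓢(ℝ, ℂ),
    eLpNorm (schrodinger f) (ENNReal.ofReal p) (μ.restrict (univ ×ˢ Icc (0 : ℝ) 1)) ≤
      ENNReal.ofReal C * parabolicDensity β μ ^ (1 / p) * sobolevNorm p γ f

end

open Complex

/-! Sufficiency. A Gamma integral removes the Sobolev weight: up to a constant, `e^{it∂ₓ²} f` is `∫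
r^{γ/2-1} e^{-r} u_r dr`, where `u_r(·, t)` has symbol `e^{-(r-it)ξ²}` acting on `g = (1 - Δ)^{γ/2}
f` (`schrodinger_eq_subordination`). The function `u_r` lives at frequencies up to about `r^{-1/2}`,
so it replaces a Littlewood–Paley piece, and its kernel is an explicit Gaussian of complex time `r -
it`. It suffices to bound `∫ |u_r|^p dμ` by `[μ] r^{-e-δ} ‖g‖_p^p` with `e = evolExp β p` for small
`r`, together with a crude bound for `r ≥ 1` (`lintegral_evol_trivial`). Marcinkiewicz interpolation
(`lintegral_evol_interpolate`) reduces the former to `p = 2` and `p = 4`.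

The case `p = 4`. For Lebesgue measure there is only a loss `r^{-δ}` (`localSmoothing_four`). The
spatial Fourier transform of `|u_r|²` at frequency `a` is dominated by the ambiguity function of `g`
averaged near the line `q = 2ta` with width `√r`. Plancherel in `x`, integration in `t` and
Plancherel in `a` leave `‖g‖_4^4`. Over times of length `r` the evolution is an average at parabolic
scale `√r`, so Lebesgue measure may be exchanged for a Frostman measure at the cost `r^{-(3-β)/2}`
(`lintegral_evol_four`).

The case `p = 2` is an iteration over scales (`lintegral_evol_sq`). Let `V(l)` be the `μ`-integral
of the spatial heat average of `|u_r|²` at scale `l`. That average is an exact superposition, over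
velocities `c`, of densities of evolutions with complex time `r + 2l - it`, evaluated along sheared
trajectories (`heatAvg_evol_eq`). For each `c` such a density is compared with its own heat average
at scale `3l`. The symbol of the difference vanishes on the diagonal of frequency pairs, which
improves the decay of the associated kernel enough for a Hilbert–Schmidt estimate
(`lintegral_hs_le`). After localisation to spatial windows (`lintegral_evol_sq_block`) the error is
the geometric mean of the masses of a small sheared box and of a sheared tube of unit duration, both
found by counting parabolic balls (`ParabolicFrostman.tubes_le`). Recombining the velocities gives
`V(l) ≤ V(4l) +` error; about `log (1/r)` steps lead to scale `1`, where a trivial bound holds.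

Necessity. The estimate is tested on multiples of Lebesgue measure over two sets: the tube `|x +
2Nt| ≤ 1/4` of a wave packet at frequency `N` (`FractalLocalSmoothing.packetExp_le`), and the `N⁻¹ ×
N⁻²` box around the focus of a chirp spread over length `N` (`FractalLocalSmoothing.focus_le`).
Letting `N → ∞` compares exponents. -/

/-- The kernel of the convolution operator with Fourier symbol `e^{-Aξ²}`. -/
noncomputable def gaussKernel (A : ℂ) (x : ℝ) : ℂ :=
  (2 * Real.pi : ℝ)⁻¹ * ((Real.pi / A) ^ (1 / 2 : ℂ) * cexp (-(x : ℂ) ^ 2 / (4 * A)))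

/-- The evolution with Fourier symbol `e^{-Aξ²}`. -/
noncomputable def gaussEvol (A : ℂ) (g : ℝ → ℂ) (x : ℝ) : ℂ := ∫ y, gaussKernel A (x - y) * g y

/-- The Fourier transform in angular frequency. -/
noncomputable def angularFT (g : ℝ → ℂ) (ξ : ℝ) : ℂ := ∫ y : ℝ, Complex.exp (Complex.I * (-(ξ * y) : ℝ)) * g y

/-- Bounded integrable functions, a class stable under truncation and under the evolution. -/
structure BddIntegrable (g : ℝ → ℂ) : Prop where
  meas : Measurable g
  int : Integrable g
  bdd : ∃ M : ℝ, 0 ≤ M ∧ ∀ y, ‖g y‖ ≤ M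

/-! ### Gaussian kernels of complex time and the evolutions they generate. -/

lemma gaussKernel_fourier {A : ℂ} (hA : 0 < A.re) (x : ℝ) :
    ∫ ξ : ℝ, cexp (I * (ξ * x : ℝ)) * cexp (-A * (ξ : ℂ) ^ 2) =
      (2 * Real.pi : ℝ) * gaussKernel A x := by
  have := fourierIntegral_gaussian hA (x : ℂ)
  have h2 : ((2 * Real.pi : ℝ) : ℂ) ≠ 0 := by exact_mod_cast (by positivity : (2 * Real.pi) ≠ 0)
  rw [gaussKernel, ofReal_inv, mul_inv_cancel_left₀ h2, neg_div, ← neg_div, ← this]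
  congr 1; ext ξ; push_cast; ring_nf

lemma norm_cexp_I_mul (x : ℝ) : ‖cexp (I * x)‖ = 1 := by
  rw [mul_comm]; exact norm_exp_ofReal_mul_I x

lemma re_ne_zero' {A : ℂ} (hA : 0 < A.re) : A ≠ 0 := by rintro rfl; simp at hA

lemma inv_four_mul_re {A : ℂ} : (1 / (4 * A)).re = A.re / (4 * normSq A) := by
  rw [one_div, mul_inv, show (4 : ℂ)⁻¹ = ((4⁻¹ : ℝ) : ℂ) by push_cast; rfl, re_ofReal_mul, inv_re]
  field_simp

lemma norm_gaussKernel {A : ℂ} (x : ℝ) :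
    ‖gaussKernel A x‖ = (2 * Real.pi)⁻¹ * √(Real.pi / ‖A‖) *
      Real.exp (-(A.re / (4 * normSq A)) * x ^ 2) := by
  rw [gaussKernel, norm_mul, norm_mul, norm_exp, norm_real, Real.norm_of_nonneg (by positivity),
    mul_assoc]
  congr 2
  · rw [show (1 / 2 : ℂ) = ((1 / 2 : ℝ) : ℂ) by push_cast; rfl, norm_cpow_real, norm_div, norm_real,
      Real.norm_of_nonneg Real.pi_pos.le, Real.sqrt_eq_rpow]
  · rw [show -(x : ℂ) ^ 2 / (4 * A) = ((-x ^ 2 : ℝ) : ℂ) * (1 / (4 * A)) by push_cast; ring,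
      re_ofReal_mul, inv_four_mul_re]
    ring_nf

lemma continuous_gaussKernel (A : ℂ) : Continuous (gaussKernel A) := by
  unfold gaussKernel; fun_prop

lemma measurable_gaussKernel : Measurable (fun p : ℂ × ℝ => gaussKernel p.1 p.2) := by
  unfold gaussKernel; fun_prop

lemma normSq_pos' {A : ℂ} (hA : 0 < A.re) : 0 < normSq A := normSq_pos.2 (re_ne_zero' hA)

lemma integrable_gaussKernel {A : ℂ} (hA : 0 < A.re) : Integrable (gaussKernel A) := by
  have h := (integrable_exp_neg_mul_sq (b := A.re / (4 * normSq A))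
    (by have := normSq_pos' hA; positivity)).const_mul ((2 * Real.pi)⁻¹ * √(Real.pi / ‖A‖))
  refine h.mono' (continuous_gaussKernel A).aestronglyMeasurable (.of_forall fun x => ?_)
  rw [norm_gaussKernel]

lemma ofReal_mul_cpow {c : ℝ} (hc : 0 < c) {z : ℂ} (hz : z ≠ 0) (w : ℂ) :
    ((c : ℂ) * z) ^ w = (c : ℂ) ^ w * z ^ w := by
  have hc' : (c : ℂ) ≠ 0 := by exact_mod_cast hc.ne'
  rw [cpow_def_of_ne_zero (mul_ne_zero hc' hz), cpow_def_of_ne_zero hc', cpow_def_of_ne_zero hz,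
    log_ofReal_mul hc hz, add_mul, Complex.exp_add, ofReal_log hc.le]

/-- Since `A` has positive real part its argument is not `π`, so the square root of `A⁻¹` is the
inverse of that of `A` and the complex roots cancel without branch trouble. This fixes the
normalisation in `angularFT_gaussKernel`. -/
lemma gaussKernel_cpow {A : ℂ} (hA : 0 < A.re) :
    (Real.pi / A) ^ (1 / 2 : ℂ) * (Real.pi / (1 / (4 * A))) ^ (1 / 2 : ℂ) = (2 * Real.pi : ℝ) := by
  have h0 := re_ne_zero' hA
  have harg : A.arg ≠ Real.pi := by
    intro h
    rw [arg_eq_pi_iff] at h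
    linarith [h.1]
  have e1 : (Real.pi / A : ℂ) = (Real.pi : ℝ) * A⁻¹ := by ring
  have e2 : (Real.pi / (1 / (4 * A)) : ℂ) = ((4 * Real.pi : ℝ) : ℂ) * A := by
    push_cast; field_simp
  rw [e1, e2, ofReal_mul_cpow Real.pi_pos (inv_ne_zero h0), ofReal_mul_cpow (by positivity) h0,
    inv_cpow _ _ harg]
  have h3 : A ^ (1 / 2 : ℂ) ≠ 0 := by simp [cpow_eq_zero_iff, h0]
  rw [mul_mul_mul_comm, inv_mul_cancel₀ h3, mul_one,
    show (1 / 2 : ℂ) = ((1 / 2 : ℝ) : ℂ) by push_cast; rfl,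
    ← ofReal_cpow Real.pi_pos.le, ← ofReal_cpow (by positivity), ← ofReal_mul, ← Real.sqrt_eq_rpow,
    ← Real.sqrt_eq_rpow, ← Real.sqrt_mul Real.pi_pos.le]
  congr 1
  rw [show Real.pi * (4 * Real.pi) = (2 * Real.pi) ^ 2 by ring, Real.sqrt_sq (by positivity)]

lemma angularFT_gaussKernel {A : ℂ} (hA : 0 < A.re) (ξ : ℝ) :
    angularFT (gaussKernel A) ξ = cexp (-A * (ξ : ℂ) ^ 2) := by
  have hb : 0 < (1 / (4 * A)).re := by
    rw [inv_four_mul_re]; have := normSq_pos' hA; positivity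
  have := fourierIntegral_gaussian hb (-ξ : ℂ)
  have h0 := re_ne_zero' hA
  have h2 : ((2 * Real.pi : ℝ) : ℂ) ≠ 0 := by exact_mod_cast (by positivity : (2 * Real.pi) ≠ 0)
  have e : ∀ y : ℝ, cexp (I * (-(ξ * y) : ℝ)) * gaussKernel A y =
      ((2 * Real.pi : ℝ)⁻¹ * (Real.pi / A) ^ (1 / 2 : ℂ)) *
        (cexp (I * (-ξ : ℂ) * y) * cexp (-(1 / (4 * A)) * (y : ℂ) ^ 2)) := by
    intro y
    rw [gaussKernel]
    have e1 : I * ((-(ξ * y) : ℝ) : ℂ) = I * (-ξ : ℂ) * y := by push_cast; ring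
    have e2 : -(y : ℂ) ^ 2 / (4 * A) = -(1 / (4 * A)) * (y : ℂ) ^ 2 := by ring
    rw [e1, e2]; push_cast; ring
  rw [angularFT]
  simp_rw [e]
  rw [integral_const_mul, this, ← mul_assoc, mul_assoc, mul_assoc, ← mul_assoc (_ ^ _),
    gaussKernel_cpow hA, ← mul_assoc, ofReal_inv, inv_mul_cancel₀ h2, one_mul]
  congr 1
  field_simp

lemma norm_angularFT_le (g : ℝ → ℂ) (ξ : ℝ) : ‖angularFT g ξ‖ ≤ ∫ y, ‖g y‖ := by
  refine (norm_integral_le_integral_norm _).trans (le_of_eq ?_)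
  simp_rw [norm_mul, norm_cexp_I_mul, one_mul]

lemma continuous_angularFT {g : ℝ → ℂ} (hg : Integrable g) : Continuous (angularFT g) := by
  unfold angularFT
  refine continuous_of_dominated (bound := fun y => ‖g y‖) ?_ ?_ hg.norm ?_
  · intro ξ
    exact (by fun_prop : Continuous fun y : ℝ => cexp (I * (-(ξ * y) : ℝ))).aestronglyMeasurable.mul
      hg.aestronglyMeasurable
  · intro ξ
    refine .of_forall fun y => ?_
    rw [norm_mul, norm_cexp_I_mul, one_mul]
  · refine .of_forall fun y => ?_
    fun_prop

lemma integrable_gaussian_symbol {A : ℂ} (hA : 0 < A.re) :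
    Integrable (fun ξ : ℝ => cexp (-A * (ξ : ℂ) ^ 2)) :=
  integrable_cexp_neg_mul_sq hA

lemma norm_gaussKernel_le {A : ℂ} (hA : 0 < A.re) (x : ℝ) :
    ‖gaussKernel A x‖ ≤ (2 * Real.pi)⁻¹ * √(Real.pi / ‖A‖) := by
  rw [norm_gaussKernel]
  refine mul_le_of_le_one_right (by positivity) (Real.exp_le_one_iff.2 ?_)
  have := normSq_pos' hA
  have : 0 ≤ A.re / (4 * normSq A) * x ^ 2 := by positivity
  linarith

lemma gaussKernel_mul_integrable {A : ℂ} (hA : 0 < A.re) {g : ℝ → ℂ} (hg : Integrable g) (x : ℝ) :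
    Integrable (fun y => gaussKernel A (x - y) * g y) :=
  hg.bdd_mul (c := (2 * Real.pi)⁻¹ * √(Real.pi / ‖A‖))
    ((continuous_gaussKernel A).comp (by fun_prop)).aestronglyMeasurable
    (.of_forall fun y => norm_gaussKernel_le hA _)

lemma gaussKernel_prod_integrable {A : ℂ} (hA : 0 < A.re) {g : ℝ → ℂ} (hg : Integrable g) :
    Integrable (fun p : ℝ × ℝ => gaussKernel A (p.1 - p.2) * g p.2) (volume.prod volume) := by
  have := hg.convolution_integrand (ContinuousLinearMap.mul ℝ ℂ).flip (integrable_gaussKernel hA)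
  exact this.congr (.of_forall fun p => by simp [mul_comm])

lemma integrable_gaussEvol {A : ℂ} (hA : 0 < A.re) {g : ℝ → ℂ} (hg : Integrable g) :
    Integrable (gaussEvol A g) :=
  (gaussKernel_prod_integrable hA hg).integral_prod_left

lemma measurable_gaussEvol {g : ℝ → ℂ} (hg : Measurable g) :
    Measurable (fun p : ℂ × ℝ => gaussEvol p.1 g p.2) := by
  unfold gaussEvol
  refine StronglyMeasurable.measurable ?_
  refine StronglyMeasurable.integral_prod_right (f := fun p : ℂ × ℝ => fun y => gaussKernel p.1 (p.2 - y) * g y) ?_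
  refine Measurable.stronglyMeasurable ?_
  have h1 : Measurable (fun q : (ℂ × ℝ) × ℝ => gaussKernel q.1.1 (q.1.2 - q.2)) :=
    measurable_gaussKernel.comp (by fun_prop : Measurable fun q : (ℂ × ℝ) × ℝ => (q.1.1, q.1.2 - q.2))
  exact h1.mul (hg.comp measurable_snd)

lemma norm_gaussEvol_le {A : ℂ} (g : ℝ → ℂ) (x : ℝ) :
    ‖gaussEvol A g x‖ ≤ ∫ y, ‖gaussKernel A (x - y)‖ * ‖g y‖ := by
  refine (norm_integral_le_integral_norm _).trans (le_of_eq ?_)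
  simp_rw [norm_mul]

lemma enorm_gaussEvol_le {A : ℂ} (g : ℝ → ℂ) (x : ℝ) :
    ‖gaussEvol A g x‖ₑ ≤ ∫⁻ y, ‖gaussKernel A (x - y)‖ₑ * ‖g y‖ₑ := by
  refine (enorm_integral_le_lintegral_enorm _).trans (le_of_eq ?_)
  simp_rw [enorm_mul]

lemma BddIntegrable.evol {A : ℂ} (hA : 0 < A.re) {g : ℝ → ℂ} (hg : BddIntegrable g) :
    BddIntegrable (gaussEvol A g) where
  meas := by
    have h : Measurable (fun x : ℝ => (A, x)) := by fun_prop
    have h2 := (measurable_gaussEvol hg.meas).comp h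
    exact h2
  int := integrable_gaussEvol hA hg.int
  bdd := by
    refine ⟨(2 * Real.pi)⁻¹ * √(Real.pi / ‖A‖) * ∫ y, ‖g y‖, by positivity, fun x => ?_⟩
    refine (norm_gaussEvol_le g x).trans ?_
    rw [← integral_const_mul]
    have h1 : Integrable (fun y => ‖gaussKernel A (x - y)‖ * ‖g y‖) :=
      (gaussKernel_mul_integrable hA hg.int x).norm.congr (.of_forall fun y => norm_mul _ _)
    exact integral_mono h1 (hg.int.norm.const_mul _) fun y =>
      mul_le_mul_of_nonneg_right (norm_gaussKernel_le hA _) (norm_nonneg _)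

lemma BddIntegrable.memLp_two {g : ℝ → ℂ} (hg : BddIntegrable g) : MemLp g 2 := by
  obtain ⟨M, -, hM⟩ := hg.bdd
  rw [memLp_two_iff_integrable_sq_norm hg.meas.aestronglyMeasurable]
  refine (hg.int.norm.bdd_mul (c := M) hg.meas.norm.aestronglyMeasurable
    (.of_forall fun y => by simpa using hM y)).congr (.of_forall fun y => by simp [sq])

lemma angularFT_gaussEvol {A : ℂ} (hA : 0 < A.re) {g : ℝ → ℂ} (hg : Integrable g) (ξ : ℝ) :
    angularFT (gaussEvol A g) ξ = cexp (-A * (ξ : ℂ) ^ 2) * angularFT g ξ := by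
  have hint := gaussKernel_prod_integrable hA hg
  calc angularFT (gaussEvol A g) ξ
      = ∫ x : ℝ, ∫ y : ℝ, cexp (I * (-(ξ * x) : ℝ)) * (gaussKernel A (x - y) * g y) := by
        unfold angularFT gaussEvol; simp_rw [← integral_const_mul]
    _ = ∫ y : ℝ, ∫ x : ℝ, cexp (I * (-(ξ * x) : ℝ)) * (gaussKernel A (x - y) * g y) := by
        refine integral_integral_swap ?_
        refine hint.bdd_mul (c := 1) ?_ (.of_forall fun p => (norm_cexp_I_mul _).le)
        exact (by fun_prop : Continuous fun p : ℝ × ℝ =>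
          cexp (I * (-(ξ * p.1) : ℝ))).aestronglyMeasurable
    _ = ∫ y : ℝ, angularFT (gaussKernel A) ξ * (cexp (I * (-(ξ * y) : ℝ)) * g y) := by
        congr 1; ext y
        have := integral_add_right_eq_self (μ := volume)
          (fun x : ℝ => cexp (I * (-(ξ * x) : ℝ)) * (gaussKernel A (x - y) * g y)) y
        rw [← this, angularFT, ← integral_mul_const]
        congr 1; ext x
        rw [add_sub_cancel_right, show I * ((-(ξ * (x + y)) : ℝ) : ℂ) =
          I * ((-(ξ * x) : ℝ) : ℂ) + I * ((-(ξ * y) : ℝ) : ℂ) by push_cast; ring, Complex.exp_add]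
        ring
    _ = _ := by rw [integral_const_mul, angularFT_gaussKernel hA]; rfl

lemma gaussEvol_eq_fourier {A : ℂ} (hA : 0 < A.re) {g : ℝ → ℂ} (hg : Integrable g) (x : ℝ) :
    (2 * Real.pi : ℝ) * gaussEvol A g x =
      ∫ ξ : ℝ, angularFT g ξ * (cexp (I * (ξ * x : ℝ)) * cexp (-A * (ξ : ℂ) ^ 2)) := by
  have hint : Integrable (fun p : ℝ × ℝ => g p.1 * cexp (-A * (p.2 : ℂ) ^ 2))
    (volume.prod volume) := hg.mul_prod (integrable_gaussian_symbol hA)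
  calc (2 * Real.pi : ℝ) * gaussEvol A g x
      = ∫ y : ℝ, ∫ ξ : ℝ, cexp (I * (ξ * (x - y) : ℝ)) * (g y * cexp (-A * (ξ : ℂ) ^ 2)) := by
        rw [gaussEvol, ← integral_const_mul]
        congr 1; ext y
        rw [← mul_assoc, ← gaussKernel_fourier hA, ← integral_mul_const]
        congr 1; ext ξ; ring
    _ = ∫ ξ : ℝ, ∫ y : ℝ, cexp (I * (ξ * (x - y) : ℝ)) * (g y * cexp (-A * (ξ : ℂ) ^ 2)) := by
        refine integral_integral_swap ?_
        refine hint.bdd_mul (c := 1) ?_ (.of_forall fun p => (norm_cexp_I_mul _).le)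
        exact (by fun_prop : Continuous fun p : ℝ × ℝ =>
          cexp (I * (p.2 * (x - p.1) : ℝ))).aestronglyMeasurable
    _ = _ := by
        congr 1; ext ξ
        rw [angularFT, ← integral_mul_const]
        congr 1; ext y
        rw [show I * ((ξ * (x - y) : ℝ) : ℂ) =
          I * ((ξ * x : ℝ) : ℂ) + I * ((-(ξ * y) : ℝ) : ℂ) by push_cast; ring, Complex.exp_add]
        ring

/-- The symbols `e^{-Aξ²}` multiply, so complex times add. This allows time shifts over short
intervals, and allows half of the smoothing to be moved onto the datum. -/
lemma gaussEvol_add {A B : ℂ} (hA : 0 < A.re) (hB : 0 < B.re) {g : ℝ → ℂ} (hg : Integrable g)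
    (x : ℝ) : gaussEvol (A + B) g x = gaussEvol A (gaussEvol B g) x := by
  have h2 : ((2 * Real.pi : ℝ) : ℂ) ≠ 0 := by exact_mod_cast (by positivity : (2 * Real.pi) ≠ 0)
  apply mul_left_cancel₀ h2
  rw [gaussEvol_eq_fourier (by simp; linarith) hg, gaussEvol_eq_fourier hA (integrable_gaussEvol hB hg)]
  congr 1; ext ξ
  rw [angularFT_gaussEvol hB hg, show -(A + B) * (ξ : ℂ) ^ 2 = -A * (ξ : ℂ) ^ 2 + -B * (ξ : ℂ) ^ 2 by ring,
    Complex.exp_add]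
  ring

/-! ### Plancherel's theorem and Hölder's inequality for kernels. -/

lemma angularFT_eq_fourier (g : ℝ → ℂ) (ξ : ℝ) : angularFT g ξ = 𝓕 g (ξ / (2 * Real.pi)) := by
  rw [Real.fourier_real_eq_integral_exp_smul, angularFT]
  congr 1; ext y
  rw [smul_eq_mul]
  congr 2
  push_cast; field_simp

/-- Both functions define the same tempered distribution: against a smooth compactly supported
function, the transform moves onto the test function by duality for the `L²` class and by Fubini for
the integral. -/
lemma fourier_L2_eq {f : ℝ → ℂ} (h1 : Integrable f) (h2 : MemLp f 2) :
    ((𝓕 (h2.toLp f) : Lp ℂ 2 (volume : Measure ℝ)) : ℝ → ℂ) =ᵐ[volume] 𝓕 f := by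
  have hc : Continuous (𝓕 f) :=
    VectorFourier.fourierIntegral_continuous Real.continuous_fourierChar (by fun_prop) h1
  refine ae_eq_of_integral_contDiff_smul_eq ?_ hc.locallyIntegrable fun φ hφ hφc => ?_
  · exact (Lp.memLp _).locallyIntegrable (by norm_num)
  let ψ : 𝓢(ℝ, ℂ) := (hφc.comp_left (g := ((↑) : ℝ → ℂ)) rfl).toSchwartzMap (ofRealCLM.contDiff.comp hφ)
  have e1 : ∀ F : ℝ → ℂ, ∫ x, φ x • F x = ∫ x, ψ x • F x := by
    intro F; congr 1
  rw [e1, e1, ← Lp.toTemperedDistribution_apply, ← Lp.fourier_toTemperedDistribution_eq]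
  have e2 : (𝓕 ((h2.toLp f : Lp ℂ 2 (volume : Measure ℝ)) : 𝓢'(ℝ, ℂ))) ψ =
      ((h2.toLp f : Lp ℂ 2 (volume : Measure ℝ)) : 𝓢'(ℝ, ℂ)) (𝓕 ψ) := rfl
  rw [e2, Lp.toTemperedDistribution_apply]
  have e3 := VectorFourier.integral_fourierIntegral_smul_eq_flip (μ := volume) (ν := volume)
    (L := innerₗ ℝ) (f := ψ) (g := f) Real.continuous_fourierChar (by fun_prop) ψ.integrable h1
  have e4 : ∫ x, (𝓕 ψ) x • (h2.toLp f) x = ∫ x, (𝓕 (ψ : ℝ → ℂ)) x • f x := by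
    refine integral_congr_ae ?_
    filter_upwards [h2.coeFn_toLp] with x hx
    rw [hx, SchwartzMap.fourier_coe]
  rw [e4]
  rw [flip_innerₗ] at e3
  exact e3

lemma lintegral_fourier_sq {f : ℝ → ℂ} (h1 : Integrable f) (h2 : MemLp f 2) :
    ∫⁻ ξ, ‖𝓕 f ξ‖ₑ ^ 2 = ∫⁻ x, ‖f x‖ₑ ^ 2 := by
  have h := Lp.norm_fourier_eq (h2.toLp f)
  have h' : ‖(𝓕 (h2.toLp f) : Lp ℂ 2 (volume : Measure ℝ))‖ₑ = ‖h2.toLp f‖ₑ := by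
    rw [← ofReal_norm, h, ofReal_norm]
  rw [Lp.enorm_def, Lp.enorm_def, eLpNorm_congr_ae (fourier_L2_eq h1 h2),
    eLpNorm_congr_ae h2.coeFn_toLp] at h'
  have := congrArg (fun t : ℝ≥0∞ => t ^ (2 : ℝ)) h'
  simp only [eLpNorm_eq_lintegral_rpow_enorm_toReal (p := 2) (by norm_num) (by norm_num),
    ← ENNReal.rpow_mul] at this
  simpa using this

lemma lintegral_comp_div {f : ℝ → ℝ≥0∞} (hf : Measurable f) {a : ℝ} (ha : 0 < a) :
    ∫⁻ x, f (x / a) = ENNReal.ofReal a * ∫⁻ x, f x := by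
  have h := Real.map_volume_mul_left (a := a⁻¹) (by positivity)
  rw [inv_inv, abs_of_pos ha] at h
  rw [← smul_eq_mul, ← lintegral_smul_measure, ← h, lintegral_map hf (by fun_prop)]
  simp_rw [div_eq_inv_mul]

/-- Plancherel's theorem in angular frequency. -/
lemma lintegral_angularFT_sq {f : ℝ → ℂ} (h1 : Integrable f) (h2 : MemLp f 2) :
    ∫⁻ ξ, ‖angularFT f ξ‖ₑ ^ 2 = ENNReal.ofReal (2 * Real.pi) * ∫⁻ x, ‖f x‖ₑ ^ 2 := by
  have hc : Continuous (𝓕 f) :=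
    VectorFourier.fourierIntegral_continuous Real.continuous_fourierChar (by fun_prop) h1
  simp_rw [angularFT_eq_fourier, ← lintegral_fourier_sq h1 h2]
  exact lintegral_comp_div (f := fun ξ => ‖𝓕 f ξ‖ₑ ^ 2) (by fun_prop) (by positivity)

/-- Hölder's inequality for the average against a kernel. -/
lemma lintegral_kernel_rpow_le {α : Type*} [MeasurableSpace α] {μ : Measure α} {p : ℝ} (hp : 1 ≤ p)
    {k h : α → ℝ≥0∞} (hk : AEMeasurable k μ) (hh : AEMeasurable h μ) :
    (∫⁻ x, k x * h x ∂μ) ^ p ≤ (∫⁻ x, k x ∂μ) ^ (p - 1) * ∫⁻ x, k x * h x ^ p ∂μ := by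
  rcases hp.eq_or_lt with rfl | hp
  · simp
  have hpq : p.HolderConjugate (p / (p - 1)) := Real.HolderConjugate.conjExponent hp
  have hp0 : 0 < p := by linarith
  set q := p / (p - 1) with hq
  have hq1 : q⁻¹ + p⁻¹ = 1 := by rw [add_comm]; exact hpq.inv_add_inv_eq_one
  have hqp : 0 < q := hpq.symm.pos
  have key := ENNReal.lintegral_mul_le_Lp_mul_Lq μ hpq.symm (f := fun x => k x ^ q⁻¹)
    (g := fun x => k x ^ p⁻¹ * h x) (hk.pow_const _) ((hk.pow_const _).mul hh)
  have e1 : ∀ x, k x ^ q⁻¹ * (k x ^ p⁻¹ * h x) = k x * h x := fun x => by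
    rw [← mul_assoc, ← ENNReal.rpow_add_of_nonneg _ _ (by positivity) (by positivity), hq1, ENNReal.rpow_one]
  have e2 : ∀ x, (k x ^ q⁻¹) ^ q = k x := fun x => by
    rw [← ENNReal.rpow_mul, inv_mul_cancel₀ hqp.ne', ENNReal.rpow_one]
  have e3 : ∀ x, (k x ^ p⁻¹ * h x) ^ p = k x * h x ^ p := fun x => by
    rw [ENNReal.mul_rpow_of_nonneg _ _ hp0.le, ← ENNReal.rpow_mul, inv_mul_cancel₀ hp0.ne', ENNReal.rpow_one]
  simp only [Pi.mul_apply, e1, e2, e3] at key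
  refine (ENNReal.rpow_le_rpow key hp0.le).trans (le_of_eq ?_)
  rw [ENNReal.mul_rpow_of_nonneg _ _ hp0.le, ← ENNReal.rpow_mul, ← ENNReal.rpow_mul,
    one_div_mul_cancel hp0.ne', ENNReal.rpow_one]
  congr 2
  rw [hq]; field_simp

lemma lintegral_kernel_sq_le {α : Type*} [MeasurableSpace α] {μ : Measure α}
    {k h : α → ℝ≥0∞} (hk : AEMeasurable k μ) (hh : AEMeasurable h μ) :
    (∫⁻ x, k x * h x ∂μ) ^ 2 ≤ (∫⁻ x, k x ∂μ) * ∫⁻ x, k x * h x ^ 2 ∂μ := by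
  have := lintegral_kernel_rpow_le (p := 2) (by norm_num) hk hh
  norm_num at this
  exact this

/-! ### Complex time `r - it` and the ambiguity function. -/

/-- The complex time `r - it`. -/
def cplxTime (r t : ℝ) : ℂ := ⟨r, -t⟩

@[simp] lemma cplxTime_re (r t : ℝ) : (cplxTime r t).re = r := rfl

@[simp] lemma cplxTime_im (r t : ℝ) : (cplxTime r t).im = -t := rfl

lemma cplxTime_add (r s t u : ℝ) : cplxTime r t + cplxTime s u = cplxTime (r + s) (t + u) := by
  apply Complex.ext <;> simp; ring

lemma normSq_cplxTime (r t : ℝ) : normSq (cplxTime r t) = r ^ 2 + t ^ 2 := by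
  simp [normSq_apply, sq]

lemma norm_cplxTime (r t : ℝ) : ‖cplxTime r t‖ = √(r ^ 2 + t ^ 2) := by
  rw [← normSq_cplxTime, normSq_eq_norm_sq, Real.sqrt_sq (norm_nonneg _)]

lemma measurable_cplxTime : Measurable fun p : ℝ × ℝ => cplxTime p.1 p.2 := by
  have : (fun p : ℝ × ℝ => cplxTime p.1 p.2) = fun p : ℝ × ℝ => (p.1 : ℂ) - p.2 * I := by
    ext p; apply Complex.ext <;> simp
  rw [this]; fun_prop

lemma gaussKernel_cplxTime {r : ℝ} (hr : 0 < r) (t x : ℝ) :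
    gaussKernel (cplxTime r t) x = ((2 * Real.pi : ℝ)⁻¹ * (Real.pi / cplxTime r t) ^ (1 / 2 : ℂ)) *
      cexp (-((r / (4 * (r ^ 2 + t ^ 2)) : ℝ) + (t / (4 * (r ^ 2 + t ^ 2)) : ℝ) * I) * (x : ℂ) ^ 2) := by
  rw [gaussKernel, mul_assoc]
  congr 3
  have h0 : cplxTime r t ≠ 0 := re_ne_zero' hr
  have hS : ((r ^ 2 + t ^ 2 : ℝ) : ℂ) ≠ 0 := by exact_mod_cast (by positivity : r ^ 2 + t ^ 2 ≠ 0)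
  have e : cplxTime r t * ((r : ℂ) + t * I) = ((r ^ 2 + t ^ 2 : ℝ) : ℂ) := by
    apply Complex.ext
    · simp [sq]
    · simp [sq]; ring
  have e2 : ((r : ℂ) + t * I) = ((r ^ 2 + t ^ 2 : ℝ) : ℂ) / cplxTime r t := by
    rw [eq_div_iff h0, mul_comm, e]
  have e3 : (((r / (4 * (r ^ 2 + t ^ 2)) : ℝ) : ℂ) + (t / (4 * (r ^ 2 + t ^ 2)) : ℝ) * I) =
      ((r : ℂ) + t * I) / (4 * ((r ^ 2 + t ^ 2 : ℝ) : ℂ)) := by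
    push_cast; ring
  rw [e3, e2]
  field_simp

lemma norm_gaussKernel_cplxTime {r : ℝ} (t x : ℝ) :
    ‖gaussKernel (cplxTime r t) x‖ = (2 * Real.pi)⁻¹ * √(Real.pi / √(r ^ 2 + t ^ 2)) *
      Real.exp (-(r / (4 * (r ^ 2 + t ^ 2))) * x ^ 2) := by
  rw [norm_gaussKernel, norm_cplxTime, normSq_cplxTime, cplxTime_re]

/-- The heat kernel in the separation variable of the ambiguity function. -/
noncomputable def ambKernel (r s : ℝ) : ℝ := √(1 / (8 * Real.pi * r)) * Real.exp (-s ^ 2 / (8 * r))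

lemma norm_integral_cexp_quadratic_real {b c d : ℝ} (hb : 0 < b) :
    ‖∫ x : ℝ, cexp (-(b : ℂ) * (x : ℂ) ^ 2 + (c * I) * x + d)‖ =
      √(Real.pi / b) * Real.exp (d - c ^ 2 / (4 * b)) := by
  rw [integral_cexp_quadratic (by simpa using hb), norm_mul, norm_exp, neg_neg]
  congr 1
  · rw [show (1 / 2 : ℂ) = ((1 / 2 : ℝ) : ℂ) by push_cast; rfl, norm_cpow_real, norm_div, norm_real,
      norm_real, Real.norm_of_nonneg Real.pi_pos.le, Real.norm_of_nonneg hb.le, Real.sqrt_eq_rpow]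
  · congr 1
    have : (d : ℂ) - (c * I) ^ 2 / (4 * -(b : ℂ)) = ((d - c ^ 2 / (4 * b) : ℝ) : ℂ) := by
      push_cast
      rw [mul_pow, I_sq]
      have : (b : ℂ) ≠ 0 := by exact_mod_cast hb.ne'
      field_simp
    rw [this, ofReal_re]

/-- The integrand is a Gaussian in `x`. With `S = r² + t²`, the exponent `-q²r/(8S) - (qt/(2S) - a)²
S/(2r)` left after integration collapses to `-ra²/2 - (q - 2ta)²/(8r)`. The correlation thus
concentrates on the classical trajectory `q = 2ta`, with width `√r`. -/
lemma norm_gaussKernel_correlation {r : ℝ} (hr : 0 < r) (t a q : ℝ) :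
    ‖∫ x : ℝ, cexp (I * (-(a * x) : ℝ)) * (gaussKernel (cplxTime r t) (x - q / 2) *
      (starRingEnd ℂ) (gaussKernel (cplxTime r t) (x + q / 2)))‖ =
      Real.exp (-(r * a ^ 2 / 2)) * ambKernel r (q - 2 * t * a) := by
  set S := r ^ 2 + t ^ 2 with hSdef
  have hS : 0 < S := by positivity
  set C : ℂ := (2 * Real.pi : ℝ)⁻¹ * (Real.pi / cplxTime r t) ^ (1 / 2 : ℂ) with hC
  have key : ∀ x : ℝ, cexp (I * (-(a * x) : ℝ)) * (gaussKernel (cplxTime r t) (x - q / 2) *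
      (starRingEnd ℂ) (gaussKernel (cplxTime r t) (x + q / 2))) =
      (C * (starRingEnd ℂ) C) * cexp (-((r / (2 * S) : ℝ) : ℂ) * (x : ℂ) ^ 2 +
        (((q * t / (2 * S) - a : ℝ) : ℂ) * I) * x + ((-(q ^ 2 * r / (8 * S)) : ℝ) : ℂ)) := by
    intro x
    rw [gaussKernel_cplxTime hr, gaussKernel_cplxTime hr, map_mul, ← exp_conj, ← hC,
      mul_mul_mul_comm, ← Complex.exp_add, mul_left_comm, ← Complex.exp_add]
    congr 2
    simp only [map_mul, map_neg, map_add, map_pow, conj_ofReal, conj_I]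
    rw [← hSdef]
    push_cast
    have : (S : ℂ) ≠ 0 := by exact_mod_cast hS.ne'
    field_simp
    ring
  simp_rw [key]
  rw [integral_const_mul, norm_mul, norm_integral_cexp_quadratic_real (by positivity), norm_mul,
    RCLike.norm_conj]
  have hCn : ‖C‖ * ‖C‖ = (2 * Real.pi)⁻¹ ^ 2 * (Real.pi / √S) := by
    have : ‖C‖ = (2 * Real.pi)⁻¹ * √(Real.pi / √S) := by
      have h := norm_gaussKernel_cplxTime (r := r) t 0
      rw [gaussKernel_cplxTime hr] at h
      simpa [hC] using h
    rw [this, mul_mul_mul_comm, Real.mul_self_sqrt (by positivity), sq]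
  rw [hCn, ambKernel, mul_left_comm (Real.exp _), ← Real.exp_add, ← mul_assoc (_ * _) (√_)]
  congr 1
  · rw [mul_assoc]
    have h1 : √(Real.pi / (r / (2 * S))) = √S * √(2 * Real.pi / r) := by
      rw [← Real.sqrt_mul hS.le]; congr 1; field_simp
    rw [h1, show Real.pi / √S * (√S * √(2 * Real.pi / r)) = Real.pi * √(2 * Real.pi / r) by
      have := (Real.sqrt_pos.2 hS).ne'; field_simp]
    symm
    rw [Real.sqrt_eq_iff_mul_self_eq (by positivity) (by positivity)]
    rw [show ∀ s : ℝ, (2 * Real.pi)⁻¹ ^ 2 * (Real.pi * s) * ((2 * Real.pi)⁻¹ ^ 2 * (Real.pi * s)) =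
      (2 * Real.pi)⁻¹ ^ 4 * Real.pi ^ 2 * (s * s) by intro s; ring, Real.mul_self_sqrt (by positivity)]
    field_simp
    norm_num
  · congr 1
    rw [hSdef]
    field_simp
    ring

/-- The ambiguity function of `g`. -/
noncomputable def ambiguity (g : ℝ → ℂ) (a q : ℝ) : ℂ :=
  angularFT (fun y => g (y + q) * (starRingEnd ℂ) (g y)) a

lemma gaussKernel_correlation_integrable {A : ℂ} (hA : 0 < A.re) {g : ℝ → ℂ} (hg : BddIntegrable g)
    (a : ℝ) : Integrable (fun w : ℝ × ℝ × ℝ => cexp (I * (-(a * w.1) : ℝ)) *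
      ((gaussKernel A (w.1 - w.2.2) * g w.2.2) *
        (starRingEnd ℂ) (gaussKernel A (w.1 - w.2.1) * g w.2.1)))
      (volume.prod (volume.prod volume)) := by
  have h1 := (gaussKernel_prod_integrable hA hg.int).mul_prod (hg.int)
  have h2 := (measurePreserving_prodAssoc (volume : Measure ℝ) (volume : Measure ℝ)
    (volume : Measure ℝ)).symm.integrable_comp_of_integrable h1
  have hmp : MeasurePreserving (fun w : ℝ × ℝ × ℝ => (w.1, w.2.2, w.2.1))
      (volume.prod (volume.prod volume)) (volume.prod (volume.prod volume)) :=
    (MeasurePreserving.id _).prod Measure.measurePreserving_swap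
  have h3 := hmp.integrable_comp_of_integrable h2
  set M := (2 * Real.pi)⁻¹ * √(Real.pi / ‖A‖)
  have hk := continuous_gaussKernel A
  have hm := hg.meas
  refine (h3.norm.const_mul M).mono' (Measurable.aestronglyMeasurable ?_) (.of_forall fun w => ?_)
  · have h4 : Measurable fun z : ℂ => (starRingEnd ℂ) z := continuous_conj.measurable
    exact Measurable.mul (by fun_prop) (((hk.measurable.comp (by fun_prop)).mul (hm.comp (by fun_prop))).mul
      (h4.comp ((hk.measurable.comp (by fun_prop)).mul (hm.comp (by fun_prop)))))
  · simp only [norm_mul, norm_cexp_I_mul, one_mul, RCLike.norm_conj, Function.comp]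
    have := norm_gaussKernel_le hA (w.1 - w.2.1)
    have h5 : 0 ≤ ‖gaussKernel A (w.1 - w.2.2)‖ * ‖g w.2.2‖ * ‖g w.2.1‖ := by positivity
    have := mul_le_mul_of_nonneg_left this h5
    calc _ = ‖gaussKernel A (w.1 - w.2.2)‖ * ‖g w.2.2‖ * ‖g w.2.1‖ * ‖gaussKernel A (w.1 - w.2.1)‖ := by ring
      _ ≤ _ := by rw [mul_comm M]; exact this

/-- Write `|u|²` as a double integral over two source points `y` and `y + q`. Translating `x` by `y`
extracts the phase `e^{-iay}` from the kernel correlation, and the `y`-integral of this phase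
against `g(y + q) conj (g y)` is the ambiguity function. Only the modulus of the remaining
correlation is needed. -/
lemma enorm_angularFT_density_le {r : ℝ} (hr : 0 < r) (t : ℝ) {g : ℝ → ℂ} (hg : BddIntegrable g)
    (a : ℝ) :
    ‖angularFT (fun x => gaussEvol (cplxTime r t) g x *
      (starRingEnd ℂ) (gaussEvol (cplxTime r t) g x)) a‖ₑ ≤
      ENNReal.ofReal (Real.exp (-(r * a ^ 2 / 2))) *
        ∫⁻ q, ENNReal.ofReal (ambKernel r (q - 2 * t * a)) * ‖ambiguity g a q‖ₑ := by
  set A := cplxTime r t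
  have hA : 0 < A.re := hr
  have hint := gaussKernel_correlation_integrable hA hg a
  set κ : ℝ → ℝ → ℂ := fun y' y => ∫ x : ℝ, cexp (I * (-(a * x) : ℝ)) *
    (gaussKernel A (x - y) * (starRingEnd ℂ) (gaussKernel A (x - y'))) with hκ
  have e1 : angularFT (fun x => gaussEvol A g x * (starRingEnd ℂ) (gaussEvol A g x)) a =
      ∫ p : ℝ × ℝ, (g p.2 * (starRingEnd ℂ) (g p.1)) * κ p.1 p.2 := by
    calc _ = ∫ x : ℝ, ∫ p : ℝ × ℝ, cexp (I * (-(a * x) : ℝ)) * ((gaussKernel A (x - p.2) * g p.2) *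
        (starRingEnd ℂ) (gaussKernel A (x - p.1) * g p.1)) := by
          rw [angularFT]; congr 1; ext x
          rw [integral_const_mul]; congr 1
          rw [gaussEvol, ← integral_conj, mul_comm, ← integral_prod_mul]
          congr 1; ext p; ring
      _ = ∫ p : ℝ × ℝ, ∫ x : ℝ, cexp (I * (-(a * x) : ℝ)) * ((gaussKernel A (x - p.2) * g p.2) *
        (starRingEnd ℂ) (gaussKernel A (x - p.1) * g p.1)) := integral_integral_swap hint
      _ = _ := by
          congr 1; ext p
          rw [hκ, ← integral_const_mul]; congr 1; ext x
          rw [map_mul]; ring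
  have hint2 : Integrable (fun p : ℝ × ℝ => (g p.2 * (starRingEnd ℂ) (g p.1)) * κ p.1 p.2)
      (volume.prod volume) := by
    refine hint.integral_prod_right.congr (.of_forall fun p => ?_)
    simp only [hκ]
    rw [← integral_const_mul]; congr 1; ext x
    rw [map_mul]; ring
  have hκ2 : ∀ y q, κ y (y + q) = cexp (I * (-(a * y) : ℝ)) * κ 0 q := by
    intro y q
    simp only [hκ]
    rw [← integral_add_right_eq_self (μ := volume) (fun x : ℝ => cexp (I * (-(a * x) : ℝ)) *
      (gaussKernel A (x - (y + q)) * (starRingEnd ℂ) (gaussKernel A (x - y)))) y, ← integral_const_mul]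
    congr 1; ext x
    rw [show I * ((-(a * (x + y)) : ℝ) : ℂ) = I * ((-(a * y) : ℝ) : ℂ) + I * ((-(a * x) : ℝ) : ℂ) by
      push_cast; ring, Complex.exp_add, show x + y - (y + q) = x - q by ring, add_sub_cancel_right, sub_zero]
    ring
  have hκ3 : ∀ q, ‖κ 0 q‖ = Real.exp (-(r * a ^ 2 / 2)) * ambKernel r (q - 2 * t * a) := by
    intro q
    rw [← norm_gaussKernel_correlation hr t a q]
    simp only [hκ]
    rw [← integral_add_right_eq_self (μ := volume) (fun x : ℝ => cexp (I * (-(a * x) : ℝ)) *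
      (gaussKernel A (x - q) * (starRingEnd ℂ) (gaussKernel A (x - 0)))) (q / 2)]
    have : ∀ x : ℝ, cexp (I * (-(a * (x + q / 2)) : ℝ)) *
      (gaussKernel A (x + q / 2 - q) * (starRingEnd ℂ) (gaussKernel A (x + q / 2 - 0))) =
      cexp (I * (-(a * (q / 2)) : ℝ)) * (cexp (I * (-(a * x) : ℝ)) *
      (gaussKernel A (x - q / 2) * (starRingEnd ℂ) (gaussKernel A (x + q / 2)))) := by
      intro x
      rw [show I * ((-(a * (x + q / 2)) : ℝ) : ℂ) = I * ((-(a * (q / 2)) : ℝ) : ℂ) + I * ((-(a * x) : ℝ) : ℂ) by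
        push_cast; ring, Complex.exp_add, show x + q / 2 - q = x - q / 2 by ring, sub_zero]
      ring
    simp_rw [this]
    rw [integral_const_mul, norm_mul, norm_cexp_I_mul, one_mul]
  have hshear := (measurePreserving_prod_add (volume : Measure ℝ) (volume : Measure ℝ))
  have hint3 := hshear.integrable_comp_of_integrable hint2
  have e2 : ∫ p : ℝ × ℝ, (g p.2 * (starRingEnd ℂ) (g p.1)) * κ p.1 p.2 =
      ∫ q : ℝ, κ 0 q * ambiguity g a q := by
    calc _ = ∫ y : ℝ, ∫ q : ℝ, (g q * (starRingEnd ℂ) (g y)) * κ y q := integral_prod _ hint2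
      _ = ∫ y : ℝ, ∫ q : ℝ, (g (y + q) * (starRingEnd ℂ) (g y)) * κ y (y + q) := by
          congr 1; ext y
          exact (integral_add_left_eq_self (fun q => (g q * (starRingEnd ℂ) (g y)) * κ y q) y).symm
      _ = ∫ q : ℝ, ∫ y : ℝ, (g (y + q) * (starRingEnd ℂ) (g y)) * κ y (y + q) :=
          integral_integral_swap hint3
      _ = _ := by
          congr 1; ext q
          rw [ambiguity, angularFT, ← integral_const_mul]
          congr 1; ext y
          rw [hκ2]; ring
  rw [e1, e2]
  refine (enorm_integral_le_lintegral_enorm _).trans ?_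
  rw [← lintegral_const_mul' _ _ ENNReal.ofReal_ne_top]
  refine le_of_eq (lintegral_congr fun q => ?_)
  rw [enorm_mul, ← ofReal_norm (κ 0 q), hκ3, ENNReal.ofReal_mul (Real.exp_pos _).le, mul_assoc]

/-! ### The `L⁴` estimate for Lebesgue measure. -/

lemma exp_neg_le_rpow {s x : ℝ} (hs : 0 < s) (hx : 0 ≤ x) :
    Real.exp (-x) ≤ (Real.exp 1 * s ^ s) * (1 + x) ^ (-s) := by
  have h1 : (1 + x) / s ≤ Real.exp ((1 + x) / s) := by
    linarith [Real.add_one_le_exp ((1 + x) / s)]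
  have h2 : ((1 + x) / s) ^ s ≤ Real.exp (1 + x) := by
    calc ((1 + x) / s) ^ s ≤ Real.exp ((1 + x) / s) ^ s := by gcongr
      _ = Real.exp (1 + x) := by rw [← Real.exp_mul]; congr 1; field_simp
  rw [Real.div_rpow (by positivity) hs.le, div_le_iff₀ (by positivity)] at h2
  rw [Real.exp_neg, Real.rpow_neg (by positivity), ← div_eq_mul_inv, inv_le_iff_one_le_mul₀ (Real.exp_pos _),
    div_mul_eq_mul_div, one_le_div (by positivity)]
  rw [Real.exp_add] at h2
  linarith

lemma continuous_ambKernel (r : ℝ) : Continuous (ambKernel r) := by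
  unfold ambKernel; fun_prop

lemma ambKernel_nonneg (r s : ℝ) : 0 ≤ ambKernel r s := by
  unfold ambKernel; positivity

lemma integral_ambKernel {r : ℝ} (hr : 0 < r) : ∫ s, ambKernel r s = 1 := by
  unfold ambKernel
  have : ∀ s : ℝ, -s ^ 2 / (8 * r) = -(1 / (8 * r)) * s ^ 2 := fun s => by ring
  simp_rw [this]
  rw [integral_const_mul, integral_gaussian, ← Real.sqrt_mul (by positivity), Real.sqrt_eq_one]
  field_simp

lemma integrable_ambKernel {r : ℝ} (hr : 0 < r) : Integrable (ambKernel r) := by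
  by_contra h
  have := integral_ambKernel hr
  rw [integral_undef h] at this
  norm_num at this

lemma lintegral_ambKernel {r : ℝ} (hr : 0 < r) : ∫⁻ s, ENNReal.ofReal (ambKernel r s) = 1 := by
  rw [← ofReal_integral_eq_lintegral_ofReal (integrable_ambKernel hr)
    (.of_forall (ambKernel_nonneg r)), integral_ambKernel hr, ENNReal.ofReal_one]

lemma ambKernel_le {r : ℝ} (hr : 0 < r) (s : ℝ) :
    ambKernel r s ≤ (1 / 2) * r ^ (-(1 / 2) : ℝ) * Real.exp (-s ^ 2 / (8 * r)) := by
  unfold ambKernel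
  gcongr
  rw [Real.rpow_neg hr.le, ← Real.sqrt_eq_rpow, ← Real.sqrt_inv, show (1 / 2 : ℝ) = √(1 / 4) by
    rw [show (1 / 4 : ℝ) = (1 / 2) ^ 2 by norm_num, Real.sqrt_sq (by norm_num)], ← Real.sqrt_mul (by norm_num)]
  apply Real.sqrt_le_sqrt
  rw [← div_eq_mul_inv, div_div]
  apply one_div_le_one_div_of_le (by positivity)
  nlinarith [Real.pi_gt_three]

lemma measurable_ambiguity {g : ℝ → ℂ} (hg : Measurable g) :
    Measurable (fun p : ℝ × ℝ => ambiguity g p.1 p.2) := by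
  unfold ambiguity angularFT
  refine StronglyMeasurable.measurable ?_
  refine StronglyMeasurable.integral_prod_right (f := fun p : ℝ × ℝ => fun y : ℝ =>
    cexp (I * (-(p.1 * y) : ℝ)) * (g (y + p.2) * (starRingEnd ℂ) (g y))) ?_
  refine Measurable.stronglyMeasurable ?_
  have h4 : Measurable fun z : ℂ => (starRingEnd ℂ) z := continuous_conj.measurable
  exact Measurable.mul (by fun_prop) ((hg.comp (by fun_prop)).mul (h4.comp (hg.comp (by fun_prop))))

lemma BddIntegrable.mul_shift {g : ℝ → ℂ} (hg : BddIntegrable g) (q : ℝ) :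
    BddIntegrable (fun y => g (y + q) * (starRingEnd ℂ) (g y)) := by
  obtain ⟨M, hM0, hM⟩ := hg.bdd
  have h4 : Measurable fun z : ℂ => (starRingEnd ℂ) z := continuous_conj.measurable
  have hm : Measurable fun y => g (y + q) := hg.meas.comp (by fun_prop)
  refine ⟨hm.mul (h4.comp hg.meas), ?_, M * M, by positivity, fun y => ?_⟩
  · refine Integrable.bdd_mul (c := M) ?_ hm.aestronglyMeasurable (.of_forall fun y => hM _)
    exact (LinearIsometryEquiv.integrable_comp_iff conjLIE).2 hg.int
  · rw [norm_mul, RCLike.norm_conj]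
    exact mul_le_mul (hM _) (hM _) (norm_nonneg _) hM0

/-- Plancherel in `a` at fixed separation `q` gives `∫ |g(y+q)|² |g(y)|² dy`, which is at most the
sum of two fourth-power integrals equal by translation. The bound is uniform in `q`. -/
lemma lintegral_ambiguity_sq_le {g : ℝ → ℂ} (hg : BddIntegrable g) (q : ℝ) :
    ∫⁻ a, ‖ambiguity g a q‖ₑ ^ 2 ≤ ENNReal.ofReal (2 * Real.pi) * (2 * ∫⁻ x, ‖g x‖ₑ ^ 4) := by
  have h := hg.mul_shift q
  unfold ambiguity
  rw [lintegral_angularFT_sq h.int h.memLp_two]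
  gcongr
  calc ∫⁻ x, ‖g (x + q) * (starRingEnd ℂ) (g x)‖ₑ ^ 2
      ≤ ∫⁻ x, (‖g (x + q)‖ₑ ^ 4 + ‖g x‖ₑ ^ 4) := by
        refine lintegral_mono fun x => ?_
        rw [enorm_mul, RCLike.enorm_conj, mul_pow]
        rcases le_total ‖g (x + q)‖ₑ ‖g x‖ₑ with h | h
        · calc _ ≤ ‖g x‖ₑ ^ 2 * ‖g x‖ₑ ^ 2 := by gcongr
            _ ≤ _ := by rw [← pow_add]; exact le_add_self
        · calc _ ≤ ‖g (x + q)‖ₑ ^ 2 * ‖g (x + q)‖ₑ ^ 2 := by gcongr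
            _ ≤ _ := by rw [← pow_add]; exact le_self_add
    _ = _ := by
        have hm : Measurable fun y => g (y + q) := hg.meas.comp (by fun_prop)
        rw [lintegral_add_left (hm.enorm.pow_const 4), lintegral_add_right_eq_self (fun x => ‖g x‖ₑ ^ 4), two_mul]

/-- The fourth power of `|u|` is the square of the density, so Plancherel applies to `|u|²`. As
`ambKernel` has total mass one, Cauchy–Schwarz brings the square inside the `q`-integral at no cost.
-/
lemma lintegral_evol_pow_four_le {r : ℝ} (hr : 0 < r) (t : ℝ) {g : ℝ → ℂ} (hg : BddIntegrable g) :
    ENNReal.ofReal (2 * Real.pi) * ∫⁻ x, ‖gaussEvol (cplxTime r t) g x‖ₑ ^ 4 ≤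
      ∫⁻ a, ∫⁻ q, ENNReal.ofReal (Real.exp (-(r * a ^ 2))) *
        (ENNReal.ofReal (ambKernel r (q - 2 * t * a)) * ‖ambiguity g a q‖ₑ ^ 2) := by
  have hu : BddIntegrable (gaussEvol (cplxTime r t) g) := hg.evol hr
  have h := hu.mul_shift 0
  simp only [add_zero] at h
  have e : ∀ x, ‖gaussEvol (cplxTime r t) g x‖ₑ ^ 4 = ‖gaussEvol (cplxTime r t) g x *
      (starRingEnd ℂ) (gaussEvol (cplxTime r t) g x)‖ₑ ^ 2 := fun x => by
    rw [enorm_mul, RCLike.enorm_conj, mul_pow, ← pow_add]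
  simp_rw [e]
  rw [← lintegral_angularFT_sq h.int h.memLp_two]
  refine lintegral_mono fun a => ?_
  have hma : Measurable fun q => ambiguity g a q :=
    (measurable_ambiguity hg.meas).comp (by fun_prop : Measurable fun q : ℝ => (a, q))
  have hmk : Measurable fun q => ENNReal.ofReal (ambKernel r (q - 2 * t * a)) :=
    ((continuous_ambKernel r).comp (by fun_prop)).measurable.ennreal_ofReal
  calc _ ≤ (ENNReal.ofReal (Real.exp (-(r * a ^ 2 / 2))) *
        ∫⁻ q, ENNReal.ofReal (ambKernel r (q - 2 * t * a)) * ‖ambiguity g a q‖ₑ) ^ 2 := by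
        gcongr; exact enorm_angularFT_density_le hr t hg a
    _ ≤ ENNReal.ofReal (Real.exp (-(r * a ^ 2))) * (1 * ∫⁻ q,
        (ENNReal.ofReal (ambKernel r (q - 2 * t * a)) * ‖ambiguity g a q‖ₑ ^ 2)) := by
        rw [mul_pow, ← ENNReal.ofReal_pow (Real.exp_pos _).le, ← Real.exp_nat_mul]
        gcongr
        · apply le_of_eq; push_cast; ring
        · refine (lintegral_kernel_sq_le hmk.aemeasurable hma.enorm.aemeasurable).trans ?_
          rw [lintegral_sub_right_eq_self (fun q => ENNReal.ofReal (ambKernel r q)), lintegral_ambKernel hr]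
    _ = _ := by rw [one_mul, lintegral_const_mul' _ _ ENNReal.ofReal_ne_top]

/-- In this range the line `q = 2ta` may be crossed. If `q² ≤ r`, the supremum of the kernel
suffices. Otherwise integration over all `t` has Jacobian `1/(2|a|)`, at most `4/|q|`. -/
lemma lintegral_time_ambKernel_le_of_le {r : ℝ} (hr : 0 < r) {a q : ℝ} (h : |q| ≤ 8 * |a|) :
    ∫⁻ t in Icc (0 : ℝ) 2, ENNReal.ofReal (ambKernel r (q - 2 * t * a)) ≤
      ENNReal.ofReal (8 * r ^ (-(1 / 2) : ℝ) * (1 + (q / √r) ^ 2) ^ (-(1 / 2) : ℝ)) := by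
  have hy : (q / √r) ^ 2 = q ^ 2 / r := by rw [div_pow, Real.sq_sqrt hr.le]
  have hrs : r ^ (-(1 / 2) : ℝ) = (√r)⁻¹ := by rw [Real.rpow_neg hr.le, ← Real.sqrt_eq_rpow]
  have hs : (1 + (q / √r) ^ 2) ^ (-(1 / 2) : ℝ) = (√(1 + (q / √r) ^ 2))⁻¹ := by
    rw [Real.rpow_neg (by positivity), ← Real.sqrt_eq_rpow]
  have hsr := Real.sqrt_pos.2 hr
  by_cases hq : (q / √r) ^ 2 ≤ 1
  · calc _ ≤ ∫⁻ t in Icc (0 : ℝ) 2, ENNReal.ofReal ((1 / 2) * r ^ (-(1 / 2) : ℝ)) := by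
          refine lintegral_mono fun t => ENNReal.ofReal_le_ofReal ((ambKernel_le hr _).trans ?_)
          refine mul_le_of_le_one_right (by positivity) (Real.exp_le_one_iff.2 ?_)
          rw [neg_div]
          exact neg_nonpos.2 (by positivity)
      _ ≤ _ := by
          rw [lintegral_const, Measure.restrict_apply_univ, Real.volume_Icc,
            ← ENNReal.ofReal_mul (by positivity)]
          apply ENNReal.ofReal_le_ofReal
          rw [hs]
          have : √(1 + (q / √r) ^ 2) ≤ 2 := by
            rw [Real.sqrt_le_left (by norm_num)]; linarith
          have h2 : (1 / 2 : ℝ) ≤ (√(1 + (q / √r) ^ 2))⁻¹ := by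
            rw [one_div]; exact inv_anti₀ (by positivity) this
          have h3 : 0 < r ^ (-(1 / 2) : ℝ) := by positivity
          nlinarith
  · push Not at hq
    have hq0 : q ≠ 0 := by rintro rfl; norm_num at hq
    have hqp : 0 < |q| := abs_pos.2 hq0
    have ha : 0 < |a| := by linarith
    have ha0 : a ≠ 0 := abs_pos.1 ha
    have hsub : ∀ t, q - 2 * t * a = (q / (2 * a) - t) / (2 * a)⁻¹ := fun t => by field_simp
    calc _ ≤ ∫⁻ t, ENNReal.ofReal (ambKernel r (q - 2 * t * a)) := setLIntegral_le_lintegral _ _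
      _ = ENNReal.ofReal (2 * |a|)⁻¹ := by
          have hev : ∀ x, ambKernel r x = ambKernel r |x| := fun x => by
            unfold ambKernel; rw [sq_abs]
          calc _ = ∫⁻ t, ENNReal.ofReal (ambKernel r ((q / (2 * a) - t) / (2 * |a|)⁻¹)) := by
                refine lintegral_congr fun t => ?_
                rw [hev, hsub, hev ((q / (2 * a) - t) / (2 * |a|)⁻¹)]
                simp [abs_div, abs_mul]
            _ = _ := by
                rw [lintegral_sub_left_eq_self (fun t => ENNReal.ofReal (ambKernel r (t / (2 * |a|)⁻¹))),
                  lintegral_comp_div (f := fun t => ENNReal.ofReal (ambKernel r t))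
                    (continuous_ambKernel r).measurable.ennreal_ofReal (by positivity),
                  lintegral_ambKernel hr, mul_one]
      _ ≤ _ := by
          apply ENNReal.ofReal_le_ofReal
          rw [hrs, hs, mul_assoc, ← mul_inv]
          have h1 : √r * √(1 + (q / √r) ^ 2) ≤ 2 * |q| := by
            rw [← Real.sqrt_mul hr.le, Real.sqrt_le_left (by positivity), hy]
            rw [hy, lt_div_iff₀ hr] at hq
            have : r * (1 + q ^ 2 / r) = r + q ^ 2 := by field_simp
            rw [this, mul_pow, sq_abs]
            nlinarith
          have h2 : (2 * |q|)⁻¹ ≤ (√r * √(1 + (q / √r) ^ 2))⁻¹ := inv_anti₀ (by positivity) h1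
          have h3 : (2 * |a|)⁻¹ ≤ 8 * (2 * |q|)⁻¹ := by
            rw [mul_inv, mul_inv]
            have : |a|⁻¹ ≤ (|q| / 8)⁻¹ := inv_anti₀ (by positivity) (by linarith)
            rw [inv_div, div_eq_mul_inv] at this
            linarith
          linarith

/-- If `|q| ≤ 8|a|`, the factor `e^{-ra²}` supplies the extra decay `(1 + q²/r)^{-δ/2}` that makes
the bound integrable in `q`, at the price `r^{-δ}`. If `|q| > 8|a|`, then `|2ta| ≤ |q|/2` for `t ≤
2` and the kernel is itself small. -/
lemma lintegral_time_ambKernel_le {δ : ℝ} (hδ : 0 < δ) : ∃ C : ℝ, 0 < C ∧ ∀ r, 0 < r → r ≤ 1 →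
    ∀ a q : ℝ, ENNReal.ofReal (Real.exp (-(r * a ^ 2))) *
      ∫⁻ t in Icc (0 : ℝ) 2, ENNReal.ofReal (ambKernel r (q - 2 * t * a)) ≤
      ENNReal.ofReal (C * r ^ (-(1 / 2) - δ) * (1 + (q / √r) ^ 2) ^ (-(1 + δ) / 2)) := by
  set s := (1 + δ) / 2 with hs
  have hs0 : 0 < s := by positivity
  set K := Real.exp 1 * s ^ s * (32 : ℝ) ^ s
  set K' := Real.exp 1 * (δ / 2) ^ (δ / 2) * (64 : ℝ) ^ (δ / 2)
  refine ⟨K + 8 * K', by positivity, fun r hr hr1 a q => ?_⟩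
  have hy : (q / √r) ^ 2 = q ^ 2 / r := by rw [div_pow, Real.sq_sqrt hr.le]
  set y := (q / √r) ^ 2 with hydef
  have hy0 : 0 ≤ y := by positivity
  have hrδ : r ^ (-(1 / 2) - δ) = r ^ (-(1 / 2) : ℝ) * r ^ (-δ) := by rw [← Real.rpow_add hr]; rfl
  have hrδ1 : 1 ≤ r ^ (-δ) := Real.one_le_rpow_of_pos_of_le_one_of_nonpos hr hr1 (by linarith)
  rcases le_or_gt |q| (8 * |a|) with h | h
  · have h1 : Real.exp (-(r * a ^ 2)) ≤ K' * (r ^ (-δ) * (1 + y) ^ (-(δ / 2))) := by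
      have hq2 : q ^ 2 ≤ 64 * a ^ 2 := by
        rw [← sq_abs q, ← sq_abs a]; nlinarith [abs_nonneg q, abs_nonneg a]
      calc _ ≤ Real.exp (-(r ^ 2 * y / 64)) := by
            apply Real.exp_le_exp.2
            rw [hy, show r ^ 2 * (q ^ 2 / r) = r * q ^ 2 by field_simp]
            nlinarith
        _ ≤ (Real.exp 1 * (δ / 2) ^ (δ / 2)) * (1 + r ^ 2 * y / 64) ^ (-(δ / 2)) :=
            exp_neg_le_rpow (by positivity) (by positivity)
        -- As `r ≤ 1`, one has `1 + r²y/64 ≥ r²(1 + y)/64`; the power `-δ/2` of `r²` is the loss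
        -- `r^{-δ}`.
        _ ≤ (Real.exp 1 * (δ / 2) ^ (δ / 2)) * (r ^ 2 * (1 + y) / 64) ^ (-(δ / 2)) := by
            gcongr ?_ * ?_
            apply Real.rpow_le_rpow_of_nonpos (by positivity) _ (by linarith)
            nlinarith
        _ = _ := by
            rw [Real.div_rpow (x := r ^ 2 * (1 + y)) (by positivity) (by norm_num), Real.mul_rpow (x := r ^ 2) (by positivity) (by positivity),
              ← Real.rpow_natCast, ← Real.rpow_mul hr.le, show ((2 : ℕ) : ℝ) * -(δ / 2) = -δ by push_cast; ring,
              Real.rpow_neg (x := 64) (by norm_num), div_inv_eq_mul]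
            ring
    refine (mul_le_mul' (ENNReal.ofReal_le_ofReal h1) (lintegral_time_ambKernel_le_of_le hr h)).trans ?_
    rw [← ENNReal.ofReal_mul (by positivity)]
    apply ENNReal.ofReal_le_ofReal
    have e : (1 + y) ^ (-(1 + δ) / 2) = (1 + y) ^ (-(δ / 2)) * (1 + y) ^ (-(1 / 2) : ℝ) := by
      rw [← Real.rpow_add (by positivity)]; congr 1; ring
    rw [hrδ, e]
    have : 0 ≤ K * (r ^ (-(1 / 2) : ℝ) * r ^ (-δ)) * ((1 + y) ^ (-(δ / 2)) * (1 + y) ^ (-(1 / 2) : ℝ)) := by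
      positivity
    linarith
  · have h1 : ∀ t ∈ Icc (0 : ℝ) 2, ambKernel r (q - 2 * t * a) ≤
        (1 / 2) * r ^ (-(1 / 2) : ℝ) * (K * (1 + y) ^ (-s)) := by
      intro t ht
      refine (ambKernel_le hr _).trans ?_
      gcongr
      have hq2 : y / 32 ≤ (q - 2 * t * a) ^ 2 / (8 * r) := by
        rw [hy, div_div, div_le_div_iff₀ (by positivity) (by positivity)]
        have h5 : |2 * t * a| ≤ |q| / 2 := by
          rw [abs_mul, abs_mul, abs_of_nonneg ht.1, abs_two]
          nlinarith [ht.2, abs_nonneg a]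
        have h6 : |q| / 2 ≤ |q - 2 * t * a| := by
          have := abs_sub_abs_le_abs_sub q (2 * t * a); linarith
        have h7 : q ^ 2 / 4 ≤ (q - 2 * t * a) ^ 2 := by
          rw [← sq_abs q, ← sq_abs (q - 2 * t * a)]; nlinarith [abs_nonneg q]
        nlinarith
      calc _ ≤ Real.exp (-(y / 32)) := by
            apply Real.exp_le_exp.2; rw [neg_div]; linarith
        _ ≤ (Real.exp 1 * s ^ s) * (1 + y / 32) ^ (-s) := exp_neg_le_rpow hs0 (by positivity)
        _ ≤ (Real.exp 1 * s ^ s) * ((1 + y) / 32) ^ (-s) := by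
            gcongr ?_ * ?_
            apply Real.rpow_le_rpow_of_nonpos (by positivity) _ (by linarith)
            linarith
        _ = _ := by
            rw [Real.div_rpow (x := 1 + y) (by positivity) (by norm_num), Real.rpow_neg (x := 32) (by norm_num),
              div_inv_eq_mul]
            ring
    calc _ ≤ 1 * ∫⁻ t in Icc (0 : ℝ) 2, ENNReal.ofReal ((1 / 2) * r ^ (-(1 / 2) : ℝ) * (K * (1 + y) ^ (-s))) := by
          gcongr ?_ * ?_
          · rw [ENNReal.ofReal_le_one]
            exact Real.exp_le_one_iff.2 (neg_nonpos.2 (by positivity))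
          · exact setLIntegral_mono' measurableSet_Icc fun t ht => ENNReal.ofReal_le_ofReal (h1 t ht)
      _ ≤ _ := by
          rw [lintegral_const, Measure.restrict_apply_univ, Real.volume_Icc, one_mul,
            ← ENNReal.ofReal_mul (by positivity)]
          apply ENNReal.ofReal_le_ofReal
          rw [hrδ, show -(1 + δ) / 2 = -s by rw [hs]; ring]
          have h8 : 0 ≤ r ^ (-(1 / 2) : ℝ) * (1 + y) ^ (-s) := by positivity
          have h9 : K * 1 ≤ (K + 8 * K') * r ^ (-δ) := by
            gcongr
            have : 0 < K' := by positivity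
            linarith
          calc _ = r ^ (-(1 / 2) : ℝ) * (1 + y) ^ (-s) * (K * 1) := by ring
            _ ≤ r ^ (-(1 / 2) : ℝ) * (1 + y) ^ (-s) * ((K + 8 * K') * r ^ (-δ)) := by gcongr
            _ = _ := by ring

lemma lintegral_japanese {s : ℝ} (hs : 1 < s) : ∃ C : ℝ, 0 < C ∧ ∀ a : ℝ, 0 < a →
    ∫⁻ q : ℝ, ENNReal.ofReal ((1 + (q / a) ^ 2) ^ (-s / 2)) ≤ ENNReal.ofReal (C * a) := by
  have hint : Integrable (fun q : ℝ => (1 + q ^ 2) ^ (-s / 2)) := by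
    have := integrable_rpow_neg_one_add_norm_sq (E := ℝ) (μ := volume) (r := s) (by simpa using hs)
    simpa using this
  refine ⟨(∫ q : ℝ, (1 + q ^ 2) ^ (-s / 2)) + 1, ?_, fun a ha => ?_⟩
  · have : 0 ≤ ∫ q : ℝ, (1 + q ^ 2) ^ (-s / 2) := integral_nonneg fun q => by positivity
    linarith
  · rw [lintegral_comp_div (f := fun q => ENNReal.ofReal ((1 + q ^ 2) ^ (-s / 2))) (by fun_prop) ha,
      ← ofReal_integral_eq_lintegral_ofReal hint (.of_forall fun q => by positivity),
      ← ENNReal.ofReal_mul ha.le]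
    apply ENNReal.ofReal_le_ofReal
    nlinarith

/-- The sharp `L⁴` local smoothing estimate for data at scale `√r`. -/
theorem localSmoothing_four {δ : ℝ} (hδ : 0 < δ) : ∃ C : ℝ, 0 < C ∧ ∀ r, 0 < r → r ≤ 1 →
    ∀ g : ℝ → ℂ, BddIntegrable g →
    ∫⁻ t in Icc (0 : ℝ) 2, ∫⁻ x, ‖gaussEvol (cplxTime r t) g x‖ₑ ^ 4 ≤
      ENNReal.ofReal (C * r ^ (-δ)) * ∫⁻ x, ‖g x‖ₑ ^ 4 := by
  obtain ⟨C₁, hC₁, h₁⟩ := lintegral_time_ambKernel_le hδ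
  obtain ⟨C₂, hC₂, h₂⟩ := lintegral_japanese (s := 1 + δ) (by linarith)
  refine ⟨C₁ * C₂ * 2, by positivity, fun r hr hr1 g hg => ?_⟩
  have hpi : ENNReal.ofReal (2 * Real.pi) ≠ 0 := by
    rw [Ne, ENNReal.ofReal_eq_zero, not_le]; positivity
  rw [← ENNReal.mul_le_mul_iff_right hpi ENNReal.ofReal_ne_top]
  set G := ∫⁻ x, ‖g x‖ₑ ^ 4
  have hma := measurable_ambiguity hg.meas
  have hmk := (continuous_ambKernel r).measurable
  calc _ = ∫⁻ t in Icc (0 : ℝ) 2, ENNReal.ofReal (2 * Real.pi) *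
        ∫⁻ x, ‖gaussEvol (cplxTime r t) g x‖ₑ ^ 4 := by
        rw [lintegral_const_mul' _ _ ENNReal.ofReal_ne_top]
    _ ≤ ∫⁻ t in Icc (0 : ℝ) 2, ∫⁻ a, ∫⁻ q, ENNReal.ofReal (Real.exp (-(r * a ^ 2))) *
        (ENNReal.ofReal (ambKernel r (q - 2 * t * a)) * ‖ambiguity g a q‖ₑ ^ 2) :=
        lintegral_mono fun t => lintegral_evol_pow_four_le hr t hg
    _ = ∫⁻ t in Icc (0 : ℝ) 2, ∫⁻ p : ℝ × ℝ, ENNReal.ofReal (Real.exp (-(r * p.1 ^ 2))) *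
        (ENNReal.ofReal (ambKernel r (p.2 - 2 * t * p.1)) * ‖ambiguity g p.1 p.2‖ₑ ^ 2) := by
        refine lintegral_congr fun t => ?_
        refine (lintegral_prod (μ := (volume : Measure ℝ)) (ν := (volume : Measure ℝ)) (fun p : ℝ × ℝ =>
          ENNReal.ofReal (Real.exp (-(r * p.1 ^ 2))) * (ENNReal.ofReal (ambKernel r (p.2 - 2 * t * p.1)) *
            ‖ambiguity g p.1 p.2‖ₑ ^ 2)) ?_).symm
        exact (Measurable.mul (by fun_prop) (((hmk.comp (by fun_prop)).ennreal_ofReal).mul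
          (hma.enorm.pow_const 2))).aemeasurable
    -- The ambiguity function does not depend on time, so the time integral falls on the kernel
    -- alone.
    _ = ∫⁻ p : ℝ × ℝ, ∫⁻ t in Icc (0 : ℝ) 2, ENNReal.ofReal (Real.exp (-(r * p.1 ^ 2))) *
        (ENNReal.ofReal (ambKernel r (p.2 - 2 * t * p.1)) * ‖ambiguity g p.1 p.2‖ₑ ^ 2) := by
        refine lintegral_lintegral_swap ?_
        exact (Measurable.mul (by fun_prop) (((hmk.comp (by fun_prop)).ennreal_ofReal).mul
          ((hma.comp measurable_snd).enorm.pow_const 2))).aemeasurable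
    _ ≤ ∫⁻ p : ℝ × ℝ, ENNReal.ofReal (C₁ * r ^ (-(1 / 2) - δ) * (1 + (p.2 / √r) ^ 2) ^ (-(1 + δ) / 2)) *
          ‖ambiguity g p.1 p.2‖ₑ ^ 2 := by
        refine lintegral_mono fun p => ?_
        simp only
        rw [lintegral_const_mul' _ _ ENNReal.ofReal_ne_top, lintegral_mul_const, ← mul_assoc]
        · gcongr
          exact h₁ r hr hr1 p.1 p.2
        · exact (hmk.comp (by fun_prop)).ennreal_ofReal
    _ = ∫⁻ q, ∫⁻ a, ENNReal.ofReal (C₁ * r ^ (-(1 / 2) - δ) * (1 + (q / √r) ^ 2) ^ (-(1 + δ) / 2)) *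
          ‖ambiguity g a q‖ₑ ^ 2 := by
        refine lintegral_prod_symm (μ := (volume : Measure ℝ)) (ν := (volume : Measure ℝ)) _ ?_
        exact (Measurable.mul (by fun_prop) (hma.enorm.pow_const 2)).aemeasurable
    _ ≤ ∫⁻ q, ENNReal.ofReal (C₁ * r ^ (-(1 / 2) - δ)) * ENNReal.ofReal ((1 + (q / √r) ^ 2) ^ (-(1 + δ) / 2)) *
          (ENNReal.ofReal (2 * Real.pi) * (2 * G)) := by
        refine lintegral_mono fun q => ?_
        simp only
        rw [lintegral_const_mul' _ _ ENNReal.ofReal_ne_top, ENNReal.ofReal_mul (by positivity)]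
        gcongr
        exact lintegral_ambiguity_sq_le hg q
    -- The bracket has integral of order `√r`, which cancels the factor `r^{-1/2}`.
    _ ≤ ENNReal.ofReal (C₁ * r ^ (-(1 / 2) - δ)) * ENNReal.ofReal (C₂ * √r) *
          (ENNReal.ofReal (2 * Real.pi) * (2 * G)) := by
        rw [lintegral_mul_const _ (by fun_prop), lintegral_const_mul' _ _ ENNReal.ofReal_ne_top]
        gcongr
        exact h₂ _ (Real.sqrt_pos.2 hr)
    _ = _ := by
        rw [← ENNReal.ofReal_mul (by positivity)]
        have e1 : C₁ * r ^ (-(1 / 2) - δ) * (C₂ * √r) = C₁ * C₂ * r ^ (-δ) := by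
          rw [Real.sqrt_eq_rpow, show ∀ a b : ℝ, C₁ * a * (C₂ * b) = C₁ * C₂ * (a * b) by intros; ring,
            ← Real.rpow_add hr]
          congr 2; ring
        rw [e1, show C₁ * C₂ * 2 * r ^ (-δ) = C₁ * C₂ * r ^ (-δ) * 2 by ring,
          ENNReal.ofReal_mul (p := C₁ * C₂ * r ^ (-δ)) (by positivity), ENNReal.ofReal_ofNat]
        ring

/-! ### Frostman measures: the crude bound for large `r` and the fractal `L⁴` estimate. -/

/-- Integrals of Japanese brackets against a measure are controlled by the largest mass of a slab. -/
lemma lintegral_japanese_le_slab {s : ℝ} (hs : 1 < s) : ∃ C : ℝ, 0 < C ∧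
    ∀ (ν : Measure (ℝ × ℝ)) [SFinite ν] (X : ℝ × ℝ → ℝ) (_ : Measurable X) (a : ℝ) (_ : 0 < a) (x₀ : ℝ)
      (m : ℝ≥0∞) (_ : ∀ x, ν {z | |X z - x| ≤ a} ≤ m),
      ∫⁻ z, ENNReal.ofReal ((1 + ((X z - x₀) / a) ^ 2) ^ (-s / 2)) ∂ν ≤ ENNReal.ofReal C * m := by
  obtain ⟨C, hC, h⟩ := lintegral_japanese hs
  refine ⟨(3 : ℝ) ^ (s / 2) / 2 * C, by positivity, fun ν _ X hX a ha x₀ m hm => ?_⟩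
  set J : ℝ → ℝ := fun w => (1 + ((w - x₀) / a) ^ 2) ^ (-s / 2) with hJ
  have hJm : Measurable J := by fun_prop
  set E : Set ((ℝ × ℝ) × ℝ) := {p | |X p.1 - p.2| ≤ a} with hE
  have hEm : MeasurableSet E := measurableSet_le (by fun_prop) measurable_const
  -- `J` changes by a factor at most `3^{s/2}` over distances up to `a`, so it may be replaced by an
  -- average over such an interval; Fubini then produces masses of slabs.
  have hpt : ∀ z, ENNReal.ofReal (J (X z)) ≤ ∫⁻ w, ENNReal.ofReal ((3 : ℝ) ^ (s / 2) / (2 * a) * J w) *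
      E.indicator 1 (z, w) := by
    intro z
    have hset : ∀ w, E.indicator (1 : (ℝ × ℝ) × ℝ → ℝ≥0∞) (z, w) = (Icc (X z - a) (X z + a)).indicator 1 w := by
      intro w
      have : ((z, w) ∈ E) ↔ w ∈ Icc (X z - a) (X z + a) := by
        simp only [hE, mem_ofPred_eq, abs_le, mem_Icc]
        constructor <;> rintro ⟨h1, h2⟩ <;> constructor <;> linarith
      by_cases h' : (z, w) ∈ E
      · rw [indicator_of_mem h', indicator_of_mem (this.1 h')]; rfl
      · rw [indicator_of_notMem h', indicator_of_notMem (fun h'' => h' (this.2 h''))]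
    simp_rw [hset]
    calc ENNReal.ofReal (J (X z)) = ∫⁻ w in Icc (X z - a) (X z + a), ENNReal.ofReal (J (X z) / (2 * a)) := by
          rw [lintegral_const, Measure.restrict_apply_univ, Real.volume_Icc, ← ENNReal.ofReal_mul (by positivity)]
          congr 1; field_simp; ring
      _ ≤ ∫⁻ w in Icc (X z - a) (X z + a), ENNReal.ofReal ((3 : ℝ) ^ (s / 2) / (2 * a) * J w) := by
          refine setLIntegral_mono' measurableSet_Icc fun w hw => ENNReal.ofReal_le_ofReal ?_
          rw [div_mul_eq_mul_div]
          gcongr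
          simp only [hJ]
          have h3 : (1 + ((w - x₀) / a) ^ 2) / 3 ≤ 1 + ((X z - x₀) / a) ^ 2 := by
            have e : (w - x₀) / a = (X z - x₀) / a + (w - X z) / a := by ring
            have h4 : ((w - X z) / a) ^ 2 ≤ 1 := by
              rw [sq_le_one_iff_abs_le_one, abs_div, abs_of_pos ha, div_le_one ha, abs_le]
              constructor <;> linarith [hw.1, hw.2]
            rw [e]
            nlinarith [sq_nonneg ((X z - x₀) / a - (w - X z) / a), sq_nonneg ((X z - x₀) / a)]
          refine (Real.rpow_le_rpow_of_nonpos (by positivity) h3 (by linarith)).trans (le_of_eq ?_)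
          rw [Real.div_rpow (x := 1 + ((w - x₀) / a) ^ 2) (by positivity) (by norm_num),
            show -s / 2 = -(s / 2) by ring, Real.rpow_neg (x := 3) (by norm_num), div_inv_eq_mul, mul_comm]
      _ = _ := by
          rw [← lintegral_indicator measurableSet_Icc]
          refine lintegral_congr fun w => ?_
          by_cases h' : w ∈ Icc (X z - a) (X z + a) <;> simp [h']
  calc _ ≤ ∫⁻ z, (∫⁻ w, ENNReal.ofReal ((3 : ℝ) ^ (s / 2) / (2 * a) * J w) * E.indicator 1 (z, w)) ∂ν :=
        lintegral_mono hpt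
    _ = ∫⁻ w, ∫⁻ z, ENNReal.ofReal ((3 : ℝ) ^ (s / 2) / (2 * a) * J w) * E.indicator 1 (z, w) ∂ν := by
        refine lintegral_lintegral_swap (Measurable.aemeasurable ?_)
        exact Measurable.mul (by fun_prop) ((measurable_one.indicator hEm).comp (by fun_prop))
    _ ≤ ∫⁻ w, ENNReal.ofReal ((3 : ℝ) ^ (s / 2) / (2 * a)) * ENNReal.ofReal (J w) * m := by
        refine lintegral_mono fun w => ?_
        simp only
        rw [lintegral_const_mul' _ _ ENNReal.ofReal_ne_top, ENNReal.ofReal_mul (by positivity)]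
        gcongr
        refine le_trans (le_of_eq ?_) (hm w)
        have hS : MeasurableSet {z | |X z - w| ≤ a} := measurableSet_le (by fun_prop) measurable_const
        rw [← lintegral_indicator_one hS]
        rfl
    _ ≤ ENNReal.ofReal ((3 : ℝ) ^ (s / 2) / (2 * a)) * ENNReal.ofReal (C * a) * m := by
        rw [lintegral_mul_const _ (by fun_prop), lintegral_const_mul _ (by fun_prop)]
        gcongr
        simp only [hJ]
        rw [lintegral_sub_right_eq_self (fun w => ENNReal.ofReal ((1 + (w / a) ^ 2) ^ (-s / 2))) x₀]
        exact h a ha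
    _ = _ := by
        rw [← ENNReal.ofReal_mul (by positivity)]
        congr 2; field_simp

/-- The slab bound is used twice: once for `ν` weighted by the bracket in `T`, whose slab masses in
`X` are in turn bounded by the slab bound in `T` for `ν` restricted to a slab. -/
lemma lintegral_japanese_le_box {s s' : ℝ} (hs : 1 < s) (hs' : 1 < s') : ∃ C : ℝ, 0 < C ∧
    ∀ (ν : Measure (ℝ × ℝ)) [SFinite ν] (X T : ℝ × ℝ → ℝ) (_ : Measurable X) (_ : Measurable T)
      (a b : ℝ) (_ : 0 < a) (_ : 0 < b) (x₀ t₀ : ℝ)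
      (m : ℝ≥0∞) (_ : ∀ x t, ν {z | |X z - x| ≤ a ∧ |T z - t| ≤ b} ≤ m),
      ∫⁻ z, ENNReal.ofReal ((1 + ((X z - x₀) / a) ^ 2) ^ (-s / 2) * (1 + ((T z - t₀) / b) ^ 2) ^ (-s' / 2)) ∂ν ≤
        ENNReal.ofReal C * m := by
  obtain ⟨C, hC, h⟩ := lintegral_japanese_le_slab hs
  obtain ⟨C', hC', h'⟩ := lintegral_japanese_le_slab hs'
  refine ⟨C * C', by positivity, fun ν _ X T hX hT a b ha hb x₀ t₀ m hm => ?_⟩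
  set w : ℝ × ℝ → ℝ≥0∞ := fun z => ENNReal.ofReal ((1 + ((T z - t₀) / b) ^ 2) ^ (-s' / 2)) with hw
  have hwm : Measurable w := by fun_prop
  have h1 := h (ν.withDensity w) X hX a ha x₀ (ENNReal.ofReal C' * m) (fun x => by
    have hS : MeasurableSet {z | |X z - x| ≤ a} := measurableSet_le (by fun_prop) measurable_const
    rw [withDensity_apply _ hS]
    refine h' (ν.restrict _) T hT b hb t₀ m fun t => ?_
    rw [Measure.restrict_apply (measurableSet_le (by fun_prop) measurable_const), inter_comm]
    exact hm x t)
  rw [lintegral_withDensity_eq_lintegral_mul _ hwm (by fun_prop)] at h1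
  rw [ENNReal.ofReal_mul hC.le, mul_assoc]
  refine le_trans (le_of_eq (lintegral_congr fun z => ?_)) h1
  rw [ENNReal.ofReal_mul (by positivity), mul_comm]
  rfl

/-- A finite measure on `ℝ × [0, 1]` of parabolic dimension `β` with constant `D`. -/
structure ParabolicFrostman (β : ℝ) (D : ℝ≥0∞) (ν : Measure (ℝ × ℝ)) : Prop where
  finite : IsFiniteMeasure ν
  time : ∀ᵐ z ∂ν, z.2 ∈ Icc (0 : ℝ) 1
  ball : ∀ z ρ, 0 < ρ → ν (parabolicBall z ρ) ≤ D * ENNReal.ofReal (ρ ^ β)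

lemma gaussEvol_time_shift {r : ℝ} (hr : 0 < r) {g : ℝ → ℂ} (hg : BddIntegrable g) (x t t' : ℝ) :
    gaussEvol (cplxTime r t) g x =
      gaussEvol (cplxTime (r / 2) (t - t')) (gaussEvol (cplxTime (r / 2) t') g) x := by
  rw [← gaussEvol_add (by simpa using hr) (by simpa using hr) hg.int, cplxTime_add]
  congr 2 <;> ring

/-- A Gaussian majorant for the kernel over short times. -/
noncomputable def heatMajorant (r x : ℝ) : ℝ := r ^ (-(1 / 2) : ℝ) * Real.exp (-(x ^ 2 / (10 * r)))

lemma measurable_heatMajorant (r : ℝ) : Measurable (heatMajorant r) := by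
  unfold heatMajorant; fun_prop

/-- The constant `10` serves both uses. For `σ = r/2`, `|τ| ≤ r` the condition reads at worst `5r² ≤
5r²`; for `σ = r ≥ 1`, `0 ≤ τ ≤ 1` it follows from `8r² ≤ 10r²`. -/
lemma norm_gaussKernel_le_heatMajorant {r σ τ : ℝ} (hr : 0 < r) (hσ : r / 2 ≤ σ)
    (h : 4 * (σ ^ 2 + τ ^ 2) ≤ 10 * r * σ) (x : ℝ) :
    ‖gaussKernel (cplxTime σ τ) x‖ ≤ heatMajorant r x := by
  rw [norm_gaussKernel_cplxTime, heatMajorant]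
  have hσ0 : 0 < σ := by linarith
  gcongr
  · rw [Real.rpow_neg hr.le, ← Real.sqrt_eq_rpow, ← Real.sqrt_inv]
    have h1 : σ ≤ √(σ ^ 2 + τ ^ 2) := Real.le_sqrt_of_sq_le (by nlinarith [sq_nonneg τ])
    calc (2 * Real.pi)⁻¹ * √(Real.pi / √(σ ^ 2 + τ ^ 2)) ≤ (2 * Real.pi)⁻¹ * √((2 * Real.pi) ^ 2 * r⁻¹) := by
          gcongr
          rw [div_le_iff₀ (by positivity)]
          have h2 : 1 / 2 ≤ r⁻¹ * √(σ ^ 2 + τ ^ 2) := by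
            rw [inv_mul_eq_div, le_div_iff₀ hr]; linarith
          nlinarith [Real.pi_gt_three, Real.pi_pos]
      _ = _ := by
          rw [Real.sqrt_mul (by positivity), Real.sqrt_sq (by positivity), inv_mul_cancel_left₀ (by positivity)]
  · rw [neg_mul, neg_le_neg_iff, div_eq_mul_one_div, mul_comm]
    refine mul_le_mul_of_nonneg_right ?_ (sq_nonneg x)
    rw [div_le_div_iff₀ (by positivity) (by positivity)]
    linarith

lemma lintegral_heatMajorant {r : ℝ} (hr : 0 < r) :
    ∫⁻ x, ENNReal.ofReal (heatMajorant r x) ≤ 6 := by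
  have e : ∀ x, heatMajorant r x = r ^ (-(1 / 2) : ℝ) * Real.exp (-(1 / (10 * r)) * x ^ 2) := fun x => by
    rw [heatMajorant]; congr 2; ring
  simp_rw [e]
  rw [← ofReal_integral_eq_lintegral_ofReal ((integrable_exp_neg_mul_sq (by positivity)).const_mul _)
    (.of_forall fun x => by positivity), integral_const_mul, integral_gaussian, ← ENNReal.ofReal_ofNat]
  apply ENNReal.ofReal_le_ofReal
  rw [Real.rpow_neg hr.le, ← Real.sqrt_eq_rpow, ← Real.sqrt_inv, ← Real.sqrt_mul (by positivity),
    Real.sqrt_le_left (by norm_num)]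
  field_simp
  nlinarith [Real.pi_lt_d2]

lemma heatMajorant_le {r : ℝ} (hr : 0 < r) (x : ℝ) :
    heatMajorant r x ≤ 10 * r ^ (-(1 / 2) : ℝ) * (1 + (x / √r) ^ 2) ^ (-2 / 2 : ℝ) := by
  rw [heatMajorant, div_pow, Real.sq_sqrt hr.le, show (-2 / 2 : ℝ) = -1 by norm_num,
    Real.rpow_neg_one, mul_comm (10 : ℝ) (r ^ (-(1 / 2) : ℝ)), mul_assoc]
  refine mul_le_mul_of_nonneg_left ?_ (by positivity : 0 ≤ r ^ (-(1 / 2) : ℝ))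
  rw [Real.exp_neg, ← div_eq_mul_inv, le_div_iff₀ (by positivity : 0 < 1 + x ^ 2 / r), inv_mul_le_iff₀ (Real.exp_pos _)]
  have h := Real.add_one_le_exp (x ^ 2 / (10 * r))
  have e : x ^ 2 / (10 * r) = x ^ 2 / r / 10 := by rw [div_div, mul_comm]
  have : 0 ≤ x ^ 2 / r := by positivity
  rw [e] at h ⊢
  linarith

lemma enorm_gaussEvol_rpow_le {r : ℝ} (hr : 0 < r) {A : ℂ} (hA : ∀ x, ‖gaussKernel A x‖ ≤ heatMajorant r x)
    {p : ℝ} (hp : 1 ≤ p) {g : ℝ → ℂ} (hg : Measurable g) (x : ℝ) :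
    ‖gaussEvol A g x‖ₑ ^ p ≤ 6 ^ (p - 1) * ∫⁻ y, ENNReal.ofReal (heatMajorant r (x - y)) * ‖g y‖ₑ ^ p := by
  have hk : Measurable fun y => ENNReal.ofReal (heatMajorant r (x - y)) :=
    ((measurable_heatMajorant r).comp (by fun_prop)).ennreal_ofReal
  calc _ ≤ (∫⁻ y, ENNReal.ofReal (heatMajorant r (x - y)) * ‖g y‖ₑ) ^ p := by
        gcongr
        refine (enorm_gaussEvol_le g x).trans (lintegral_mono fun y => ?_)
        gcongr
        rw [← ofReal_norm]
        exact ENNReal.ofReal_le_ofReal (hA _)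
    _ ≤ _ := (lintegral_kernel_rpow_le hp hk.aemeasurable hg.enorm.aemeasurable)
    _ ≤ _ := by
        gcongr
        rw [lintegral_sub_left_eq_self (fun y => ENNReal.ofReal (heatMajorant r y)) x]
        exact lintegral_heatMajorant hr

/-- The crude estimate for large `r`. -/
lemma lintegral_evol_trivial {β p : ℝ} (hβ : β ∈ Icc (0 : ℝ) 3) (hp : 1 ≤ p) : ∃ C : ℝ, 0 < C ∧
    ∀ (ν : Measure (ℝ × ℝ)) (D : ℝ≥0∞), ParabolicFrostman β D ν → ∀ r, 1 ≤ r → ∀ g, BddIntegrable g →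
      ∫⁻ z, ‖gaussEvol (cplxTime r z.2) g z.1‖ₑ ^ p ∂ν ≤
        D * ENNReal.ofReal (C * r) * ∫⁻ x, ‖g x‖ₑ ^ p := by
  obtain ⟨C, hC, h⟩ := lintegral_japanese_le_slab (s := 2) (by norm_num)
  refine ⟨6 ^ (p - 1) * (10 * C * 8), by positivity, fun ν D hν r hr1 g hg => ?_⟩
  have := hν.finite
  have hr : 0 < r := by linarith
  have hgm := hg.meas
  have hhm := measurable_heatMajorant r
  -- For `r ≥ 1` a parabolic ball of radius `2√r` spans the whole unit time interval, so it contains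
  -- the slab.
  have hb : ∀ x, ν {z | |z.1 - x| ≤ √r} ≤ D * ENNReal.ofReal ((2 * √r) ^ β) := by
    intro x
    refine le_trans (measure_mono_ae ?_) (hν.ball (x, 0) (2 * √r) (by positivity))
    filter_upwards [hν.time] with z hz hz'
    have h2 : |z.1 - x| < 2 * √r := lt_of_le_of_lt hz' (by have := Real.sqrt_pos.2 hr; linarith)
    rw [abs_lt] at h2
    refine ⟨⟨by simp only; linarith, by simp only; linarith⟩, ?_⟩
    rw [mul_pow, Real.sq_sqrt hr.le]
    exact ⟨by simp only; linarith [hz.1], by simp only; linarith [hz.2]⟩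
  have hker : ∀ y, ∫⁻ z, ENNReal.ofReal (heatMajorant r (z.1 - y)) ∂ν ≤ D * ENNReal.ofReal (10 * C * 8 * r) := by
    intro y
    calc _ ≤ ∫⁻ z, ENNReal.ofReal (10 * r ^ (-(1 / 2) : ℝ)) *
          ENNReal.ofReal ((1 + ((z.1 - y) / √r) ^ 2) ^ (-2 / 2 : ℝ)) ∂ν := by
          refine lintegral_mono fun z => ?_
          rw [← ENNReal.ofReal_mul (by positivity)]
          exact ENNReal.ofReal_le_ofReal (heatMajorant_le hr _)
      _ ≤ ENNReal.ofReal (10 * r ^ (-(1 / 2) : ℝ)) * (ENNReal.ofReal C * (D * ENNReal.ofReal ((2 * √r) ^ β))) := by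
          rw [lintegral_const_mul' _ _ ENNReal.ofReal_ne_top]
          gcongr
          exact h ν (fun z => z.1) measurable_fst _ (Real.sqrt_pos.2 hr) y _ hb
      _ = D * ENNReal.ofReal (10 * r ^ (-(1 / 2) : ℝ) * C * (2 * √r) ^ β) := by
          rw [ENNReal.ofReal_mul (q := (2 * √r) ^ β) (by positivity), ENNReal.ofReal_mul (q := C) (by positivity)]
          ring
      _ ≤ _ := by
          gcongr D * ENNReal.ofReal ?_
          have h1 : (2 * √r) ^ β ≤ (2 * √r) ^ (3 : ℝ) := by
            have : 1 ≤ √r := Real.one_le_sqrt.2 hr1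
            exact Real.rpow_le_rpow_of_exponent_le (by linarith) hβ.2
          have h2 : r ^ (-(1 / 2) : ℝ) * (2 * √r) ^ (3 : ℝ) = 8 * r := by
            rw [Real.mul_rpow (by norm_num) (by positivity), Real.sqrt_eq_rpow, ← Real.rpow_mul hr.le,
              mul_left_comm, ← Real.rpow_add hr]
            norm_num
          calc _ = 10 * C * (r ^ (-(1 / 2) : ℝ) * (2 * √r) ^ β) := by ring
            _ ≤ 10 * C * (r ^ (-(1 / 2) : ℝ) * (2 * √r) ^ (3 : ℝ)) := by gcongr
            _ = _ := by rw [h2]; ring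
  calc _ ≤ ∫⁻ z, (6 ^ (p - 1) * ∫⁻ y, ENNReal.ofReal (heatMajorant r (z.1 - y)) * ‖g y‖ₑ ^ p) ∂ν := by
        refine lintegral_mono_ae ?_
        filter_upwards [hν.time] with z hz
        refine enorm_gaussEvol_rpow_le hr (norm_gaussKernel_le_heatMajorant hr (by linarith) ?_) hp hgm _
        · nlinarith [hz.1, hz.2]
    _ = 6 ^ (p - 1) * ∫⁻ y, ∫⁻ z, ENNReal.ofReal (heatMajorant r (z.1 - y)) * ‖g y‖ₑ ^ p ∂ν := by
        rw [lintegral_const_mul' _ _ (by simp), lintegral_lintegral_swap]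
        exact (Measurable.mul (hhm.comp (by fun_prop)).ennreal_ofReal
          ((hgm.comp measurable_snd).enorm.pow_const p)).aemeasurable
    _ ≤ 6 ^ (p - 1) * ∫⁻ y, (D * ENNReal.ofReal (10 * C * 8 * r)) * ‖g y‖ₑ ^ p := by
        gcongr with y
        have hm : Measurable fun z : ℝ × ℝ => ENNReal.ofReal (heatMajorant r (z.1 - y)) :=
          (hhm.comp (by fun_prop : Measurable fun z : ℝ × ℝ => z.1 - y)).ennreal_ofReal
        rw [lintegral_mul_const _ hm]
        gcongr
        exact hker y
    _ = _ := by
        rw [lintegral_const_mul _ (by fun_prop), mul_assoc (_ ^ _) (_ * _) r, ENNReal.ofReal_mul (p := 6 ^ (p - 1)) (by positivity),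
          ← ENNReal.ofReal_rpow_of_pos (by norm_num), ENNReal.ofReal_ofNat]
        ring

/-- The kernel dominating short-time evolutions. -/
noncomputable def slabKernel (r : ℝ) (p : (ℝ × ℝ) × (ℝ × ℝ)) : ℝ≥0∞ :=
  (Icc (-r) r).indicator 1 (p.1.2 - p.2.1) * ENNReal.ofReal (heatMajorant r (p.1.1 - p.2.2))

lemma measurable_slabKernel (r : ℝ) : Measurable (slabKernel r) :=
  ((measurable_one.indicator measurableSet_Icc).comp (by fun_prop)).mul
    ((measurable_heatMajorant r).comp (by fun_prop)).ennreal_ofReal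

lemma measurable_evol_time {g : ℝ → ℂ} (hg : Measurable g) (r : ℝ) :
    Measurable fun p : ℝ × ℝ => gaussEvol (cplxTime r p.1) g p.2 := by
  have h1 : Measurable fun p : ℝ × ℝ => cplxTime r p.1 := by
    have h := measurable_cplxTime
    have h' : Measurable fun p : ℝ × ℝ => (r, p.1) := measurable_const.prodMk measurable_fst
    exact h.comp h'
  have h2 := (measurable_gaussEvol hg).comp (h1.prodMk measurable_snd)
  exact h2

lemma lintegral_time_average {r : ℝ} {z : ℝ} (hz : z ∈ Icc (0 : ℝ) 1) (hr1 : r ≤ 1) {c : ℝ≥0∞}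
    {H : ℝ → ℝ≥0∞} (h : ∀ t ∈ Icc z (z + r), c ≤ H t) :
    ENNReal.ofReal r * c ≤ ∫⁻ t in Icc (0 : ℝ) 2, H t := by
  calc _ = ∫⁻ t in Icc z (z + r), c := by
        rw [lintegral_const, Measure.restrict_apply_univ, Real.volume_Icc, add_sub_cancel_left, mul_comm]
    _ ≤ ∫⁻ t in Icc z (z + r), H t := setLIntegral_mono' measurableSet_Icc h
    _ ≤ _ := lintegral_mono_set (Icc_subset_Icc hz.1 (by linarith [hz.2]))

/-- For every `t'` within `r` after `z.2`, half of the real time carries `u` from `t'` to `z.2`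
through a kernel dominated by a Gaussian of width about `√r`. Averaging in `t'` trades the value at
a point for a parabolic average. As `t'` may exceed `1`, the times run over `[0, 2]`. -/
lemma enorm_evol_pow_four_le_slab {r : ℝ} (hr : 0 < r) (hr1 : r ≤ 1) {g : ℝ → ℂ} (hg : BddIntegrable g)
    {z : ℝ × ℝ} (hz : z.2 ∈ Icc (0 : ℝ) 1) :
    ENNReal.ofReal r * ‖gaussEvol (cplxTime r z.2) g z.1‖ₑ ^ (4 : ℝ) ≤
      ∫⁻ t in Icc (0 : ℝ) 2, ∫⁻ y, 6 ^ 3 * (slabKernel r (z, (t, y)) * ‖gaussEvol (cplxTime (r / 2) t) g y‖ₑ ^ 4) := by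
  refine lintegral_time_average hz hr1 fun t' ht' => ?_
  have hvt : Measurable (gaussEvol (cplxTime (r / 2) t') g) := (hg.evol (by simpa using hr)).meas
  have h2 : |z.2 - t'| ≤ r := abs_le.2 ⟨by linarith [ht'.2], by linarith [ht'.1]⟩
  have h1 := enorm_gaussEvol_rpow_le hr (norm_gaussKernel_le_heatMajorant hr le_rfl
    (τ := z.2 - t') (by nlinarith [sq_abs (z.2 - t'), abs_nonneg (z.2 - t')])) (p := 4) (by norm_num) hvt z.1
  rw [← gaussEvol_time_shift hr hg z.1 z.2 t'] at h1
  refine h1.trans (le_of_eq ?_)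
  rw [lintegral_const_mul' _ _ (by simp)]
  have : z.2 - t' ∈ Icc (-r) r := abs_le.1 h2
  simp_rw [slabKernel, indicator_of_mem this, Pi.one_apply, one_mul]
  norm_num

/-- The kernel has height `r^{-1/2}` and lives essentially on a box `√r × r`, which is contained in
a parabolic ball of radius `2√r` and so has mass of order `r^{β/2}`. -/
lemma lintegral_slabKernel_le (β : ℝ) : ∃ C : ℝ, 0 < C ∧ ∀ (ν : Measure (ℝ × ℝ)) (D : ℝ≥0∞),
    ParabolicFrostman β D ν → ∀ r, 0 < r → ∀ w : ℝ × ℝ,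
      ∫⁻ z, slabKernel r (z, w) ∂ν ≤ D * ENNReal.ofReal (C * r ^ ((β - 1) / 2)) := by
  obtain ⟨C, hC, h⟩ := lintegral_japanese_le_box (s := 2) (s' := 2) (by norm_num) (by norm_num)
  refine ⟨20 * C * 2 ^ β, by positivity, fun ν D hν r hr w => ?_⟩
  have := hν.finite
  calc _ ≤ ∫⁻ z, ENNReal.ofReal (20 * r ^ (-(1 / 2) : ℝ)) *
        ENNReal.ofReal ((1 + ((z.1 - w.2) / √r) ^ 2) ^ (-2 / 2 : ℝ) * (1 + ((z.2 - w.1) / r) ^ 2) ^ (-2 / 2 : ℝ)) ∂ν := by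
        refine lintegral_mono fun z => ?_
        simp only [slabKernel]
        by_cases hz : z.2 - w.1 ∈ Icc (-r) r
        · rw [indicator_of_mem hz, Pi.one_apply, one_mul, ← ENNReal.ofReal_mul (by positivity)]
          apply ENNReal.ofReal_le_ofReal
          refine (heatMajorant_le hr _).trans ?_
          have h1 : ((z.2 - w.1) / r) ^ 2 ≤ 1 := by
            rw [sq_le_one_iff_abs_le_one, abs_div, abs_of_pos hr, div_le_one hr, abs_le]
            exact hz
          have h2 : 1 / 2 ≤ (1 + ((z.2 - w.1) / r) ^ 2) ^ (-2 / 2 : ℝ) := by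
            rw [show (-2 / 2 : ℝ) = -1 by norm_num, Real.rpow_neg_one, one_div]
            exact inv_anti₀ (by positivity) (by linarith)
          have h3 : 0 ≤ r ^ (-(1 / 2) : ℝ) * (1 + ((z.1 - w.2) / √r) ^ 2) ^ (-2 / 2 : ℝ) := by positivity
          nlinarith
        · rw [indicator_of_notMem hz, zero_mul]; exact zero_le
    _ ≤ ENNReal.ofReal (20 * r ^ (-(1 / 2) : ℝ)) * (ENNReal.ofReal C * (D * ENNReal.ofReal ((2 * √r) ^ β))) := by
        rw [lintegral_const_mul' _ _ ENNReal.ofReal_ne_top]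
        gcongr
        refine h ν (fun z => z.1) (fun z => z.2) measurable_fst measurable_snd _ _ (Real.sqrt_pos.2 hr) hr _ _ _ ?_
        intro x t
        refine le_trans (measure_mono ?_) (hν.ball (x, t) (2 * √r) (by positivity))
        rintro z ⟨hz1, hz2⟩
        have h2 : |z.1 - x| < 2 * √r := lt_of_le_of_lt hz1 (by have := Real.sqrt_pos.2 hr; linarith)
        rw [abs_lt] at h2
        rw [abs_le] at hz2
        refine ⟨⟨by simp only; linarith, by simp only; linarith⟩, ?_⟩
        rw [mul_pow, Real.sq_sqrt hr.le]
        exact ⟨by simp only; linarith, by simp only; linarith⟩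
    _ = D * ENNReal.ofReal (20 * r ^ (-(1 / 2) : ℝ) * C * (2 * √r) ^ β) := by
        rw [ENNReal.ofReal_mul (q := (2 * √r) ^ β) (by positivity), ENNReal.ofReal_mul (q := C) (by positivity)]
        ring
    _ = _ := by
        congr 2
        rw [Real.mul_rpow (by norm_num) (by positivity), Real.sqrt_eq_rpow, ← Real.rpow_mul hr.le,
          show (β - 1) / 2 = -(1 / 2) + 1 / 2 * β by ring, Real.rpow_add hr]
        ring
/-- The `L⁴` estimate with respect to a fractal measure. -/
theorem lintegral_evol_four {β δ : ℝ} (hδ : 0 < δ) : ∃ C : ℝ, 0 < C ∧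
    ∀ (ν : Measure (ℝ × ℝ)) (D : ℝ≥0∞), ParabolicFrostman β D ν → ∀ r, 0 < r → r ≤ 1 →
    ∀ g, BddIntegrable g →
      ∫⁻ z, ‖gaussEvol (cplxTime r z.2) g z.1‖ₑ ^ (4 : ℝ) ∂ν ≤
        D * ENNReal.ofReal (C * r ^ (-((3 - β) / 2) - δ)) * ∫⁻ x, ‖g x‖ₑ ^ (4 : ℝ) := by
  obtain ⟨C, hC, hker⟩ := lintegral_slabKernel_le β
  obtain ⟨C', hC', h'⟩ := localSmoothing_four hδ
  refine ⟨6 ^ 3 * C * (C' * (1 / 2) ^ (-δ)), by positivity, fun ν D hν r hr hr1 g hg => ?_⟩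
  have := hν.finite
  have hgm := hg.meas
  have hvm : Measurable fun p : ℝ × ℝ => gaussEvol (cplxTime (r / 2) p.1) g p.2 := measurable_evol_time hg.meas _
  have hFm := measurable_slabKernel r
  have hr0 : ENNReal.ofReal r ≠ 0 := by rwa [Ne, ENNReal.ofReal_eq_zero, not_le]
  -- The factor `r` is the length of the time average. Undoing it costs `r⁻¹`, which with
  -- `r^{(β-1)/2}` from the kernel gives `r^{-(3-β)/2}`.
  rw [← ENNReal.mul_le_mul_iff_right hr0 ENNReal.ofReal_ne_top]
  calc _ = ∫⁻ z, ENNReal.ofReal r * ‖gaussEvol (cplxTime r z.2) g z.1‖ₑ ^ (4 : ℝ) ∂ν := by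
        rw [lintegral_const_mul' _ _ ENNReal.ofReal_ne_top]
    _ ≤ ∫⁻ z, (∫⁻ w, 6 ^ 3 * (slabKernel r (z, w) * ‖gaussEvol (cplxTime (r / 2) w.1) g w.2‖ₑ ^ 4) ∂((volume.restrict (Icc (0 : ℝ) 2)).prod volume)) ∂ν :=
        lintegral_mono_ae (hν.time.mono fun z hz => (enorm_evol_pow_four_le_slab hr hr1 hg hz).trans (by
          have hm : Measurable fun w : ℝ × ℝ => 6 ^ 3 * (slabKernel r (z, w) * ‖gaussEvol (cplxTime (r / 2) w.1) g w.2‖ₑ ^ 4) :=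
            ((hFm.comp measurable_prodMk_left).mul (hvm.enorm.pow_const 4)).const_mul _
          rw [lintegral_prod _ hm.aemeasurable]))
    _ = ∫⁻ w, (∫⁻ z, 6 ^ 3 * (slabKernel r (z, w) * ‖gaussEvol (cplxTime (r / 2) w.1) g w.2‖ₑ ^ 4) ∂ν) ∂((volume.restrict (Icc (0 : ℝ) 2)).prod volume) := by
        refine lintegral_lintegral_swap ?_
        exact ((hFm.mul ((hvm.comp measurable_snd).enorm.pow_const 4)).const_mul _).aemeasurable
    _ ≤ ∫⁻ w, 6 ^ 3 * (D * ENNReal.ofReal (C * r ^ ((β - 1) / 2))) * ‖gaussEvol (cplxTime (r / 2) w.1) g w.2‖ₑ ^ 4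
          ∂((volume.restrict (Icc (0 : ℝ) 2)).prod volume) := by
        refine lintegral_mono fun w => ?_
        simp only
        have hm : Measurable fun z : ℝ × ℝ => slabKernel r (z, w) := hFm.comp measurable_prodMk_right
        rw [lintegral_const_mul' _ _ (by simp), lintegral_mul_const _ hm, mul_assoc]
        gcongr
        exact hker ν D hν r hr w
    _ = 6 ^ 3 * (D * ENNReal.ofReal (C * r ^ ((β - 1) / 2))) *
          ∫⁻ t in Icc (0 : ℝ) 2, ∫⁻ x, ‖gaussEvol (cplxTime (r / 2) t) g x‖ₑ ^ 4 := by
        rw [lintegral_const_mul _ (hvm.enorm.pow_const 4), lintegral_prod _ (hvm.enorm.pow_const 4).aemeasurable]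
    _ ≤ 6 ^ 3 * (D * ENNReal.ofReal (C * r ^ ((β - 1) / 2))) *
          (ENNReal.ofReal (C' * (r / 2) ^ (-δ)) * ∫⁻ x, ‖g x‖ₑ ^ 4) := by
        gcongr
        exact h' (r / 2) (by positivity) (by linarith) g hg
    _ = _ := by
        have e : r * (6 ^ 3 * C * (C' * (1 / 2) ^ (-δ)) * r ^ (-((3 - β) / 2) - δ)) =
            6 ^ 3 * (C * r ^ ((β - 1) / 2)) * (C' * (r / 2) ^ (-δ)) := by
          rw [div_eq_mul_one_div r 2, Real.mul_rpow hr.le (by norm_num),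
            show -((3 - β) / 2) - δ = (β - 1) / 2 + -δ - 1 by ring, Real.rpow_sub_one hr.ne', Real.rpow_add hr]
          field_simp
        have e2 : ENNReal.ofReal r * (D * ENNReal.ofReal (6 ^ 3 * C * (C' * (1 / 2) ^ (-δ)) * r ^ (-((3 - β) / 2) - δ))
            * ∫⁻ x, ‖g x‖ₑ ^ (4 : ℝ)) = D * ENNReal.ofReal (r * (6 ^ 3 * C * (C' * (1 / 2) ^ (-δ)) * r ^ (-((3 - β) / 2) - δ)))
            * ∫⁻ x, ‖g x‖ₑ ^ (4 : ℝ) := by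
          rw [ENNReal.ofReal_mul hr.le]; ring
        rw [e2, e, ENNReal.ofReal_mul (p := 6 ^ 3 * (C * r ^ ((β - 1) / 2))) (by positivity),
          ENNReal.ofReal_mul (p := 6 ^ 3) (by positivity)]
        have e3 : ENNReal.ofReal (6 ^ 3) = 6 ^ 3 := by
          rw [ENNReal.ofReal_pow (by norm_num), ENNReal.ofReal_ofNat]
        have e4 : ∫⁻ x, ‖g x‖ₑ ^ (4 : ℝ) = ∫⁻ x, ‖g x‖ₑ ^ 4 := by
          refine lintegral_congr fun x => ?_
          exact_mod_cast ENNReal.rpow_natCast _ 4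
        rw [e3, e4]
        ring

/-! ### Heat kernels. -/

/-- The heat kernel with symbol `e^{-ηa²}`. -/
noncomputable def heatKernel (η p : ℝ) : ℝ := (2 * Real.pi)⁻¹ * √(Real.pi / η) * Real.exp (-p ^ 2 / (4 * η))

lemma heatKernel_nonneg (η p : ℝ) : 0 ≤ heatKernel η p := by unfold heatKernel; positivity

lemma continuous_heatKernel (η : ℝ) : Continuous (heatKernel η) := by unfold heatKernel; fun_prop

lemma gaussKernel_ofReal {η : ℝ} (hη : 0 < η) (p : ℝ) : gaussKernel η p = heatKernel η p := by
  rw [gaussKernel, heatKernel, Real.sqrt_eq_rpow]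
  push_cast
  rw [ofReal_cpow (by positivity)]
  push_cast
  ring

lemma integrable_heatKernel {η : ℝ} (hη : 0 < η) : Integrable (heatKernel η) := by
  have h := (integrable_gaussKernel (A := (η : ℂ)) (by simpa using hη)).norm
  refine h.congr (.of_forall fun p => ?_)
  simp only
  rw [gaussKernel_ofReal hη, norm_real, Real.norm_of_nonneg (heatKernel_nonneg _ _)]

lemma integral_heatKernel_cexp {η : ℝ} (hη : 0 < η) (a : ℝ) :
    ∫ p : ℝ, cexp (I * (-(a * p) : ℝ)) * (heatKernel η p : ℂ) = (Real.exp (-(η * a ^ 2)) : ℝ) := by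
  have h := angularFT_gaussKernel (A := (η : ℂ)) (by simpa using hη) a
  rw [angularFT] at h
  simp_rw [gaussKernel_ofReal hη] at h
  rw [h]; push_cast; congr 1; ring

lemma integral_heatKernel {η : ℝ} (hη : 0 < η) : ∫ p, heatKernel η p = 1 := by
  have h := integral_heatKernel_cexp hη 0
  simp only [zero_mul, neg_zero, ofReal_zero, mul_zero, Complex.exp_zero, one_mul, ne_eq, OfNat.ofNat_ne_zero,
    not_false_eq_true, zero_pow, Real.exp_zero, ofReal_one] at h
  rw [← ofReal_inj, ofReal_one, ← h]
  exact integral_ofReal.symm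

lemma lintegral_heatKernel {η : ℝ} (hη : 0 < η) : ∫⁻ p, ENNReal.ofReal (heatKernel η p) = 1 := by
  rw [← ofReal_integral_eq_lintegral_ofReal (integrable_heatKernel hη) (.of_forall (heatKernel_nonneg η)),
    integral_heatKernel hη, ENNReal.ofReal_one]

/-- Completing the square in `p` leaves the kernel of the total time, times a translated heat kernel
of mass one in `p`. The semigroup law follows on integration. -/
lemma heatKernel_mul_eq {κ η : ℝ} (hκ : 0 < κ) (hη : 0 < η) (x p : ℝ) :
    heatKernel η p * heatKernel κ (x - p) =
      heatKernel (κ + η) x * heatKernel (κ * η / (κ + η)) (p - η * x / (κ + η)) := by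
  have h1 : √(Real.pi / η) * √(Real.pi / κ) = √(Real.pi / (κ + η)) * √(Real.pi / (κ * η / (κ + η))) := by
    rw [← Real.sqrt_mul (by positivity), ← Real.sqrt_mul (by positivity)]
    congr 1; field_simp
  have h2 : -p ^ 2 / (4 * η) + -(x - p) ^ 2 / (4 * κ) =
      -x ^ 2 / (4 * (κ + η)) + -(p - η * x / (κ + η)) ^ 2 / (4 * (κ * η / (κ + η))) := by
    field_simp; ring
  calc _ = (2 * Real.pi)⁻¹ ^ 2 * (√(Real.pi / η) * √(Real.pi / κ)) *
        Real.exp (-p ^ 2 / (4 * η) + -(x - p) ^ 2 / (4 * κ)) := by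
        rw [Real.exp_add]; unfold heatKernel; ring
    _ = _ := by rw [h1, h2, Real.exp_add]; unfold heatKernel; ring

lemma integral_heatKernel_mul {κ η : ℝ} (hκ : 0 < κ) (hη : 0 < η) (x : ℝ) :
    ∫ p, heatKernel η p * heatKernel κ (x - p) = heatKernel (κ + η) x := by
  simp_rw [heatKernel_mul_eq hκ hη]
  rw [integral_const_mul, integral_sub_right_eq_self (fun p => heatKernel (κ * η / (κ + η)) p),
    integral_heatKernel (by positivity), mul_one]

lemma lintegral_heatKernel_mul {κ η : ℝ} (hκ : 0 < κ) (hη : 0 < η) (x : ℝ) :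
    ∫⁻ p, ENNReal.ofReal (heatKernel η p) * ENNReal.ofReal (heatKernel κ (x - p)) =
      ENNReal.ofReal (heatKernel (κ + η) x) := by
  simp_rw [← ENNReal.ofReal_mul (heatKernel_nonneg _ _), heatKernel_mul_eq hκ hη,
    ENNReal.ofReal_mul (heatKernel_nonneg _ _)]
  rw [lintegral_const_mul' _ _ ENNReal.ofReal_ne_top,
    lintegral_sub_right_eq_self (fun p => ENNReal.ofReal (heatKernel (κ * η / (κ + η)) p)),
    lintegral_heatKernel (by positivity), mul_one]

/-- This is the mean value inequality in the time variable. With `y = x²/(4k)`, the time derivative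
is of order `k^{-3/2} e^{-y} |y - 1/2|`, and `e^{-y} |y - 1/2| ≤ 2/(1 + y)`; the resulting bound
decreases in `k` and is evaluated at `κ`. -/
lemma abs_heatKernel_sub_le {κ η : ℝ} (hκ : 0 < κ) (hη : 0 ≤ η) (x : ℝ) :
    |heatKernel κ x - heatKernel (κ + η) x| ≤ η * ((√κ)⁻¹ / (κ + x ^ 2 / 4)) := by
  set f : ℝ → ℝ := fun k => heatKernel k x with hf
  set Y := x ^ 2 / 4 with hY
  have hY0 : 0 ≤ Y := by positivity
  have hfe : ∀ k > 0, f k = ((2 * Real.pi)⁻¹ * √Real.pi) * ((√k)⁻¹ * Real.exp (-(Y * k⁻¹))) := by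
    intro k hk
    simp only [hf, heatKernel]
    rw [Real.sqrt_div Real.pi_pos.le, show -x ^ 2 / (4 * k) = -(Y * k⁻¹) by rw [hY]; field_simp]
    ring
  have hc : (2 * Real.pi)⁻¹ * √Real.pi ≤ 1 / 2 := by
    have h1 : √Real.pi ≤ Real.pi := by
      rw [Real.sqrt_le_left Real.pi_pos.le]; nlinarith [Real.pi_gt_three]
    rw [inv_mul_le_iff₀ (by positivity)]; linarith
  have hc0 : 0 ≤ (2 * Real.pi)⁻¹ * √Real.pi := by positivity
  have hd : ∀ k > 0, HasDerivAt (fun k => ((2 * Real.pi)⁻¹ * √Real.pi) * ((√k)⁻¹ * Real.exp (-(Y * k⁻¹))))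
      (((2 * Real.pi)⁻¹ * √Real.pi) * ((√k)⁻¹ * k⁻¹ * Real.exp (-(Y * k⁻¹)) * (Y * k⁻¹ - 1 / 2))) k := by
    intro k hk
    have hs := Real.sqrt_pos.2 hk
    have h1 : HasDerivAt (fun k => (√k)⁻¹) (-(1 / (2 * √k)) / (√k) ^ 2) k :=
      (Real.hasDerivAt_sqrt hk.ne').inv hs.ne'
    have h2 : HasDerivAt (fun k : ℝ => k⁻¹) (-(k ^ 2)⁻¹) k := hasDerivAt_inv hk.ne'
    have h3 : HasDerivAt (fun k => Real.exp (-(Y * k⁻¹))) (Real.exp (-(Y * k⁻¹)) * -(Y * -(k ^ 2)⁻¹)) k :=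
      (h2.const_mul Y).neg.exp
    refine ((h1.mul h3).const_mul ((2 * Real.pi)⁻¹ * √Real.pi)).congr_deriv ?_
    rw [Real.sq_sqrt hk.le]
    field_simp
    ring
  have hbound : ∀ k ∈ Icc κ (κ + η), ‖((2 * Real.pi)⁻¹ * √Real.pi) *
      ((√k)⁻¹ * k⁻¹ * Real.exp (-(Y * k⁻¹)) * (Y * k⁻¹ - 1 / 2))‖ ≤ (√κ)⁻¹ / (κ + Y) := by
    intro k hk
    have hk0 : 0 < k := hκ.trans_le hk.1
    have hs := Real.sqrt_pos.2 hk0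
    set y := Y * k⁻¹ with hy
    have hy0 : 0 ≤ y := by positivity
    have h1 : Real.exp (-y) * |y - 1 / 2| ≤ 2 / (1 + y) := by
      rw [le_div_iff₀ (by positivity), Real.exp_neg, mul_assoc, inv_mul_le_iff₀ (Real.exp_pos _)]
      have h2 := Real.quadratic_le_exp_of_nonneg hy0
      have h3 : |y - 1 / 2| ≤ y + 1 / 2 := abs_le.2 ⟨by linarith, by linarith⟩
      nlinarith
    have h4 : k⁻¹ * (2 / (1 + y)) = 2 / (k + Y) := by rw [hy]; field_simp
    rw [norm_mul, Real.norm_of_nonneg hc0, norm_mul, norm_mul, norm_mul, norm_inv, norm_inv,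
      Real.norm_of_nonneg hs.le, Real.norm_of_nonneg hk0.le, Real.norm_of_nonneg (Real.exp_pos _).le,
      Real.norm_eq_abs]
    calc _ = ((2 * Real.pi)⁻¹ * √Real.pi) * ((√k)⁻¹ * (k⁻¹ * (Real.exp (-y) * |y - 1 / 2|))) := by ring
      _ ≤ (1 / 2) * ((√k)⁻¹ * (k⁻¹ * (2 / (1 + y)))) := by gcongr
      _ = (√k)⁻¹ / (k + Y) := by rw [h4]; ring
      _ ≤ _ := by
        have := hk.1
        have := Real.sqrt_pos.2 hκ
        gcongr
  have h := (convex_Icc κ (κ + η)).norm_image_sub_le_of_norm_hasDerivWithin_le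
    (fun k hk => (hd k (hκ.trans_le hk.1)).hasDerivWithinAt) hbound
    (left_mem_Icc.2 (by linarith)) (right_mem_Icc.2 (by linarith))
  rw [← hfe _ hκ, ← hfe _ (by linarith)] at h
  rw [abs_sub_comm]
  simpa [abs_of_nonneg hη, mul_comm] using h

/-! ### Densities on pairs of frequencies and the Hilbert–Schmidt bound. -/

/-- The phase of a product of two plane waves at frequencies `q.1`, `q.2`. -/
def pairPhase (z q : ℝ × ℝ) : ℝ := (q.1 - q.2) * z.1 + (q.1 ^ 2 - q.2 ^ 2) * z.2

lemma pairPhase_sub (z w q : ℝ × ℝ) : pairPhase (z - w) q = pairPhase z q - pairPhase w q := by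
  simp only [pairPhase, Prod.fst_sub, Prod.snd_sub]; ring

/-- A density `|u|²` is quadratic in the datum, so its space-time oscillations are differences of
two points of the parabola. Here a symbol on pairs of frequencies is synthesised into a function of
space-time. -/
noncomputable def pairTransform (Φ : ℝ × ℝ → ℂ) (z : ℝ × ℝ) : ℂ := ∫ q, Φ q * cexp (I * (pairPhase z q : ℝ))

lemma continuous_pairPhase : Continuous fun p : (ℝ × ℝ) × (ℝ × ℝ) => pairPhase p.1 p.2 := by
  unfold pairPhase; fun_prop

lemma continuous_pair_cexp : Continuous fun p : (ℝ × ℝ) × (ℝ × ℝ) => cexp (I * (pairPhase p.1 p.2 : ℝ)) := by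
  have := continuous_pairPhase; fun_prop

lemma integrable_pairTransform {Φ : ℝ × ℝ → ℂ} (hΦ : Integrable Φ) (z : ℝ × ℝ) :
    Integrable fun q => Φ q * cexp (I * (pairPhase z q : ℝ)) := by
  refine hΦ.mul_bdd (c := 1) ?_ (.of_forall fun q => (norm_cexp_I_mul _).le)
  have h : Continuous fun q : ℝ × ℝ => (z, q) := by fun_prop
  exact (continuous_pair_cexp.comp h).aestronglyMeasurable

/-- A pair `q` oscillates in space at frequency `q.1 - q.2`, so the spatial heat average multiplies
the symbol by `e^{-η(q.1-q.2)²}`. -/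
lemma pairTransform_heat {Φ : ℝ × ℝ → ℂ} (hΦ : Integrable Φ) {η : ℝ} (hη : 0 < η) (x t : ℝ) :
    ∫ p : ℝ, (heatKernel η p : ℂ) * pairTransform Φ (x - p, t) =
      pairTransform (fun q => (Real.exp (-(η * (q.1 - q.2) ^ 2)) : ℝ) * Φ q) (x, t) := by
  have e : ∀ p (q : ℝ × ℝ), cexp (I * (pairPhase (x - p, t) q : ℝ)) =
      cexp (I * (pairPhase (x, t) q : ℝ)) * cexp (I * (-((q.1 - q.2) * p) : ℝ)) := by
    intro p q
    rw [← Complex.exp_add, ← mul_add, ← ofReal_add]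
    congr 3; simp only [pairPhase]; ring
  have hint : Integrable (fun w : ℝ × (ℝ × ℝ) => (heatKernel η w.1 : ℂ) *
      (Φ w.2 * cexp (I * (pairPhase (x - w.1, t) w.2 : ℝ)))) (volume.prod volume) := by
    have h1 : Integrable (fun w : ℝ × (ℝ × ℝ) => (heatKernel η w.1 : ℂ) * Φ w.2) (volume.prod volume) :=
      (integrable_heatKernel hη).ofReal.mul_prod hΦ
    have h2 : Continuous fun w : ℝ × (ℝ × ℝ) => ((x - w.1, t), w.2) := by fun_prop
    refine (h1.mul_bdd (c := 1) (continuous_pair_cexp.comp h2).aestronglyMeasurable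
      (.of_forall fun q => (norm_cexp_I_mul _).le)).congr (.of_forall fun w => ?_)
    simp only [Function.comp]; ring
  calc _ = ∫ p : ℝ, ∫ q, (heatKernel η p : ℂ) * (Φ q * cexp (I * (pairPhase (x - p, t) q : ℝ))) := by
        simp_rw [pairTransform, ← integral_const_mul]
    _ = ∫ q, ∫ p : ℝ, (heatKernel η p : ℂ) * (Φ q * cexp (I * (pairPhase (x - p, t) q : ℝ))) :=
        integral_integral_swap hint
    _ = _ := by
        rw [pairTransform]
        congr 1; ext q
        rw [← integral_heatKernel_cexp hη, mul_assoc, ← integral_mul_const]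
        congr 1; ext p
        rw [e]; ring

/-- The density `|v|²` in frequency variables. -/
noncomputable def densSymbol (α : ℝ) (h : ℝ → ℂ) (q : ℝ × ℝ) : ℂ :=
  (angularFT h q.1 * (starRingEnd ℂ) (angularFT h q.2)) * (Real.exp (-(α * (q.1 ^ 2 + q.2 ^ 2))) : ℝ)

lemma integrable_exp_neg_sq_prod {α : ℝ} (hα : 0 < α) :
    Integrable fun q : ℝ × ℝ => Real.exp (-(α * (q.1 ^ 2 + q.2 ^ 2))) := by
  have h := (integrable_exp_neg_mul_sq hα).mul_prod (integrable_exp_neg_mul_sq hα)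
  refine h.congr (.of_forall fun q => ?_)
  simp only
  rw [← Real.exp_add]; congr 1; ring

lemma integrable_densSymbol {α : ℝ} (hα : 0 < α) {h : ℝ → ℂ} (hh : Integrable h) :
    Integrable (densSymbol α h) := by
  have hc := continuous_angularFT hh
  refine (integrable_exp_neg_sq_prod hα).ofReal.bdd_mul (c := (∫ y, ‖h y‖) * ∫ y, ‖h y‖) ?_
    (.of_forall fun q => ?_)
  · exact ((hc.comp continuous_fst).mul (continuous_conj.comp (hc.comp continuous_snd))).aestronglyMeasurable
  · rw [norm_mul, RCLike.norm_conj]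
    gcongr <;> exact norm_angularFT_le _ _

lemma density_eq_pairTransform {α : ℝ} (hα : 0 < α) {h : ℝ → ℂ} (hh : Integrable h) (x t : ℝ) :
    (((2 * Real.pi) ^ 2 * ‖gaussEvol (cplxTime α t) h x‖ ^ 2 : ℝ) : ℂ) =
      pairTransform (densSymbol α h) (x, t) := by
  have h1 := gaussEvol_eq_fourier (A := cplxTime α t) hα hh x
  set w := ((2 * Real.pi : ℝ) : ℂ) * gaussEvol (cplxTime α t) h x with hw
  have e : (((2 * Real.pi) ^ 2 * ‖gaussEvol (cplxTime α t) h x‖ ^ 2 : ℝ) : ℂ) = w * (starRingEnd ℂ) w := by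
    rw [mul_conj, normSq_eq_norm_sq, hw, norm_mul, norm_real, Real.norm_of_nonneg (by positivity : 0 ≤ 2 * Real.pi),
      mul_pow (2 * Real.pi) ‖_‖]
  rw [e, h1, ← integral_conj, ← integral_prod_mul, pairTransform]
  congr 1; ext q
  rw [map_mul, densSymbol]
  have e1 : cexp (I * (q.1 * x : ℝ)) * cexp (-cplxTime α t * (q.1 : ℂ) ^ 2) *
      (starRingEnd ℂ) (cexp (I * (q.2 * x : ℝ)) * cexp (-cplxTime α t * (q.2 : ℂ) ^ 2)) =
      (Real.exp (-(α * (q.1 ^ 2 + q.2 ^ 2))) : ℝ) * cexp (I * (pairPhase (x, t) q : ℝ)) := by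
    rw [map_mul, ← exp_conj, ← exp_conj, ofReal_exp, ← Complex.exp_add, ← Complex.exp_add, ← Complex.exp_add,
      ← Complex.exp_add]
    congr 1
    have : cplxTime α t = (α : ℂ) - t * I := by apply Complex.ext <;> simp
    simp only [map_mul, map_neg, map_pow, conj_I, conj_ofReal, this, map_sub, pairPhase]
    push_cast
    ring_nf
  rw [mul_assoc (_ * _) ((Real.exp _ : ℝ) : ℂ), ← e1]
  ring

/-- The integral factors into a Gaussian kernel of complex time `2α - iτ` times its conjugate. The
squared modulus of that kernel is again a Gaussian in `X`, spreading with `τ`. -/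
lemma pairTransform_gaussian {α : ℝ} (hα : 0 < α) (X τ : ℝ) :
    pairTransform (fun q => (Real.exp (-(2 * α * (q.1 ^ 2 + q.2 ^ 2))) : ℝ)) (X, τ) =
      ((√(Real.pi ^ 3 / α) * heatKernel (α + τ ^ 2 / (4 * α)) X : ℝ) : ℂ) := by
  have h1 := gaussKernel_fourier (A := cplxTime (2 * α) τ) (by simpa using hα) X
  set w := ((2 * Real.pi : ℝ) : ℂ) * gaussKernel (cplxTime (2 * α) τ) X with hw
  have e : pairTransform (fun q => (Real.exp (-(2 * α * (q.1 ^ 2 + q.2 ^ 2))) : ℝ)) (X, τ) = w * (starRingEnd ℂ) w := by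
    rw [← h1, ← integral_conj, ← integral_prod_mul, pairTransform]
    congr 1; ext q
    rw [map_mul, ← exp_conj, ← exp_conj, ofReal_exp, ← Complex.exp_add, ← Complex.exp_add, ← Complex.exp_add,
      ← Complex.exp_add]
    congr 1
    have : cplxTime (2 * α) τ = ((2 * α : ℝ) : ℂ) - τ * I := by apply Complex.ext <;> simp
    simp only [map_mul, map_neg, map_pow, conj_I, conj_ofReal, this, map_sub, pairPhase]
    push_cast
    ring_nf
  rw [e, mul_conj, normSq_eq_norm_sq, hw, norm_mul, norm_real, Real.norm_of_nonneg (by positivity),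
    norm_gaussKernel_cplxTime, heatKernel]
  congr 1
  set S := (2 * α) ^ 2 + τ ^ 2 with hS
  have hS0 : 0 < S := by positivity
  have hκ : α + τ ^ 2 / (4 * α) = S / (4 * α) := by rw [hS]; field_simp; ring
  rw [hκ, ← mul_assoc, mul_inv_cancel_left₀ (by positivity), mul_pow, Real.sq_sqrt (by positivity), ← Real.exp_nat_mul]
  rw [show -X ^ 2 / (4 * (S / (4 * α))) = ((2 : ℕ) : ℝ) * (-(2 * α / (4 * S)) * X ^ 2) by push_cast; field_simp; ring]
  have h2 : √(Real.pi ^ 3 / α) * √(Real.pi / (S / (4 * α))) = 2 * Real.pi * (Real.pi / √S) := by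
    rw [← Real.sqrt_mul (by positivity)]
    have : Real.pi ^ 3 / α * (Real.pi / (S / (4 * α))) = (2 * Real.pi * (Real.pi / √S)) ^ 2 := by
      rw [mul_pow, div_pow, Real.sq_sqrt hS0.le]; field_simp; norm_num
    rw [this, Real.sqrt_sq (by positivity)]
  rw [show ∀ a b c d : ℝ, a * (b * c * d) = b * (a * c) * d by intros; ring, h2,
    inv_mul_cancel_left₀ (by positivity)]

/-- The symbol of the Hilbert–Schmidt kernel. -/
noncomputable def hsSymbol (α η : ℝ) (q : ℝ × ℝ) : ℝ :=
  Real.exp (-(2 * α * (q.1 ^ 2 + q.2 ^ 2))) * (1 - Real.exp (-(η * (q.1 - q.2) ^ 2)))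

lemma integrable_hsSymbol {α η : ℝ} (hα : 0 < α) (hη : 0 < η) : Integrable (hsSymbol α η) := by
  refine (integrable_exp_neg_sq_prod (α := 2 * α) (by positivity)).mul_bdd (c := 1) ?_ (.of_forall fun q => ?_)
  · exact (by fun_prop : Continuous fun q : ℝ × ℝ => 1 - Real.exp (-(η * (q.1 - q.2) ^ 2))).aestronglyMeasurable
  · have h1 : Real.exp (-(η * (q.1 - q.2) ^ 2)) ≤ 1 := Real.exp_le_one_iff.2 (neg_nonpos.2 (by positivity))
    have h2 := Real.exp_pos (-(η * (q.1 - q.2) ^ 2))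
    rw [Real.norm_eq_abs, abs_le]; constructor <;> linarith

lemma pairTransform_hsSymbol {α η : ℝ} (hα : 0 < α) (hη : 0 < η) (X τ : ℝ) :
    pairTransform (fun q => (hsSymbol α η q : ℂ)) (X, τ) =
      ((√(Real.pi ^ 3 / α) * (heatKernel (α + τ ^ 2 / (4 * α)) X - heatKernel (α + τ ^ 2 / (4 * α) + η) X) : ℝ) : ℂ) := by
  set Φ : ℝ × ℝ → ℂ := fun q => (Real.exp (-(2 * α * (q.1 ^ 2 + q.2 ^ 2))) : ℝ) with hΦ
  have hint : Integrable Φ := (integrable_exp_neg_sq_prod (α := 2 * α) (by positivity)).ofReal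
  set κ := α + τ ^ 2 / (4 * α)
  have hκ : 0 < κ := by positivity
  have h2 : pairTransform (fun q => (Real.exp (-(η * (q.1 - q.2) ^ 2)) : ℝ) * Φ q) (X, τ) =
      ((√(Real.pi ^ 3 / α) * heatKernel (κ + η) X : ℝ) : ℂ) := by
    rw [← pairTransform_heat hint hη, ← integral_heatKernel_mul hκ hη, ← integral_const_mul]
    refine Eq.trans ?_ integral_ofReal
    congr 1; ext p
    change _ = ((√(Real.pi ^ 3 / α) * (heatKernel η p * heatKernel κ (X - p)) : ℝ) : ℂ)
    rw [show pairTransform Φ (X - p, τ) = ((√(Real.pi ^ 3 / α) * heatKernel κ (X - p) : ℝ) : ℂ) from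
      pairTransform_gaussian hα _ _]
    simp only [ofReal_mul]; ring
  have h3 : Integrable (fun q : ℝ × ℝ => (Real.exp (-(η * (q.1 - q.2) ^ 2)) : ℝ) * Φ q) := by
    refine hint.bdd_mul (c := 1) ?_ (.of_forall fun q => ?_)
    · exact (by fun_prop : Continuous fun q : ℝ × ℝ => ((Real.exp (-(η * (q.1 - q.2) ^ 2)) : ℝ) : ℂ)).aestronglyMeasurable
    · rw [norm_real, Real.norm_of_nonneg (Real.exp_pos _).le]
      exact Real.exp_le_one_iff.2 (neg_nonpos.2 (by positivity))
  rw [mul_sub, ofReal_sub, ← h2, ← pairTransform_gaussian hα, pairTransform, pairTransform, pairTransform,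
    ← integral_sub (integrable_pairTransform hint _) (integrable_pairTransform h3 _)]
  congr 1; ext q
  simp only [hsSymbol, hΦ]; push_cast; ring

/-- Put `x = (X/(2√α))²`, `y = (τ/(2α))²` and `κ = α(1 + y)`. Subtracting the heat average turns the
kernel into a difference of heat kernels at `κ` and `κ + η`, which gains `η/κ` and gives `α⁻¹
(1+y)^{-1/2} (1+y+x)⁻¹`. Shifting a power `1/4` between the factors gives exponent `-3/4` in each of
`1 + x` and `1 + y`: brackets of order `3/2 > 1`, as the box lemma requires. Without the subtraction
the decay in `τ` would only be of order one. -/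
lemma norm_pairTransform_hsSymbol_le {α η : ℝ} (hα : 0 < α) (hη : 0 < η) (hηα : η ≤ 3 * α) (X τ : ℝ) :
    ‖pairTransform (fun q => (hsSymbol α η q : ℂ)) (X, τ)‖ ≤ 18 * α⁻¹ *
      ((1 + (X / (2 * √α)) ^ 2) ^ (-(3 / 2) / 2 : ℝ) * (1 + (τ / (2 * α)) ^ 2) ^ (-(3 / 2) / 2 : ℝ)) := by
  have hsα := Real.sqrt_pos.2 hα
  set y := (τ / (2 * α)) ^ 2 with hy
  set x := (X / (2 * √α)) ^ 2 with hx
  have hy0 : 0 ≤ y := by positivity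
  have hx0 : 0 ≤ x := by positivity
  have hκ : α + τ ^ 2 / (4 * α) = α * (1 + y) := by rw [hy]; field_simp; ring
  have hX : X ^ 2 / 4 = α * x := by
    rw [hx, div_pow, mul_pow, Real.sq_sqrt hα.le]; field_simp; ring
  rw [pairTransform_hsSymbol hα hη, hκ, norm_real, norm_mul, Real.norm_of_nonneg (by positivity), Real.norm_eq_abs]
  have h1 := abs_heatKernel_sub_le (κ := α * (1 + y)) (by positivity) hη.le X
  rw [hX, ← mul_add] at h1
  have h2 : √(Real.pi ^ 3 / α) ≤ 6 / √α := by
    rw [Real.sqrt_div (by positivity)]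
    gcongr
    rw [Real.sqrt_le_left (by norm_num)]
    have := Real.pi_lt_d2
    have h0 := Real.pi_pos
    calc Real.pi ^ 3 ≤ 3.15 ^ 3 := by gcongr
      _ ≤ _ := by norm_num
  have h3 : (1 + x) ^ (3 / 4 : ℝ) * (1 + y) ^ (3 / 4 : ℝ) ≤ (1 + y) ^ (1 / 2 : ℝ) * (1 + y + x) := by
    calc _ ≤ (1 + y + x) ^ (3 / 4 : ℝ) * ((1 + y) ^ (1 / 2 : ℝ) * (1 + y) ^ (1 / 4 : ℝ)) := by
          rw [← Real.rpow_add (by positivity), show (1 / 2 + 1 / 4 : ℝ) = 3 / 4 by norm_num]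
          refine mul_le_mul_of_nonneg_right (Real.rpow_le_rpow ?_ ?_ (by norm_num)) ?_ <;>
            first | positivity | linarith
      _ ≤ (1 + y + x) ^ (3 / 4 : ℝ) * ((1 + y) ^ (1 / 2 : ℝ) * (1 + y + x) ^ (1 / 4 : ℝ)) := by
          have : (1 + y) ^ (1 / 4 : ℝ) ≤ (1 + y + x) ^ (1 / 4 : ℝ) :=
            Real.rpow_le_rpow (by positivity) (by linarith) (by norm_num)
          gcongr
      _ = (1 + y) ^ (1 / 2 : ℝ) * ((1 + y + x) ^ (3 / 4 : ℝ) * (1 + y + x) ^ (1 / 4 : ℝ)) := by ring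
      _ = _ := by rw [← Real.rpow_add (by positivity)]; norm_num
  have hs : √(α * (1 + y)) = √α * (1 + y) ^ (1 / 2 : ℝ) := by
    rw [Real.sqrt_mul hα.le, Real.sqrt_eq_rpow (1 + y)]
  calc _ ≤ 6 / √α * (3 * α * ((√(α * (1 + y)))⁻¹ / (α * (1 + y + x)))) := by
        gcongr
        exact h1.trans (by gcongr)
    _ = 18 * (√α * √α)⁻¹ * ((1 + y) ^ (1 / 2 : ℝ) * (1 + y + x))⁻¹ := by
        rw [hs]; field_simp
        norm_num
    _ ≤ 18 * (√α * √α)⁻¹ * ((1 + x) ^ (3 / 4 : ℝ) * (1 + y) ^ (3 / 4 : ℝ))⁻¹ := by gcongr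
    _ = _ := by
        rw [Real.mul_self_sqrt hα.le, mul_inv, ← Real.rpow_neg (by positivity), ← Real.rpow_neg (by positivity)]
        norm_num

/-- The Fourier transform of `ν` along pairs of frequencies. -/
noncomputable def pairFT (ν : Measure (ℝ × ℝ)) (q : ℝ × ℝ) : ℂ := ∫ z, cexp (I * (pairPhase z q : ℝ)) ∂ν

lemma norm_pairFT_le (ν : Measure (ℝ × ℝ)) (q : ℝ × ℝ) : ‖pairFT ν q‖ ≤ ν.real univ := by
  refine (norm_integral_le_integral_norm _).trans (le_of_eq ?_)
  simp_rw [norm_cexp_I_mul]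
  simp [Measure.real]

lemma measurable_pairFT (ν : Measure (ℝ × ℝ)) [SFinite ν] : Measurable (pairFT ν) := by
  have h : Continuous fun p : (ℝ × ℝ) × (ℝ × ℝ) => cexp (I * (pairPhase p.2 p.1 : ℝ)) :=
    continuous_pair_cexp.comp continuous_swap
  exact (h.stronglyMeasurable.integral_prod_right (ν := ν)).measurable

lemma integral_pairTransform {ν : Measure (ℝ × ℝ)} [IsFiniteMeasure ν] {Φ : ℝ × ℝ → ℂ} (hΦ : Integrable Φ) :
    ∫ z, pairTransform Φ z ∂ν = ∫ q, Φ q * pairFT ν q := by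
  have hint : Integrable (fun w : (ℝ × ℝ) × (ℝ × ℝ) => Φ w.2 * cexp (I * (pairPhase w.1 w.2 : ℝ))) (ν.prod volume) := by
    have h1 : Integrable (fun w : (ℝ × ℝ) × (ℝ × ℝ) => Φ w.2) (ν.prod volume) := by
      have := (integrable_const (μ := ν) (1 : ℂ)).mul_prod hΦ
      simpa using this
    exact h1.mul_bdd (c := 1) continuous_pair_cexp.aestronglyMeasurable (.of_forall fun q => (norm_cexp_I_mul _).le)
  calc _ = ∫ q, (∫ z, Φ q * cexp (I * (pairPhase z q : ℝ)) ∂ν) := integral_integral_swap hint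
    _ = _ := by simp_rw [integral_const_mul]; rfl

lemma pairFT_mul_conj (ν : Measure (ℝ × ℝ)) [IsFiniteMeasure ν] (q : ℝ × ℝ) :
    pairFT ν q * (starRingEnd ℂ) (pairFT ν q) = ∫ p : (ℝ × ℝ) × (ℝ × ℝ), cexp (I * (pairPhase (p.1 - p.2) q : ℝ)) ∂(ν.prod ν) := by
  rw [pairFT, ← integral_conj, ← integral_prod_mul]
  congr 1; ext p
  rw [pairPhase_sub, ← exp_conj, ← Complex.exp_add]
  congr 1
  simp only [map_mul, conj_I, conj_ofReal]
  push_cast; ring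

/-- Opening the square of `pairFT` gives a double integral over `ν × ν` of a kernel in the
difference of the two points. For one point fixed, the decay of that kernel makes the integral in
the other at most a constant times the largest mass `m` of a box. -/
lemma lintegral_hs_le : ∃ C : ℝ, 0 < C ∧ ∀ α η : ℝ, 0 < α → 0 < η → η ≤ 3 * α →
    ∀ (ν : Measure (ℝ × ℝ)) [IsFiniteMeasure ν] (m : ℝ≥0∞),
      (∀ x t, ν {z | |z.1 - x| ≤ 2 * √α ∧ |z.2 - t| ≤ 2 * α} ≤ m) →
      ∫⁻ q, ENNReal.ofReal (hsSymbol α η q) * ‖pairFT ν q‖ₑ ^ 2 ≤ ENNReal.ofReal (C * α⁻¹) * m * ν univ := by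
  obtain ⟨C, hC, h⟩ := lintegral_japanese_le_box (s := 3 / 2) (s' := 3 / 2) (by norm_num) (by norm_num)
  refine ⟨18 * C, by positivity, fun α η hα hη hηα ν _ m hm => ?_⟩
  have hsym := integrable_hsSymbol hα hη
  have hnn : ∀ q, 0 ≤ hsSymbol α η q := fun q => by
    have h1 : Real.exp (-(η * (q.1 - q.2) ^ 2)) ≤ 1 := Real.exp_le_one_iff.2 (neg_nonpos.2 (by positivity))
    exact mul_nonneg (Real.exp_pos _).le (by linarith)
  have hint : Integrable (fun q => hsSymbol α η q * ‖pairFT ν q‖ ^ 2) := by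
    refine hsym.mul_bdd (c := ν.real univ ^ 2) ?_ (.of_forall fun q => ?_)
    · exact ((measurable_pairFT ν).norm.pow_const 2).aestronglyMeasurable
    · rw [Real.norm_of_nonneg (by positivity)]
      gcongr
      exact norm_pairFT_le ν q
  have e1 : ∫⁻ q, ENNReal.ofReal (hsSymbol α η q) * ‖pairFT ν q‖ₑ ^ 2 =
      ‖∫ q, ((hsSymbol α η q * ‖pairFT ν q‖ ^ 2 : ℝ) : ℂ)‖ₑ := by
    have h1 : ∫ q, ((hsSymbol α η q * ‖pairFT ν q‖ ^ 2 : ℝ) : ℂ) = ((∫ q, hsSymbol α η q * ‖pairFT ν q‖ ^ 2 : ℝ) : ℂ) :=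
      integral_ofReal
    rw [h1, ← ofReal_norm, norm_real, Real.norm_of_nonneg (integral_nonneg fun q => mul_nonneg (hnn q) (by positivity)),
      ofReal_integral_eq_lintegral_ofReal hint (.of_forall fun q => mul_nonneg (hnn q) (by positivity))]
    refine lintegral_congr fun q => ?_
    rw [ENNReal.ofReal_mul (hnn q), ENNReal.ofReal_pow (norm_nonneg _), ofReal_norm]
  have hint2 : Integrable (fun w : (ℝ × ℝ) × ((ℝ × ℝ) × (ℝ × ℝ)) => (hsSymbol α η w.1 : ℂ) *
      cexp (I * (pairPhase (w.2.1 - w.2.2) w.1 : ℝ))) (volume.prod (ν.prod ν)) := by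
    have h1 : Integrable (fun w : (ℝ × ℝ) × ((ℝ × ℝ) × (ℝ × ℝ)) => (hsSymbol α η w.1 : ℂ)) (volume.prod (ν.prod ν)) := by
      have := hsym.ofReal.mul_prod (integrable_const (μ := ν.prod ν) (1 : ℂ))
      simpa using this
    have h2 : Continuous fun w : (ℝ × ℝ) × ((ℝ × ℝ) × (ℝ × ℝ)) => (w.2.1 - w.2.2, w.1) := by fun_prop
    exact h1.mul_bdd (c := 1) (continuous_pair_cexp.comp h2).aestronglyMeasurable
      (.of_forall fun q => (norm_cexp_I_mul _).le)
  have e2 : ∫ q, ((hsSymbol α η q * ‖pairFT ν q‖ ^ 2 : ℝ) : ℂ) =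
      ∫ p : (ℝ × ℝ) × (ℝ × ℝ), pairTransform (fun q => (hsSymbol α η q : ℂ)) (p.1 - p.2) ∂(ν.prod ν) := by
    calc _ = ∫ q, (∫ p : (ℝ × ℝ) × (ℝ × ℝ), (hsSymbol α η q : ℂ) *
          cexp (I * (pairPhase (p.1 - p.2) q : ℝ)) ∂(ν.prod ν)) := by
          congr 1; ext q
          rw [integral_const_mul, ← pairFT_mul_conj, mul_conj, normSq_eq_norm_sq, ofReal_mul]
      _ = _ := integral_integral_swap hint2
  rw [e1, e2]
  have hmeas : Measurable fun p : (ℝ × ℝ) × (ℝ × ℝ) => ENNReal.ofReal (18 * α⁻¹ *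
      ((1 + ((p.1 - p.2).1 / (2 * √α)) ^ 2) ^ (-(3 / 2) / 2 : ℝ) *
        (1 + ((p.1 - p.2).2 / (2 * α)) ^ 2) ^ (-(3 / 2) / 2 : ℝ))) := by fun_prop
  calc _ ≤ ∫⁻ p : (ℝ × ℝ) × (ℝ × ℝ), ‖pairTransform (fun q => (hsSymbol α η q : ℂ)) (p.1 - p.2)‖ₑ ∂(ν.prod ν) :=
        enorm_integral_le_lintegral_enorm _
    _ ≤ ∫⁻ p : (ℝ × ℝ) × (ℝ × ℝ), ENNReal.ofReal (18 * α⁻¹ *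
      ((1 + ((p.1 - p.2).1 / (2 * √α)) ^ 2) ^ (-(3 / 2) / 2 : ℝ) *
        (1 + ((p.1 - p.2).2 / (2 * α)) ^ 2) ^ (-(3 / 2) / 2 : ℝ))) ∂(ν.prod ν) := by
        refine lintegral_mono fun p => ?_
        rw [← ofReal_norm]
        exact ENNReal.ofReal_le_ofReal (norm_pairTransform_hsSymbol_le hα hη hηα _ _)
    _ = ∫⁻ p', (∫⁻ p, ENNReal.ofReal (18 * α⁻¹ *
      ((1 + ((p.1 - p'.1) / (2 * √α)) ^ 2) ^ (-(3 / 2) / 2 : ℝ) *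
        (1 + ((p.2 - p'.2) / (2 * α)) ^ 2) ^ (-(3 / 2) / 2 : ℝ))) ∂ν) ∂ν := lintegral_prod_symm' _ hmeas
    _ ≤ ∫⁻ p', ENNReal.ofReal (18 * α⁻¹) * (ENNReal.ofReal C * m) ∂ν := by
        refine lintegral_mono fun p' => ?_
        simp_rw [ENNReal.ofReal_mul (show 0 ≤ 18 * α⁻¹ by positivity)]
        rw [lintegral_const_mul' _ _ ENNReal.ofReal_ne_top]
        gcongr
        exact h ν Prod.fst Prod.snd measurable_fst measurable_snd _ _ (by positivity) (by positivity) _ _ m hm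
    _ = _ := by
        rw [lintegral_const, ← mul_assoc, ← ENNReal.ofReal_mul (by positivity), show 18 * α⁻¹ * C = 18 * C * α⁻¹ by ring]

/-- The heat average in the space variable. -/
noncomputable def heatAvg (η : ℝ) (F : ℝ → ℝ≥0∞) (x : ℝ) : ℝ≥0∞ :=
  ∫⁻ p, ENNReal.ofReal (heatKernel η p) * F (x - p)

lemma norm_evol_le {α : ℝ} (hα : 0 < α) (t : ℝ) {h : ℝ → ℂ} (hh : Integrable h) (x : ℝ) :
    ‖gaussEvol (cplxTime α t) h x‖ ≤ (√α)⁻¹ * ∫ y, ‖h y‖ := by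
  refine (norm_gaussEvol_le h x).trans ?_
  rw [← integral_const_mul]
  refine integral_mono_of_nonneg (.of_forall fun y => by positivity) (hh.norm.const_mul _) (.of_forall fun y => ?_)
  simp only
  gcongr
  refine (norm_gaussKernel_le (A := cplxTime α t) hα _).trans ?_
  rw [norm_cplxTime, inv_mul_le_iff₀ (by positivity)]
  have h1 : α ≤ √(α ^ 2 + t ^ 2) := Real.le_sqrt_of_sq_le (by nlinarith [sq_nonneg t])
  calc √(Real.pi / √(α ^ 2 + t ^ 2)) ≤ √(Real.pi / α) := by gcongr
    _ = √Real.pi / √α := Real.sqrt_div Real.pi_pos.le _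
    _ ≤ _ := by
      rw [div_eq_mul_inv]
      gcongr
      rw [Real.sqrt_le_left (by positivity)]
      nlinarith [Real.pi_gt_three]

lemma measurable_evol_space_time {g : ℝ → ℂ} (hg : Measurable g) (r : ℝ) :
    Measurable fun z : ℝ × ℝ => gaussEvol (cplxTime r z.2) g z.1 := by
  have h := measurable_evol_time hg r
  have h2 := h.comp (measurable_swap (α := ℝ) (β := ℝ))
  exact h2

-- On pairs of frequencies the density minus its heat average has symbol `ĥ ⊗ conj ĥ` times a weight
-- vanishing on the diagonal. Pairing with the transform of `ν` and applying Cauchy–Schwarz gives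
-- `2π ‖h‖₂²` from the tensor product and the Hilbert–Schmidt bound from the rest.
set_option maxHeartbeats 800000 in
lemma lintegral_evol_sq_le_heat : ∃ C : ℝ, 0 < C ∧ ∀ α η : ℝ, 0 < α → 0 < η → η ≤ 3 * α →
    ∀ (ν : Measure (ℝ × ℝ)) [IsFiniteMeasure ν] (m : ℝ≥0∞),
      (∀ x t, ν {z | |z.1 - x| ≤ 2 * √α ∧ |z.2 - t| ≤ 2 * α} ≤ m) → ∀ h, BddIntegrable h →
      ∫⁻ z, ‖gaussEvol (cplxTime α z.2) h z.1‖ₑ ^ 2 ∂ν ≤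
        ∫⁻ z, heatAvg η (fun x => ‖gaussEvol (cplxTime α z.2) h x‖ₑ ^ 2) z.1 ∂ν +
          (ENNReal.ofReal (C * α⁻¹) * m * ν univ) ^ (1 / 2 : ℝ) * ∫⁻ x, ‖h x‖ₑ ^ 2 := by
  obtain ⟨C, hC, hHS⟩ := lintegral_hs_le
  refine ⟨C, hC, fun α η hα hη hηα ν _ m hm h hh => ?_⟩
  set Φ := densSymbol α h with hΦ
  have hΦi : Integrable Φ := integrable_densSymbol hα hh.int
  set Φ' : ℝ × ℝ → ℂ := fun q => (Real.exp (-(η * (q.1 - q.2) ^ 2)) : ℝ) * Φ q with hΦ'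
  have hΦi' : Integrable Φ' := by
    refine hΦi.bdd_mul (c := 1) ?_ (.of_forall fun q => ?_)
    · exact (by fun_prop : Continuous fun q : ℝ × ℝ => ((Real.exp (-(η * (q.1 - q.2) ^ 2)) : ℝ) : ℂ)).aestronglyMeasurable
    · rw [norm_real, Real.norm_of_nonneg (Real.exp_pos _).le]
      exact Real.exp_le_one_iff.2 (neg_nonpos.2 (by positivity))
  set f : ℝ × ℝ → ℝ := fun z => (2 * Real.pi) ^ 2 * ‖gaussEvol (cplxTime α z.2) h z.1‖ ^ 2 with hf
  set K := (√α)⁻¹ * ∫ y, ‖h y‖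
  have hmv : Measurable fun z : ℝ × ℝ => gaussEvol (cplxTime α z.2) h z.1 :=
    measurable_evol_space_time hh.meas α
  have hfm : Measurable f := (hmv.norm.pow_const 2).const_mul _
  have hf0 : ∀ z, 0 ≤ f z := fun z => by positivity
  have hfb : ∀ z, f z ≤ (2 * Real.pi) ^ 2 * K ^ 2 := fun z => by
    simp only [hf]; gcongr; exact norm_evol_le hα _ hh.int _
  have hfi : Integrable f ν := by
    refine Integrable.of_bound hfm.aestronglyMeasurable ((2 * Real.pi) ^ 2 * K ^ 2) (.of_forall fun z => ?_)
    rw [Real.norm_of_nonneg (hf0 z)]; exact hfb z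
  have hft : ∀ z : ℝ × ℝ, (f z : ℂ) = pairTransform Φ z := fun z => density_eq_pairTransform hα hh.int z.1 z.2
  set F : ℝ × ℝ → ℝ := fun z => ∫ p, heatKernel η p * f (z.1 - p, z.2) with hF
  have hFt : ∀ z : ℝ × ℝ, (F z : ℂ) = pairTransform Φ' z := fun z => by
    have := pairTransform_heat hΦi hη z.1 z.2
    rw [hF, hΦ', ← this]
    refine Eq.trans integral_ofReal.symm ?_
    congr 1; ext p
    rw [← hft]
    exact ofReal_mul _ _
  have hF0 : ∀ z, 0 ≤ F z := fun z => integral_nonneg fun p => mul_nonneg (heatKernel_nonneg _ _) (hf0 _)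
  have hheat_int : ∀ z : ℝ × ℝ, Integrable fun p => heatKernel η p * f (z.1 - p, z.2) := fun z => by
    refine (integrable_heatKernel hη).mul_bdd (c := (2 * Real.pi) ^ 2 * K ^ 2) ?_ (.of_forall fun p => ?_)
    · exact (hfm.comp (by fun_prop : Measurable fun p : ℝ => (z.1 - p, z.2))).aestronglyMeasurable
    · rw [Real.norm_of_nonneg (hf0 _)]; exact hfb _
  have hFi : Integrable F ν := by
    have hFm : Measurable F := by
      have h1 : Measurable fun w : (ℝ × ℝ) × ℝ => heatKernel η w.2 * f (w.1.1 - w.2, w.1.2) := by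
        have h2 : Measurable fun w : (ℝ × ℝ) × ℝ => (w.1.1 - w.2, w.1.2) := by fun_prop
        have h3 : Measurable fun w : (ℝ × ℝ) × ℝ => heatKernel η w.2 := (continuous_heatKernel η).measurable.comp measurable_snd
        exact h3.mul (hfm.comp h2)
      exact (h1.stronglyMeasurable.integral_prod_right (ν := volume)).measurable
    refine Integrable.of_bound hFm.aestronglyMeasurable ((2 * Real.pi) ^ 2 * K ^ 2) (.of_forall fun z => ?_)
    rw [Real.norm_of_nonneg (hF0 z)]
    calc F z ≤ ∫ p, heatKernel η p * ((2 * Real.pi) ^ 2 * K ^ 2) := by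
          refine integral_mono (hheat_int z) ((integrable_heatKernel hη).mul_const _) fun p => ?_
          exact mul_le_mul_of_nonneg_left (hfb _) (heatKernel_nonneg _ _)
      _ = _ := by rw [integral_mul_const, integral_heatKernel hη, one_mul]
  set w : ℝ × ℝ → ℝ := fun q => Real.exp (-(α * (q.1 ^ 2 + q.2 ^ 2))) * (1 - Real.exp (-(η * (q.1 - q.2) ^ 2))) with hw
  set G : ℝ × ℝ → ℂ := fun q => angularFT h q.1 * (starRingEnd ℂ) (angularFT h q.2) with hG
  have hcH := continuous_angularFT hh.int
  have hGm : Measurable G := by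
    exact ((hcH.comp continuous_fst).mul (continuous_conj.comp (hcH.comp continuous_snd))).measurable
  have hNm := measurable_pairFT ν
  have hdiff : ENNReal.ofReal (∫ z, f z ∂ν) ≤ ENNReal.ofReal (∫ z, F z ∂ν) + ∫⁻ q, ‖G q‖ₑ * ‖(w q : ℂ) * pairFT ν q‖ₑ := by
    have e1 : (((∫ z, f z ∂ν) - ∫ z, F z ∂ν : ℝ) : ℂ) = ∫ q, G q * ((w q : ℂ) * pairFT ν q) := by
      have h1 : ((∫ z, f z ∂ν : ℝ) : ℂ) = ∫ q, Φ q * pairFT ν q := by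
        rw [← integral_pairTransform hΦi]
        refine Eq.trans integral_ofReal.symm ?_
        congr 1; ext z; exact hft z
      have h2 : ((∫ z, F z ∂ν : ℝ) : ℂ) = ∫ q, Φ' q * pairFT ν q := by
        rw [← integral_pairTransform hΦi']
        refine Eq.trans integral_ofReal.symm ?_
        congr 1; ext z; exact hFt z
      have hb : ∀ {Ψ : ℝ × ℝ → ℂ}, Integrable Ψ → Integrable fun q => Ψ q * pairFT ν q := fun hΨ =>
        hΨ.mul_bdd (c := ν.real univ) hNm.aestronglyMeasurable (.of_forall (norm_pairFT_le ν))
      rw [ofReal_sub, h1, h2, ← integral_sub (hb hΦi) (hb hΦi')]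
      congr 1; ext q
      simp only [hΦ', hΦ, densSymbol, hG, hw]
      push_cast; ring
    calc ENNReal.ofReal (∫ z, f z ∂ν) = ENNReal.ofReal ((∫ z, F z ∂ν) + ((∫ z, f z ∂ν) - ∫ z, F z ∂ν)) := by
          congr 1; ring
      _ ≤ ENNReal.ofReal (∫ z, F z ∂ν) + ENNReal.ofReal ((∫ z, f z ∂ν) - ∫ z, F z ∂ν) := ENNReal.ofReal_add_le
      _ ≤ _ := by
          gcongr
          refine (ENNReal.ofReal_le_ofReal (le_abs_self _)).trans ?_
          rw [← Real.norm_eq_abs, ← norm_real, e1, ofReal_norm]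
          refine (enorm_integral_le_lintegral_enorm _).trans (le_of_eq ?_)
          simp_rw [enorm_mul]
  have hGw : ∫⁻ q, ‖G q‖ₑ * ‖(w q : ℂ) * pairFT ν q‖ₑ ≤ ENNReal.ofReal (2 * Real.pi) * (∫⁻ x, ‖h x‖ₑ ^ 2) *
      (ENNReal.ofReal (C * α⁻¹) * m * ν univ) ^ (1 / 2 : ℝ) := by
    have hwm : Measurable w := by simp only [hw]; fun_prop
    have hCS := ENNReal.lintegral_mul_le_Lp_mul_Lq (volume : Measure (ℝ × ℝ)) Real.HolderConjugate.two_two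
      hGm.enorm.aemeasurable (hwm.complex_ofReal.mul hNm).enorm.aemeasurable
    refine hCS.trans ?_
    have h2 : ∀ a : ℝ≥0∞, a ^ (2 : ℝ) = a ^ 2 := fun a => by exact_mod_cast ENNReal.rpow_natCast a 2
    simp_rw [h2]
    gcongr ?_ * (?_) ^ (1 / 2 : ℝ)
    · have e3 : ∫⁻ q, ‖G q‖ₑ ^ 2 = (ENNReal.ofReal (2 * Real.pi) * ∫⁻ x, ‖h x‖ₑ ^ 2) ^ 2 := by
        have := lintegral_prod_mul (μ := (volume : Measure ℝ)) (ν := (volume : Measure ℝ))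
          (hcH.measurable.enorm.pow_const 2).aemeasurable (hcH.measurable.enorm.pow_const 2).aemeasurable
        rw [lintegral_angularFT_sq hh.int hh.memLp_two, ← sq] at this
        rw [← this]
        refine lintegral_congr fun q => ?_
        rw [hG, enorm_mul, RCLike.enorm_conj, mul_pow]
      rw [e3, ← h2, ← ENNReal.rpow_mul]
      norm_num
    · refine le_trans (lintegral_mono fun q => ?_) (hHS α η hα hη hηα ν m hm)
      simp only [Pi.mul_apply]
      rw [enorm_mul, mul_pow]
      gcongr
      rw [← ofReal_norm, norm_real, ← ENNReal.ofReal_pow (norm_nonneg _), Real.norm_eq_abs, sq_abs]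
      apply ENNReal.ofReal_le_ofReal
      -- The square of `w` is at most `hsSymbol α η`, because `(1 - e)² ≤ 1 - e` for `e ∈ [0, 1]`.
      have h1 : Real.exp (-(η * (q.1 - q.2) ^ 2)) ≤ 1 := Real.exp_le_one_iff.2 (neg_nonpos.2 (by positivity))
      have h3 := Real.exp_pos (-(η * (q.1 - q.2) ^ 2))
      simp only [hw, hsSymbol]
      rw [mul_pow, ← Real.exp_nat_mul]
      have e4 : Real.exp ((2 : ℕ) * -(α * (q.1 ^ 2 + q.2 ^ 2))) = Real.exp (-(2 * α * (q.1 ^ 2 + q.2 ^ 2))) := by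
        congr 1; push_cast; ring
      rw [e4]
      gcongr
      nlinarith
  have hc : ENNReal.ofReal ((2 * Real.pi) ^ 2) ≠ 0 := by
    rw [Ne, ENNReal.ofReal_eq_zero, not_le]; positivity
  have e5 : ∀ z : ℝ × ℝ, ENNReal.ofReal (f z) = ENNReal.ofReal ((2 * Real.pi) ^ 2) * ‖gaussEvol (cplxTime α z.2) h z.1‖ₑ ^ 2 := by
    intro z
    simp only [hf]
    rw [ENNReal.ofReal_mul (by positivity), ENNReal.ofReal_pow (norm_nonneg _), ofReal_norm]
  rw [ofReal_integral_eq_lintegral_ofReal hfi (.of_forall hf0), ofReal_integral_eq_lintegral_ofReal hFi (.of_forall hF0)] at hdiff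
  have e6 : ∀ z : ℝ × ℝ, ENNReal.ofReal (F z) = ENNReal.ofReal ((2 * Real.pi) ^ 2) *
      heatAvg η (fun x => ‖gaussEvol (cplxTime α z.2) h x‖ₑ ^ 2) z.1 := by
    intro z
    rw [hF, heatAvg, ofReal_integral_eq_lintegral_ofReal (hheat_int z)
      (.of_forall fun p => mul_nonneg (heatKernel_nonneg _ _) (hf0 _)), ← lintegral_const_mul' _ _ ENNReal.ofReal_ne_top]
    refine lintegral_congr fun p => ?_
    rw [ENNReal.ofReal_mul (heatKernel_nonneg _ _), e5]
    ring
  simp_rw [e5, e6] at hdiff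
  rw [lintegral_const_mul' _ _ ENNReal.ofReal_ne_top, lintegral_const_mul' _ _ ENNReal.ofReal_ne_top] at hdiff
  rw [← ENNReal.mul_le_mul_iff_right hc ENNReal.ofReal_ne_top, mul_add]
  refine hdiff.trans (add_le_add le_rfl (hGw.trans ?_))
  rw [mul_assoc, mul_comm (∫⁻ x, _)]
  gcongr
  nlinarith [Real.pi_gt_three]

/-! ### Localisation to spatial windows of width `α^{-1/2}`. -/

section Window

variable {Ω : Type*} [MeasurableSpace Ω] {μ : Measure Ω} {X : Ω → ℝ} {F : Ω → ℝ≥0∞}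

lemma measurableSet_window (hX : Measurable X) (a : ℝ) : MeasurableSet {p : ℝ × Ω | |X p.2 - p.1| ≤ a} :=
  measurableSet_le (by fun_prop) measurable_const

lemma setLIntegral_window_eq (hX : Measurable X) (a κ : ℝ) :
    ∫⁻ z in {z | |X z - κ| ≤ a}, F z ∂μ =
      ∫⁻ z, {p : ℝ × Ω | |X p.2 - p.1| ≤ a}.indicator (fun p => F p.2) (κ, z) ∂μ := by
  rw [← lintegral_indicator (measurableSet_le (by fun_prop) measurable_const)]
  rfl

lemma measurable_window [SFinite μ] (hX : Measurable X) (hF : Measurable F) (a : ℝ) :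
    Measurable fun κ : ℝ => ∫⁻ z in {z | |X z - κ| ≤ a}, F z ∂μ := by
  simp_rw [setLIntegral_window_eq hX]
  exact Measurable.lintegral_prod_right' ((hF.comp measurable_snd).indicator (measurableSet_window hX a))

/-- Each point belongs to the windows whose centres fill an interval of length `2a`. Averaging over
all centres takes the place of a partition, so no overlaps are counted. -/
lemma lintegral_window [SFinite μ] (hX : Measurable X) (hF : Measurable F) {a : ℝ} :
    ∫⁻ κ : ℝ, ∫⁻ z in {z | |X z - κ| ≤ a}, F z ∂μ = ENNReal.ofReal (2 * a) * ∫⁻ z, F z ∂μ := by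
  simp_rw [setLIntegral_window_eq hX]
  rw [lintegral_lintegral_swap, ← lintegral_const_mul _ hF]
  · refine lintegral_congr fun z => ?_
    have : ∀ κ : ℝ, {p : ℝ × Ω | |X p.2 - p.1| ≤ a}.indicator (fun p => F p.2) (κ, z) =
        (Icc (X z - a) (X z + a)).indicator (fun _ => F z) κ := by
      intro κ
      have h : (κ, z) ∈ {p : ℝ × Ω | |X p.2 - p.1| ≤ a} ↔ κ ∈ Icc (X z - a) (X z + a) := by
        simp only [mem_ofPred_eq, abs_le, mem_Icc]
        constructor <;> rintro ⟨h1, h2⟩ <;> constructor <;> linarith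
      by_cases h' : κ ∈ Icc (X z - a) (X z + a)
      · rw [indicator_of_mem h', indicator_of_mem (h.2 h')]
      · rw [indicator_of_notMem h', indicator_of_notMem (fun h'' => h' (h.1 h''))]
    simp_rw [this]
    rw [lintegral_indicator measurableSet_Icc, lintegral_const, Measure.restrict_apply_univ, Real.volume_Icc,
      mul_comm]
    congr 2; ring
  · exact ((hF.comp measurable_snd).indicator (measurableSet_window hX a)).aemeasurable

end Window

/-- Gaussian majorant of the kernel at spatial scale `α^{-1/2}`. -/
noncomputable def locKernel (c α x : ℝ) : ℝ := (√α)⁻¹ * Real.exp (-(α * x ^ 2 / c))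

lemma measurable_locKernel (c α : ℝ) : Measurable (locKernel c α) := by unfold locKernel; fun_prop

/-- Averages of `|h|` at spatial scale `α^{-1/2}`. -/
noncomputable def locAvg (c α : ℝ) (h : ℝ → ℂ) (x : ℝ) : ℝ≥0∞ :=
  ∫⁻ y, ENNReal.ofReal (locKernel c α (x - y)) * ‖h y‖ₑ

lemma measurable_locAvg (c α : ℝ) {h : ℝ → ℂ} (hh : Measurable h) : Measurable (locAvg c α h) := by
  unfold locAvg
  refine Measurable.lintegral_prod_right' (f := fun p : ℝ × ℝ => ENNReal.ofReal (locKernel c α (p.1 - p.2)) * ‖h p.2‖ₑ) ?_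
  exact ((measurable_locKernel c α).comp (by fun_prop)).ennreal_ofReal.mul (hh.comp measurable_snd).enorm

lemma locAvg_mono {c α : ℝ} {h h' : ℝ → ℂ} (hh : ∀ y, ‖h y‖ ≤ ‖h' y‖) (x : ℝ) :
    locAvg c α h x ≤ locAvg c α h' x := by
  unfold locAvg
  gcongr with y
  exact enorm_le_iff_norm_le.2 (hh y)

/-- For `α ≤ 2` and `t ≤ 1` one has `4(α² + t²) ≤ 20`. The Gaussian width `α^{-1/2}` reflects that
waves of frequency up to `α^{-1/2}` travel about that distance in unit time. -/
lemma enorm_evol_le_locAvg {α t : ℝ} (hα : 0 < α) (hα2 : α ≤ 2) (ht : t ∈ Icc (0 : ℝ) 1) (h : ℝ → ℂ) (x : ℝ) :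
    ‖gaussEvol (cplxTime α t) h x‖ₑ ≤ locAvg 20 α h x := by
  refine (enorm_gaussEvol_le h x).trans ?_
  unfold locAvg
  gcongr with y
  rw [← ofReal_norm]
  apply ENNReal.ofReal_le_ofReal
  rw [norm_gaussKernel_cplxTime, locKernel]
  have h1 : α ≤ √(α ^ 2 + t ^ 2) := Real.le_sqrt_of_sq_le (by nlinarith [sq_nonneg t])
  gcongr ?_ * Real.exp ?_
  · rw [inv_mul_le_iff₀ (by positivity)]
    calc √(Real.pi / √(α ^ 2 + t ^ 2)) ≤ √(Real.pi / α) := by gcongr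
      _ = √Real.pi / √α := Real.sqrt_div Real.pi_pos.le _
      _ ≤ _ := by
        rw [div_eq_mul_inv]
        gcongr
        rw [Real.sqrt_le_left (by positivity)]
        nlinarith [Real.pi_gt_three]
  · rw [neg_mul, neg_le_neg_iff, div_mul_eq_mul_div]
    refine div_le_div_of_nonneg_left (by positivity) (by positivity) ?_
    nlinarith [ht.1, ht.2]

lemma sq_add_le_of_le {a b c W V : ℝ≥0∞} (h : a ≤ b + c) (hb : b ≤ W) (hc : c ≤ V) (hV : V ≤ W) :
    a ^ 2 ≤ b ^ 2 + 3 * (W * V) := by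
  calc a ^ 2 ≤ (b + c) ^ 2 := by gcongr
    _ = b ^ 2 + (2 * (b * c) + c * c) := by ring
    _ ≤ b ^ 2 + (2 * (W * V) + W * V) := by gcongr; exact hc.trans hV
    _ = _ := by ring

/-- Only points with `|x - y| ≥ Lα^{-1/2}/2` contribute. Half of the Gaussian exponent pays for the
tail factor, and the other half remains as the wider average. -/
lemma locAvg_far_le {α L κ x : ℝ} (hα : 0 < α) (hL : 1 ≤ L) {h h' : ℝ → ℂ} (hh : ∀ y, ‖h' y‖ ≤ ‖h y‖)
    (hfar : ∀ y, |y - κ| ≤ L * (√α)⁻¹ → h' y = 0) (hx : |x - κ| ≤ (√α)⁻¹ / 2) :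
    locAvg 20 α h' x ≤ ENNReal.ofReal (Real.exp (-(L ^ 2 / 768))) * locAvg 40 α h x := by
  unfold locAvg
  rw [← lintegral_const_mul' _ _ ENNReal.ofReal_ne_top]
  refine lintegral_mono fun y => ?_
  by_cases hy : |y - κ| ≤ L * (√α)⁻¹
  · simp [hfar y hy]
  · push Not at hy
    rw [← mul_assoc, ← ENNReal.ofReal_mul (Real.exp_pos _).le]
    gcongr ENNReal.ofReal ?_ * ?_
    · unfold locKernel
      rw [mul_left_comm, ← Real.exp_add]
      gcongr
      have hs : 0 < (√α)⁻¹ := by positivity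
      have h1 : L * (√α)⁻¹ / 2 ≤ |x - y| := by
        have := abs_sub_le y x κ
        rw [abs_sub_comm y x] at this
        nlinarith
      have h2 : (L * (√α)⁻¹ / 2) ^ 2 ≤ (x - y) ^ 2 := by
        rw [← sq_abs (x - y)]; gcongr
      have h3 : α * (L * (√α)⁻¹ / 2) ^ 2 = L ^ 2 / 4 := by
        rw [div_pow, mul_pow, inv_pow, Real.sq_sqrt hα.le]; field_simp; norm_num
      have h4 : L ^ 2 / 4 ≤ α * (x - y) ^ 2 := by rw [← h3]; gcongr
      linarith [sq_nonneg L]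
    · exact enorm_le_iff_norm_le.2 (hh y)

/-- Half of each exponent is spent: `p²/(8η) ≥ αp²/96` since `8αη ≤ 96`, and `α(x-p-y)²/40`. Their
sum is at least `α(x-y)²/192`, hence at least `L²/768`. The halves kept are the heat kernel at time
`2η` and the average with constant `40`. -/
lemma heatKernel_mul_locAvg_far_le {α η L κ x p : ℝ} (hα : 0 < α) (hα2 : α ≤ 2) (hη : 0 < η) (hηα : η ≤ 3 * α)
    (hL : 1 ≤ L) {h h' : ℝ → ℂ} (hh : ∀ y, ‖h' y‖ ≤ ‖h y‖)
    (hfar : ∀ y, |y - κ| ≤ L * (√α)⁻¹ → h' y = 0) (hx : |x - κ| ≤ (√α)⁻¹ / 2) :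
    ENNReal.ofReal (heatKernel η p) * locAvg 20 α h' (x - p) ≤
      ENNReal.ofReal (2 * Real.exp (-(L ^ 2 / 768))) *
        (ENNReal.ofReal (heatKernel (2 * η) p) * locAvg 40 α h (x - p)) := by
  unfold locAvg
  rw [← mul_assoc, ← ENNReal.ofReal_mul (by positivity), ← lintegral_const_mul' _ _ ENNReal.ofReal_ne_top,
    ← lintegral_const_mul' _ _ ENNReal.ofReal_ne_top]
  refine lintegral_mono fun y => ?_
  by_cases hy : |y - κ| ≤ L * (√α)⁻¹
  · simp [hfar y hy]
  · push Not at hy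
    have hH := heatKernel_nonneg (2 * η) p
    rw [← mul_assoc, ← mul_assoc, ← ENNReal.ofReal_mul (heatKernel_nonneg _ _), ← ENNReal.ofReal_mul (by positivity)]
    gcongr ENNReal.ofReal ?_ * ?_
    · have hs : 0 < (√α)⁻¹ := by positivity
      have h1 : L * (√α)⁻¹ / 2 ≤ |x - y| := by
        have := abs_sub_le y x κ
        rw [abs_sub_comm y x] at this
        nlinarith
      have h2 : (L * (√α)⁻¹ / 2) ^ 2 ≤ (x - y) ^ 2 := by
        rw [← sq_abs (x - y)]; gcongr
      have h3 : α * (L * (√α)⁻¹ / 2) ^ 2 = L ^ 2 / 4 := by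
        rw [div_pow, mul_pow, inv_pow, Real.sq_sqrt hα.le]; field_simp; norm_num
      have h4 : L ^ 2 / 4 ≤ α * (x - y) ^ 2 := by rw [← h3]; gcongr
      have h5 : α * p ^ 2 / 96 ≤ p ^ 2 / (8 * η) := by
        rw [div_le_div_iff₀ (by norm_num) (by positivity)]
        have : α * (8 * η) ≤ 96 := by nlinarith
        nlinarith [sq_nonneg p]
      have h6 : (x - y) ^ 2 ≤ 2 * (p ^ 2 + (x - p - y) ^ 2) := by nlinarith [sq_nonneg (p - (x - p - y))]
      have h7 : √(Real.pi / η) ≤ 2 * √(Real.pi / (2 * η)) := by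
        have : (2 : ℝ) = √4 := by rw [show (4 : ℝ) = 2 ^ 2 by norm_num, Real.sqrt_sq (by norm_num)]
        rw [this, ← Real.sqrt_mul (by norm_num)]
        apply Real.sqrt_le_sqrt
        rw [← this, div_le_iff₀ hη]
        field_simp
        norm_num
      have h8 : -p ^ 2 / (4 * η) + -(α * (x - p - y) ^ 2 / 20) ≤
          -(L ^ 2 / 768) + -p ^ 2 / (4 * (2 * η)) + -(α * (x - p - y) ^ 2 / 40) := by
        have e1 : -p ^ 2 / (4 * η) = -p ^ 2 / (4 * (2 * η)) - p ^ 2 / (8 * η) := by field_simp; ring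
        have h9 : α * (x - y) ^ 2 ≤ α * (2 * (p ^ 2 + (x - p - y) ^ 2)) := by gcongr
        have h10 : 0 ≤ α * (x - p - y) ^ 2 := by positivity
        rw [e1]
        linarith
      calc heatKernel η p * locKernel 20 α (x - p - y)
          = (2 * Real.pi)⁻¹ * √(Real.pi / η) * (√α)⁻¹ *
            Real.exp (-p ^ 2 / (4 * η) + -(α * (x - p - y) ^ 2 / 20)) := by
            rw [Real.exp_add]; unfold heatKernel locKernel; ring
        _ ≤ (2 * Real.pi)⁻¹ * (2 * √(Real.pi / (2 * η))) * (√α)⁻¹ *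
            Real.exp (-(L ^ 2 / 768) + -p ^ 2 / (4 * (2 * η)) + -(α * (x - p - y) ^ 2 / 40)) := by
            gcongr
        _ = _ := by rw [Real.exp_add, Real.exp_add]; unfold heatKernel locKernel; ring
    · exact enorm_le_iff_norm_le.2 (hh y)

lemma lintegral_locKernel {α : ℝ} (hα : 0 < α) :
    ∫⁻ x, ENNReal.ofReal (locKernel 40 α x) ≤ ENNReal.ofReal (12 * α⁻¹) := by
  have e : ∀ x, locKernel 40 α x = (√α)⁻¹ * Real.exp (-(α / 40) * x ^ 2) := fun x => by
    rw [locKernel]; congr 2; ring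
  simp_rw [e]
  rw [← ofReal_integral_eq_lintegral_ofReal ((integrable_exp_neg_mul_sq (by positivity)).const_mul _)
    (.of_forall fun x => by positivity), integral_const_mul, integral_gaussian]
  apply ENNReal.ofReal_le_ofReal
  have h1 : √(Real.pi / (α / 40)) = √(40 * Real.pi) * (√α)⁻¹ := by
    rw [← Real.sqrt_inv, ← Real.sqrt_mul (by positivity)]; congr 1; field_simp
  have h2 : √(40 * Real.pi) ≤ 12 := by
    rw [Real.sqrt_le_left (by norm_num)]; nlinarith [Real.pi_lt_d2]
  have h3 : α⁻¹ = (√α)⁻¹ * (√α)⁻¹ := by rw [← mul_inv, Real.mul_self_sqrt hα.le]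
  rw [h1, h3]
  have : 0 ≤ (√α)⁻¹ * (√α)⁻¹ := by positivity
  nlinarith

lemma locKernel_le {α : ℝ} (hα : 0 < α) (x : ℝ) :
    locKernel 40 α x ≤ 40 * (√α)⁻¹ * (1 + (x / (√α)⁻¹) ^ 2) ^ (-2 / 2 : ℝ) := by
  have e : (x / (√α)⁻¹) ^ 2 = α * x ^ 2 := by rw [div_inv_eq_mul, mul_pow, Real.sq_sqrt hα.le, mul_comm]
  rw [locKernel, e, show (-2 / 2 : ℝ) = -1 by norm_num, Real.rpow_neg_one, mul_comm 40, mul_assoc]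
  refine mul_le_mul_of_nonneg_left ?_ (by positivity : 0 ≤ (√α)⁻¹)
  rw [Real.exp_neg, ← div_eq_mul_inv, le_div_iff₀ (by positivity : 0 < 1 + α * x ^ 2), inv_mul_le_iff₀ (Real.exp_pos _)]
  have h := Real.add_one_le_exp (α * x ^ 2 / 40)
  have : 0 ≤ α * x ^ 2 := by positivity
  linarith

/-- This is Schur's test: Cauchy–Schwarz against a kernel of mass of order `α⁻¹`, then Fubini and
the slab masses. The bound is wasteful but serves only for exponentially small tails and at unit
scale. -/
lemma lintegral_locAvg_sq_le : ∃ C : ℝ, 0 < C ∧ ∀ α : ℝ, 0 < α → ∀ (ν : Measure (ℝ × ℝ)) [SFinite ν] (m : ℝ≥0∞),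
    (∀ x, ν {z | |z.1 - x| ≤ (√α)⁻¹} ≤ m) → ∀ h : ℝ → ℂ, Measurable h → ∀ p : ℝ,
      ∫⁻ z, locAvg 40 α h (z.1 - p) ^ 2 ∂ν ≤ ENNReal.ofReal (C * α⁻¹ * (√α)⁻¹) * m * ∫⁻ y, ‖h y‖ₑ ^ 2 := by
  obtain ⟨C, hC, hj⟩ := lintegral_japanese_le_slab (s := 2) (by norm_num)
  refine ⟨12 * 40 * C, by positivity, fun α hα ν _ m hm h hh p => ?_⟩
  have hkm := measurable_locKernel 40 α
  have hker : ∀ y, ∫⁻ z, ENNReal.ofReal (locKernel 40 α (z.1 - p - y)) ∂ν ≤ ENNReal.ofReal (40 * (√α)⁻¹) * (ENNReal.ofReal C * m) := by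
    intro y
    calc _ ≤ ∫⁻ z, ENNReal.ofReal (40 * (√α)⁻¹) * ENNReal.ofReal ((1 + ((z.1 - (p + y)) / (√α)⁻¹) ^ 2) ^ (-2 / 2 : ℝ)) ∂ν := by
          refine lintegral_mono fun z => ?_
          rw [← ENNReal.ofReal_mul (by positivity), ← sub_sub]
          exact ENNReal.ofReal_le_ofReal (locKernel_le hα _)
      _ ≤ _ := by
          rw [lintegral_const_mul' _ _ ENNReal.ofReal_ne_top]
          gcongr
          exact hj ν Prod.fst measurable_fst _ (by positivity) _ m hm
  have hmm : Measurable fun q : (ℝ × ℝ) × ℝ => ENNReal.ofReal (locKernel 40 α (q.1.1 - p - q.2)) :=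
    (hkm.comp (by fun_prop : Measurable fun q : (ℝ × ℝ) × ℝ => q.1.1 - p - q.2)).ennreal_ofReal
  calc _ ≤ ∫⁻ z, ENNReal.ofReal (12 * α⁻¹) * (∫⁻ y, ENNReal.ofReal (locKernel 40 α (z.1 - p - y)) * ‖h y‖ₑ ^ 2) ∂ν := by
        refine lintegral_mono fun z => ?_
        unfold locAvg
        have hk : Measurable fun y => ENNReal.ofReal (locKernel 40 α (z.1 - p - y)) :=
          (hkm.comp (by fun_prop : Measurable fun y : ℝ => z.1 - p - y)).ennreal_ofReal
        refine (lintegral_kernel_sq_le hk.aemeasurable hh.enorm.aemeasurable).trans ?_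
        gcongr
        rw [lintegral_sub_left_eq_self (fun y => ENNReal.ofReal (locKernel 40 α y))]
        exact lintegral_locKernel hα
    _ = ENNReal.ofReal (12 * α⁻¹) * ∫⁻ y, ∫⁻ z, ENNReal.ofReal (locKernel 40 α (z.1 - p - y)) * ‖h y‖ₑ ^ 2 ∂ν := by
        rw [lintegral_const_mul' _ _ ENNReal.ofReal_ne_top, lintegral_lintegral_swap]
        exact (hmm.mul ((hh.comp measurable_snd).enorm.pow_const 2)).aemeasurable
    _ ≤ ENNReal.ofReal (12 * α⁻¹) * ∫⁻ y, ENNReal.ofReal (40 * (√α)⁻¹) * (ENNReal.ofReal C * m) * ‖h y‖ₑ ^ 2 := by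
        gcongr with y
        have hmy : Measurable fun z : ℝ × ℝ => ENNReal.ofReal (locKernel 40 α (z.1 - p - y)) :=
          (hkm.comp (by fun_prop : Measurable fun z : ℝ × ℝ => z.1 - p - y)).ennreal_ofReal
        rw [lintegral_mul_const _ hmy]
        gcongr
        exact hker y
    _ = _ := by
        rw [lintegral_const_mul _ (hh.enorm.pow_const 2), show 12 * 40 * C * α⁻¹ * (√α)⁻¹ = (12 * α⁻¹) * ((40 * (√α)⁻¹) * C) by ring,
          ENNReal.ofReal_mul (p := 12 * α⁻¹) (by positivity), ENNReal.ofReal_mul (p := 40 * (√α)⁻¹) (by positivity)]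
        ring

lemma locAvg_twenty_le {α : ℝ} (hα : 0 < α) (h : ℝ → ℂ) (x : ℝ) : locAvg 20 α h x ≤ locAvg 40 α h x := by
  unfold locAvg locKernel
  gcongr
  norm_num

lemma BddIntegrable.indicator {h : ℝ → ℂ} (hh : BddIntegrable h) {S : Set ℝ} (hS : MeasurableSet S) :
    BddIntegrable (S.indicator h) := by
  obtain ⟨M, hM0, hM⟩ := hh.bdd
  exact ⟨hh.meas.indicator hS, hh.int.indicator hS, M, hM0, fun y => (norm_indicator_le_norm_self _ _).trans (hM y)⟩

lemma gaussEvol_add_fun {A : ℂ} (hA : 0 < A.re) {h₁ h₂ : ℝ → ℂ} (h1 : Integrable h₁) (h2 : Integrable h₂) (x : ℝ) :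
    gaussEvol A (fun y => h₁ y + h₂ y) x = gaussEvol A h₁ x + gaussEvol A h₂ x := by
  unfold gaussEvol
  rw [← integral_add (gaussKernel_mul_integrable hA h1 x) (gaussKernel_mul_integrable hA h2 x)]
  simp_rw [mul_add]

lemma measurable_heatAvg {η : ℝ} {F : ℝ × ℝ → ℝ≥0∞} (hF : Measurable F) :
    Measurable fun z : ℝ × ℝ => heatAvg η (fun x => F (x, z.2)) z.1 := by
  unfold heatAvg
  refine Measurable.lintegral_prod_right' (f := fun w : (ℝ × ℝ) × ℝ => ENNReal.ofReal (heatKernel η w.2) * F (w.1.1 - w.2, w.1.2)) ?_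
  have h2 : Measurable fun w : (ℝ × ℝ) × ℝ => (w.1.1 - w.2, w.1.2) := by fun_prop
  have h3 : Measurable fun w : (ℝ × ℝ) × ℝ => heatKernel η w.2 := (continuous_heatKernel η).measurable.comp measurable_snd
  exact h3.ennreal_ofReal.mul (hF.comp h2)

lemma lintegral_heatAvg_swap {η : ℝ} {F : ℝ × ℝ → ℝ≥0∞} (hF : Measurable F) (ν : Measure (ℝ × ℝ)) [SFinite ν] :
    ∫⁻ z, heatAvg η (fun x => F (x, z.2)) z.1 ∂ν =
      ∫⁻ p, ENNReal.ofReal (heatKernel η p) * ∫⁻ z, F (z.1 - p, z.2) ∂ν := by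
  unfold heatAvg
  have h2 : Measurable fun w : (ℝ × ℝ) × ℝ => (w.1.1 - w.2, w.1.2) := by fun_prop
  have h3 : Measurable fun w : (ℝ × ℝ) × ℝ => heatKernel η w.2 := (continuous_heatKernel η).measurable.comp measurable_snd
  rw [lintegral_lintegral_swap (h3.ennreal_ofReal.mul (hF.comp h2)).aemeasurable]
  refine lintegral_congr fun p => ?_
  rw [lintegral_const_mul' _ _ ENNReal.ofReal_ne_top]

/-- The global comparison involves the total mass of the measure. Restricting `ν` to one window
replaces that mass by `m₂`, while finite propagation lets `h` be cut to the `L` times wider window;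
the part of `h` outside enters only through Gaussian tails. -/
lemma lintegral_evol_sq_window_le : ∃ C : ℝ, 0 < C ∧ ∀ α η L : ℝ, 0 < α → α ≤ 2 → 0 < η → η ≤ 3 * α → 1 ≤ L →
    ∀ (ν : Measure (ℝ × ℝ)) [IsFiniteMeasure ν] (m₁ m₂ : ℝ≥0∞), (∀ᵐ z ∂ν, z.2 ∈ Icc (0 : ℝ) 1) →
      (∀ x t, ν {z | |z.1 - x| ≤ 2 * √α ∧ |z.2 - t| ≤ 2 * α} ≤ m₁) →
      (∀ x, ν {z | |z.1 - x| ≤ (√α)⁻¹} ≤ m₂) → ∀ h, BddIntegrable h → ∀ κ : ℝ,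
      ∫⁻ z in {z | |z.1 - κ| ≤ (√α)⁻¹ / 2}, ‖gaussEvol (cplxTime α z.2) h z.1‖ₑ ^ 2 ∂ν ≤
        ∫⁻ z in {z | |z.1 - κ| ≤ (√α)⁻¹ / 2}, heatAvg η (fun x => ‖gaussEvol (cplxTime α z.2) h x‖ₑ ^ 2) z.1 ∂ν +
        (ENNReal.ofReal (6 * Real.exp (-(L ^ 2 / 768))) *
            ∫⁻ z in {z | |z.1 - κ| ≤ (√α)⁻¹ / 2}, heatAvg (2 * η) (fun x => locAvg 40 α h x ^ 2) z.1 ∂ν +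
          ((ENNReal.ofReal (C * α⁻¹) * m₁ * m₂) ^ (1 / 2 : ℝ) * (∫⁻ y in {y | |y - κ| ≤ L * (√α)⁻¹}, ‖h y‖ₑ ^ 2) +
          ENNReal.ofReal (3 * Real.exp (-(L ^ 2 / 768))) *
            ∫⁻ z in {z | |z.1 - κ| ≤ (√α)⁻¹ / 2}, locAvg 40 α h z.1 ^ 2 ∂ν)) := by
  obtain ⟨C, hC, hcore⟩ := lintegral_evol_sq_le_heat
  refine ⟨C, hC, fun α η L hα hα2 hη hηα hL ν _ m₁ m₂ hT hm₁ hm₂ h hh κ => ?_⟩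
  have hs : 0 < (√α)⁻¹ := by positivity
  set S : Set (ℝ × ℝ) := {z | |z.1 - κ| ≤ (√α)⁻¹ / 2} with hS
  have hSm : MeasurableSet S := measurableSet_le (by fun_prop) measurable_const
  set N : Set ℝ := {y | |y - κ| ≤ L * (√α)⁻¹} with hN
  have hNm : MeasurableSet N := measurableSet_le (by fun_prop) measurable_const
  set h₁ := N.indicator h with hh₁
  set h₂ := Nᶜ.indicator h with hh₂
  have hb₁ : BddIntegrable h₁ := hh.indicator hNm
  have hb₂ : BddIntegrable h₂ := hh.indicator hNm.compl
  have hle₁ : ∀ y, ‖h₁ y‖ ≤ ‖h y‖ := fun y => norm_indicator_le_norm_self _ _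
  have hle₂ : ∀ y, ‖h₂ y‖ ≤ ‖h y‖ := fun y => norm_indicator_le_norm_self _ _
  have hfar : ∀ y, |y - κ| ≤ L * (√α)⁻¹ → h₂ y = 0 := fun y hy =>
    indicator_of_notMem (by rw [mem_compl_iff, not_not]; exact hy) _
  have hsum : ∀ t x, gaussEvol (cplxTime α t) h x = gaussEvol (cplxTime α t) h₁ x + gaussEvol (cplxTime α t) h₂ x := by
    intro t x
    rw [← gaussEvol_add_fun hα hb₁.int hb₂.int]
    congr 1
    exact (indicator_self_add_compl N h).symm
  set e := Real.exp (-(L ^ 2 / 768)) with he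
  have he0 : 0 < e := Real.exp_pos _
  have hmv := measurable_evol_space_time hh.meas α
  have hmW : Measurable fun x => locAvg 40 α h x ^ 2 := (measurable_locAvg 40 α hh.meas).pow_const 2
  -- pointwise comparison of the evolutions of `h` and `h₁`
  have hup : ∀ t ∈ Icc (0 : ℝ) 1, ∀ x, ‖gaussEvol (cplxTime α t) h x‖ₑ ^ 2 ≤
      ‖gaussEvol (cplxTime α t) h₁ x‖ₑ ^ 2 + 3 * (locAvg 20 α h x * locAvg 20 α h₂ x) := by
    intro t ht x
    refine sq_add_le_of_le (c := ‖gaussEvol (cplxTime α t) h₂ x‖ₑ) ?_ ?_ ?_ ?_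
    · rw [hsum]; exact enorm_add_le _ _
    · exact (enorm_evol_le_locAvg hα hα2 ht h₁ x).trans (locAvg_mono hle₁ x)
    · exact enorm_evol_le_locAvg hα hα2 ht h₂ x
    · exact locAvg_mono hle₂ x
  have hdown : ∀ t ∈ Icc (0 : ℝ) 1, ∀ x, ‖gaussEvol (cplxTime α t) h₁ x‖ₑ ^ 2 ≤
      ‖gaussEvol (cplxTime α t) h x‖ₑ ^ 2 + 3 * (locAvg 20 α h x * locAvg 20 α h₂ x) := by
    intro t ht x
    refine sq_add_le_of_le (c := ‖gaussEvol (cplxTime α t) h₂ x‖ₑ) ?_ ?_ ?_ ?_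
    · rw [show gaussEvol (cplxTime α t) h₁ x = gaussEvol (cplxTime α t) h x - gaussEvol (cplxTime α t) h₂ x by
        rw [hsum]; ring]
      exact enorm_sub_le
    · exact enorm_evol_le_locAvg hα hα2 ht h x
    · exact enorm_evol_le_locAvg hα hα2 ht h₂ x
    · exact locAvg_mono hle₂ x
  have hTS : ∀ᵐ z ∂(ν.restrict S), z.2 ∈ Icc (0 : ℝ) 1 ∧ |z.1 - κ| ≤ (√α)⁻¹ / 2 := by
    filter_upwards [ae_restrict_of_ae hT, ae_restrict_mem hSm] with z h1 h2 using ⟨h1, h2⟩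
  have step1 : ∫⁻ z in S, ‖gaussEvol (cplxTime α z.2) h z.1‖ₑ ^ 2 ∂ν ≤
      ∫⁻ z in S, ‖gaussEvol (cplxTime α z.2) h₁ z.1‖ₑ ^ 2 ∂ν +
        ENNReal.ofReal (3 * e) * ∫⁻ z in S, locAvg 40 α h z.1 ^ 2 ∂ν := by
    rw [← lintegral_const_mul' _ _ ENNReal.ofReal_ne_top,
      ← lintegral_add_left ((measurable_evol_space_time hb₁.meas α).enorm.pow_const 2)]
    refine lintegral_mono_ae ?_
    filter_upwards [hTS] with z hz
    refine (hup z.2 hz.1 z.1).trans (add_le_add le_rfl ?_)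
    calc 3 * (locAvg 20 α h z.1 * locAvg 20 α h₂ z.1)
        ≤ 3 * (locAvg 40 α h z.1 * (ENNReal.ofReal e * locAvg 40 α h z.1)) := by
          gcongr
          · exact locAvg_twenty_le hα h _
          · exact locAvg_far_le hα hL hle₂ hfar hz.2
      _ = _ := by rw [ENNReal.ofReal_mul (by norm_num), ENNReal.ofReal_ofNat]; ring
  have step2 : ∫⁻ z in S, ‖gaussEvol (cplxTime α z.2) h₁ z.1‖ₑ ^ 2 ∂ν ≤
      ∫⁻ z in S, heatAvg η (fun x => ‖gaussEvol (cplxTime α z.2) h₁ x‖ₑ ^ 2) z.1 ∂ν +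
        (ENNReal.ofReal (C * α⁻¹) * m₁ * m₂) ^ (1 / 2 : ℝ) * ∫⁻ y in N, ‖h y‖ₑ ^ 2 := by
    have h1 := hcore α η hα hη hηα (ν.restrict S) m₁ (fun x t => (Measure.restrict_apply_le _ _).trans (hm₁ x t)) h₁ hb₁
    refine h1.trans ?_
    gcongr ?_ + (_ * ?_) ^ (1 / 2 : ℝ) * ?_
    · exact le_rfl
    · rw [Measure.restrict_apply_univ]
      refine le_trans (measure_mono ?_) (hm₂ κ)
      intro z hz
      simp only [hS, mem_ofPred_eq] at hz ⊢
      linarith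
    · rw [← lintegral_indicator hNm]
      refine lintegral_mono fun y => ?_
      by_cases hy : y ∈ N <;> simp [hh₁, hy]
  have step3 : ∫⁻ z in S, heatAvg η (fun x => ‖gaussEvol (cplxTime α z.2) h₁ x‖ₑ ^ 2) z.1 ∂ν ≤
      ∫⁻ z in S, heatAvg η (fun x => ‖gaussEvol (cplxTime α z.2) h x‖ₑ ^ 2) z.1 ∂ν +
        ENNReal.ofReal (6 * e) * ∫⁻ z in S, heatAvg (2 * η) (fun x => locAvg 40 α h x ^ 2) z.1 ∂ν := by
    rw [← lintegral_const_mul' _ _ ENNReal.ofReal_ne_top,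
      ← lintegral_add_left (measurable_heatAvg (η := η) (hmv.enorm.pow_const 2))]
    refine lintegral_mono_ae ?_
    filter_upwards [hTS] with z hz
    unfold heatAvg
    have hm1 : Measurable fun p => ENNReal.ofReal (heatKernel η p) * ‖gaussEvol (cplxTime α z.2) h (z.1 - p)‖ₑ ^ 2 := by
      have h3 := (hh.evol (A := cplxTime α z.2) hα).meas
      have h4 : Measurable fun p => gaussEvol (cplxTime α z.2) h (z.1 - p) := h3.comp (by fun_prop)
      exact (continuous_heatKernel η).measurable.ennreal_ofReal.mul (h4.enorm.pow_const 2)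
    rw [← lintegral_const_mul' _ _ ENNReal.ofReal_ne_top, ← lintegral_add_left hm1]
    refine lintegral_mono fun p => ?_
    calc _ ≤ ENNReal.ofReal (heatKernel η p) * (‖gaussEvol (cplxTime α z.2) h (z.1 - p)‖ₑ ^ 2 +
          3 * (locAvg 20 α h (z.1 - p) * locAvg 20 α h₂ (z.1 - p))) := by
          gcongr; exact hdown z.2 hz.1 _
      _ = ENNReal.ofReal (heatKernel η p) * ‖gaussEvol (cplxTime α z.2) h (z.1 - p)‖ₑ ^ 2 +
          3 * locAvg 20 α h (z.1 - p) * (ENNReal.ofReal (heatKernel η p) * locAvg 20 α h₂ (z.1 - p)) := by ring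
      _ ≤ ENNReal.ofReal (heatKernel η p) * ‖gaussEvol (cplxTime α z.2) h (z.1 - p)‖ₑ ^ 2 +
          3 * locAvg 40 α h (z.1 - p) * (ENNReal.ofReal (2 * e) *
            (ENNReal.ofReal (heatKernel (2 * η) p) * locAvg 40 α h (z.1 - p))) := by
          refine add_le_add le_rfl (mul_le_mul' (mul_le_mul' le_rfl ?_) ?_)
          · exact locAvg_twenty_le hα h _
          · exact heatKernel_mul_locAvg_far_le hα hα2 hη hηα hL hle₂ hfar hz.2
      _ = _ := by
          rw [show 6 * e = 3 * (2 * e) by ring, ENNReal.ofReal_mul (p := 3) (by norm_num), ENNReal.ofReal_ofNat]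
          ring
  calc _ ≤ _ := step1
    _ ≤ _ := add_le_add_left step2 _
    _ ≤ _ := add_le_add_left (add_le_add_left step3 _) _
    _ = _ := by ring

/-- The local masses of `h` in the windows add up to the full mass, so the error sees the mass `m₂`
of one slab in place of the total mass of `ν`, at the price of a factor `L`. -/
theorem lintegral_evol_sq_block : ∃ C : ℝ, 0 < C ∧ ∀ α η L : ℝ, 0 < α → α ≤ 2 → 0 < η → η ≤ 3 * α → 1 ≤ L →
    ∀ (ν : Measure (ℝ × ℝ)) [IsFiniteMeasure ν] (m₁ m₂ : ℝ≥0∞), (∀ᵐ z ∂ν, z.2 ∈ Icc (0 : ℝ) 1) →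
      (∀ x t, ν {z | |z.1 - x| ≤ 2 * √α ∧ |z.2 - t| ≤ 2 * α} ≤ m₁) →
      (∀ x, ν {z | |z.1 - x| ≤ (√α)⁻¹} ≤ m₂) → ∀ h, BddIntegrable h →
      ∫⁻ z, ‖gaussEvol (cplxTime α z.2) h z.1‖ₑ ^ 2 ∂ν ≤
        ∫⁻ z, heatAvg η (fun x => ‖gaussEvol (cplxTime α z.2) h x‖ₑ ^ 2) z.1 ∂ν +
        (ENNReal.ofReal (C * L) * (ENNReal.ofReal α⁻¹ * m₁ * m₂) ^ (1 / 2 : ℝ) +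
          ENNReal.ofReal (C * α⁻¹ * (√α)⁻¹ * Real.exp (-(L ^ 2 / 768))) * m₂) * ∫⁻ y, ‖h y‖ₑ ^ 2 := by
  obtain ⟨C, hC, hwin⟩ := lintegral_evol_sq_window_le
  obtain ⟨C', hC', hloc⟩ := lintegral_locAvg_sq_le
  refine ⟨2 * √C + 9 * C', by positivity, fun α η L hα hα2 hη hηα hL ν _ m₁ m₂ hT hm₁ hm₂ h hh => ?_⟩
  have hw := hwin α η L hα hα2 hη hηα hL ν m₁ m₂ hT hm₁ hm₂ h hh
  have hs : 0 < (√α)⁻¹ := by positivity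
  set s := (√α)⁻¹ with hsdef
  set e := Real.exp (-(L ^ 2 / 768)) with he
  have he0 : 0 < e := Real.exp_pos _
  have hmv : Measurable fun z : ℝ × ℝ => ‖gaussEvol (cplxTime α z.2) h z.1‖ₑ ^ 2 :=
    (measurable_evol_space_time hh.meas α).enorm.pow_const 2
  have hmh : Measurable fun z : ℝ × ℝ => heatAvg η (fun x => ‖gaussEvol (cplxTime α z.2) h x‖ₑ ^ 2) z.1 :=
    measurable_heatAvg hmv
  have hmW : Measurable fun z : ℝ × ℝ => locAvg 40 α h z.1 ^ 2 :=
    ((measurable_locAvg 40 α hh.meas).comp measurable_fst).pow_const 2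
  have hmW2 : Measurable fun z : ℝ × ℝ => heatAvg (2 * η) (fun x => locAvg 40 α h x ^ 2) z.1 :=
    measurable_heatAvg (F := fun z : ℝ × ℝ => locAvg 40 α h z.1 ^ 2) hmW
  have hmh2 : Measurable fun y => ‖h y‖ₑ ^ 2 := hh.meas.enorm.pow_const 2
  set B := ENNReal.ofReal (C' * α⁻¹ * s) * m₂ * ∫⁻ y, ‖h y‖ₑ ^ 2 with hB
  have hB1 : ∫⁻ z, locAvg 40 α h z.1 ^ 2 ∂ν ≤ B := by
    have := hloc α hα ν m₂ hm₂ h hh.meas 0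
    simpa using this
  have hB2 : ∫⁻ z, heatAvg (2 * η) (fun x => locAvg 40 α h x ^ 2) z.1 ∂ν ≤ B := by
    have h1 := lintegral_heatAvg_swap (η := 2 * η) (F := fun z : ℝ × ℝ => locAvg 40 α h z.1 ^ 2) hmW ν
    simp only at h1
    rw [h1]
    calc _ ≤ ∫⁻ p, ENNReal.ofReal (heatKernel (2 * η) p) * B := by
          gcongr with p
          exact hloc α hα ν m₂ hm₂ h hh.meas p
      _ = _ := by
          rw [lintegral_mul_const _ (continuous_heatKernel _).measurable.ennreal_ofReal,
            lintegral_heatKernel (by positivity), one_mul]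
  set E := (ENNReal.ofReal (C * α⁻¹) * m₁ * m₂) ^ (1 / 2 : ℝ) with hE
  have h2s : 2 * (s / 2) = s := by ring
  -- The window inequality is integrated over all centres. Integrals over `ν` acquire the factor
  -- `s`, the mass of `h` the factor `2Ls`; dividing by `s` leaves the factor `L`.
  have hint := lintegral_mono (μ := (volume : Measure ℝ)) hw
  have hwm := fun {F : ℝ × ℝ → ℝ≥0∞} (hF : Measurable F) => measurable_window (μ := ν) (X := Prod.fst) measurable_fst hF (s / 2)
  have hwi := fun {F : ℝ × ℝ → ℝ≥0∞} (hF : Measurable F) => lintegral_window (μ := ν) (X := Prod.fst) measurable_fst hF (a := s / 2)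
  rw [h2s] at hwi
  rw [hwi hmv, lintegral_add_left (hwm hmh), hwi hmh, lintegral_add_left ((hwm hmW2).const_mul _),
    lintegral_const_mul _ (hwm hmW2), hwi hmW2,
    lintegral_add_right _ ((hwm hmW).const_mul _), lintegral_const_mul _ (hwm hmW), hwi hmW,
    lintegral_const_mul E (measurable_window (μ := (volume : Measure ℝ)) (X := fun y => y) measurable_id hmh2 (L * s)),
    lintegral_window (μ := (volume : Measure ℝ)) (X := fun y => y) measurable_id hmh2 (a := L * s)] at hint
  have hs0 : ENNReal.ofReal s ≠ 0 := by rwa [Ne, ENNReal.ofReal_eq_zero, not_le]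
  rw [← ENNReal.mul_le_mul_iff_right hs0 ENNReal.ofReal_ne_top]
  refine hint.trans ?_
  rw [mul_add (ENNReal.ofReal s)]
  gcongr ?_ + ?_
  · exact le_rfl
  have hEE : E = ENNReal.ofReal (√C) * (ENNReal.ofReal α⁻¹ * m₁ * m₂) ^ (1 / 2 : ℝ) := by
    rw [hE, ENNReal.ofReal_mul hC.le, mul_assoc, mul_assoc, ENNReal.mul_rpow_of_nonneg _ _ (by norm_num),
      ENNReal.ofReal_rpow_of_pos hC, ← Real.sqrt_eq_rpow, mul_assoc]
  set Q := (ENNReal.ofReal α⁻¹ * m₁ * m₂) ^ (1 / 2 : ℝ)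
  set H := ∫⁻ y, ‖h y‖ₑ ^ 2
  calc _ ≤ ENNReal.ofReal (6 * e) * (ENNReal.ofReal s * B) + (E * (ENNReal.ofReal (2 * (L * s)) * H) +
        ENNReal.ofReal (3 * e) * (ENNReal.ofReal s * B)) := by gcongr
    _ = ENNReal.ofReal s * ((ENNReal.ofReal (2 * √C * L) * Q + ENNReal.ofReal (9 * C' * α⁻¹ * s * e) * m₂) * H) := by
        rw [hEE, hB, show 2 * (L * s) = 2 * L * s by ring, ENNReal.ofReal_mul (p := 2 * L) (by positivity),
          show 2 * √C * L = √C * (2 * L) by ring, ENNReal.ofReal_mul (p := √C) (by positivity),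
          show 9 * C' * α⁻¹ * s * e = (6 * e + 3 * e) * (C' * α⁻¹ * s) by ring,
          ENNReal.ofReal_mul (p := 6 * e + 3 * e) (by positivity), ENNReal.ofReal_add (by positivity) (by positivity)]
        ring
    _ ≤ _ := by
        gcongr
        · have := hC'.le; linarith
        · have := Real.sqrt_nonneg C; linarith

/-! ### Masses of tubes under a Frostman measure. -/

/-- Cut time into steps `τ ≤ ρ²`. During one step the tube drifts by at most `2|c|τ`, so this piece
is covered by a row of parabolic balls of radius `ρ` whose number is the second factor. -/
lemma ParabolicFrostman.tube_le {β : ℝ} {D : ℝ≥0∞} {ν : Measure (ℝ × ℝ)} (hν : ParabolicFrostman β D ν)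
    {c x₀ t₀ w h ρ τ : ℝ} (hw : 0 ≤ w) (hh : 0 ≤ h) (hρ : 0 < ρ) (hτ : 0 < τ) (hτρ : τ ≤ ρ ^ 2) :
    ν {z | |z.1 + 2 * c * z.2 - x₀| ≤ w ∧ |z.2 - t₀| ≤ h} ≤
      D * ENNReal.ofReal ((2 * h / τ + 1) * ((2 * w + 4 * |c| * τ) / ρ + 1) * ρ ^ β) := by
  set nt := ⌊2 * h / τ⌋₊ + 1 with hnt
  set nx := ⌊(2 * w + 4 * |c| * τ) / ρ⌋₊ + 1 with hnx
  set T : ℕ → ℝ := fun i => t₀ - h + i * τ with hT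
  set Xp : ℕ → ℕ → ℝ := fun i k => x₀ - 2 * c * T i - w - 2 * |c| * τ + k * ρ with hX
  have hsub : {z : ℝ × ℝ | |z.1 + 2 * c * z.2 - x₀| ≤ w ∧ |z.2 - t₀| ≤ h} ⊆
      ⋃ q ∈ Finset.range nt ×ˢ Finset.range nx, parabolicBall (Xp q.1 q.2, T q.1) ρ := by
    rintro z ⟨hz1, hz2⟩
    rw [abs_le] at hz1 hz2
    have ha0 : 0 ≤ (z.2 - (t₀ - h)) / τ := div_nonneg (by linarith) hτ.le
    set i := ⌊(z.2 - (t₀ - h)) / τ⌋₊ with hi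
    have hi1 : (i : ℝ) * τ ≤ z.2 - (t₀ - h) := by
      have := Nat.floor_le ha0; rwa [le_div_iff₀ hτ] at this
    have hi2 : z.2 - (t₀ - h) < (i + 1) * τ := by
      have := Nat.lt_floor_add_one ((z.2 - (t₀ - h)) / τ); rwa [div_lt_iff₀ hτ] at this
    have hdt : 0 ≤ z.2 - T i ∧ z.2 - T i < τ := ⟨by simp only [hT]; linarith, by simp only [hT]; linarith⟩
    have hct : |2 * c * (z.2 - T i)| ≤ 2 * |c| * τ := by
      rw [abs_mul, abs_mul, abs_two, abs_of_nonneg hdt.1]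
      have := hdt.2.le
      gcongr
    rw [abs_le] at hct
    set b := z.1 - (x₀ - 2 * c * T i - w - 2 * |c| * τ) with hb
    have hb0 : 0 ≤ b := by rw [hb]; linarith [hct.2, hz1.1, hct.1]
    have hb1 : b ≤ 2 * w + 4 * |c| * τ := by rw [hb]; linarith [hct.2, hz1.2, hct.1]
    set k := ⌊b / ρ⌋₊ with hk
    have hk1 : (k : ℝ) * ρ ≤ b := by
      have := Nat.floor_le (div_nonneg hb0 hρ.le); rwa [le_div_iff₀ hρ] at this
    have hk2 : b < (k + 1) * ρ := by
      have := Nat.lt_floor_add_one (b / ρ); rwa [div_lt_iff₀ hρ] at this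
    simp only [mem_iUnion, Finset.mem_product, Finset.mem_range]
    refine ⟨(i, k), ⟨?_, ?_⟩, ⟨?_, ?_⟩, ?_, ?_⟩
    · refine Nat.lt_succ_of_le (Nat.floor_le_floor ?_)
      gcongr; linarith
    · refine Nat.lt_succ_of_le (Nat.floor_le_floor ?_)
      gcongr
    all_goals simp only [hX]
    · linarith
    · linarith
    · linarith
    · linarith
  have hnt' : (nt : ℝ) ≤ 2 * h / τ + 1 := by
    rw [hnt]; push_cast; have := Nat.floor_le (show 0 ≤ 2 * h / τ by positivity); linarith
  have hnx' : (nx : ℝ) ≤ (2 * w + 4 * |c| * τ) / ρ + 1 := by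
    rw [hnx]; push_cast; have := Nat.floor_le (show 0 ≤ (2 * w + 4 * |c| * τ) / ρ by positivity); linarith
  calc _ ≤ ν (⋃ q ∈ Finset.range nt ×ˢ Finset.range nx, parabolicBall (Xp q.1 q.2, T q.1) ρ) := measure_mono hsub
    _ ≤ ∑ q ∈ Finset.range nt ×ˢ Finset.range nx, ν (parabolicBall (Xp q.1 q.2, T q.1) ρ) :=
        measure_biUnion_finset_le _ _
    _ ≤ ∑ q ∈ Finset.range nt ×ˢ Finset.range nx, D * ENNReal.ofReal (ρ ^ β) := by
        gcongr; exact hν.ball _ _ hρ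
    _ = D * ENNReal.ofReal (nt * nx * ρ ^ β) := by
        rw [Finset.sum_const, Finset.card_product, Finset.card_range, Finset.card_range, nsmul_eq_mul,
          ENNReal.ofReal_mul (by positivity), ENNReal.ofReal_mul (by positivity), ENNReal.ofReal_natCast,
          ENNReal.ofReal_natCast]
        push_cast; ring
    _ ≤ _ := by gcongr

/-- The growth exponent of the `L²` estimate in the frequency. -/
noncomputable def tubeExp (β : ℝ) : ℝ := if 1 ≤ β then (3 - β) / 2 else 1

lemma tubeExp_le_one (β : ℝ) : tubeExp β ≤ 1 := by
  unfold tubeExp; split_ifs <;> linarith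

lemma tubeExp_nonneg {β : ℝ} (hβ : β ≤ 3) : 0 ≤ tubeExp β := by
  unfold tubeExp; split_ifs <;> linarith

/-- With `s = α^{-1/2}` these are the box `2√α × 2α` and the tube of width `s` and unit duration.
Only the product of the two masses matters later, so the bounds may be unbalanced by opposite powers
`s^{-a}` and `s^a`. The covering radii depend on whether `β ≥ 1`. -/
lemma ParabolicFrostman.tubes_le {β : ℝ} (hβ : β ∈ Icc (0 : ℝ) 3) : ∃ a : ℝ, |a| ≤ 1 ∧
    ∀ (ν : Measure (ℝ × ℝ)) (D : ℝ≥0∞), ParabolicFrostman β D ν → ∀ c N s x₀ : ℝ, 2 * |c| ≤ N → s ≤ N →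
      1 ≤ N → 1 ≤ 2 * s ^ 2 → 0 < s →
      (∀ t₀, ν {z | |z.1 + 2 * c * z.2 - x₀| ≤ 2 / s ∧ |z.2 - t₀| ≤ 2 / s ^ 2} ≤
        D * ENNReal.ofReal (40 * (N ^ tubeExp β * s ^ (-2 - a)))) ∧
      ν {z | |z.1 + 2 * c * z.2 - x₀| ≤ s ∧ |z.2 - 1 / 2| ≤ 1 / 2} ≤
        D * ENNReal.ofReal (40 * (N ^ tubeExp β * s ^ a)) := by
  by_cases h1 : 1 ≤ β
  · refine ⟨(β - 1) / 2, abs_le.2 ⟨by linarith, by linarith [hβ.2]⟩, fun ν D hν c N s x₀ hc hsN hN hs2 hs => ⟨fun t₀ => ?_, ?_⟩⟩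
    · have hN0 : 0 < N := by linarith
      -- In time `ρ² = 1/(Ns)` a tube of velocity `2|c| ≤ N` drifts by at most `1/s`, the order of
      -- the width of the box.
      set ρ := √((N * s)⁻¹) with hρ
      have hρ0 : 0 < ρ := Real.sqrt_pos.2 (by positivity)
      have hρ2 : ρ ^ 2 = (N * s)⁻¹ := Real.sq_sqrt (by positivity)
      refine (hν.tube_le (by positivity) (by positivity) hρ0 (τ := (N * s)⁻¹) (by positivity) hρ2.ge).trans ?_
      gcongr D * ENNReal.ofReal ?_
      have hsρ : s * ρ ≤ 1 := by
        rw [← sq_le_one_iff₀ (by positivity), mul_pow, hρ2, mul_inv]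
        have : s / N ≤ 1 := (div_le_one hN0).2 hsN
        calc s ^ 2 * (N⁻¹ * s⁻¹) = s / N := by field_simp
          _ ≤ 1 := this
      have e1 : 2 * (2 / s ^ 2) / (N * s)⁻¹ + 1 ≤ 5 * (N / s) := by
        have : 1 ≤ N / s := (one_le_div hs).2 hsN
        have e : 2 * (2 / s ^ 2) / (N * s)⁻¹ = 4 * (N / s) := by field_simp; ring
        rw [e]; linarith
      have e2 : (2 * (2 / s) + 4 * |c| * (N * s)⁻¹) / ρ + 1 ≤ 7 * (1 / (s * ρ)) := by
        have h2 : 1 ≤ 1 / (s * ρ) := (one_le_div (by positivity)).2 hsρ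
        have h3 : 4 * |c| * (N * s)⁻¹ ≤ 2 / s := by
          rw [mul_inv, ← mul_assoc, ← div_eq_mul_inv]
          gcongr
          rw [← div_eq_mul_inv, div_le_iff₀ hN0]; linarith
        calc _ ≤ (2 * (2 / s) + 2 / s) / ρ + 1 := by gcongr
          _ = 6 * (1 / (s * ρ)) + 1 := by field_simp; ring
          _ ≤ _ := by linarith
      have e3 : ρ ^ β = ρ * (N * s) ^ (-((β - 1) / 2)) := by
        have : (N * s) ^ (-((β - 1) / 2)) = ρ ^ (β - 1) := by
          rw [hρ, Real.sqrt_eq_rpow, ← Real.rpow_mul (by positivity), Real.inv_rpow (by positivity), ← Real.rpow_neg (by positivity)]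
          congr 1; ring
        rw [this, ← Real.rpow_one_add' hρ0.le (by linarith)]
        congr 1; ring
      have e4 : N ^ tubeExp β * s ^ (-2 - (β - 1) / 2) = N * s ^ (-2 : ℝ) * (N * s) ^ (-((β - 1) / 2)) := by
        rw [tubeExp, if_pos h1, Real.mul_rpow hN0.le hs.le, show (3 - β) / 2 = 1 + -((β - 1) / 2) by ring,
          Real.rpow_add hN0, Real.rpow_one,
          show -2 - (β - 1) / 2 = -2 + -((β - 1) / 2) by ring, Real.rpow_add hs]
        ring
      rw [e3, e4]
      calc _ ≤ (5 * (N / s)) * (7 * (1 / (s * ρ))) * (ρ * (N * s) ^ (-((β - 1) / 2))) := by gcongr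
        _ = 35 * (N * s ^ (-2 : ℝ) * (N * s) ^ (-((β - 1) / 2))) := by
          rw [Real.rpow_neg hs.le, Real.rpow_two]; field_simp; ring
        _ ≤ _ := by gcongr; norm_num
    · have hN0 : 0 < N := by linarith
      -- In time `ρ² = s/N` the tube drifts by at most its own width `s`.
      set ρ := √(s / N) with hρ
      have hρ0 : 0 < ρ := Real.sqrt_pos.2 (by positivity)
      have hρ2 : ρ ^ 2 = s / N := Real.sq_sqrt (by positivity)
      have hsN1 : s / N ≤ 1 := (div_le_one hN0).2 hsN
      refine (hν.tube_le hs.le (by positivity) hρ0 (τ := s / N) (by positivity) hρ2.ge).trans ?_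
      gcongr D * ENNReal.ofReal ?_
      have hρ1 : ρ ≤ 2 * s := by
        refine abs_le_of_sq_le_sq' ?_ (by positivity) |>.2
        rw [hρ2]; nlinarith
      have e1 : 2 * (1 / 2) / (s / N) + 1 ≤ 2 * (N / s) := by
        have : 1 ≤ N / s := (one_le_div hs).2 hsN
        have e : 2 * (1 / 2) / (s / N) = N / s := by field_simp
        rw [e]; linarith
      have e2 : (2 * s + 4 * |c| * (s / N)) / ρ + 1 ≤ 6 * (s / ρ) := by
        have h2 : 1 ≤ 2 * s / ρ := (one_le_div (by positivity)).2 hρ1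
        have h3 : 4 * |c| * (s / N) ≤ 2 * s := by
          rw [mul_div_assoc', div_le_iff₀ hN0]; nlinarith
        calc _ ≤ (2 * s + 2 * s) / ρ + 1 := by gcongr
          _ = 4 * (s / ρ) + 1 := by ring
          _ ≤ _ := by have : 2 * s / ρ = 2 * (s / ρ) := by ring
                      linarith
      have e3 : ρ ^ β = ρ * (s / N) ^ ((β - 1) / 2) := by
        have : (s / N) ^ ((β - 1) / 2) = ρ ^ (β - 1) := by
          rw [hρ, Real.sqrt_eq_rpow, ← Real.rpow_mul (by positivity)]
          congr 1; ring
        rw [this, ← Real.rpow_one_add' hρ0.le (by linarith)]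
        congr 1; ring
      have e4 : N ^ tubeExp β * s ^ ((β - 1) / 2) = N * (s / N) ^ ((β - 1) / 2) := by
        rw [tubeExp, if_pos h1, Real.div_rpow hs.le hN0.le, show (3 - β) / 2 = 1 - (β - 1) / 2 by ring,
          Real.rpow_sub hN0, Real.rpow_one]
        ring
      rw [e3, e4]
      calc _ ≤ (2 * (N / s)) * (6 * (s / ρ)) * (ρ * (s / N) ^ ((β - 1) / 2)) := by gcongr
        _ = 12 * (N * (s / N) ^ ((β - 1) / 2)) := by field_simp; ring
        _ ≤ _ := by gcongr; norm_num
  · have h1' : β < 1 := not_le.1 h1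
    refine ⟨β - 1, abs_le.2 ⟨by linarith [hβ.1], by linarith⟩, fun ν D hν c N s x₀ hc hsN hN hs2 hs => ⟨fun t₀ => ?_, ?_⟩⟩
    · have hN0 : 0 < N := by linarith
      have hNs : 1 ≤ N / s := (one_le_div hs).2 hsN
      -- For `β < 1` fewer and larger balls are better: a bounded number of time steps, each needing
      -- about `N/s` balls in space.
      refine (hν.tube_le (by positivity) (by positivity) (ρ := 1 / s) (by positivity) (τ := 1 / s ^ 2) (by positivity)
        (by rw [div_pow, one_pow])).trans ?_
      gcongr D * ENNReal.ofReal ?_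
      have e1 : 2 * (2 / s ^ 2) / (1 / s ^ 2) + 1 = 5 := by field_simp; norm_num
      have e2 : (2 * (2 / s) + 4 * |c| * (1 / s ^ 2)) / (1 / s) + 1 ≤ 7 * (N / s) := by
        have e : (2 * (2 / s) + 4 * |c| * (1 / s ^ 2)) / (1 / s) + 1 = 5 + 2 * ((2 * |c|) / s) := by
          field_simp; ring
        have : (2 * |c|) / s ≤ N / s := by gcongr
        rw [e]; linarith
      have e4 : N ^ tubeExp β * s ^ (-2 - (β - 1)) = (N / s) * (1 / s) ^ β := by
        rw [tubeExp, if_neg h1, Real.rpow_one, Real.div_rpow (by norm_num) hs.le, Real.one_rpow,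
          show -2 - (β - 1) = -1 - β by ring, Real.rpow_sub hs, Real.rpow_neg_one]
        field_simp
      rw [e1, e4]
      calc _ ≤ 5 * (7 * (N / s)) * (1 / s) ^ β := by gcongr
        _ = 35 * (N / s * (1 / s) ^ β) := by ring
        _ ≤ _ := by gcongr; norm_num
    · have hN0 : 0 < N := by linarith
      have hNs : 1 ≤ N / s := (one_le_div hs).2 hsN
      refine (hν.tube_le hs.le (by positivity) (ρ := 2 * s) (by positivity) (τ := 1) (by positivity)
        (by nlinarith)).trans ?_
      gcongr D * ENNReal.ofReal ?_
      have e2 : (2 * s + 4 * |c| * 1) / (2 * s) + 1 ≤ 3 * (N / s) := by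
        have e : (2 * s + 4 * |c| * 1) / (2 * s) + 1 = 2 + (2 * |c|) / s := by
          field_simp; ring
        have : (2 * |c|) / s ≤ N / s := by gcongr
        rw [e]; linarith
      have e4 : N ^ tubeExp β * s ^ (β - 1) = (N / s) * s ^ β := by
        rw [tubeExp, if_neg h1, Real.rpow_one, Real.rpow_sub_one hs.ne']; ring
      have e5 : (2 * s) ^ β ≤ 2 * s ^ β := by
        rw [Real.mul_rpow (by norm_num) hs.le]
        gcongr
        calc (2 : ℝ) ^ β ≤ 2 ^ (1 : ℝ) := Real.rpow_le_rpow_of_exponent_le (by norm_num) h1'.le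
          _ = 2 := Real.rpow_one 2
      rw [e4]
      calc _ ≤ (2 * (1 / 2) / 1 + 1) * (3 * (N / s)) * (2 * s ^ β) := by gcongr
        _ = 12 * (N / s * s ^ β) := by ring
        _ ≤ _ := by gcongr; norm_num

/-! ### Phase space decomposition of heat averages. -/

/-- Modulation by a plane wave. -/
noncomputable def modulate (c : ℝ) (g : ℝ → ℂ) (y : ℝ) : ℂ := cexp (I * (-(c * y) : ℝ)) * g y

lemma norm_modulate (c : ℝ) (g : ℝ → ℂ) (y : ℝ) : ‖modulate c g y‖ = ‖g y‖ := by
  rw [modulate, norm_mul, norm_cexp_I_mul, one_mul]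

lemma BddIntegrable.modulate {g : ℝ → ℂ} (hg : BddIntegrable g) (c : ℝ) : BddIntegrable (modulate c g) := by
  obtain ⟨M, hM0, hM⟩ := hg.bdd
  have hm : Measurable (_root_.modulate c g) := by
    have := hg.meas
    exact Measurable.mul (by fun_prop) this
  exact ⟨hm, hg.int.mono hm.aestronglyMeasurable (.of_forall fun y => (norm_modulate c g y).le), M, hM0,
    fun y => (norm_modulate c g y).le.trans (hM y)⟩

lemma angularFT_modulate (c : ℝ) (g : ℝ → ℂ) (ξ : ℝ) : angularFT (modulate c g) ξ = angularFT g (ξ + c) := by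
  unfold angularFT modulate
  congr 1; ext y
  rw [← mul_assoc, ← Complex.exp_add]
  congr 2; push_cast; ring

/-- The window whose square is the heat kernel. -/
lemma sqrt_heatKernel {l : ℝ} (hl : 0 < l) (p : ℝ) :
    √(heatKernel l p) = (√((2 * Real.pi)⁻¹ * √(Real.pi / l)) * (2 * Real.pi * (√(Real.pi / (2 * l)))⁻¹)) * heatKernel (2 * l) p := by
  have h1 : √(Real.pi / (2 * l)) ≠ 0 := (Real.sqrt_pos.2 (by have := Real.pi_pos; positivity)).ne'
  unfold heatKernel
  rw [Real.sqrt_mul (by positivity), show -p ^ 2 / (4 * l) = -p ^ 2 / (4 * (2 * l)) + -p ^ 2 / (4 * (2 * l)) by field_simp; norm_num,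
    Real.exp_add, Real.sqrt_mul_self (Real.exp_pos _).le]
  field_simp

lemma sq_heatWindow_const {l : ℝ} (hl : 0 < l) :
    (√((2 * Real.pi)⁻¹ * √(Real.pi / l)) * (2 * Real.pi * (√(Real.pi / (2 * l)))⁻¹)) ^ 2 = 4 * l * √(Real.pi / l) := by
  rw [mul_pow, Real.sq_sqrt (by positivity), mul_pow, inv_pow, Real.sq_sqrt (by positivity)]
  field_simp
  norm_num

lemma BddIntegrable.heatWindow {u : ℝ → ℂ} (hu : BddIntegrable u) {l : ℝ} (hl : 0 < l) (x : ℝ) :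
    BddIntegrable fun p => (√(heatKernel l p) : ℂ) * u (x - p) := by
  obtain ⟨M, hM0, hM⟩ := hu.bdd
  have hm : Measurable fun p => u (x - p) := hu.meas.comp (by fun_prop)
  have hw : Measurable fun p => √(heatKernel l p) := (continuous_heatKernel l).measurable.sqrt
  have hb : ∀ p, √(heatKernel l p) ≤ √((2 * Real.pi)⁻¹ * √(Real.pi / l)) := fun p => by
    apply Real.sqrt_le_sqrt
    unfold heatKernel
    refine mul_le_of_le_one_right (by positivity) (Real.exp_le_one_iff.2 ?_)
    rw [neg_div]; exact neg_nonpos.2 (by positivity)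
  refine ⟨hw.complex_ofReal.mul hm, ?_, √((2 * Real.pi)⁻¹ * √(Real.pi / l)) * M, by positivity, fun p => ?_⟩
  · refine (hu.int.comp_sub_left x).bdd_mul (c := √((2 * Real.pi)⁻¹ * √(Real.pi / l)))
      hw.complex_ofReal.aestronglyMeasurable (.of_forall fun p => ?_)
    rw [norm_real, Real.norm_of_nonneg (Real.sqrt_nonneg _)]; exact hb p
  · rw [norm_mul, norm_real, Real.norm_of_nonneg (Real.sqrt_nonneg _)]
    exact mul_le_mul (hb p) (hM _) (norm_nonneg _) (by positivity)

lemma angularFT_heatWindow {l : ℝ} (hl : 0 < l) {A : ℂ} (hA : 0 < A.re) {g : ℝ → ℂ} (hg : BddIntegrable g) (x c : ℝ) :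
    ((2 * Real.pi : ℝ) : ℂ) * angularFT (fun p => (heatKernel (2 * l) p : ℂ) * gaussEvol A g (x - p)) c =
      ∫ ξ : ℝ, angularFT g ξ * (cexp (I * (ξ * x : ℝ)) * cexp (-A * (ξ : ℂ) ^ 2)) * (Real.exp (-(2 * l * (c + ξ) ^ 2)) : ℝ) := by
  have hint0 := integrable_gaussian_symbol hA
  have hHc := continuous_angularFT hg.int
  set Ψ : ℝ → ℂ := fun ξ => angularFT g ξ * cexp (-A * (ξ : ℂ) ^ 2) with hΨ
  have hΨi : Integrable Ψ := hint0.bdd_mul (c := ∫ y, ‖g y‖) hHc.aestronglyMeasurable (.of_forall fun ξ => norm_angularFT_le g ξ)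
  have hint : Integrable (fun w : ℝ × ℝ => (cexp (I * (-(c * w.1) : ℝ)) * cexp (I * (w.2 * (x - w.1) : ℝ))) *
      ((heatKernel (2 * l) w.1 : ℂ) * Ψ w.2)) (volume.prod volume) := by
    refine ((integrable_heatKernel (η := 2 * l) (by positivity)).ofReal.mul_prod hΨi).bdd_mul (c := 1) ?_
      (.of_forall fun w => ?_)
    · exact (by fun_prop : Continuous fun w : ℝ × ℝ => cexp (I * (-(c * w.1) : ℝ)) * cexp (I * (w.2 * (x - w.1) : ℝ))).aestronglyMeasurable
    · rw [norm_mul, norm_cexp_I_mul, norm_cexp_I_mul, one_mul]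
  calc _ = ∫ p : ℝ, ∫ ξ : ℝ, (cexp (I * (-(c * p) : ℝ)) * cexp (I * (ξ * (x - p) : ℝ))) * ((heatKernel (2 * l) p : ℂ) * Ψ ξ) := by
        rw [angularFT, ← integral_const_mul]
        congr 1; ext p
        rw [show ∀ a b c d : ℂ, a * (b * (c * d)) = b * c * (a * d) by intros; ring, gaussEvol_eq_fourier hA hg.int,
          ← integral_const_mul]
        congr 1; ext ξ
        simp only [hΨ]; ring
    _ = ∫ ξ : ℝ, ∫ p : ℝ, (cexp (I * (-(c * p) : ℝ)) * cexp (I * (ξ * (x - p) : ℝ))) * ((heatKernel (2 * l) p : ℂ) * Ψ ξ) :=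
        integral_integral_swap hint
    _ = _ := by
        congr 1; ext ξ
        rw [← integral_heatKernel_cexp (η := 2 * l) (by positivity), ← integral_const_mul]
        congr 1; ext p
        have e : cexp (I * (-(c * p) : ℝ)) * cexp (I * (ξ * (x - p) : ℝ)) =
            cexp (I * (ξ * x : ℝ)) * cexp (I * (-((c + ξ) * p) : ℝ)) := by
          rw [← Complex.exp_add, ← Complex.exp_add]; congr 1; push_cast; ring
        rw [e]; simp only [hΨ]; ring

/-- Recentre at `ξ + c`. The frequency `(r+2l)c/(2l)` of the window is the one for which the linear
terms of `r(ξ+c)²` and of the window's Gaussian cancel, leaving `(r+2l)ξ²` and the constant in the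
exponential. The time phase `t(ξ+c)²` contributes the translation `2ct`. -/
lemma norm_integral_husimi {l r : ℝ} (hl : 0 < l) (hr : 0 < r) (t : ℝ) {g : ℝ → ℂ} (hg : BddIntegrable g) (x c : ℝ) :
    ‖∫ ξ : ℝ, angularFT g ξ * (cexp (I * (ξ * x : ℝ)) * cexp (-cplxTime r t * (ξ : ℂ) ^ 2)) *
      (Real.exp (-(2 * l * (-((r + 2 * l) / (2 * l) * c) + ξ) ^ 2)) : ℝ)‖ =
    (2 * Real.pi) * Real.exp (-(r * (r + 2 * l) / (2 * l) * c ^ 2)) *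
      ‖gaussEvol (cplxTime (r + 2 * l) t) (modulate c g) (x + 2 * c * t)‖ := by
  have hA : 0 < (cplxTime (r + 2 * l) t).re := by simp; positivity
  have h2 := gaussEvol_eq_fourier hA (hg.modulate c).int (x + 2 * c * t)
  have h3 : ‖((2 * Real.pi : ℝ) : ℂ) * gaussEvol (cplxTime (r + 2 * l) t) (modulate c g) (x + 2 * c * t)‖ =
      (2 * Real.pi) * ‖gaussEvol (cplxTime (r + 2 * l) t) (modulate c g) (x + 2 * c * t)‖ := by
    rw [norm_mul, norm_real, Real.norm_of_nonneg (by positivity)]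
  rw [mul_right_comm, ← h3, h2, ← integral_add_right_eq_self (μ := volume) (fun ξ : ℝ => angularFT g ξ *
    (cexp (I * (ξ * x : ℝ)) * cexp (-cplxTime r t * (ξ : ℂ) ^ 2)) *
      (Real.exp (-(2 * l * (-((r + 2 * l) / (2 * l) * c) + ξ) ^ 2)) : ℝ)) c]
  have e : ∀ ξ : ℝ, angularFT g (ξ + c) * (cexp (I * ((ξ + c) * x : ℝ)) * cexp (-cplxTime r t * ((ξ + c : ℝ) : ℂ) ^ 2)) *
      (Real.exp (-(2 * l * (-((r + 2 * l) / (2 * l) * c) + (ξ + c)) ^ 2)) : ℝ) =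
      ((Real.exp (-(r * (r + 2 * l) / (2 * l) * c ^ 2)) : ℝ) * cexp (I * ((c * x + t * c ^ 2 : ℝ)))) *
        (angularFT (modulate c g) ξ * (cexp (I * (ξ * (x + 2 * c * t) : ℝ)) * cexp (-cplxTime (r + 2 * l) t * (ξ : ℂ) ^ 2))) := by
    intro ξ
    rw [angularFT_modulate, mul_assoc, mul_left_comm _ (angularFT g (ξ + c))]
    congr 1
    rw [ofReal_exp, ofReal_exp, ← Complex.exp_add, ← Complex.exp_add, ← Complex.exp_add, ← Complex.exp_add, ← Complex.exp_add]
    congr 1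
    have e1 : cplxTime r t = (r : ℂ) - t * I := by apply Complex.ext <;> simp
    have e2 : cplxTime (r + 2 * l) t = ((r : ℂ) + 2 * l) - t * I := by apply Complex.ext <;> simp
    rw [e1, e2]
    have hl' : (l : ℂ) ≠ 0 := by exact_mod_cast hl.ne'
    push_cast
    field_simp
    ring
  simp_rw [e]
  rw [integral_const_mul, norm_mul, norm_mul, norm_real, norm_cexp_I_mul, mul_one, Real.norm_of_nonneg (Real.exp_pos _).le, mul_comm]

lemma lintegral_comp_neg_mul {f : ℝ → ℝ≥0∞} (hf : Measurable f) {a : ℝ} (ha : 0 < a) :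
    ∫⁻ x, f x = ENNReal.ofReal a * ∫⁻ x, f (-(a * x)) := by
  have h := lintegral_comp_div (f := fun x => f (-(a * x))) (hf.comp (by fun_prop)) ha
  rw [← h, ← lintegral_neg_eq_self]
  refine lintegral_congr fun x => ?_
  rw [mul_div_cancel₀ _ ha.ne']

/-- Phase space weight of the heat average at scale `l`. -/
noncomputable def husimiWeight (r l c : ℝ) : ℝ := (r + 2 * l) / l * √(l / Real.pi) * Real.exp (-(r * (r + 2 * l) / l * c ^ 2))

/-- Phase space decomposition of the heat average of `|u|²`. -/
lemma heatAvg_evol_eq {l r : ℝ} (hl : 0 < l) (hr : 0 < r) (t : ℝ) {g : ℝ → ℂ} (hg : BddIntegrable g) (x : ℝ) :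
    heatAvg l (fun y => ‖gaussEvol (cplxTime r t) g y‖ₑ ^ 2) x =
      ∫⁻ c, ENNReal.ofReal (husimiWeight r l c) *
        ‖gaussEvol (cplxTime (r + 2 * l) t) (modulate c g) (x + 2 * c * t)‖ₑ ^ 2 := by
  have hu : BddIntegrable (gaussEvol (cplxTime r t) g) := hg.evol hr
  set F : ℝ → ℂ := fun p => (√(heatKernel l p) : ℂ) * gaussEvol (cplxTime r t) g (x - p) with hF
  have hFb : BddIntegrable F := hu.heatWindow hl x
  set k := √((2 * Real.pi)⁻¹ * √(Real.pi / l)) * (2 * Real.pi * (√(Real.pi / (2 * l)))⁻¹) with hk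
  have hk0 : 0 ≤ k := by positivity
  have hk2 : k ^ 2 = 4 * l * √(Real.pi / l) := sq_heatWindow_const hl
  -- Frequencies of the windowed function are parametrised as `-ac`, so that `c` is the modulation
  -- of the datum.
  set a := (r + 2 * l) / (2 * l) with ha
  have ha0 : 0 < a := by positivity
  have e1 : heatAvg l (fun y => ‖gaussEvol (cplxTime r t) g y‖ₑ ^ 2) x = ∫⁻ p, ‖F p‖ₑ ^ 2 := by
    refine lintegral_congr fun p => ?_
    rw [hF, enorm_mul, mul_pow, ← ofReal_norm, norm_real, Real.norm_of_nonneg (Real.sqrt_nonneg _),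
      ← ENNReal.ofReal_pow (Real.sqrt_nonneg _), Real.sq_sqrt (heatKernel_nonneg _ _)]
  have hpi : ENNReal.ofReal (2 * Real.pi) ≠ 0 := by
    rw [Ne, ENNReal.ofReal_eq_zero, not_le]; positivity
  have e2 : ∀ c, ‖angularFT F (-(a * c))‖ = k * Real.exp (-(r * (r + 2 * l) / (2 * l) * c ^ 2)) *
      ‖gaussEvol (cplxTime (r + 2 * l) t) (modulate c g) (x + 2 * c * t)‖ := by
    intro c
    have h1 : angularFT F (-(a * c)) = (k : ℂ) * angularFT (fun p => (heatKernel (2 * l) p : ℂ) * gaussEvol (cplxTime r t) g (x - p)) (-(a * c)) := by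
      rw [angularFT, angularFT, ← integral_const_mul]
      congr 1; ext p
      simp only [hF]
      rw [sqrt_heatKernel hl]; push_cast [hk]; ring
    have h2 := congrArg norm (angularFT_heatWindow hl (A := cplxTime r t) hr hg x (-(a * c)))
    rw [norm_integral_husimi hl hr t hg x c, norm_mul, norm_real, Real.norm_of_nonneg (by positivity)] at h2
    have h3 := mul_left_cancel₀ (by positivity : (2 * Real.pi) ≠ 0) (h2.trans (mul_assoc _ _ _))
    rw [h1, norm_mul, norm_real, Real.norm_of_nonneg hk0, h3]
    ring
  have hc := continuous_angularFT hFb.int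
  rw [e1, ← ENNReal.mul_right_inj hpi ENNReal.ofReal_ne_top, ← lintegral_angularFT_sq hFb.int hFb.memLp_two,
    lintegral_comp_neg_mul (hc.measurable.enorm.pow_const 2) ha0, ← lintegral_const_mul' _ _ ENNReal.ofReal_ne_top,
    ← lintegral_const_mul' _ _ ENNReal.ofReal_ne_top]
  refine lintegral_congr fun c => ?_
  rw [← ofReal_norm, e2, ENNReal.ofReal_mul (by positivity), ofReal_norm, mul_pow, ← mul_assoc, ← mul_assoc,
    ← ENNReal.ofReal_pow (by positivity), ← ENNReal.ofReal_mul (by positivity), ← ENNReal.ofReal_mul (by positivity)]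
  congr 2
  rw [mul_pow, hk2, ← Real.exp_nat_mul, husimiWeight]
  have e3 : ((2 : ℕ) : ℝ) * -(r * (r + 2 * l) / (2 * l) * c ^ 2) = -(r * (r + 2 * l) / l * c ^ 2) := by
    push_cast; field_simp
  have e4 : √(Real.pi / l) * l = Real.pi * √(l / Real.pi) := by
    rw [Real.sqrt_div Real.pi_pos.le, Real.sqrt_div hl.le]
    have h1 := Real.mul_self_sqrt hl.le
    have h2 := Real.mul_self_sqrt Real.pi_pos.le
    have h3 := Real.sqrt_pos.2 hl
    have h4 := Real.sqrt_pos.2 Real.pi_pos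
    field_simp
    nlinarith
  rw [e3, ha]
  calc _ = (r + 2 * l) / (2 * l) * 4 * (√(Real.pi / l) * l) * Real.exp (-(r * (r + 2 * l) / l * c ^ 2)) := by ring
    _ = _ := by rw [e4]; field_simp; ring

/-! ### Estimates for sheared measures. -/

lemma measurable_shear (c : ℝ) : Measurable fun z : ℝ × ℝ => (z.1 + 2 * c * z.2, z.2) := by fun_prop

/-- With `y = r^{1/2}|c|` the left side is `r^{-θ/2} (2 + 2y)^θ`. Growth in the velocity is traded
for `e^{2rc²}`, which the phase space weight absorbs in `husimiWeight_mul_le`. -/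
lemma exp_mul_rpow_bound {θ r : ℝ} (hθ : θ ≤ 1) (hr : 0 < r) (c : ℝ) :
    (2 * r ^ (-(1 / 2) : ℝ) + 2 * |c|) ^ θ ≤ 4 * r ^ (-(θ / 2)) * Real.exp (2 * r * c ^ 2) := by
  set y := r ^ (1 / 2 : ℝ) * |c| with hy
  have hr2 : 0 < r ^ (1 / 2 : ℝ) := by positivity
  have hrr : r ^ (1 / 2 : ℝ) * r ^ (1 / 2 : ℝ) = r := by rw [← Real.rpow_add hr]; norm_num
  have hy0 : 0 ≤ y := by positivity
  have hy2 : y ^ 2 = r * c ^ 2 := by rw [hy, mul_pow, sq_abs, sq, hrr]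
  have e1 : 2 * r ^ (-(1 / 2) : ℝ) + 2 * |c| = r ^ (-(1 / 2) : ℝ) * (2 + 2 * y) := by
    rw [hy, Real.rpow_neg hr.le]; field_simp
  rw [e1, Real.mul_rpow (by positivity) (by positivity), ← Real.rpow_mul hr.le, show -(1 / 2) * θ = -(θ / 2) by ring]
  have h1 : (2 + 2 * y) ^ θ ≤ 4 * Real.exp (2 * r * c ^ 2) := by
    calc (2 + 2 * y) ^ θ ≤ (2 + 2 * y) ^ (1 : ℝ) := Real.rpow_le_rpow_of_exponent_le (by linarith) hθ
      _ = 2 + 2 * y := Real.rpow_one _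
      _ ≤ 4 * (2 * y ^ 2 + 1) := by nlinarith [sq_nonneg (y - 1)]
      _ ≤ 4 * Real.exp (2 * y ^ 2) := by gcongr; exact Real.add_one_le_exp _
      _ = _ := by rw [hy2, ← mul_assoc]
  calc _ ≤ r ^ (-(θ / 2)) * (4 * Real.exp (2 * r * c ^ 2)) := by gcongr
    _ = _ := by ring

/-- The window enlargement will be `L = r^{-δ}`, so the Gaussian tails beat any power of `r⁻¹`. -/
lemma exp_neg_mul_rpow_bound {δ : ℝ} (hδ : 0 < δ) : ∃ C : ℝ, 0 < C ∧ ∀ r : ℝ, 0 < r →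
    Real.exp (-((r ^ (-δ)) ^ 2 / 768)) * r ^ (-2 : ℝ) ≤ C := by
  set s := 1 / δ with hs
  have hs0 : 0 < s := by positivity
  refine ⟨Real.exp 1 * s ^ s * (768 : ℝ) ^ s, by positivity, fun r hr => ?_⟩
  set x := (r ^ (-δ)) ^ 2 / 768 with hx
  have hx0 : 0 < x := by positivity
  have h1 := exp_neg_le_rpow hs0 hx0.le
  have h2 : (1 + x) ^ (-s) ≤ x ^ (-s) := Real.rpow_le_rpow_of_nonpos hx0 (by linarith) (by linarith)
  have h3 : x ^ (-s) = 768 ^ s * r ^ (2 : ℝ) := by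
    rw [hx, Real.div_rpow (by positivity) (by norm_num), ← Real.rpow_natCast, ← Real.rpow_mul hr.le, ← Real.rpow_mul hr.le,
      Real.rpow_neg (by norm_num : (0 : ℝ) ≤ 768), div_inv_eq_mul, mul_comm]
    congr 2
    rw [hs]; push_cast; field_simp
  calc _ ≤ Real.exp 1 * s ^ s * (768 ^ s * r ^ (2 : ℝ)) * r ^ (-2 : ℝ) := by
        gcongr; exact h1.trans (by rw [← h3]; gcongr)
    _ = Real.exp 1 * s ^ s * 768 ^ s * (r ^ (2 : ℝ) * r ^ (-2 : ℝ)) := by ring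
    _ = _ := by rw [← Real.rpow_add hr]; norm_num

lemma inv_sqrt_le {r α : ℝ} (hr : 0 < r) (hα : r / 2 ≤ α) : (√α)⁻¹ ≤ 2 * r ^ (-(1 / 2) : ℝ) := by
  have hα0 : 0 < α := by linarith
  have hr2 : (r ^ (-(1 / 2) : ℝ)) ^ 2 = r⁻¹ := by
    rw [← Real.rpow_natCast, ← Real.rpow_mul hr.le, ← Real.rpow_neg_one]; norm_num
  apply le_of_sq_le_sq _ (by positivity)
  rw [inv_pow, Real.sq_sqrt hα0.le, mul_pow, hr2, inv_eq_one_div, div_le_iff₀ hα0]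
  calc (1 : ℝ) ≤ 2 ^ 2 * r⁻¹ * (r / 2) := by field_simp; norm_num
    _ ≤ _ := by gcongr

/-- Bounds for the sheared measure on the two relevant boxes. -/
lemma ParabolicFrostman.shear_tubes_le {β : ℝ} (hβ : β ∈ Icc (0 : ℝ) 3) : ∃ a : ℝ, |a| ≤ 1 ∧ ∀ ν D, ParabolicFrostman β D ν →
    ∀ r α c : ℝ, 0 < r → r ≤ 1 → r / 2 ≤ α → α ≤ 2 →
      (∀ x t, (ν.map fun z : ℝ × ℝ => (z.1 + 2 * c * z.2, z.2)) {z | |z.1 - x| ≤ 2 * √α ∧ |z.2 - t| ≤ 2 * α} ≤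
        D * ENNReal.ofReal (40 * ((2 * r ^ (-(1 / 2) : ℝ) + 2 * |c|) ^ tubeExp β * (√α)⁻¹ ^ (-2 - a)))) ∧
      (∀ x, (ν.map fun z : ℝ × ℝ => (z.1 + 2 * c * z.2, z.2)) {z | |z.1 - x| ≤ (√α)⁻¹} ≤
        D * ENNReal.ofReal (40 * ((2 * r ^ (-(1 / 2) : ℝ) + 2 * |c|) ^ tubeExp β * (√α)⁻¹ ^ a))) := by
  obtain ⟨a, ha, htub⟩ := ParabolicFrostman.tubes_le hβ
  refine ⟨a, ha, fun ν D hν r α c hr hr1 hα hα2 => ?_⟩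
  have hα0 : 0 < α := by linarith
  set s := (√α)⁻¹ with hs
  have hs0 : 0 < s := by positivity
  have hsα : s ^ 2 = α⁻¹ := by rw [hs, inv_pow, Real.sq_sqrt hα0.le]
  have hr3 : 1 ≤ r ^ (-(1 / 2) : ℝ) := Real.one_le_rpow_of_pos_of_le_one_of_nonpos hr hr1 (by norm_num)
  have hN1 : s ≤ 2 * r ^ (-(1 / 2) : ℝ) := inv_sqrt_le hr hα
  have habs := abs_nonneg c
  have key := fun x => htub ν D hν c (2 * r ^ (-(1 / 2) : ℝ) + 2 * |c|) s x (by linarith) (by linarith) (by linarith)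
    (by rw [hsα, ← div_eq_mul_inv, one_le_div hα0]; exact hα2) hs0
  refine ⟨fun x t => ?_, fun x => ?_⟩
  · rw [Measure.map_apply (measurable_shear c) (by measurability)]
    refine le_trans (measure_mono fun z hz => ?_) ((key x).1 t)
    simp only [mem_preimage, mem_ofPred_eq] at hz ⊢
    have e1 : 2 / s = 2 * √α := by rw [hs, div_inv_eq_mul]
    have e2 : 2 / s ^ 2 = 2 * α := by rw [hsα, div_inv_eq_mul]
    rwa [e1, e2]
  · rw [Measure.map_apply (measurable_shear c) (by measurability)]
    refine le_trans (measure_mono_ae ?_) (key x).2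
    filter_upwards [hν.time] with z hz h
    refine ⟨h, ?_⟩
    rw [abs_le]; constructor <;> linarith [hz.1, hz.2]

lemma lintegral_shear {ν : Measure (ℝ × ℝ)} {F : ℝ × ℝ → ℝ≥0∞} (hF : Measurable F) (c : ℝ) :
    ∫⁻ z, F z ∂(ν.map fun z : ℝ × ℝ => (z.1 + 2 * c * z.2, z.2)) = ∫⁻ z, F (z.1 + 2 * c * z.2, z.2) ∂ν :=
  lintegral_map hF (measurable_shear c)

lemma ae_time_shear {ν : Measure (ℝ × ℝ)} (h : ∀ᵐ z ∂ν, z.2 ∈ Icc (0 : ℝ) 1) (c : ℝ) :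
    ∀ᵐ z ∂(ν.map fun z : ℝ × ℝ => (z.1 + 2 * c * z.2, z.2)), z.2 ∈ Icc (0 : ℝ) 1 := by
  rw [ae_map_iff (measurable_shear c).aemeasurable (measurable_snd measurableSet_Icc)]
  exact h

/-- The block estimate for a sheared Frostman measure. -/
lemma lintegral_evol_sq_shear {β : ℝ} (hβ : β ∈ Icc (0 : ℝ) 3) {δ : ℝ} (hδ : 0 < δ) : ∃ C : ℝ, 0 < C ∧
    ∀ ν D, ParabolicFrostman β D ν → ∀ r α η c : ℝ, 0 < r → r ≤ 1 → r / 2 ≤ α → α ≤ 2 → 0 < η → η ≤ 3 * α →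
      ∀ h, BddIntegrable h →
      ∫⁻ z, ‖gaussEvol (cplxTime α z.2) h (z.1 + 2 * c * z.2)‖ₑ ^ 2 ∂ν ≤
        ∫⁻ z, heatAvg η (fun x => ‖gaussEvol (cplxTime α z.2) h x‖ₑ ^ 2) (z.1 + 2 * c * z.2) ∂ν +
        D * ENNReal.ofReal (C * r ^ (-(tubeExp β / 2) - δ) * Real.exp (2 * r * c ^ 2)) * ∫⁻ y, ‖h y‖ₑ ^ 2 := by
  obtain ⟨C, hC, hblk⟩ := lintegral_evol_sq_block
  obtain ⟨a, ha, htub⟩ := ParabolicFrostman.shear_tubes_le hβ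
  obtain ⟨K, hK, hexp⟩ := exp_neg_mul_rpow_bound hδ
  refine ⟨C * (1 + 16 * K) * 160, by positivity, fun ν D hν r α η c hr hr1 hα hα2 hη hηα h hh => ?_⟩
  have hα0 : 0 < α := by linarith
  have := hν.finite
  obtain ⟨hm1, hm2⟩ := htub ν D hν r α c hr hr1 hα hα2
  set ν' := ν.map fun z : ℝ × ℝ => (z.1 + 2 * c * z.2, z.2) with hν'
  set s := (√α)⁻¹ with hs
  set N := 2 * r ^ (-(1 / 2) : ℝ) + 2 * |c| with hN
  set L := r ^ (-δ) with hL
  have hL1 : 1 ≤ L := Real.one_le_rpow_of_pos_of_le_one_of_nonpos hr hr1 (by linarith)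
  have hs0 : 0 < s := by positivity
  have hN0 : 0 < N := by have := Real.rpow_pos_of_pos hr (-(1 / 2)); positivity
  have hsα : s ^ 2 = α⁻¹ := by rw [hs, inv_pow, Real.sq_sqrt hα0.le]
  have hmF : Measurable fun z : ℝ × ℝ => ‖gaussEvol (cplxTime α z.2) h z.1‖ₑ ^ 2 :=
    (measurable_evol_space_time hh.meas α).enorm.pow_const 2
  have hmH := measurable_heatAvg (η := η) hmF
  have hb := hblk α η L hα0 hα2 hη hηα hL1 ν' _ _ (ae_time_shear hν.time c) hm1 hm2 h hh
  rw [lintegral_shear hmF, lintegral_shear hmH] at hb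
  refine hb.trans (add_le_add le_rfl ?_)
  gcongr
  have hP : 0 ≤ N ^ tubeExp β := by positivity
  -- All powers of `s` cancel, since `α⁻¹ = s²` meets `s^{-2-a} s^a`; the geometric mean is
  -- therefore independent of `a` and of the scale `α`.
  have e1 : ENNReal.ofReal α⁻¹ * (D * ENNReal.ofReal (40 * (N ^ tubeExp β * s ^ (-2 - a)))) *
      (D * ENNReal.ofReal (40 * (N ^ tubeExp β * s ^ a))) = (D * ENNReal.ofReal (40 * N ^ tubeExp β)) ^ (2 : ℝ) := by
    rw [show ∀ x y z w : ℝ≥0∞, x * (y * z) * (y * w) = (y * y) * (x * (z * w)) by intros; ring,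
      ← ENNReal.ofReal_mul (by positivity), ← ENNReal.ofReal_mul (by positivity), ENNReal.rpow_two, mul_pow, sq, sq,
      ← ENNReal.ofReal_mul (by positivity)]
    congr 2
    have : s ^ (-2 - a) * s ^ a * s ^ 2 = 1 := by
      rw [← Real.rpow_natCast, ← Real.rpow_add hs0, ← Real.rpow_add hs0]; norm_num
    rw [← hsα]
    linear_combination 1600 * (N ^ tubeExp β) ^ 2 * this
  have e2 : s ^ 2 * s * s ^ a ≤ 16 * r ^ (-2 : ℝ) := by
    have hs2 : s ≤ 2 * r ^ (-(1 / 2) : ℝ) := inv_sqrt_le hr hα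
    have hr3 : 1 ≤ r ^ (-(1 / 2) : ℝ) := Real.one_le_rpow_of_pos_of_le_one_of_nonpos hr hr1 (by norm_num)
    calc s ^ 2 * s * s ^ a = s ^ (3 + a) := by
          rw [Real.rpow_add hs0, ← pow_succ]; norm_cast
      _ ≤ (2 * r ^ (-(1 / 2) : ℝ)) ^ (3 + a) := Real.rpow_le_rpow hs0.le hs2 (by linarith [(abs_le.1 ha).1])
      _ ≤ (2 * r ^ (-(1 / 2) : ℝ)) ^ (4 : ℝ) := Real.rpow_le_rpow_of_exponent_le (by linarith) (by linarith [(abs_le.1 ha).2])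
      _ = _ := by
          rw [Real.mul_rpow (by norm_num) (by positivity), ← Real.rpow_mul hr.le]; norm_num
  rw [e1, ← ENNReal.rpow_mul, show (2 : ℝ) * (1 / 2) = 1 by norm_num, ENNReal.rpow_one]
  have hle := exp_mul_rpow_bound (tubeExp_le_one β) hr c
  calc _ = D * ENNReal.ofReal (C * (L * (40 * N ^ tubeExp β)) + C * (s ^ 2 * s * s ^ a * Real.exp (-(L ^ 2 / 768))) * (40 * N ^ tubeExp β)) := by
        rw [mul_left_comm, mul_left_comm _ D, ← mul_add, ← ENNReal.ofReal_mul (by positivity), ← ENNReal.ofReal_mul (by positivity),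
          ← ENNReal.ofReal_add (by positivity) (by positivity), ← hsα]
        congr 2; ring
    _ ≤ D * ENNReal.ofReal (C * (L * (40 * N ^ tubeExp β)) + C * (16 * K * L) * (40 * N ^ tubeExp β)) := by
        gcongr D * ENNReal.ofReal (_ + C * ?_ * _)
        calc _ ≤ 16 * r ^ (-2 : ℝ) * Real.exp (-(L ^ 2 / 768)) := by gcongr
          _ = 16 * (Real.exp (-(L ^ 2 / 768)) * r ^ (-2 : ℝ)) := by ring
          _ ≤ 16 * K * 1 := by rw [mul_one]; gcongr; exact hexp r hr
          _ ≤ _ := by gcongr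
    _ ≤ D * ENNReal.ofReal (C * (1 + 16 * K) * 40 * L * (4 * r ^ (-(tubeExp β / 2)) * Real.exp (2 * r * c ^ 2))) := by
        gcongr D * ENNReal.ofReal ?_
        calc _ = C * (1 + 16 * K) * 40 * L * N ^ tubeExp β := by ring
          _ ≤ _ := by gcongr
    _ = _ := by
        rw [sub_eq_add_neg, Real.rpow_add hr]
        congr 2; ring

/-- The trivial estimate for a sheared Frostman measure at unit scale. -/
lemma lintegral_evol_sq_shear_unit {β : ℝ} (hβ : β ∈ Icc (0 : ℝ) 3) : ∃ C : ℝ, 0 < C ∧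
    ∀ ν D, ParabolicFrostman β D ν → ∀ r α c : ℝ, 0 < r → r ≤ 1 → 1 ≤ α → α ≤ 2 → ∀ h, BddIntegrable h →
      ∫⁻ z, ‖gaussEvol (cplxTime α z.2) h (z.1 + 2 * c * z.2)‖ₑ ^ 2 ∂ν ≤
        D * ENNReal.ofReal (C * r ^ (-(tubeExp β / 2)) * Real.exp (2 * r * c ^ 2)) * ∫⁻ y, ‖h y‖ₑ ^ 2 := by
  obtain ⟨C, hC, hloc⟩ := lintegral_locAvg_sq_le
  obtain ⟨a, ha, htub⟩ := ParabolicFrostman.shear_tubes_le hβ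
  refine ⟨C * 160 * 2, by positivity, fun ν D hν r α c hr hr1 hα hα2 h hh => ?_⟩
  have hα0 : 0 < α := by linarith
  have := hν.finite
  obtain ⟨-, hm2⟩ := htub ν D hν r α c hr hr1 (by linarith) hα2
  set ν' := ν.map fun z : ℝ × ℝ => (z.1 + 2 * c * z.2, z.2) with hν'
  set s := (√α)⁻¹ with hs
  set N := 2 * r ^ (-(1 / 2) : ℝ) + 2 * |c| with hN
  have hs0 : 0 < s := by positivity
  have hN0 : 0 < N := by have := Real.rpow_pos_of_pos hr (-(1 / 2)); positivity
  have hs1 : s ≤ 1 := inv_le_one_of_one_le₀ (Real.one_le_sqrt.2 hα)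
  have hsα : s ^ 2 = α⁻¹ := by rw [hs, inv_pow, Real.sq_sqrt hα0.le]
  have hmF : Measurable fun z : ℝ × ℝ => ‖gaussEvol (cplxTime α z.2) h z.1‖ₑ ^ 2 :=
    (measurable_evol_space_time hh.meas α).enorm.pow_const 2
  have hb := hloc α hα0 ν' _ hm2 h hh.meas 0
  have e2 : s ^ 2 * s * s ^ a ≤ 1 := by
    calc s ^ 2 * s * s ^ a = s ^ (3 + a) := by
          rw [Real.rpow_add hs0, ← pow_succ]; norm_cast
      _ ≤ 1 := Real.rpow_le_one hs0.le hs1 (by linarith [(abs_le.1 ha).1])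
  have hle := exp_mul_rpow_bound (tubeExp_le_one β) hr c
  rw [← lintegral_shear hmF]
  calc _ ≤ ∫⁻ z, locAvg 40 α h (z.1 - 0) ^ 2 ∂ν' := by
        refine lintegral_mono_ae ((ae_time_shear hν.time c).mono fun z hz => ?_)
        rw [sub_zero]
        gcongr
        exact (enorm_evol_le_locAvg hα0 hα2 hz h z.1).trans (locAvg_twenty_le hα0 h z.1)
    _ ≤ _ := hb
    _ ≤ _ := by
        gcongr ?_ * _
        rw [mul_left_comm, ← ENNReal.ofReal_mul (by positivity)]
        gcongr D * ENNReal.ofReal ?_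
        calc _ = C * 40 * (s ^ 2 * s * s ^ a) * N ^ tubeExp β := by rw [hsα]; ring
          _ ≤ C * 40 * 1 * (4 * r ^ (-(tubeExp β / 2)) * Real.exp (2 * r * c ^ 2)) := by gcongr
          _ = C * 160 * 1 * r ^ (-(tubeExp β / 2)) * Real.exp (2 * r * c ^ 2) := by ring
          _ ≤ _ := by gcongr; norm_num

/-! ### Summation over phase space components. -/

lemma measurable_evol_modulate {g : ℝ → ℂ} (hg : Measurable g) (ρ : ℝ) :
    Measurable fun w : ℝ × ℝ × ℝ => gaussEvol (cplxTime ρ w.2.2) (modulate w.1 g) w.2.1 := by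
  have h1 : Measurable fun w : (ℝ × ℝ × ℝ) × ℝ => (cplxTime ρ w.1.2.2, w.1.2.1 - w.2) := by
    have h := measurable_cplxTime
    have h' : Measurable fun w : (ℝ × ℝ × ℝ) × ℝ => (ρ, w.1.2.2) := by fun_prop
    exact (h.comp h').prodMk (by fun_prop)
  have h2 := measurable_gaussKernel.comp h1
  have h3 : Measurable fun w : (ℝ × ℝ × ℝ) × ℝ => modulate w.1.1 g w.2 := by
    unfold modulate
    exact Measurable.mul (by fun_prop) (hg.comp measurable_snd)
  unfold gaussEvol
  refine StronglyMeasurable.measurable (StronglyMeasurable.integral_prod_right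
    (f := fun (w : ℝ × ℝ × ℝ) (y : ℝ) => gaussKernel (cplxTime ρ w.2.2) (w.2.1 - y) * modulate w.1 g y) ?_)
  exact (h2.mul h3).stronglyMeasurable

/-- The phase space masses add up to the mass of `g`. -/
lemma lintegral_phaseSpace_mass {α : ℝ} (hα : 0 < α) {g : ℝ → ℂ} (hg : BddIntegrable g) :
    ∫⁻ c, (∫⁻ y, ‖gaussEvol (cplxTime α 0) (modulate c g) y‖ₑ ^ 2) =
      ENNReal.ofReal (√(Real.pi / (2 * α))) * ∫⁻ y, ‖g y‖ₑ ^ 2 := by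
  have hA : 0 < (cplxTime α 0).re := hα
  have hpi : ENNReal.ofReal (2 * Real.pi) ≠ 0 := by
    rw [Ne, ENNReal.ofReal_eq_zero, not_le]; positivity
  have hc := continuous_angularFT hg.int
  have e1 : ∀ c, ENNReal.ofReal (2 * Real.pi) * ∫⁻ y, ‖gaussEvol (cplxTime α 0) (modulate c g) y‖ₑ ^ 2 =
      ∫⁻ ξ : ℝ, ENNReal.ofReal (Real.exp (-(2 * α) * ξ ^ 2)) * ‖angularFT g (ξ + c)‖ₑ ^ 2 := by
    intro c
    have hb := (hg.modulate c).evol hA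
    rw [← lintegral_angularFT_sq hb.int hb.memLp_two]
    refine lintegral_congr fun ξ => ?_
    rw [angularFT_gaussEvol hA (hg.modulate c).int, angularFT_modulate, enorm_mul, mul_pow]
    congr 1
    rw [← ofReal_norm, Complex.norm_exp, ← ENNReal.ofReal_pow (Real.exp_pos _).le, ← Real.exp_nat_mul]
    congr 2
    have : -cplxTime α 0 * (ξ : ℂ) ^ 2 = ((-α * ξ ^ 2 : ℝ) : ℂ) := by
      apply Complex.ext <;> simp [sq]
    rw [this, ofReal_re]; push_cast; ring
  rw [← ENNReal.mul_right_inj hpi ENNReal.ofReal_ne_top, ← lintegral_const_mul' _ _ ENNReal.ofReal_ne_top]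
  simp_rw [e1]
  have hm : Measurable fun w : ℝ × ℝ => ENNReal.ofReal (Real.exp (-(2 * α) * w.2 ^ 2)) * ‖angularFT g (w.2 + w.1)‖ₑ ^ 2 := by
    have h1 : Measurable fun w : ℝ × ℝ => angularFT g (w.2 + w.1) := hc.measurable.comp (by fun_prop)
    exact Measurable.mul (by fun_prop) (h1.enorm.pow_const 2)
  rw [lintegral_lintegral_swap hm.aemeasurable]
  have e2 : ∀ ξ : ℝ, ∫⁻ c, ENNReal.ofReal (Real.exp (-(2 * α) * ξ ^ 2)) * ‖angularFT g (ξ + c)‖ₑ ^ 2 =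
      ENNReal.ofReal (Real.exp (-(2 * α) * ξ ^ 2)) * (ENNReal.ofReal (2 * Real.pi) * ∫⁻ x, ‖g x‖ₑ ^ 2) := by
    intro ξ
    rw [lintegral_const_mul' _ _ ENNReal.ofReal_ne_top, lintegral_add_left_eq_self (fun c => ‖angularFT g c‖ₑ ^ 2),
      lintegral_angularFT_sq hg.int hg.memLp_two]
  simp_rw [e2]
  rw [lintegral_mul_const _ (by fun_prop), ← ofReal_integral_eq_lintegral_ofReal (integrable_exp_neg_mul_sq (by positivity))
    (.of_forall fun _ => (Real.exp_pos _).le), integral_gaussian]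
  ring

lemma husimiWeight_nonneg {r l : ℝ} (hr : 0 < r) (hl : 0 < l) (c : ℝ) : 0 ≤ husimiWeight r l c := by
  unfold husimiWeight; positivity

lemma measurable_husimiWeight (r l : ℝ) : Measurable (husimiWeight r l) := by
  unfold husimiWeight; fun_prop

/-- The exponent `r(r+2l)/l` of the weight exceeds `2r` by `r²/l`, so the growth `e^{2rc²}` is
absorbed exactly. The root normalises the total phase space mass, and `r ≤ 4l` makes `(r+2l)/l ≤ 6`.
-/
lemma husimiWeight_mul_le {r l : ℝ} (hr : 0 < r) (hl : 0 < l) (hrl : r ≤ 4 * l) (c : ℝ) :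
    husimiWeight r l c * Real.exp (2 * r * c ^ 2) * √(Real.pi / (2 * ((r + 2 * l) / 2))) ≤ 6 := by
  have h1 : Real.exp (-(r * (r + 2 * l) / l * c ^ 2)) * Real.exp (2 * r * c ^ 2) ≤ 1 := by
    rw [← Real.exp_add, Real.exp_le_one_iff]
    have : r * (r + 2 * l) / l * c ^ 2 = r ^ 2 / l * c ^ 2 + 2 * r * c ^ 2 := by field_simp
    rw [this]
    have : 0 ≤ r ^ 2 / l * c ^ 2 := by positivity
    linarith
  have h2 : √(l / Real.pi) * √(Real.pi / (2 * ((r + 2 * l) / 2))) ≤ 1 := by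
    rw [← Real.sqrt_mul (by positivity)]
    refine Real.sqrt_le_one.2 ?_
    have := Real.pi_pos
    have e : l / Real.pi * (Real.pi / (2 * ((r + 2 * l) / 2))) = l / (r + 2 * l) := by field_simp
    rw [e, div_le_one (by positivity)]; linarith
  have h3 : (r + 2 * l) / l ≤ 6 := by rw [div_le_iff₀ hl]; linarith
  unfold husimiWeight
  calc _ = (r + 2 * l) / l * (√(l / Real.pi) * √(Real.pi / (2 * ((r + 2 * l) / 2)))) *
        (Real.exp (-(r * (r + 2 * l) / l * c ^ 2)) * Real.exp (2 * r * c ^ 2)) := by ring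
    _ ≤ 6 * 1 * 1 := by gcongr
    _ = 6 := by norm_num

/-- Half of the real time stays with the evolution to be estimated. The other half acts on the datum
as a frequency cutoff, which makes the masses over all `c` summable. -/
lemma gaussEvol_modulate_split {r l : ℝ} (h : 0 < r + 2 * l) (t : ℝ) {g : ℝ → ℂ} (hg : BddIntegrable g) (c x : ℝ) :
    gaussEvol (cplxTime (r + 2 * l) t) (modulate c g) x =
      gaussEvol (cplxTime ((r + 2 * l) / 2) t) (gaussEvol (cplxTime ((r + 2 * l) / 2) 0) (modulate c g)) x := by
  rw [← gaussEvol_add (by simp; linarith) (by simp; linarith) (hg.modulate c).int]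
  congr 1
  apply Complex.ext <;> simp

/-- Summation of estimates for the phase space components. -/
lemma lintegral_heatAvg_le_of_components {r l : ℝ} (hr : 0 < r) (hl : 0 < l) (hrl : r ≤ 4 * l)
    {ν : Measure (ℝ × ℝ)} [SFinite ν] {g : ℝ → ℂ} (hg : BddIntegrable g) {X : ℝ → ℝ≥0∞} (hX : Measurable X) (D : ℝ≥0∞) {K : ℝ}
    (hK : 0 ≤ K)
    (h : ∀ c, ∫⁻ z, ‖gaussEvol (cplxTime ((r + 2 * l) / 2) z.2) (gaussEvol (cplxTime ((r + 2 * l) / 2) 0) (modulate c g))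
      (z.1 + 2 * c * z.2)‖ₑ ^ 2 ∂ν ≤ X c + D * ENNReal.ofReal (K * Real.exp (2 * r * c ^ 2)) *
        ∫⁻ y, ‖gaussEvol (cplxTime ((r + 2 * l) / 2) 0) (modulate c g) y‖ₑ ^ 2) :
    ∫⁻ z, heatAvg l (fun x => ‖gaussEvol (cplxTime r z.2) g x‖ₑ ^ 2) z.1 ∂ν ≤
      (∫⁻ c, ENNReal.ofReal (husimiWeight r l c) * X c) + D * ENNReal.ofReal (6 * K) * ∫⁻ y, ‖g y‖ₑ ^ 2 := by
  set α := (r + 2 * l) / 2 with hα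
  have hα0 : 0 < α := by positivity
  have hm : Measurable fun w : ℝ × ℝ × ℝ => ‖gaussEvol (cplxTime (r + 2 * l) w.2.2) (modulate w.1 g) (w.2.1 + 2 * w.1 * w.2.2)‖ₑ ^ 2 := by
    have h1 := measurable_evol_modulate hg.meas (r + 2 * l)
    have h2 : Measurable fun w : ℝ × ℝ × ℝ => (w.1, w.2.1 + 2 * w.1 * w.2.2, w.2.2) := by fun_prop
    have h3 := h1.comp h2
    exact h3.enorm.pow_const 2
  have hW := (measurable_husimiWeight r l).ennreal_ofReal
  have hm2 : Measurable fun w : (ℝ × ℝ) × ℝ => ENNReal.ofReal (husimiWeight r l w.2) *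
      ‖gaussEvol (cplxTime (r + 2 * l) w.1.2) (modulate w.2 g) (w.1.1 + 2 * w.2 * w.1.2)‖ₑ ^ 2 := by
    have h2 : Measurable fun w : (ℝ × ℝ) × ℝ => (w.2, w.1) := by fun_prop
    have h3 := hm.comp h2
    exact (hW.comp measurable_snd).mul h3
  calc _ = ∫⁻ z, (∫⁻ c, ENNReal.ofReal (husimiWeight r l c) *
        ‖gaussEvol (cplxTime (r + 2 * l) z.2) (modulate c g) (z.1 + 2 * c * z.2)‖ₑ ^ 2) ∂ν :=
        lintegral_congr fun z => heatAvg_evol_eq hl hr z.2 hg z.1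
    _ = ∫⁻ c, (∫⁻ z, ENNReal.ofReal (husimiWeight r l c) *
        ‖gaussEvol (cplxTime (r + 2 * l) z.2) (modulate c g) (z.1 + 2 * c * z.2)‖ₑ ^ 2 ∂ν) :=
        lintegral_lintegral_swap hm2.aemeasurable
    _ ≤ ∫⁻ c, (ENNReal.ofReal (husimiWeight r l c) * X c + D * ENNReal.ofReal K *
          (ENNReal.ofReal (husimiWeight r l c * Real.exp (2 * r * c ^ 2)) *
          ∫⁻ y, ‖gaussEvol (cplxTime α 0) (modulate c g) y‖ₑ ^ 2)) := by
        refine lintegral_mono fun c => ?_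
        simp only
        rw [lintegral_const_mul' _ _ ENNReal.ofReal_ne_top]
        simp_rw [gaussEvol_modulate_split (by positivity : 0 < r + 2 * l) _ hg]
        refine (mul_le_mul_right (h c) _).trans (le_of_eq ?_)
        rw [mul_add, ENNReal.ofReal_mul hK, ENNReal.ofReal_mul (husimiWeight_nonneg hr hl c)]
        ring
    _ = (∫⁻ c, ENNReal.ofReal (husimiWeight r l c) * X c) + ∫⁻ c, D * ENNReal.ofReal K *
          (ENNReal.ofReal (husimiWeight r l c * Real.exp (2 * r * c ^ 2)) *
          ∫⁻ y, ‖gaussEvol (cplxTime α 0) (modulate c g) y‖ₑ ^ 2) := lintegral_add_left (hW.mul hX) _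
    _ ≤ _ := by
        gcongr
        have hs : 0 < √(Real.pi / (2 * α)) := Real.sqrt_pos.2 (by have := Real.pi_pos; positivity)
        have hmm : Measurable fun c => ∫⁻ y, ‖gaussEvol (cplxTime α 0) (modulate c g) y‖ₑ ^ 2 := by
          have h1 := measurable_evol_modulate hg.meas α
          have h2 : Measurable fun w : ℝ × ℝ => (w.1, w.2, (0 : ℝ)) := by fun_prop
          have h3 := h1.comp h2
          exact (h3.enorm.pow_const 2).lintegral_prod_right'
        calc _ ≤ ∫⁻ c, D * ENNReal.ofReal K * (ENNReal.ofReal (6 / √(Real.pi / (2 * α))) *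
              ∫⁻ y, ‖gaussEvol (cplxTime α 0) (modulate c g) y‖ₑ ^ 2) := by
              gcongr with c
              rw [le_div_iff₀ hs]
              exact husimiWeight_mul_le hr hl hrl c
          _ = D * ENNReal.ofReal K * (ENNReal.ofReal (6 / √(Real.pi / (2 * α))) *
              (ENNReal.ofReal (√(Real.pi / (2 * α))) * ∫⁻ y, ‖g y‖ₑ ^ 2)) := by
              rw [lintegral_const_mul _ (hmm.const_mul _), lintegral_const_mul _ hmm, lintegral_phaseSpace_mass hα0 hg]
          _ = _ := by
              rw [← mul_assoc (ENNReal.ofReal _), ← ENNReal.ofReal_mul (by positivity), div_mul_cancel₀ _ hs.ne',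
                ENNReal.ofReal_mul (by norm_num)]
              ring

lemma heatAvg_heatAvg {l η : ℝ} (hl : 0 < l) (hη : 0 < η) {F : ℝ → ℝ≥0∞} (hF : Measurable F) (x : ℝ) :
    heatAvg η (heatAvg l F) x = heatAvg (l + η) F x := by
  have hk : ∀ l, Measurable fun p => ENNReal.ofReal (heatKernel l p) := fun l =>
    (continuous_heatKernel l).measurable.ennreal_ofReal
  unfold heatAvg
  calc _ = ∫⁻ p, (∫⁻ q, ENNReal.ofReal (heatKernel η p) * (ENNReal.ofReal (heatKernel l (q - p)) * F (x - q))) := by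
        refine lintegral_congr fun p => ?_
        rw [lintegral_const_mul' _ _ ENNReal.ofReal_ne_top,
          ← lintegral_sub_right_eq_self (fun q => ENNReal.ofReal (heatKernel l q) * F (x - p - q)) p]
        congr 1
        refine lintegral_congr fun q => ?_
        rw [sub_sub_sub_cancel_right]
    _ = ∫⁻ q, (∫⁻ p, ENNReal.ofReal (heatKernel η p) * (ENNReal.ofReal (heatKernel l (q - p)) * F (x - q))) := by
        apply lintegral_lintegral_swap
        have h1 : Measurable fun w : ℝ × ℝ => ENNReal.ofReal (heatKernel l (w.2 - w.1)) := (hk l).comp (by fun_prop)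
        have h2 : Measurable fun w : ℝ × ℝ => F (x - w.2) := hF.comp (by fun_prop)
        exact (((hk η).comp measurable_fst).mul (h1.mul h2)).aemeasurable
    _ = _ := by
        refine lintegral_congr fun q => ?_
        have h1 : Measurable fun p : ℝ => ENNReal.ofReal (heatKernel l (q - p)) := (hk l).comp (by fun_prop)
        simp_rw [← mul_assoc]
        have h2 : Measurable fun p : ℝ => ENNReal.ofReal (heatKernel η p) * ENNReal.ofReal (heatKernel l (q - p)) := (hk η).mul h1
        rw [lintegral_mul_const _ h2, lintegral_heatKernel_mul hl hη]

/-- Phase space components of a further heat average. -/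
lemma lintegral_husimi_heatAvg {r l η : ℝ} (hr : 0 < r) (hl : 0 < l) (hη : 0 < η)
    {ν : Measure (ℝ × ℝ)} [SFinite ν] {g : ℝ → ℂ} (hg : BddIntegrable g) :
    (∫⁻ c, ENNReal.ofReal (husimiWeight r l c) * ∫⁻ z, heatAvg η (fun x => ‖gaussEvol (cplxTime (r + 2 * l) z.2) (modulate c g) x‖ₑ ^ 2)
      (z.1 + 2 * c * z.2) ∂ν) = ∫⁻ z, heatAvg (l + η) (fun x => ‖gaussEvol (cplxTime r z.2) g x‖ₑ ^ 2) z.1 ∂ν := by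
  have hk : Measurable fun p => ENNReal.ofReal (heatKernel η p) :=
    (continuous_heatKernel η).measurable.ennreal_ofReal
  have hW := (measurable_husimiWeight r l).ennreal_ofReal
  have hm : Measurable fun w : ((ℝ × ℝ) × ℝ) × ℝ => ENNReal.ofReal (heatKernel η w.2) *
      ‖gaussEvol (cplxTime (r + 2 * l) w.1.1.2) (modulate w.1.2 g) (w.1.1.1 + 2 * w.1.2 * w.1.1.2 - w.2)‖ₑ ^ 2 := by
    have h1 := measurable_evol_modulate hg.meas (r + 2 * l)
    have h2 : Measurable fun w : ((ℝ × ℝ) × ℝ) × ℝ => (w.1.2, w.1.1.1 + 2 * w.1.2 * w.1.1.2 - w.2, w.1.1.2) := by fun_prop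
    have h3 := h1.comp h2
    exact (hk.comp measurable_snd).mul (h3.enorm.pow_const 2)
  have hm1 : Measurable fun w : (ℝ × ℝ) × ℝ => heatAvg η (fun x => ‖gaussEvol (cplxTime (r + 2 * l) w.1.2) (modulate w.2 g) x‖ₑ ^ 2)
      (w.1.1 + 2 * w.2 * w.1.2) := hm.lintegral_prod_right'
  calc _ = ∫⁻ c, (∫⁻ z, ENNReal.ofReal (husimiWeight r l c) * heatAvg η (fun x => ‖gaussEvol (cplxTime (r + 2 * l) z.2) (modulate c g) x‖ₑ ^ 2)
      (z.1 + 2 * c * z.2) ∂ν) := by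
        refine lintegral_congr fun c => ?_
        rw [lintegral_const_mul' _ _ ENNReal.ofReal_ne_top]
    _ = ∫⁻ z, (∫⁻ c, ENNReal.ofReal (husimiWeight r l c) * heatAvg η (fun x => ‖gaussEvol (cplxTime (r + 2 * l) z.2) (modulate c g) x‖ₑ ^ 2)
      (z.1 + 2 * c * z.2)) ∂ν :=
        (lintegral_lintegral_swap ((hW.comp measurable_snd).mul hm1).aemeasurable).symm
    _ = _ := by
        refine lintegral_congr fun z => ?_
        have hu : Measurable fun x => ‖gaussEvol (cplxTime r z.2) g x‖ₑ ^ 2 := (hg.evol (by exact hr)).meas.enorm.pow_const 2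
        rw [← heatAvg_heatAvg hl hη hu]
        conv_rhs => rw [heatAvg]
        simp_rw [heatAvg_evol_eq hl hr z.2 hg]
        simp_rw [heatAvg, ← lintegral_const_mul' _ _ ENNReal.ofReal_ne_top]
        rw [lintegral_lintegral_swap]
        · refine lintegral_congr fun p => lintegral_congr fun c => ?_
          rw [mul_left_comm, sub_add_eq_add_sub]
        · have h2 : Measurable fun w : ℝ × ℝ => ((z, w.1), w.2) := by fun_prop
          have h3 := hm.comp h2
          exact ((hW.comp measurable_fst).mul h3).aemeasurable

/-! ### The `L²` estimate by iteration over scales. -/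

/-- The number of scales between `r` and `1` is logarithmic in `1/r`: `1 + Jδ ≤ e^{Jδ} ≤ 4^{Jδ} ≤
r^{-δ}`. -/
lemma natCast_add_one_le {δ r : ℝ} (hδ : 0 < δ) (hr : 0 < r) {J : ℕ} (hJ : r ≤ (1 / 4) ^ J) :
    (J : ℝ) + 1 ≤ (1 + 1 / δ) * r ^ (-δ) := by
  have h1 : (4 : ℝ) ^ (J * δ) ≤ r ^ (-δ) := by
    calc (4 : ℝ) ^ (J * δ) = ((1 / 4 : ℝ) ^ J) ^ (-δ) := by
          rw [← Real.rpow_natCast, ← Real.rpow_mul (by norm_num), one_div, Real.inv_rpow (by norm_num),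
            ← Real.rpow_neg (by norm_num)]
          congr 1; ring
      _ ≤ r ^ (-δ) := Real.rpow_le_rpow_of_nonpos hr hJ (by linarith)
  have h2 : 1 + J * δ ≤ (4 : ℝ) ^ (J * δ) := by
    calc 1 + J * δ ≤ Real.exp (J * δ) := by linarith [Real.add_one_le_exp (J * δ)]
      _ = Real.exp 1 ^ (J * δ) := by rw [← Real.exp_mul, one_mul]
      _ ≤ 4 ^ (J * δ) := Real.rpow_le_rpow (Real.exp_pos _).le (by linarith [Real.exp_one_lt_d9]) (by positivity)
  calc (J : ℝ) + 1 ≤ (1 + 1 / δ) * (1 + J * δ) := by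
        have : (1 + 1 / δ) * (1 + J * δ) = 1 + J + J * δ + 1 / δ := by field_simp; ring
        rw [this]
        have : 0 < 1 / δ := by positivity
        have : 0 ≤ J * δ := by positivity
        linarith
    _ ≤ _ := by gcongr; exact h2.trans h1

lemma lintegral_gaussEvol_sq_le {A : ℂ} (hA : 0 < A.re) {g : ℝ → ℂ} (hg : BddIntegrable g) :
    ∫⁻ y, ‖gaussEvol A g y‖ₑ ^ 2 ≤ ∫⁻ y, ‖g y‖ₑ ^ 2 := by
  have hpi : ENNReal.ofReal (2 * Real.pi) ≠ 0 := by
    rw [Ne, ENNReal.ofReal_eq_zero, not_le]; positivity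
  have hb := hg.evol hA
  rw [← ENNReal.mul_le_mul_iff_right hpi ENNReal.ofReal_ne_top, ← lintegral_angularFT_sq hb.int hb.memLp_two,
    ← lintegral_angularFT_sq hg.int hg.memLp_two]
  gcongr with ξ
  rw [angularFT_gaussEvol hA hg.int, enorm_mul]
  refine mul_le_of_le_one_left' ?_
  rw [← ofReal_norm, Complex.norm_exp, ENNReal.ofReal_le_one, Real.exp_le_one_iff]
  have : (-A * (ξ : ℂ) ^ 2).re = -(A.re * ξ ^ 2) := by simp [sq]
  rw [this]
  have := hA.le
  exact neg_nonpos.2 (by positivity)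

/-- The `L²` estimate for the regularised evolution with respect to a Frostman measure. -/
theorem lintegral_evol_sq {β : ℝ} (hβ : β ∈ Icc (0 : ℝ) 3) {δ : ℝ} (hδ : 0 < δ) : ∃ C : ℝ, 0 < C ∧
    ∀ ν D, ParabolicFrostman β D ν → ∀ r : ℝ, 0 < r → r ≤ 1 → ∀ g, BddIntegrable g →
      ∫⁻ z, ‖gaussEvol (cplxTime r z.2) g z.1‖ₑ ^ 2 ∂ν ≤
        D * ENNReal.ofReal (C * r ^ (-(tubeExp β / 2) - δ)) * ∫⁻ y, ‖g y‖ₑ ^ 2 := by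
  obtain ⟨C₁, hC₁, hstep⟩ := lintegral_evol_sq_shear hβ (half_pos hδ)
  obtain ⟨C₂, hC₂, hunit⟩ := lintegral_evol_sq_shear_unit hβ
  refine ⟨(6 * C₁ + 6 * C₂) * (1 + 1 / (δ / 2)) + C₁, by positivity, fun ν D hν r hr hr1 g hg => ?_⟩
  have := hν.finite
  set E := r ^ (-(tubeExp β / 2) - δ / 2) with hE
  have hE0 : 0 < E := by positivity
  set G := ∫⁻ y, ‖g y‖ₑ ^ 2 with hG
  set V : ℝ → ℝ≥0∞ := fun l => ∫⁻ z, heatAvg l (fun x => ‖gaussEvol (cplxTime r z.2) g x‖ₑ ^ 2) z.1 ∂ν with hV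
  -- At scale `1` the components have complex time with real part `(r+2)/2`, whose halved smoothing
  -- `α` lies in `[1, 2]`; the unit-scale estimate applies with no further average.
  have hone : V 1 ≤ D * ENNReal.ofReal (6 * (C₂ * E)) * G := by
    have h := lintegral_heatAvg_le_of_components (ν := ν) hr one_pos (by linarith) hg (X := fun _ => 0) measurable_const D
      (K := C₂ * r ^ (-(tubeExp β / 2))) (by positivity) (fun c => by
        rw [zero_add]
        exact hunit ν D hν r _ c hr hr1 (by linarith) (by linarith) _ ((hg.modulate c).evol (by simp; linarith)))
    simp only [mul_zero, lintegral_zero, zero_add] at h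
    refine h.trans ?_
    gcongr
    exact Real.rpow_le_rpow_of_exponent_ge hr hr1 (by linarith)
  -- The components have `α = (r+2l)/2 ≥ l`, so `η = 3l` is admissible. Averaging every component at
  -- scale `3l` amounts to averaging `|u|²` at scale `l + 3l = 4l`.
  have hquarter : ∀ l : ℝ, 0 < l → l ≤ 1 / 4 → r ≤ 4 * l → V l ≤ V (4 * l) + D * ENNReal.ofReal (6 * (C₁ * E)) * G := by
    intro l hl hl1 hrl
    have hmX : Measurable fun c : ℝ => ∫⁻ z, heatAvg (3 * l) (fun x => ‖gaussEvol (cplxTime (r + 2 * l) z.2) (modulate c g) x‖ₑ ^ 2)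
        (z.1 + 2 * c * z.2) ∂ν := by
      have hk : Measurable fun p => ENNReal.ofReal (heatKernel (3 * l) p) :=
        (continuous_heatKernel _).measurable.ennreal_ofReal
      have hm : Measurable fun w : (ℝ × ℝ × ℝ) × ℝ => ENNReal.ofReal (heatKernel (3 * l) w.2) *
          ‖gaussEvol (cplxTime (r + 2 * l) w.1.2.2) (modulate w.1.1 g) (w.1.2.1 + 2 * w.1.1 * w.1.2.2 - w.2)‖ₑ ^ 2 := by
        have h1 := measurable_evol_modulate hg.meas (r + 2 * l)
        have h2 : Measurable fun w : (ℝ × ℝ × ℝ) × ℝ => (w.1.1, w.1.2.1 + 2 * w.1.1 * w.1.2.2 - w.2, w.1.2.2) := by fun_prop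
        have h3 := h1.comp h2
        exact (hk.comp measurable_snd).mul (h3.enorm.pow_const 2)
      have hm1 : Measurable fun w : ℝ × ℝ × ℝ => heatAvg (3 * l) (fun x => ‖gaussEvol (cplxTime (r + 2 * l) w.2.2) (modulate w.1 g) x‖ₑ ^ 2)
          (w.2.1 + 2 * w.1 * w.2.2) := hm.lintegral_prod_right'
      exact hm1.lintegral_prod_right'
    have h := lintegral_heatAvg_le_of_components (ν := ν) hr hl hrl hg hmX D (K := C₁ * E) (by positivity) (fun c => by
      simp_rw [gaussEvol_modulate_split (by positivity : 0 < r + 2 * l) _ hg]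
      exact hstep ν D hν r _ (3 * l) c hr hr1 (by linarith) (by linarith) (by positivity) (by linarith) _
        ((hg.modulate c).evol (by simp; linarith)))
    rw [lintegral_husimi_heatAvg hr hl (by positivity) hg, show l + 3 * l = 4 * l by ring] at h
    exact h
  have hsum : ∀ j : ℕ, r ≤ 4 * (1 / 4) ^ j → V ((1 / 4) ^ j) ≤ D * ENNReal.ofReal (6 * (C₂ * E)) * G + j * (D * ENNReal.ofReal (6 * (C₁ * E)) * G) := by
    intro j
    induction j with
    | zero => intro _; simpa using hone
    | succ j ih =>
      intro hj
      have h4 : 4 * (1 / 4 : ℝ) ^ (j + 1) = (1 / 4) ^ j := by rw [pow_succ]; ring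
      have h1 := hquarter ((1 / 4) ^ (j + 1)) (by positivity)
        (by rw [pow_succ]; exact mul_le_of_le_one_left (by norm_num) (pow_le_one₀ (by norm_num) (by norm_num))) hj
      rw [h4] at h1 hj
      have h2 := ih (hj.trans (le_mul_of_one_le_left (by positivity) (by norm_num)))
      refine h1.trans ((add_le_add h2 le_rfl).trans (le_of_eq ?_))
      push_cast; ring
  obtain ⟨J, hJ1, hJ2⟩ := exists_nat_pow_near_of_lt_one hr hr1 (by norm_num : (0 : ℝ) < 1 / 4) (by norm_num)
  -- The iteration starts from `|u|²` itself: velocity `c = 0`, `α = r/2`, compared with its heat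
  -- average at the first scale `4^{-(J+1)}`, which is less than `r`.
  have hlast := hstep ν D hν r (r / 2) ((1 / 4) ^ (J + 1)) 0 hr hr1 le_rfl (by linarith) (by positivity) (by linarith)
    (gaussEvol (cplxTime (r / 2) 0) g) (hg.evol (by simp; linarith))
  have hsplit : ∀ t x, gaussEvol (cplxTime (r / 2) t) (gaussEvol (cplxTime (r / 2) 0) g) x = gaussEvol (cplxTime r t) g x := by
    intro t x
    rw [← gaussEvol_add (by simp; linarith) (by simp; linarith) hg.int]
    congr 1
    apply Complex.ext <;> simp
  simp only [hsplit, mul_zero, zero_mul, add_zero, ne_eq, OfNat.ofNat_ne_zero, not_false_eq_true, zero_pow, Real.exp_zero, mul_one] at hlast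
  have hcontr : ∫⁻ y, ‖gaussEvol (cplxTime (r / 2) 0) g y‖ₑ ^ 2 ≤ G := by
    exact lintegral_gaussEvol_sq_le (by simp; linarith) hg
  refine hlast.trans ?_
  have h1 := hsum (J + 1) (by rw [pow_succ]; linarith)
  have hJ := natCast_add_one_le (half_pos hδ) hr hJ2
  have hR1 : 1 ≤ r ^ (-(δ / 2)) := Real.one_le_rpow_of_pos_of_le_one_of_nonpos hr hr1 (by linarith)
  calc _ ≤ (D * ENNReal.ofReal (6 * (C₂ * E)) * G + ((J + 1 : ℕ) : ℝ≥0∞) * (D * ENNReal.ofReal (6 * (C₁ * E)) * G)) +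
        D * ENNReal.ofReal (C₁ * E) * G := by gcongr
    _ = D * ENNReal.ofReal (6 * (C₂ * E) + (J + 1) * (6 * (C₁ * E)) + C₁ * E) * G := by
        rw [ENNReal.ofReal_add (by positivity) (by positivity), ENNReal.ofReal_add (by positivity) (by positivity),
          ENNReal.ofReal_mul (p := (J : ℝ) + 1) (by positivity), show ((J : ℝ) + 1) = ((J + 1 : ℕ) : ℝ) by push_cast; ring,
          ENNReal.ofReal_natCast]
        ring
    _ ≤ _ := by
        gcongr
        have e : r ^ (-(tubeExp β / 2) - δ) = E * r ^ (-(δ / 2)) := by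
          rw [hE, ← Real.rpow_add hr]; congr 1; ring
        rw [e]
        set R := r ^ (-(δ / 2))
        set q := 1 + 1 / (δ / 2) with hq
        have hq1 : 1 ≤ q := by rw [hq]; have : 0 < 1 / (δ / 2) := by positivity
                               linarith
        have hqR : 1 ≤ q * R := one_le_mul_of_one_le_of_one_le hq1 hR1
        calc _ ≤ 6 * (C₂ * E) * (q * R) + (q * R) * (6 * (C₁ * E)) + C₁ * E * R := by
              gcongr ?_ + ?_ + ?_
              · exact le_mul_of_one_le_right (by positivity) hqR
              · gcongr
              · exact le_mul_of_one_le_right (by positivity) hR1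
          _ = _ := by ring

/-! ### Interpolation between `L²` and `L⁴`. -/

lemma setLIntegral_Ioo_rpow {q u : ℝ} (hq : 0 < q) (hu : 0 ≤ u) :
    ∫⁻ s in Ioo 0 u, ENNReal.ofReal (s ^ (q - 1)) = ENNReal.ofReal (u ^ q / q) := by
  have hi : IntegrableOn (fun s : ℝ => s ^ (q - 1)) (Ioo 0 u) :=
    ((intervalIntegral.intervalIntegrable_rpow' (by linarith : -1 < q - 1) (a := 0) (b := u)).1).mono_set Ioo_subset_Ioc_self
  rw [← ofReal_integral_eq_lintegral_ofReal hi
    ((ae_restrict_iff' measurableSet_Ioo).2 (.of_forall fun s hs => Real.rpow_nonneg hs.1.le _)),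
    ← integral_Ioc_eq_integral_Ioo, ← intervalIntegral.integral_of_le hu, integral_rpow (Or.inl (by linarith))]
  rw [sub_add_cancel, Real.zero_rpow hq.ne', sub_zero]

lemma setLIntegral_Ici_rpow {q u : ℝ} (hq : 0 < q) (hu : 0 < u) :
    ∫⁻ s in Ici u, ENNReal.ofReal (s ^ (-q - 1)) = ENNReal.ofReal (u ^ (-q) / q) := by
  rw [setLIntegral_congr Ioi_ae_eq_Ici.symm,
    ← ofReal_integral_eq_lintegral_ofReal (integrableOn_Ioi_rpow_of_lt (by linarith) hu)
    ((ae_restrict_iff' measurableSet_Ioi).2 (.of_forall fun s hs => Real.rpow_nonneg (hu.trans hs).le _)),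
    integral_Ioi_rpow_of_lt (by linarith) hu]
  rw [sub_add_cancel, neg_div_neg_eq]

/-- For fixed `y` the integrand lives on `s < |g y|/k`, and `p > 2` makes the power integrable at
zero. -/
lemma lintegral_high_part {p k : ℝ} (hp : 2 < p) (hk : 0 < k) (g : ℝ → ℂ) (y : ℝ) :
    ∫⁻ s in Ioi (0 : ℝ), ENNReal.ofReal (s ^ (p - 3)) * ‖{y | k * s < ‖g y‖}.indicator g y‖ₑ ^ 2 =
      ENNReal.ofReal (k ^ (2 - p) / (p - 2)) * ‖g y‖ₑ ^ p := by
  set v := ‖g y‖ with hv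
  have hv0 : 0 ≤ v := norm_nonneg _
  have e : ∀ s ∈ Ioi (0 : ℝ), ENNReal.ofReal (s ^ (p - 3)) * ‖{y | k * s < ‖g y‖}.indicator g y‖ₑ ^ 2 =
      (Ioo 0 (v / k)).indicator (fun s => ENNReal.ofReal (s ^ (p - 2 - 1)) * ENNReal.ofReal (v ^ 2)) s := by
    intro s hs
    by_cases h : k * s < v
    · rw [indicator_of_mem (show y ∈ {y | k * s < ‖g y‖} from h), indicator_of_mem (show s ∈ Ioo 0 (v / k) from ⟨hs, by rwa [lt_div_iff₀' hk]⟩),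
        ← ofReal_norm, ENNReal.ofReal_pow hv0]
      congr 3; ring
    · rw [indicator_of_notMem (show y ∉ {y | k * s < ‖g y‖} from h), indicator_of_notMem (fun h' => h ((lt_div_iff₀' hk).1 h'.2))]
      simp
  rw [setLIntegral_congr_fun measurableSet_Ioi e, lintegral_indicator measurableSet_Ioo, Measure.restrict_restrict measurableSet_Ioo,
    inter_eq_left.2 (fun s hs => hs.1), lintegral_mul_const' _ _ ENNReal.ofReal_ne_top,
    setLIntegral_Ioo_rpow (by linarith) (by positivity), ← ofReal_norm, ENNReal.ofReal_rpow_of_nonneg hv0 (by linarith),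
    ← ENNReal.ofReal_mul (by have : 0 < p - 2 := by linarith
                             positivity), ← ENNReal.ofReal_mul (by have : 0 < p - 2 := by linarith
                                                                   positivity)]
  congr 1
  rw [Real.div_rpow hv0 hk.le, show 2 - p = -(p - 2) by ring, Real.rpow_neg hk.le]
  rcases hv0.eq_or_lt with h0 | h0
  · rw [← h0, Real.zero_rpow (by linarith), Real.zero_rpow (by linarith)]; simp
  · have : v ^ p = v ^ (p - 2) * v ^ 2 := by
      rw [← Real.rpow_natCast, ← Real.rpow_add h0]; norm_num
    rw [this]; ring

/-- For fixed `y` the integrand lives on `s ≥ |g y|/k`, and `p < 4` makes the power integrable at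
infinity. -/
lemma lintegral_low_part {p k : ℝ} (hp0 : 0 < p) (hp : p < 4) (hk : 0 < k) (g : ℝ → ℂ) (y : ℝ) :
    ∫⁻ s in Ioi (0 : ℝ), ENNReal.ofReal (s ^ (p - 5)) * ‖{y | k * s < ‖g y‖}ᶜ.indicator g y‖ₑ ^ (4 : ℝ) =
      ENNReal.ofReal (k ^ (4 - p) / (4 - p)) * ‖g y‖ₑ ^ p := by
  set v := ‖g y‖ with hv
  have hv0 : 0 ≤ v := norm_nonneg _
  rcases hv0.eq_or_lt with h0 | h0
  · have hg0 : g y = 0 := norm_eq_zero.1 h0.symm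
    have : ∀ s : ℝ, {y | k * s < ‖g y‖}ᶜ.indicator g y = 0 := fun s => by
      by_cases h : y ∈ {y | k * s < ‖g y‖}ᶜ <;> simp [indicator, hg0]
    simp [this, hg0, hp0]
  have e : ∀ s ∈ Ioi (0 : ℝ), ENNReal.ofReal (s ^ (p - 5)) * ‖{y | k * s < ‖g y‖}ᶜ.indicator g y‖ₑ ^ (4 : ℝ) =
      (Ici (v / k)).indicator (fun s => ENNReal.ofReal (s ^ (-(4 - p) - 1)) * ENNReal.ofReal (v ^ (4 : ℝ))) s := by
    intro s hs
    by_cases h : k * s < v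
    · rw [indicator_of_notMem (show y ∉ {y | k * s < ‖g y‖}ᶜ from fun h' => h' h), indicator_of_notMem (show s ∉ Ici (v / k) from fun h' => by
        have := (div_le_iff₀' hk).1 (mem_Ici.1 h'); linarith)]
      simp
    · rw [indicator_of_mem (show y ∈ {y | k * s < ‖g y‖}ᶜ from h), indicator_of_mem (show s ∈ Ici (v / k) by
        rw [mem_Ici, div_le_iff₀' hk]; exact not_lt.1 h), ← ofReal_norm, ENNReal.ofReal_rpow_of_nonneg hv0 (by norm_num)]
      congr 3; ring
  rw [setLIntegral_congr_fun measurableSet_Ioi e, lintegral_indicator measurableSet_Ici, Measure.restrict_restrict measurableSet_Ici,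
    inter_eq_left.2 (show Ici (v / k) ⊆ Ioi 0 from fun s hs => (div_pos h0 hk).trans_le (mem_Ici.1 hs)), lintegral_mul_const' _ _ ENNReal.ofReal_ne_top,
    setLIntegral_Ici_rpow (by linarith) (by positivity), ← ofReal_norm, ENNReal.ofReal_rpow_of_nonneg hv0 hp0.le,
    ← ENNReal.ofReal_mul (by have : 0 < 4 - p := by linarith
                             positivity), ← ENNReal.ofReal_mul (by have : 0 < 4 - p := by linarith
                                                                   positivity)]
  congr 1
  have : v ^ p = v ^ (-(4 - p)) * v ^ (4 : ℝ) := by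
    rw [← Real.rpow_add h0]; congr 1; ring
  rw [this, Real.div_rpow hv0 hk.le, Real.rpow_neg hk.le]
  field_simp

/-- Where the evolution exceeds `s`, one of the pieces coming from `S` and its complement reaches
`s/2`. Chebyshev's inequality is applied to the first in `L²` and to the second in `L⁴`. -/
lemma meas_evol_lt_le {A : ℝ} (hA : 0 < A) {ν : Measure (ℝ × ℝ)} {D : ℝ≥0∞} {a b : ℝ}
    (h2 : ∀ g, BddIntegrable g → ∫⁻ z, ‖gaussEvol (cplxTime A z.2) g z.1‖ₑ ^ 2 ∂ν ≤ D * ENNReal.ofReal a * ∫⁻ y, ‖g y‖ₑ ^ 2)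
    (h4 : ∀ g, BddIntegrable g → ∫⁻ z, ‖gaussEvol (cplxTime A z.2) g z.1‖ₑ ^ (4 : ℝ) ∂ν ≤
      D * ENNReal.ofReal b * ∫⁻ y, ‖g y‖ₑ ^ (4 : ℝ)) {g : ℝ → ℂ} (hg : BddIntegrable g) {S : Set ℝ} (hS : MeasurableSet S)
    {s : ℝ} (hs : 0 < s) :
    ν {z | s < ‖gaussEvol (cplxTime A z.2) g z.1‖} ≤
      ENNReal.ofReal (4 * s ^ (-2 : ℝ)) * (D * ENNReal.ofReal a * ∫⁻ y, ‖S.indicator g y‖ₑ ^ 2) +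
      ENNReal.ofReal (16 * s ^ (-4 : ℝ)) * (D * ENNReal.ofReal b * ∫⁻ y, ‖Sᶜ.indicator g y‖ₑ ^ (4 : ℝ)) := by
  have hg1 := hg.indicator hS
  have hg2 := hg.indicator hS.compl
  have hm1 : Measurable fun z : ℝ × ℝ => ‖gaussEvol (cplxTime A z.2) (S.indicator g) z.1‖ₑ ^ 2 :=
    (measurable_evol_space_time hg1.meas A).enorm.pow_const 2
  have hm2 : Measurable fun z : ℝ × ℝ => ‖gaussEvol (cplxTime A z.2) (Sᶜ.indicator g) z.1‖ₑ ^ (4 : ℝ) :=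
    (measurable_evol_space_time hg2.meas A).enorm.pow_const _
  calc _ ≤ ∫⁻ z, (ENNReal.ofReal (4 * s ^ (-2 : ℝ)) * ‖gaussEvol (cplxTime A z.2) (S.indicator g) z.1‖ₑ ^ 2 +
        ENNReal.ofReal (16 * s ^ (-4 : ℝ)) * ‖gaussEvol (cplxTime A z.2) (Sᶜ.indicator g) z.1‖ₑ ^ (4 : ℝ)) ∂ν := by
        refine meas_le_lintegral₀ ((hm1.const_mul _).add (hm2.const_mul _)).aemeasurable fun z hz => ?_
        simp only [Pi.add_apply]
        have hz' : s < ‖gaussEvol (cplxTime A z.2) g z.1‖ := hz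
        have hsum := gaussEvol_add_fun (A := cplxTime A z.2) hA hg1.int hg2.int z.1
        have hsplit : (fun y => S.indicator g y + Sᶜ.indicator g y) = g := by
          ext y; exact congrFun (indicator_self_add_compl S g) y
        rw [hsplit] at hsum
        rw [hsum] at hz'
        have h3 := hz'.trans_le (norm_add_le _ _)
        set u := ‖gaussEvol (cplxTime A z.2) (S.indicator g) z.1‖ with hu
        set w := ‖gaussEvol (cplxTime A z.2) (Sᶜ.indicator g) z.1‖ with hw
        by_cases h : s / 2 ≤ u
        · refine le_trans ?_ le_self_add
          rw [← ofReal_norm, ← ENNReal.ofReal_pow (norm_nonneg _), ← ENNReal.ofReal_mul (by positivity), ENNReal.one_le_ofReal]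
          calc (1 : ℝ) = 4 * s ^ (-2 : ℝ) * (s / 2) ^ 2 := by
                rw [Real.rpow_neg hs.le, Real.rpow_two]; field_simp; norm_num
            _ ≤ _ := by gcongr
        · have h' : s / 2 ≤ w := by linarith [not_le.1 h]
          refine le_trans ?_ le_add_self
          rw [← ofReal_norm, ENNReal.ofReal_rpow_of_nonneg (norm_nonneg _) (by norm_num), ← ENNReal.ofReal_mul (by positivity),
            ENNReal.one_le_ofReal]
          calc (1 : ℝ) = 16 * s ^ (-4 : ℝ) * (s / 2) ^ (4 : ℝ) := by
                rw [Real.rpow_neg hs.le, show (4 : ℝ) = ((4 : ℕ) : ℝ) by norm_num, Real.rpow_natCast, Real.rpow_natCast]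
                field_simp; norm_num
            _ ≤ _ := by gcongr
    _ = _ := by rw [lintegral_add_left (hm1.const_mul _), lintegral_const_mul _ hm1, lintegral_const_mul _ hm2]
    _ ≤ _ := by
        gcongr
        · exact h2 _ hg1
        · exact h4 _ hg2

/-- Marcinkiewicz interpolation between the exponents `2` and `4`. -/
theorem lintegral_evol_interpolate {p : ℝ} (hp2 : 2 < p) (hp4 : p < 4) {A : ℝ} (hA : 0 < A) {ν : Measure (ℝ × ℝ)} [SFinite ν] {D : ℝ≥0∞} {a b : ℝ}
    (ha : 0 < a) (hb : 0 < b)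
    (h2 : ∀ g, BddIntegrable g → ∫⁻ z, ‖gaussEvol (cplxTime A z.2) g z.1‖ₑ ^ 2 ∂ν ≤ D * ENNReal.ofReal a * ∫⁻ y, ‖g y‖ₑ ^ 2)
    (h4 : ∀ g, BddIntegrable g → ∫⁻ z, ‖gaussEvol (cplxTime A z.2) g z.1‖ₑ ^ (4 : ℝ) ∂ν ≤
      D * ENNReal.ofReal b * ∫⁻ y, ‖g y‖ₑ ^ (4 : ℝ)) {g : ℝ → ℂ} (hg : BddIntegrable g) :
    ∫⁻ z, ‖gaussEvol (cplxTime A z.2) g z.1‖ₑ ^ p ∂ν ≤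
      D * ENNReal.ofReal (p * (4 / (p - 2) + 16 / (4 - p)) * (a ^ ((4 - p) / 2) * b ^ ((p - 2) / 2))) * ∫⁻ y, ‖g y‖ₑ ^ p := by
  have hp0 : 0 < p := by linarith
  have hp2' : 0 < p - 2 := by linarith
  have hp4' : 0 < 4 - p := by linarith
  -- Truncating `g` at height `ks` with `k² = a/b` balances the two contributions: both carry
  -- `a^{(4-p)/2} b^{(p-2)/2}`.
  set k := (a / b) ^ (1 / 2 : ℝ) with hk
  have hk0 : 0 < k := by positivity
  have hm := measurable_evol_space_time hg.meas A
  have hS : ∀ s : ℝ, MeasurableSet {y | k * s < ‖g y‖} := fun s => measurableSet_lt measurable_const hg.meas.norm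
  have hSS : MeasurableSet {w : ℝ × ℝ | k * w.1 < ‖g w.2‖} :=
    measurableSet_lt (by fun_prop) (hg.meas.comp measurable_snd).norm
  have hgm : Measurable fun w : ℝ × ℝ => g w.2 := hg.meas.comp measurable_snd
  have hind1 : Measurable fun w : ℝ × ℝ => {y | k * w.1 < ‖g y‖}.indicator g w.2 := hgm.indicator hSS
  have hind2 : Measurable fun w : ℝ × ℝ => {y | k * w.1 < ‖g y‖}ᶜ.indicator g w.2 := hgm.indicator hSS.compl
  have hf1 : Measurable fun w : ℝ × ℝ => ENNReal.ofReal (w.1 ^ (p - 3)) * ‖{y | k * w.1 < ‖g y‖}.indicator g w.2‖ₑ ^ 2 :=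
    (by fun_prop : Measurable fun w : ℝ × ℝ => ENNReal.ofReal (w.1 ^ (p - 3))).mul (hind1.enorm.pow_const 2)
  have hf2 : Measurable fun w : ℝ × ℝ => ENNReal.ofReal (w.1 ^ (p - 5)) * ‖{y | k * w.1 < ‖g y‖}ᶜ.indicator g w.2‖ₑ ^ (4 : ℝ) :=
    (by fun_prop : Measurable fun w : ℝ × ℝ => ENNReal.ofReal (w.1 ^ (p - 5))).mul (hind2.enorm.pow_const _)
  have hF1 : Measurable fun s : ℝ => ∫⁻ y, ENNReal.ofReal (s ^ (p - 3)) * ‖{y | k * s < ‖g y‖}.indicator g y‖ₑ ^ 2 :=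
    hf1.lintegral_prod_right'
  have hF2 : Measurable fun s : ℝ => ∫⁻ y, ENNReal.ofReal (s ^ (p - 5)) * ‖{y | k * s < ‖g y‖}ᶜ.indicator g y‖ₑ ^ (4 : ℝ) :=
    hf2.lintegral_prod_right'
  set G := ∫⁻ y, ‖g y‖ₑ ^ p with hG
  calc _ = ∫⁻ z, ENNReal.ofReal (‖gaussEvol (cplxTime A z.2) g z.1‖ ^ p) ∂ν := by
        refine lintegral_congr fun z => ?_
        rw [← ofReal_norm, ENNReal.ofReal_rpow_of_nonneg (norm_nonneg _) hp0.le]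
    _ = ENNReal.ofReal p * ∫⁻ s in Ioi (0 : ℝ), ν {z | s < ‖gaussEvol (cplxTime A z.2) g z.1‖} * ENNReal.ofReal (s ^ (p - 1)) :=
        lintegral_rpow_eq_lintegral_meas_lt_mul ν (.of_forall fun z => norm_nonneg _) hm.norm.aemeasurable hp0
    _ ≤ ENNReal.ofReal p * ∫⁻ s in Ioi (0 : ℝ), (ENNReal.ofReal 4 * (D * ENNReal.ofReal a) *
          (∫⁻ y, ENNReal.ofReal (s ^ (p - 3)) * ‖{y | k * s < ‖g y‖}.indicator g y‖ₑ ^ 2) +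
          ENNReal.ofReal 16 * (D * ENNReal.ofReal b) *
          ∫⁻ y, ENNReal.ofReal (s ^ (p - 5)) * ‖{y | k * s < ‖g y‖}ᶜ.indicator g y‖ₑ ^ (4 : ℝ)) := by
        gcongr ENNReal.ofReal p * ?_
        refine setLIntegral_mono' measurableSet_Ioi fun s hs => ?_
        have hs0 : 0 < s := hs
        refine (mul_le_mul_left (meas_evol_lt_le hA h2 h4 hg (hS s) hs0) _).trans (le_of_eq ?_)
        rw [lintegral_const_mul' _ _ ENNReal.ofReal_ne_top, lintegral_const_mul' _ _ ENNReal.ofReal_ne_top,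
          show s ^ (p - 3) = s ^ (-2 : ℝ) * s ^ (p - 1) by rw [← Real.rpow_add hs0]; congr 1; ring,
          show s ^ (p - 5) = s ^ (-4 : ℝ) * s ^ (p - 1) by rw [← Real.rpow_add hs0]; congr 1; ring,
          ENNReal.ofReal_mul (by norm_num), ENNReal.ofReal_mul (by norm_num), ENNReal.ofReal_mul (by positivity), ENNReal.ofReal_mul (by positivity)]
        ring
    _ = ENNReal.ofReal p * (ENNReal.ofReal 4 * (D * ENNReal.ofReal a) * (ENNReal.ofReal (k ^ (2 - p) / (p - 2)) * G) +
          ENNReal.ofReal 16 * (D * ENNReal.ofReal b) * (ENNReal.ofReal (k ^ (4 - p) / (4 - p)) * G)) := by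
        rw [lintegral_add_left (hF1.const_mul _), lintegral_const_mul _ hF1, lintegral_const_mul _ hF2,
          lintegral_lintegral_swap (f := fun s y => ENNReal.ofReal (s ^ (p - 3)) * ‖{y | k * s < ‖g y‖}.indicator g y‖ₑ ^ 2) hf1.aemeasurable,
          lintegral_lintegral_swap (f := fun s y => ENNReal.ofReal (s ^ (p - 5)) * ‖{y | k * s < ‖g y‖}ᶜ.indicator g y‖ₑ ^ (4 : ℝ)) hf2.aemeasurable]
        simp_rw [lintegral_high_part hp2 hk0, lintegral_low_part hp0 hp4 hk0]
        rw [lintegral_const_mul' _ _ ENNReal.ofReal_ne_top, lintegral_const_mul' _ _ ENNReal.ofReal_ne_top]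
    _ = _ := by
        have e1 : a * k ^ (2 - p) = a ^ ((4 - p) / 2) * b ^ ((p - 2) / 2) := by
          rw [hk, ← Real.rpow_mul (by positivity), Real.div_rpow ha.le hb.le, show 1 / 2 * (2 - p) = (4 - p) / 2 - 1 by ring,
            Real.rpow_sub_one ha.ne', show (4 - p) / 2 - 1 = -((p - 2) / 2) by ring, Real.rpow_neg hb.le]
          field_simp
        have e2 : b * k ^ (4 - p) = a ^ ((4 - p) / 2) * b ^ ((p - 2) / 2) := by
          rw [hk, ← Real.rpow_mul (by positivity), Real.div_rpow ha.le hb.le, show 1 / 2 * (4 - p) = (4 - p) / 2 by ring,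
            show (p - 2) / 2 = 1 - (4 - p) / 2 by ring, Real.rpow_sub hb, Real.rpow_one]
          field_simp
        have e3 : p * (4 / (p - 2) + 16 / (4 - p)) * (a ^ ((4 - p) / 2) * b ^ ((p - 2) / 2)) =
            p * (4 * (a * (k ^ (2 - p) / (p - 2))) + 16 * (b * (k ^ (4 - p) / (4 - p)))) := by
          rw [show a * (k ^ (2 - p) / (p - 2)) = a * k ^ (2 - p) / (p - 2) by ring,
            show b * (k ^ (4 - p) / (4 - p)) = b * k ^ (4 - p) / (4 - p) by ring, e1, e2]; ring
        rw [e3, ENNReal.ofReal_mul hp0.le, ENNReal.ofReal_add (by positivity) (by positivity), ENNReal.ofReal_mul (p := 4) (by norm_num),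
          ENNReal.ofReal_mul (p := 16) (by norm_num), ENNReal.ofReal_mul ha.le, ENNReal.ofReal_mul hb.le]
        ring

/-- The exponent of the regularised `L^p` estimate. -/
noncomputable def evolExp (β p : ℝ) : ℝ := tubeExp β / 2 * ((4 - p) / 2) + (3 - β) / 2 * ((p - 2) / 2)

theorem lintegral_evol_rpow {β p : ℝ} (hβ : β ∈ Icc (0 : ℝ) 3) (hp2 : 2 ≤ p) (hp4 : p ≤ 4) {δ : ℝ} (hδ : 0 < δ) : ∃ C : ℝ, 0 < C ∧
    ∀ ν D, ParabolicFrostman β D ν → ∀ r : ℝ, 0 < r → r ≤ 1 → ∀ g, BddIntegrable g →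
      ∫⁻ z, ‖gaussEvol (cplxTime r z.2) g z.1‖ₑ ^ p ∂ν ≤
        D * ENNReal.ofReal (C * r ^ (-evolExp β p - δ)) * ∫⁻ y, ‖g y‖ₑ ^ p := by
  obtain ⟨C₂, hC₂, h2⟩ := lintegral_evol_sq hβ hδ
  obtain ⟨C₄, hC₄, h4⟩ := lintegral_evol_four (β := β) hδ
  rcases hp2.eq_or_lt with rfl | hp2
  · refine ⟨C₂, hC₂, fun ν D hν r hr hr1 g hg => ?_⟩
    have h := h2 ν D hν r hr hr1 g hg
    simp only [ENNReal.rpow_two]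
    rwa [show evolExp β 2 = tubeExp β / 2 by unfold evolExp; ring]
  rcases hp4.eq_or_lt with rfl | hp4
  · refine ⟨C₄, hC₄, fun ν D hν r hr hr1 g hg => ?_⟩
    have h := h4 ν D hν r hr hr1 g hg
    rwa [show evolExp β 4 = (3 - β) / 2 by unfold evolExp; ring]
  have hp2' : 0 < p - 2 := by linarith
  have hp4' : 0 < 4 - p := by linarith
  refine ⟨p * (4 / (p - 2) + 16 / (4 - p)) * (C₂ ^ ((4 - p) / 2) * C₄ ^ ((p - 2) / 2)), by positivity, fun ν D hν r hr hr1 g hg => ?_⟩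
  have := hν.finite
  refine (lintegral_evol_interpolate hp2 hp4 hr (by positivity) (by positivity) (fun g hg => h2 ν D hν r hr hr1 g hg)
    (fun g hg => h4 ν D hν r hr hr1 g hg) hg).trans (le_of_eq ?_)
  congr 3
  rw [Real.mul_rpow hC₂.le (by positivity), Real.mul_rpow hC₄.le (by positivity), ← Real.rpow_mul hr.le, ← Real.rpow_mul hr.le]
  have : r ^ (-evolExp β p - δ) = r ^ ((-(tubeExp β / 2) - δ) * ((4 - p) / 2)) * r ^ ((-((3 - β) / 2) - δ) * ((p - 2) / 2)) := by
    rw [← Real.rpow_add hr]; congr 1; unfold evolExp; ring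
  rw [this]; ring

/-! ### Bessel potentials and subordination to the regularised evolution. -/

/-- The symbol of `(1 - Δ)^{γ/2}` in the frequency normalisation of Mathlib. -/
noncomputable def besselSymbol (γ ξ : ℝ) : ℝ := (1 + (2 * Real.pi * ξ) ^ 2) ^ (γ / 2)

lemma besselSymbol_pos (γ ξ : ℝ) : 0 < besselSymbol γ ξ := by unfold besselSymbol; positivity

lemma hasTemperateGrowth_besselSymbol (γ : ℝ) : (fun ξ : ℝ => (besselSymbol γ ξ : ℂ)).HasTemperateGrowth := by
  have h1 : (fun ξ : ℝ => (1 + ‖ξ‖ ^ 2) ^ (γ / 2)).HasTemperateGrowth := Function.hasTemperateGrowth_one_add_norm_sq_rpow ℝ _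
  have h2 : (fun ξ : ℝ => 2 * Real.pi * ξ).HasTemperateGrowth := by fun_prop
  have h3 := h1.comp h2
  have h4 : (fun ξ : ℝ => besselSymbol γ ξ).HasTemperateGrowth := by
    convert h3 using 2 with ξ
    simp [besselSymbol]
  fun_prop

/-- The Bessel potential `(1 - Δ)^{γ/2}` on Schwartz functions. -/
noncomputable def besselPotential (γ : ℝ) (f : 𝓢(ℝ, ℂ)) : 𝓢(ℝ, ℂ) :=
  𝓕⁻ (SchwartzMap.smulLeftCLM ℂ (fun ξ : ℝ => (besselSymbol γ ξ : ℂ)) (𝓕 f))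

lemma fourier_besselPotential (γ : ℝ) (f : 𝓢(ℝ, ℂ)) (ξ : ℝ) :
    𝓕 (besselPotential γ f : ℝ → ℂ) ξ = besselSymbol γ ξ * 𝓕 (f : ℝ → ℂ) ξ := by
  rw [← SchwartzMap.fourier_coe, besselPotential, FourierTransform.fourier_fourierInv_eq,
    SchwartzMap.smulLeftCLM_apply_apply (hasTemperateGrowth_besselSymbol γ), SchwartzMap.fourier_coe, smul_eq_mul]

lemma sobolevNorm_eq (p γ : ℝ) (f : 𝓢(ℝ, ℂ)) :
    sobolevNorm p γ f = eLpNorm (besselPotential γ f) (ENNReal.ofReal p) volume := by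
  rw [sobolevNorm, besselPotential, SchwartzMap.fourierInv_coe,
    SchwartzMap.smulLeftCLM_apply (hasTemperateGrowth_besselSymbol γ), SchwartzMap.fourier_coe]
  rfl

lemma besselPotential_neg (γ : ℝ) (g : 𝓢(ℝ, ℂ)) : besselPotential γ (besselPotential (-γ) g) = g := by
  have h : besselPotential γ (besselPotential (-γ) g) = 𝓕⁻ (𝓕 g : 𝓢(ℝ, ℂ)) := by
    rw [besselPotential]
    congr 1
    ext ξ
    rw [SchwartzMap.smulLeftCLM_apply_apply (hasTemperateGrowth_besselSymbol γ),
      SchwartzMap.fourier_coe, fourier_besselPotential, SchwartzMap.fourier_coe, smul_eq_mul, ← mul_assoc, ← ofReal_mul]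
    have : besselSymbol γ ξ * besselSymbol (-γ) ξ = 1 := by
      unfold besselSymbol
      rw [← Real.rpow_add (by positivity), neg_div, add_neg_cancel, Real.rpow_zero]
    rw [this, ofReal_one, one_mul]
  rw [h, FourierTransform.fourierInv_fourier_eq]

lemma SchwartzMap.bddIntegrable (g : 𝓢(ℝ, ℂ)) : BddIntegrable g := by
  obtain ⟨C, hC⟩ := g.decay 0 0
  refine ⟨g.continuous.measurable, g.integrable, C, hC.1.le, fun y => ?_⟩
  simpa using hC.2 y

lemma gaussEvol_eq_integral_fourier {A : ℂ} (hA : 0 < A.re) {g : ℝ → ℂ} (hg : Integrable g) (x : ℝ) :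
    gaussEvol A g x = ∫ ξ : ℝ, 𝓕 g ξ * (cexp (I * (2 * Real.pi * ξ * x : ℝ)) * cexp (-A * ((2 * Real.pi * ξ : ℝ) : ℂ) ^ 2)) := by
  have h2 : ((2 * Real.pi : ℝ) : ℂ) ≠ 0 := by exact_mod_cast (by positivity : (2 * Real.pi) ≠ 0)
  apply mul_left_cancel₀ h2
  rw [gaussEvol_eq_fourier hA hg]
  have h := Measure.integral_comp_mul_left (fun ξ : ℝ => angularFT g ξ * (cexp (I * (ξ * x : ℝ)) * cexp (-A * (ξ : ℂ) ^ 2))) (2 * Real.pi)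
  have e : ∀ ξ : ℝ, angularFT g (2 * Real.pi * ξ) = 𝓕 g ξ := fun ξ => by
    rw [angularFT_eq_fourier, mul_div_cancel_left₀ _ (by positivity)]
  simp_rw [e] at h
  rw [h, abs_of_pos (by positivity), Complex.real_smul, ofReal_inv, mul_inv_cancel_left₀ h2]

lemma schrodinger_eq_integral (f : 𝓢(ℝ, ℂ)) (z : ℝ × ℝ) :
    schrodinger f z = ∫ ξ : ℝ, cexp (I * (2 * Real.pi * ξ * z.1 : ℝ)) * cexp (I * (z.2 * (2 * Real.pi * ξ) ^ 2 : ℝ)) * 𝓕 (f : ℝ → ℂ) ξ := by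
  rw [schrodinger, fourierMult, Real.fourierInv_eq']
  congr 1; ext ξ
  rw [smul_eq_mul, ← mul_assoc]
  congr 3
  simp; ring

/-- The Gamma function representation of the evolution of a Bessel potential. -/
lemma schrodinger_eq_subordination {γ : ℝ} (hγ : 0 < γ) (f : 𝓢(ℝ, ℂ)) (z : ℝ × ℝ) :
    (Real.Gamma (γ / 2) : ℂ) * schrodinger f z =
      ∫ r in Ioi (0 : ℝ), ((r ^ (γ / 2 - 1) * Real.exp (-r) : ℝ) : ℂ) * gaussEvol (cplxTime r z.2) (besselPotential γ f) z.1 := by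
  have ha : 0 < γ / 2 := half_pos hγ
  set g := besselPotential γ f with hg
  have hgi : Integrable (𝓕 (g : ℝ → ℂ)) := by rw [← SchwartzMap.fourier_coe]; exact (𝓕 g).integrable
  have hki : IntegrableOn (fun r : ℝ => r ^ (γ / 2 - 1) * Real.exp (-r)) (Ioi 0) := by
    have h := Real.GammaIntegral_convergent ha
    exact h.congr_fun (fun r _ => mul_comm _ _) measurableSet_Ioi
  have hint : Integrable (fun w : ℝ × ℝ => (cexp (I * (2 * Real.pi * w.2 * z.1 : ℝ)) *
      cexp (-cplxTime w.1 z.2 * ((2 * Real.pi * w.2 : ℝ) : ℂ) ^ 2)) * (((w.1 ^ (γ / 2 - 1) * Real.exp (-w.1) : ℝ) : ℂ) * 𝓕 (g : ℝ → ℂ) w.2))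
      ((volume.restrict (Ioi 0)).prod volume) := by
    have hm : Measurable fun w : ℝ × ℝ => cplxTime w.1 z.2 := by
      have h := measurable_cplxTime
      have h2 : Measurable fun w : ℝ × ℝ => (w.1, z.2) := by fun_prop
      exact h.comp h2
    refine (hki.ofReal.mul_prod hgi).bdd_mul (c := 1) ?_ ?_
    · refine Measurable.aestronglyMeasurable ?_
      exact Measurable.mul (by fun_prop) (hm.neg.mul (by fun_prop)).cexp
    · have h0 : ∀ᵐ w ∂((volume.restrict (Ioi (0 : ℝ))).prod (volume : Measure ℝ)), 0 < w.1 :=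
        Measure.quasiMeasurePreserving_fst.ae (ae_restrict_mem measurableSet_Ioi)
      filter_upwards [h0] with w hw
      rw [norm_mul, norm_cexp_I_mul, one_mul, Complex.norm_exp, Real.exp_le_one_iff]
      have : (-cplxTime w.1 z.2 * ((2 * Real.pi * w.2 : ℝ) : ℂ) ^ 2).re = -(w.1 * (2 * Real.pi * w.2) ^ 2) := by
        rw [← ofReal_pow, re_mul_ofReal]; simp
      rw [this]
      exact neg_nonpos.2 (by positivity)
  symm
  calc _ = ∫ r in Ioi (0 : ℝ), ∫ ξ : ℝ, (cexp (I * (2 * Real.pi * ξ * z.1 : ℝ)) *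
      cexp (-cplxTime r z.2 * ((2 * Real.pi * ξ : ℝ) : ℂ) ^ 2)) * (((r ^ (γ / 2 - 1) * Real.exp (-r) : ℝ) : ℂ) * 𝓕 (g : ℝ → ℂ) ξ) := by
        refine setIntegral_congr_fun measurableSet_Ioi fun r hr => ?_
        rw [gaussEvol_eq_integral_fourier (A := cplxTime r z.2) hr g.integrable, ← integral_const_mul]
        congr 1; ext ξ; ring
    _ = ∫ ξ : ℝ, ∫ r in Ioi (0 : ℝ), (cexp (I * (2 * Real.pi * ξ * z.1 : ℝ)) *
      cexp (-cplxTime r z.2 * ((2 * Real.pi * ξ : ℝ) : ℂ) ^ 2)) * (((r ^ (γ / 2 - 1) * Real.exp (-r) : ℝ) : ℂ) * 𝓕 (g : ℝ → ℂ) ξ) :=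
        integral_integral_swap hint
    _ = _ := by
        rw [schrodinger_eq_integral, ← integral_const_mul]
        congr 1; ext ξ
        set w := (2 * Real.pi * ξ) ^ 2 with hw
        have hw0 : 0 ≤ w := sq_nonneg _
        -- The `r`-integral of `r^{γ/2-1} e^{-(1+w)r}` is `Γ(γ/2) (1+w)^{-γ/2}`, which undoes the
        -- symbol of the Bessel potential.
        have h1 := Real.integral_rpow_mul_exp_neg_mul_Ioi ha (r := 1 + w) (by positivity)
        have h2 : ∫ r in Ioi (0 : ℝ), ((r ^ (γ / 2 - 1) * Real.exp (-((1 + w) * r)) : ℝ) : ℂ) =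
            ((1 / (1 + w)) ^ (γ / 2) * Real.Gamma (γ / 2) : ℝ) := by rw [← h1]; exact integral_ofReal
        have e : ∀ r : ℝ, (cexp (I * (2 * Real.pi * ξ * z.1 : ℝ)) *
            cexp (-cplxTime r z.2 * ((2 * Real.pi * ξ : ℝ) : ℂ) ^ 2)) * (((r ^ (γ / 2 - 1) * Real.exp (-r) : ℝ) : ℂ) * 𝓕 (g : ℝ → ℂ) ξ) =
            (cexp (I * (2 * Real.pi * ξ * z.1 : ℝ)) * cexp (I * (z.2 * w : ℝ)) * 𝓕 (g : ℝ → ℂ) ξ) *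
              ((r ^ (γ / 2 - 1) * Real.exp (-((1 + w) * r)) : ℝ) : ℂ) := by
          intro r
          have e1 : cplxTime r z.2 = (r : ℂ) - z.2 * I := by apply Complex.ext <;> simp
          have e2 : cexp (-cplxTime r z.2 * ((2 * Real.pi * ξ : ℝ) : ℂ) ^ 2) * cexp (-r : ℝ) =
              cexp (I * (z.2 * w : ℝ)) * cexp (-((1 + w) * r) : ℝ) := by
            rw [← Complex.exp_add, ← Complex.exp_add, e1]
            congr 1
            simp only [hw]
            push_cast; ring
          rw [ofReal_mul (r ^ (γ / 2 - 1)) (Real.exp (-r)), ofReal_mul (r ^ (γ / 2 - 1)) (Real.exp (-((1 + w) * r))), ofReal_exp, ofReal_exp]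
          linear_combination (cexp (I * (2 * Real.pi * ξ * z.1 : ℝ)) * (r ^ (γ / 2 - 1) : ℝ) * 𝓕 (g : ℝ → ℂ) ξ) * e2
        simp_rw [e]
        rw [integral_const_mul, h2, hg, fourier_besselPotential]
        have e3 : ((1 / (1 + w)) ^ (γ / 2) : ℝ) * besselSymbol γ ξ = 1 := by
          unfold besselSymbol
          rw [← hw, ← Real.mul_rpow (by positivity) (by positivity), one_div_mul_cancel (by positivity), Real.one_rpow]
        have e3' : (((1 / (1 + w)) ^ (γ / 2) : ℝ) : ℂ) * besselSymbol γ ξ = 1 := by rw [← ofReal_mul, e3, ofReal_one]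
        rw [ofReal_mul _ (Real.Gamma (γ / 2))]
        linear_combination (cexp (I * (2 * Real.pi * ξ * z.1 : ℝ)) * cexp (I * (z.2 * w : ℝ)) * 𝓕 (f : ℝ → ℂ) ξ * Real.Gamma (γ / 2)) * e3'

lemma enorm_schrodinger_le {γ : ℝ} (hγ : 0 < γ) (f : 𝓢(ℝ, ℂ)) (z : ℝ × ℝ) :
    ‖schrodinger f z‖ₑ ≤ ENNReal.ofReal (Real.Gamma (γ / 2))⁻¹ * ∫⁻ r in Ioi (0 : ℝ), ENNReal.ofReal (r ^ (γ / 2 - 1) * Real.exp (-r)) *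
      ‖gaussEvol (cplxTime r z.2) (besselPotential γ f) z.1‖ₑ := by
  have hG : 0 < Real.Gamma (γ / 2) := Real.Gamma_pos_of_pos (half_pos hγ)
  have e : schrodinger f z = ((Real.Gamma (γ / 2))⁻¹ : ℝ) * ((Real.Gamma (γ / 2) : ℂ) * schrodinger f z) := by
    rw [← mul_assoc, ← ofReal_mul, inv_mul_cancel₀ hG.ne', ofReal_one, one_mul]
  rw [e, schrodinger_eq_subordination hγ, enorm_mul, ← ofReal_norm, norm_real, Real.norm_of_nonneg (by positivity)]
  gcongr
  refine (enorm_integral_le_lintegral_enorm _).trans (le_of_eq ?_)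
  refine setLIntegral_congr_fun measurableSet_Ioi fun r hr => ?_
  have hr0 : 0 < r := hr
  rw [enorm_mul, ← ofReal_norm, norm_real, Real.norm_of_nonneg (by positivity)]

lemma measurable_evol_scale {g : ℝ → ℂ} (hg : Measurable g) :
    Measurable fun w : ℝ × ℝ × ℝ => gaussEvol (cplxTime w.1 w.2.2) g w.2.1 := by
  have h1 : Measurable fun w : ℝ × ℝ × ℝ => (cplxTime w.1 w.2.2, w.2.1) := by
    have h := measurable_cplxTime
    have h2 : Measurable fun w : ℝ × ℝ × ℝ => (w.1, w.2.2) := by fun_prop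
    exact (h.comp h2).prodMk (by fun_prop)
  have h2 := (measurable_gaussEvol hg).comp h1
  exact h2

lemma setLIntegral_gamma {a : ℝ} (ha : 0 < a) :
    ∫⁻ r in Ioi (0 : ℝ), ENNReal.ofReal (r ^ (a - 1) * Real.exp (-r)) = ENNReal.ofReal (Real.Gamma a) := by
  have h := Real.GammaIntegral_convergent ha
  rw [Real.Gamma_eq_integral ha, ofReal_integral_eq_lintegral_ofReal h
    ((ae_restrict_iff' measurableSet_Ioi).2 (.of_forall fun s hs => by have : 0 < s := hs
                                                                       positivity))]
  simp_rw [mul_comm]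

lemma evolExp_nonneg {β p : ℝ} (hβ : β ≤ 3) (hp2 : 2 ≤ p) (hp4 : p ≤ 4) : 0 ≤ evolExp β p := by
  have h1 := tubeExp_nonneg hβ
  have h2 : 0 ≤ (4 - p) / 2 := by linarith
  have h3 : 0 ≤ (p - 2) / 2 := by linarith
  have h4 : 0 ≤ (3 - β) / 2 := by linarith
  unfold evolExp; positivity

/-- The `L^p` estimate for the Schrödinger evolution with respect to a Frostman measure. -/
theorem lintegral_schrodinger_rpow_le {β p γ : ℝ} (hβ : β ∈ Icc (0 : ℝ) 3) (hp2 : 2 ≤ p) (hp4 : p ≤ 4) (hγ : evolExp β p < p * γ / 2) :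
    ∃ C : ℝ, 0 < C ∧ ∀ ν D, ParabolicFrostman β D ν → ∀ f : 𝓢(ℝ, ℂ),
      ∫⁻ z, ‖schrodinger f z‖ₑ ^ p ∂ν ≤ D * ENNReal.ofReal C * ∫⁻ y, ‖besselPotential γ f y‖ₑ ^ p := by
  have hE := evolExp_nonneg hβ.2 hp2 hp4
  have hp0 : 0 < p := by linarith
  have hγ0 : 0 < γ := by
    by_contra h
    have : p * γ ≤ 0 := mul_nonpos_of_nonneg_of_nonpos hp0.le (not_lt.1 h)
    linarith
  set m := p * γ / 2 - evolExp β p with hm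
  have hm0 : 0 < m := by linarith
  -- Half of the spare exponent `m` goes to Hölder against the finite measure `r^{ε-1} e^{-r} dr`.
  -- The `p`-th power of what remains is `r^κ`, which exactly cancels the loss `r^{-evolExp β p -
  -- m/2}` of the regularised estimate.
  set ε := m / (2 * p) with hε
  have hε0 : 0 < ε := by positivity
  obtain ⟨C₁, hC₁, h1⟩ := lintegral_evol_rpow hβ hp2 hp4 (half_pos hm0)
  obtain ⟨C₂, hC₂, h2⟩ := lintegral_evol_trivial hβ (by linarith : 1 ≤ p)
  set κ := evolExp β p + m / 2 with hκ
  have hκ0 : 0 < κ := by positivity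
  have hκε : p * (γ / 2 - ε) = κ := by rw [hκ, hε, hm]; field_simp; ring
  have hG : 0 < Real.Gamma (γ / 2) := Real.Gamma_pos_of_pos (half_pos hγ0)
  have hGε : 0 < Real.Gamma ε := Real.Gamma_pos_of_pos hε0
  have hGκ : 0 < Real.Gamma (ε + κ + 1) := Real.Gamma_pos_of_pos (by positivity)
  refine ⟨(Real.Gamma (γ / 2))⁻¹ ^ p * (Real.Gamma ε ^ (p - 1) * ((C₁ + C₂) * (Real.Gamma ε + Real.Gamma (ε + κ + 1)))), by positivity,
    fun ν D hν f => ?_⟩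
  have := hν.finite
  set g := besselPotential γ f with hg
  have hgb : BddIntegrable g := SchwartzMap.bddIntegrable g
  set G := ∫⁻ y, ‖g y‖ₑ ^ p with hGdef
  -- One bound covers both ranges: `r^{-κ}` for `r ≤ 1`, and `r` for `r ≥ 1`, where `e^{-r}` makes
  -- the growth harmless.
  have hall : ∀ r : ℝ, 0 < r → ∫⁻ z, ‖gaussEvol (cplxTime r z.2) g z.1‖ₑ ^ p ∂ν ≤
      D * ENNReal.ofReal ((C₁ + C₂) * (r ^ (-κ) + r)) * G := by
    intro r hr
    rcases le_total r 1 with hr1 | hr1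
    · refine (h1 ν D hν r hr hr1 g hgb).trans ?_
      gcongr
      · linarith
      · rw [show -evolExp β p - m / 2 = -κ by rw [hκ]; ring]; linarith
    · refine (h2 ν D hν r hr1 g hgb).trans ?_
      gcongr
      · linarith
      · have := Real.rpow_pos_of_pos hr (-κ); linarith
  have hms := measurable_evol_scale hgb.meas
  have hmk : Measurable fun r : ℝ => ENNReal.ofReal (r ^ (ε - 1) * Real.exp (-r)) := by fun_prop
  have hmz : ∀ z : ℝ × ℝ, Measurable fun r : ℝ => ENNReal.ofReal (r ^ (γ / 2 - ε)) * ‖gaussEvol (cplxTime r z.2) g z.1‖ₑ := by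
    intro z
    have h3 : Measurable fun r : ℝ => (r, z) := by fun_prop
    have h4 := hms.comp h3
    exact (by fun_prop : Measurable fun r : ℝ => ENNReal.ofReal (r ^ (γ / 2 - ε))).mul h4.enorm
  have hpt : ∀ z, ‖schrodinger f z‖ₑ ^ p ≤ ENNReal.ofReal ((Real.Gamma (γ / 2))⁻¹ ^ p * Real.Gamma ε ^ (p - 1)) *
      ∫⁻ r in Ioi (0 : ℝ), ENNReal.ofReal (r ^ (ε - 1) * Real.exp (-r) * r ^ κ) * ‖gaussEvol (cplxTime r z.2) g z.1‖ₑ ^ p := by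
    intro z
    have e1 : ∫⁻ r in Ioi (0 : ℝ), ENNReal.ofReal (r ^ (γ / 2 - 1) * Real.exp (-r)) * ‖gaussEvol (cplxTime r z.2) g z.1‖ₑ =
        ∫⁻ r in Ioi (0 : ℝ), ENNReal.ofReal (r ^ (ε - 1) * Real.exp (-r)) * (ENNReal.ofReal (r ^ (γ / 2 - ε)) *
          ‖gaussEvol (cplxTime r z.2) g z.1‖ₑ) := by
      refine setLIntegral_congr_fun measurableSet_Ioi fun r hr => ?_
      have hr0 : 0 < r := hr
      rw [← mul_assoc, ← ENNReal.ofReal_mul (by positivity), mul_right_comm, ← Real.rpow_add hr0]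
      congr 4; ring
    calc _ ≤ (ENNReal.ofReal (Real.Gamma (γ / 2))⁻¹ * ∫⁻ r in Ioi (0 : ℝ), ENNReal.ofReal (r ^ (γ / 2 - 1) * Real.exp (-r)) *
          ‖gaussEvol (cplxTime r z.2) g z.1‖ₑ) ^ p := by
          gcongr; exact enorm_schrodinger_le hγ0 f z
      _ ≤ ENNReal.ofReal ((Real.Gamma (γ / 2))⁻¹ ^ p) * ((∫⁻ r in Ioi (0 : ℝ), ENNReal.ofReal (r ^ (ε - 1) * Real.exp (-r))) ^ (p - 1) *
          ∫⁻ r in Ioi (0 : ℝ), ENNReal.ofReal (r ^ (ε - 1) * Real.exp (-r)) * (ENNReal.ofReal (r ^ (γ / 2 - ε)) *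
          ‖gaussEvol (cplxTime r z.2) g z.1‖ₑ) ^ p) := by
          rw [ENNReal.mul_rpow_of_nonneg _ _ hp0.le, ENNReal.ofReal_rpow_of_nonneg (by positivity) hp0.le, e1]
          gcongr
          exact lintegral_kernel_rpow_le (by linarith) hmk.aemeasurable (hmz z).aemeasurable
      _ = _ := by
          rw [setLIntegral_gamma hε0, ENNReal.ofReal_rpow_of_nonneg hGε.le (by linarith), ← mul_assoc, ← ENNReal.ofReal_mul (by positivity)]
          congr 1
          refine setLIntegral_congr_fun measurableSet_Ioi fun r hr => ?_
          have hr0 : 0 < r := hr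
          rw [ENNReal.mul_rpow_of_nonneg _ _ hp0.le, ENNReal.ofReal_rpow_of_nonneg (by positivity) hp0.le, ← mul_assoc,
            ← ENNReal.ofReal_mul (by positivity), ← Real.rpow_mul hr0.le, mul_comm _ p, hκε]
  have hm3 : Measurable fun w : (ℝ × ℝ) × ℝ => ENNReal.ofReal (w.2 ^ (ε - 1) * Real.exp (-w.2) * w.2 ^ κ) *
      ‖gaussEvol (cplxTime w.2 w.1.2) g w.1.1‖ₑ ^ p := by
    have h3 : Measurable fun w : (ℝ × ℝ) × ℝ => (w.2, w.1) := by fun_prop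
    have h4 := hms.comp h3
    exact (by fun_prop : Measurable fun w : (ℝ × ℝ) × ℝ => ENNReal.ofReal (w.2 ^ (ε - 1) * Real.exp (-w.2) * w.2 ^ κ)).mul (h4.enorm.pow_const p)
  calc _ ≤ ∫⁻ z, (ENNReal.ofReal ((Real.Gamma (γ / 2))⁻¹ ^ p * Real.Gamma ε ^ (p - 1)) *
      ∫⁻ r in Ioi (0 : ℝ), ENNReal.ofReal (r ^ (ε - 1) * Real.exp (-r) * r ^ κ) * ‖gaussEvol (cplxTime r z.2) g z.1‖ₑ ^ p) ∂ν :=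
        lintegral_mono hpt
    _ = ENNReal.ofReal ((Real.Gamma (γ / 2))⁻¹ ^ p * Real.Gamma ε ^ (p - 1)) *
      ∫⁻ r in Ioi (0 : ℝ), (∫⁻ z, ENNReal.ofReal (r ^ (ε - 1) * Real.exp (-r) * r ^ κ) * ‖gaussEvol (cplxTime r z.2) g z.1‖ₑ ^ p ∂ν) := by
        rw [lintegral_const_mul' _ _ ENNReal.ofReal_ne_top, lintegral_lintegral_swap hm3.aemeasurable]
    _ ≤ ENNReal.ofReal ((Real.Gamma (γ / 2))⁻¹ ^ p * Real.Gamma ε ^ (p - 1)) *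
      ∫⁻ r in Ioi (0 : ℝ), D * ENNReal.ofReal (C₁ + C₂) * G * (ENNReal.ofReal (r ^ (ε - 1) * Real.exp (-r)) +
        ENNReal.ofReal (r ^ (ε + κ + 1 - 1) * Real.exp (-r))) := by
        gcongr ENNReal.ofReal _ * ?_
        refine setLIntegral_mono' measurableSet_Ioi fun r hr => ?_
        have hr0 : 0 < r := hr
        rw [lintegral_const_mul' _ _ ENNReal.ofReal_ne_top]
        refine (mul_le_mul_right (hall r hr0) _).trans (le_of_eq ?_)
        have e : r ^ (ε - 1) * Real.exp (-r) * r ^ κ * ((C₁ + C₂) * (r ^ (-κ) + r)) =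
            (C₁ + C₂) * (r ^ (ε - 1) * Real.exp (-r) + r ^ (ε + κ + 1 - 1) * Real.exp (-r)) := by
          have e1 : r ^ κ * r ^ (-κ) = 1 := by rw [← Real.rpow_add hr0]; simp
          have e2 : r ^ (ε + κ + 1 - 1) = r ^ (ε - 1) * r ^ κ * r := by
            rw [← Real.rpow_add hr0, ← Real.rpow_add_one hr0.ne']; congr 1; ring
          rw [e2]
          linear_combination (r ^ (ε - 1) * Real.exp (-r) * (C₁ + C₂)) * e1
        refine Eq.trans (b := D * G * (ENNReal.ofReal (r ^ (ε - 1) * Real.exp (-r) * r ^ κ) *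
          ENNReal.ofReal ((C₁ + C₂) * (r ^ (-κ) + r)))) (by ring) ?_
        rw [← ENNReal.ofReal_add (by positivity) (by positivity), ← ENNReal.ofReal_mul (by positivity), e,
          ENNReal.ofReal_mul (by positivity)]
        ring
    _ = _ := by
        rw [lintegral_const_mul _ (by fun_prop), lintegral_add_left (by fun_prop), setLIntegral_gamma hε0, setLIntegral_gamma (by positivity),
          ← ENNReal.ofReal_add (by positivity) (by positivity), ← mul_assoc ((Real.Gamma (γ / 2))⁻¹ ^ p),
          ENNReal.ofReal_mul (p := (Real.Gamma (γ / 2))⁻¹ ^ p * _) (by positivity), ENNReal.ofReal_mul (p := C₁ + C₂) (by positivity)]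
        ring

/-! ### Sufficiency. -/

lemma measure_parabolicBall_le (β : ℝ) (μ : Measure (ℝ × ℝ)) (z : ℝ × ℝ) {ρ : ℝ} (hρ : 0 < ρ) :
    μ (parabolicBall z ρ) ≤ parabolicDensity β μ * ENNReal.ofReal (ρ ^ β) := by
  have h : ENNReal.ofReal (ρ ^ (-β)) * μ (parabolicBall z ρ) ≤ parabolicDensity β μ :=
    le_iSup_of_le z (le_iSup_of_le ρ (le_iSup_of_le hρ le_rfl))
  calc _ = ENNReal.ofReal (ρ ^ (-β)) * μ (parabolicBall z ρ) * ENNReal.ofReal (ρ ^ β) := by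
        rw [mul_right_comm, ← ENNReal.ofReal_mul (by positivity), ← Real.rpow_add hρ]
        simp
    _ ≤ _ := by gcongr

/-- The measure is finite on bounded pieces of the strip, since each lies in one parabolic ball. The
constant stays the density itself, which produces the factor `[μ]^{1/p}`; the whole strip is
recovered by monotone convergence. -/
lemma parabolicFrostman_restrict {β : ℝ} {μ : Measure (ℝ × ℝ)} (h : parabolicDensity β μ ≤ 1) (n : ℕ) :
    ParabolicFrostman β (parabolicDensity β μ) (μ.restrict (Icc (-(n : ℝ)) n ×ˢ Icc (0 : ℝ) 1)) := by
  refine ⟨⟨?_⟩, ?_, fun z ρ hρ => (Measure.restrict_apply_le _ _).trans (measure_parabolicBall_le β μ z hρ)⟩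
  · rw [Measure.restrict_apply_univ]
    have hsub : Icc (-(n : ℝ)) n ×ˢ Icc (0 : ℝ) 1 ⊆ parabolicBall (0, 0) (n + 2) := by
      rintro ⟨x, t⟩ ⟨hx, ht⟩
      simp only [mem_Icc] at hx ht
      have hn : (0 : ℝ) ≤ n := Nat.cast_nonneg n
      exact ⟨⟨by simp; linarith, by simp; linarith⟩, by simp; nlinarith, by simp; nlinarith⟩
    refine (measure_mono hsub).trans_lt ((measure_parabolicBall_le β μ _ (by positivity)).trans_lt ?_)
    exact ENNReal.mul_lt_top (h.trans_lt ENNReal.one_lt_top) ENNReal.ofReal_lt_top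
  · filter_upwards [ae_restrict_mem (measurableSet_Icc.prod measurableSet_Icc)] with z hz using hz.2

lemma setLIntegral_strip_eq_iSup (μ : Measure (ℝ × ℝ)) (F : ℝ × ℝ → ℝ≥0∞) :
    ∫⁻ z in univ ×ˢ Icc (0 : ℝ) 1, F z ∂μ = ⨆ n : ℕ, ∫⁻ z in Icc (-(n : ℝ)) n ×ˢ Icc (0 : ℝ) 1, F z ∂μ := by
  have hmono : Monotone fun n : ℕ => Icc (-(n : ℝ)) n ×ˢ Icc (0 : ℝ) 1 := by
    intro m n hmn
    have : (m : ℝ) ≤ n := by exact_mod_cast hmn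
    exact prod_mono (Icc_subset_Icc (by linarith) this) le_rfl
  rw [← setLIntegral_iUnion_of_directed F hmono.directed_le, ← iUnion_prod_const]
  congr 3
  refine (eq_univ_of_forall fun x => mem_iUnion.2 ?_).symm
  obtain ⟨n, hn⟩ := exists_nat_ge |x|
  exact ⟨n, abs_le.1 hn⟩

/-- The sufficient condition for fractal local smoothing. -/
theorem fractalLocalSmoothing_of_evolExp_lt {β p γ : ℝ} (hβ : β ∈ Icc (0 : ℝ) 3) (hp2 : 2 ≤ p) (hp4 : p ≤ 4)
    (hγ : evolExp β p < p * γ / 2) : FractalLocalSmoothing β p γ := by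
  obtain ⟨C, hC, h⟩ := lintegral_schrodinger_rpow_le hβ hp2 hp4 hγ
  have hp0 : 0 < p := by linarith
  have hpne : ENNReal.ofReal p ≠ 0 := by rwa [Ne, ENNReal.ofReal_eq_zero, not_le]
  refine ⟨C ^ (1 / p), by positivity, fun μ hμ f => ?_⟩
  rw [sobolevNorm_eq, eLpNorm_eq_lintegral_rpow_enorm_toReal hpne ENNReal.ofReal_ne_top,
    eLpNorm_eq_lintegral_rpow_enorm_toReal hpne ENNReal.ofReal_ne_top, ENNReal.toReal_ofReal hp0.le,
    ← ENNReal.ofReal_rpow_of_nonneg hC.le (by positivity), ← ENNReal.mul_rpow_of_nonneg _ _ (by positivity),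
    ← ENNReal.mul_rpow_of_nonneg _ _ (by positivity), mul_comm (ENNReal.ofReal C)]
  gcongr
  rw [setLIntegral_strip_eq_iSup]
  exact iSup_le fun n => h _ _ (parabolicFrostman_restrict hμ n) f

lemma evolExp_lt_of_one_le {β p γ : ℝ} (hβ : 1 ≤ β) (hp : 0 < p) (hγ : (3 - β) / 4 < γ) : evolExp β p < p * γ / 2 := by
  have : evolExp β p = p * ((3 - β) / 4) / 2 := by rw [evolExp, tubeExp, if_pos hβ]; ring
  rw [this]; gcongr

lemma evolExp_lt_of_le_one {β p γ : ℝ} (hβ : β ≤ 1) (hp : 0 < p) (hγ : (2 - β) / 2 - (1 - β) / p < γ) : evolExp β p < p * γ / 2 := by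
  rcases hβ.eq_or_lt with rfl | hβ
  · exact evolExp_lt_of_one_le le_rfl hp (by norm_num at hγ ⊢; exact hγ)
  have : evolExp β p = p * ((2 - β) / 2 - (1 - β) / p) / 2 := by
    rw [evolExp, tubeExp, if_neg (not_le.2 hβ)]; field_simp; ring
  rw [this]; gcongr

/-! ### Necessity: test measures and lower bounds. -/

/-- A smooth frequency cutoff supported in `[1, 2]`. -/
noncomputable def freqBump : ContDiffBump (3 / 2 : ℝ) := ⟨1 / 4, 1 / 2, by norm_num, by norm_num⟩

lemma freqBump_mem {x : ℝ} (h : freqBump x ≠ 0) : x ∈ Icc (1 : ℝ) 2 := by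
  have h1 : x ∈ Metric.ball (3 / 2 : ℝ) (1 / 2) := by
    have h2 := freqBump.support_eq
    rw [← show freqBump.rOut = 1 / 2 from rfl, ← h2]; exact h
  rw [Metric.mem_ball, Real.dist_eq, abs_lt] at h1
  constructor <;> linarith [h1.1, h1.2]

lemma integral_freqBump_pos : 0 < ∫ x, freqBump x := freqBump.integral_pos

lemma exists_schwartz_freqBump {a : ℝ} (ha : 0 < a) (b : ℝ) {e : ℝ → ℂ} (he : ContDiff ℝ ((⊤ : ℕ∞) : WithTop ℕ∞) e) :
    ∃ F : 𝓢(ℝ, ℂ), ∀ ξ, F ξ = (freqBump (a * ξ + b) : ℂ) * e ξ := by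
  have h1 : HasCompactSupport fun ξ : ℝ => (freqBump (a * ξ + b) : ℂ) * e ξ := by
    refine HasCompactSupport.of_support_subset_isCompact (K := Icc ((1 - b) / a) ((2 - b) / a)) isCompact_Icc fun ξ hξ => ?_
    have h2 : freqBump (a * ξ + b) ≠ 0 := fun h => hξ (by simp [h])
    have h3 := freqBump_mem h2
    exact ⟨by rw [div_le_iff₀ ha]; linarith [h3.1], by rw [le_div_iff₀ ha]; linarith [h3.2]⟩
  have h2 : ContDiff ℝ ((⊤ : ℕ∞) : WithTop ℕ∞) fun ξ : ℝ => (freqBump (a * ξ + b) : ℂ) * e ξ := by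
    have h3 : ContDiff ℝ ((⊤ : ℕ∞) : WithTop ℕ∞) fun ξ : ℝ => freqBump (a * ξ + b) := freqBump.contDiff.comp (by fun_prop)
    exact (ofRealCLM.contDiff.comp h3).mul he
  exact ⟨h1.toSchwartzMap h2, fun ξ => rfl⟩

/-- A fractal local smoothing estimate tested on a constant multiple of Lebesgue measure. -/
lemma FractalLocalSmoothing.test {β p γ : ℝ} (hp : 1 ≤ p) (h : FractalLocalSmoothing β p γ) : ∃ C : ℝ, 0 < C ∧
    ∀ (S : Set (ℝ × ℝ)) (M : ℝ≥0∞) (a : ℝ≥0∞) (g : 𝓢(ℝ, ℂ)), MeasurableSet S → S ⊆ univ ×ˢ Icc (0 : ℝ) 1 →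
      (∀ z ρ, 0 < ρ → M * volume (S ∩ parabolicBall z ρ) ≤ ENNReal.ofReal (ρ ^ β)) →
      (∀ z ∈ S, a ≤ ‖schrodinger (besselPotential (-γ) g) z‖ₑ) →
      a * (M * volume S) ^ (1 / p) ≤ ENNReal.ofReal C * eLpNorm g (ENNReal.ofReal p) volume := by
  obtain ⟨C, hC, h⟩ := h
  have hp0 : 0 < p := by linarith
  have hpne : ENNReal.ofReal p ≠ 0 := by rwa [Ne, ENNReal.ofReal_eq_zero, not_le]
  refine ⟨C, hC, fun S M a g hS hSs hM ha => ?_⟩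
  set μ : Measure (ℝ × ℝ) := M • volume.restrict S with hμ
  have hball : ∀ z ρ, MeasurableSet (parabolicBall z ρ) := fun z ρ => measurableSet_Ioo.prod measurableSet_Ioo
  have hd : parabolicDensity β μ ≤ 1 := by
    refine iSup_le fun z => iSup_le fun ρ => iSup_le fun hρ => ?_
    rw [hμ, Measure.smul_apply, Measure.restrict_apply (hball z ρ), smul_eq_mul, inter_comm]
    calc _ ≤ ENNReal.ofReal (ρ ^ (-β)) * ENNReal.ofReal (ρ ^ β) := by gcongr; exact hM z ρ hρ
      _ = 1 := by rw [← ENNReal.ofReal_mul (by positivity), ← Real.rpow_add hρ]; simp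
  have hmain := h μ hd (besselPotential (-γ) g)
  rw [sobolevNorm_eq, besselPotential_neg] at hmain
  calc a * (M * volume S) ^ (1 / p) ≤ eLpNorm (schrodinger (besselPotential (-γ) g)) (ENNReal.ofReal p) (μ.restrict (univ ×ˢ Icc (0 : ℝ) 1)) := by
        rw [eLpNorm_eq_lintegral_rpow_enorm_toReal hpne ENNReal.ofReal_ne_top, ENNReal.toReal_ofReal hp0.le]
        have e : a = (a ^ p) ^ (1 / p) := by rw [← ENNReal.rpow_mul, mul_one_div_cancel hp0.ne', ENNReal.rpow_one]
        conv_lhs => rw [e]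
        rw [← ENNReal.mul_rpow_of_nonneg _ _ (by positivity)]
        gcongr
        calc a ^ p * (M * volume S) = M * ∫⁻ z in S, a ^ p := by rw [setLIntegral_const]; ring
          _ ≤ M * ∫⁻ z in S, ‖schrodinger (besselPotential (-γ) g) z‖ₑ ^ p := by
              gcongr M * ?_
              exact setLIntegral_mono' hS fun z hz => ENNReal.rpow_le_rpow (ha z hz) hp0.le
          _ = ∫⁻ z, ‖schrodinger (besselPotential (-γ) g) z‖ₑ ^ p ∂μ := by rw [hμ, lintegral_smul_measure, smul_eq_mul]
          _ = _ := by
              have : μ.restrict (univ ×ˢ Icc (0 : ℝ) 1) = μ := by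
                rw [hμ, Measure.restrict_smul, Measure.restrict_restrict (MeasurableSet.univ.prod measurableSet_Icc), inter_eq_right.2 hSs]
              rw [this]
    _ ≤ _ := hmain
    _ ≤ ENNReal.ofReal C * 1 * eLpNorm g (ENNReal.ofReal p) volume := by
        gcongr
        exact ENNReal.rpow_le_one hd (by positivity)
    _ = _ := by rw [mul_one]

/-- Nonstationary lower bound: there is no cancellation when the phase is small. -/
lemma integral_le_norm_schrodinger (γ : ℝ) {F : 𝓢(ℝ, ℂ)} {z : ℝ × ℝ} {ω : ℂ} (hω : ‖ω‖ = 1) {φ h : ℝ → ℝ} (h0 : ∀ ξ, 0 ≤ h ξ)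
    (hF : ∀ ξ, cexp (I * (2 * Real.pi * ξ * z.1 : ℝ)) * cexp (I * (z.2 * (2 * Real.pi * ξ) ^ 2 : ℝ)) * F ξ = ω * (cexp (I * (φ ξ : ℝ)) * h ξ))
    (hφ : ∀ ξ, h ξ ≠ 0 → |φ ξ| ≤ 1 / 2) (hint : Integrable fun ξ => besselSymbol (-γ) ξ * h ξ) :
    (∫ ξ, besselSymbol (-γ) ξ * h ξ) / 2 ≤ ‖schrodinger (besselPotential (-γ) (𝓕⁻ F)) z‖ := by
  have hnorm : ∀ ξ, ‖F ξ‖ = h ξ := fun ξ => by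
    have := congrArg norm (hF ξ)
    simpa only [norm_mul, norm_cexp_I_mul, one_mul, hω, norm_real, Real.norm_of_nonneg (h0 ξ)] using this
  have e1 : schrodinger (besselPotential (-γ) (𝓕⁻ F)) z = ω * ∫ ξ, cexp (I * (φ ξ : ℝ)) * ((besselSymbol (-γ) ξ * h ξ : ℝ) : ℂ) := by
    rw [schrodinger_eq_integral, ← integral_const_mul]
    congr 1; ext ξ
    rw [fourier_besselPotential, ← SchwartzMap.fourier_coe, FourierTransform.fourier_fourierInv_eq, mul_left_comm, hF]
    push_cast; ring
  have hm : AEStronglyMeasurable (fun ξ => cexp (I * (φ ξ : ℝ)) * ((besselSymbol (-γ) ξ * h ξ : ℝ) : ℂ)) volume := by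
    have hb : Continuous fun ξ => besselSymbol (-γ) ξ := by
      unfold besselSymbol
      exact Continuous.rpow_const (by fun_prop) (fun ξ => Or.inl (by positivity))
    have h1 : Continuous fun ξ : ℝ => (besselSymbol (-γ) ξ : ℂ) * (ω⁻¹ * (cexp (I * (2 * Real.pi * ξ * z.1 : ℝ)) * cexp (I * (z.2 * (2 * Real.pi * ξ) ^ 2 : ℝ)) * F ξ)) := by
      have := F.continuous
      fun_prop
    refine h1.aestronglyMeasurable.congr (.of_forall fun ξ => ?_)
    have hω0 : ω ≠ 0 := by rintro rfl; simp at hω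
    simp only [hF]
    rw [inv_mul_cancel_left₀ hω0]; push_cast; ring
  have hI : Integrable (fun ξ => cexp (I * (φ ξ : ℝ)) * ((besselSymbol (-γ) ξ * h ξ : ℝ) : ℂ)) := by
    refine hint.mono hm (.of_forall fun ξ => ?_)
    rw [norm_mul, norm_cexp_I_mul, one_mul, norm_real]
  rw [e1, norm_mul, hω, one_mul]
  refine le_trans ?_ (Complex.re_le_norm _)
  rw [← integral_div, ← RCLike.re_eq_complex_re, ← integral_re hI]
  refine integral_mono (hint.div_const 2) hI.re fun ξ => ?_
  simp only [RCLike.re_eq_complex_re]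
  rw [re_mul_ofReal, mul_comm I, exp_ofReal_mul_I_re]
  have hb := besselSymbol_pos (-γ) ξ
  by_cases hh : h ξ = 0
  · simp [hh]
  have h1 := hφ ξ hh
  have h2 : 1 / 2 ≤ Real.cos (φ ξ) := by
    have := Real.one_sub_sq_div_two_le_cos (x := φ ξ)
    have h3 := sq_le_sq' (by linarith [(abs_le.1 h1).1]) (abs_le.1 h1).2
    linarith
  have h3 : 0 ≤ besselSymbol (-γ) ξ * h ξ := mul_nonneg hb.le (h0 ξ)
  nlinarith

/-- For angular frequency in `[N, 2N]` the ratio of `1 + (2πξ)²` to `N²` lies in `[1, 5]`, so the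
loss is a constant whatever the sign of `γ`. -/
lemma le_besselSymbol_neg (γ : ℝ) {N ξ : ℝ} (hN : 1 ≤ N) (hξ : 2 * Real.pi * ξ ∈ Icc N (2 * N)) :
    (5 : ℝ) ^ (-(|γ| / 2)) * N ^ (-γ) ≤ besselSymbol (-γ) ξ := by
  have hN0 : 0 < N := by linarith
  set q := (1 + (2 * Real.pi * ξ) ^ 2) / N ^ 2 with hq
  have hq1 : 1 ≤ q := by rw [hq, one_le_div (by positivity)]; nlinarith [hξ.1]
  have hq5 : q ≤ 5 := by rw [hq, div_le_iff₀ (by positivity)]; nlinarith [hξ.1, hξ.2]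
  have e : besselSymbol (-γ) ξ = q ^ (-γ / 2) * N ^ (-γ) := by
    have : 1 + (2 * Real.pi * ξ) ^ 2 = q * N ^ 2 := by rw [hq]; field_simp
    rw [besselSymbol, this, Real.mul_rpow (by positivity) (by positivity), ← Real.rpow_natCast, ← Real.rpow_mul hN0.le]
    congr 2; push_cast; ring
  rw [e]
  gcongr
  calc (5 : ℝ) ^ (-(|γ| / 2)) ≤ q ^ (-(|γ| / 2)) := Real.rpow_le_rpow_of_nonpos (by linarith) hq5 (by have := abs_nonneg γ; linarith)
    _ ≤ q ^ (-γ / 2) := Real.rpow_le_rpow_of_exponent_le hq1 (by have := le_abs_self γ; linarith)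

lemma exponent_le_of_forall_rpow_le {c C s t : ℝ} (hc : 0 < c) (h : ∀ N : ℝ, 1 ≤ N → c * N ^ s ≤ C * N ^ t) : s ≤ t := by
  by_contra hst
  have h1 := (tendsto_rpow_atTop (by linarith [not_le.1 hst] : 0 < s - t)).eventually_gt_atTop (C / c)
  obtain ⟨N, hN1, hN2⟩ := (h1.and (Filter.eventually_ge_atTop 1)).exists
  have hN0 : 0 < N := by linarith
  have h2 := h N hN2
  have h3 : N ^ s = N ^ (s - t) * N ^ t := by rw [← Real.rpow_add hN0]; congr 1; ring
  rw [h3, ← mul_assoc] at h2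
  have h4 := le_of_mul_le_mul_right h2 (by positivity)
  rw [div_lt_iff₀ hc] at hN1
  linarith

lemma volume_parabolicBall (z : ℝ × ℝ) {ρ : ℝ} (hρ : 0 < ρ) : volume (parabolicBall z ρ) = ENNReal.ofReal (4 * ρ ^ 3) := by
  rw [parabolicBall, Measure.volume_eq_prod, Measure.prod_prod, Real.volume_Ioo, Real.volume_Ioo, ← ENNReal.ofReal_mul (by linarith)]
  congr 1; ring

lemma volume_le_of_slices {A : Set (ℝ × ℝ)} (hA : MeasurableSet A) {T : Set ℝ} {w : ℝ≥0∞} (hT : ∀ z ∈ A, z.2 ∈ T)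
    (hw : ∀ t, volume {x : ℝ | (x, t) ∈ A} ≤ w) : volume A ≤ w * volume T := by
  rw [Measure.volume_eq_prod, Measure.prod_apply_symm hA, ← setLIntegral_const]
  refine (lintegral_mono fun t => ?_).trans (lintegral_indicator_le (fun _ => w) T)
  by_cases ht : t ∈ T
  · rw [indicator_of_mem ht]; exact hw t
  · rw [indicator_of_notMem ht]
    have : (fun x => (x, t)) ⁻¹' A = ∅ := eq_empty_of_forall_notMem fun x hx => ht (hT _ hx)
    rw [this, measure_empty]

lemma integral_freqBump_comp {a : ℝ} (ha : 0 < a) (b : ℝ) : ∫ ξ, freqBump (a * ξ + b) = a⁻¹ * ∫ x, freqBump x := by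
  have h := Measure.integral_comp_mul_left (fun y : ℝ => freqBump (y + b)) a
  rw [h, abs_of_pos (by positivity), smul_eq_mul, integral_add_right_eq_self (fun y => freqBump y)]

lemma integral_besselSymbol_freqBump (γ : ℝ) {N a b : ℝ} (hN : 1 ≤ N) (ha : 0 < a)
    (hsupp : ∀ ξ, freqBump (a * ξ + b) ≠ 0 → 2 * Real.pi * ξ ∈ Icc N (2 * N)) :
    Integrable (fun ξ => besselSymbol (-γ) ξ * freqBump (a * ξ + b)) ∧
    (5 : ℝ) ^ (-(|γ| / 2)) * N ^ (-γ) * (a⁻¹ * ∫ x, freqBump x) ≤ ∫ ξ, besselSymbol (-γ) ξ * freqBump (a * ξ + b) := by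
  obtain ⟨F, hF⟩ := exists_schwartz_freqBump ha b (e := fun _ => 1) contDiff_const
  have hF' : ∀ ξ, F ξ = (freqBump (a * ξ + b) : ℂ) := fun ξ => by rw [hF, mul_one]
  have hn : ∀ ξ, ‖F ξ‖ = freqBump (a * ξ + b) := fun ξ => by
    rw [hF', norm_real, Real.norm_of_nonneg freqBump.nonneg]
  have hi0 : Integrable fun ξ => freqBump (a * ξ + b) := by
    have := F.integrable (μ := volume) |>.norm
    simpa only [hn] using this
  have hi : Integrable fun ξ => besselSymbol (-γ) ξ * freqBump (a * ξ + b) := by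
    have h1 := (SchwartzMap.smulLeftCLM ℂ (fun ξ : ℝ => (besselSymbol (-γ) ξ : ℂ)) F).integrable (μ := volume) |>.norm
    refine h1.congr (.of_forall fun ξ => ?_)
    simp only
    rw [SchwartzMap.smulLeftCLM_apply_apply (hasTemperateGrowth_besselSymbol _), norm_smul, hn, norm_real,
      Real.norm_of_nonneg (besselSymbol_pos _ _).le]
  refine ⟨hi, ?_⟩
  rw [← integral_freqBump_comp ha b, ← integral_const_mul]
  refine integral_mono (hi0.const_mul _) hi fun ξ => ?_
  simp only
  by_cases h : freqBump (a * ξ + b) = 0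
  · simp [h]
  · exact mul_le_mul_of_nonneg_right (le_besselSymbol_neg γ hN (hsupp ξ h)) freqBump.nonneg

lemma fourierInv_schwartz_eq (F : 𝓢(ℝ, ℂ)) (x : ℝ) :
    (𝓕⁻ F : 𝓢(ℝ, ℂ)) x = ∫ ξ : ℝ, cexp (I * (2 * Real.pi * ξ * x : ℝ)) * F ξ := by
  rw [SchwartzMap.fourierInv_coe, Real.fourierInv_eq']
  congr 1; ext ξ
  rw [smul_eq_mul]
  congr 2
  simp; ring

/-! ### The wave packet example. -/

/-- The translated bump has inverse Fourier transform of constant size. -/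
lemma exists_translated_bump : ∃ g₀ : 𝓢(ℝ, ℂ), ∀ N : ℝ, ∃ F : 𝓢(ℝ, ℂ), (∀ ξ, F ξ = (freqBump (2 * Real.pi * ξ + (1 - N)) : ℂ)) ∧
    ∀ x, ‖(𝓕⁻ F : 𝓢(ℝ, ℂ)) x‖ = ‖g₀ x‖ := by
  have hex : ∀ N : ℝ, ∃ F : 𝓢(ℝ, ℂ), ∀ ξ, F ξ = (freqBump (2 * Real.pi * ξ + (1 - N)) : ℂ) := fun N => by
    obtain ⟨F, hF⟩ := exists_schwartz_freqBump (a := 2 * Real.pi) (by positivity) (1 - N) (e := fun _ => 1) contDiff_const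
    exact ⟨F, fun ξ => by rw [hF, mul_one]⟩
  obtain ⟨F₀, hF₀⟩ := hex 0
  refine ⟨𝓕⁻ F₀, fun N => ?_⟩
  obtain ⟨F, hF⟩ := hex N
  refine ⟨F, hF, fun x => ?_⟩
  have e : (𝓕⁻ F : 𝓢(ℝ, ℂ)) x = cexp (I * (N * x : ℝ)) * (𝓕⁻ F₀ : 𝓢(ℝ, ℂ)) x := by
    rw [fourierInv_schwartz_eq, fourierInv_schwartz_eq, ← integral_const_mul,
      ← integral_add_right_eq_self (fun ξ : ℝ => cexp (I * (2 * Real.pi * ξ * x : ℝ)) * F ξ) (N / (2 * Real.pi))]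
    congr 1; ext ξ
    rw [hF, hF₀, ← mul_assoc, ← Complex.exp_add]
    have e1 : 2 * Real.pi * (ξ + N / (2 * Real.pi)) = 2 * Real.pi * ξ + N := by field_simp
    rw [e1]
    congr 2
    · push_cast; ring
    · congr 1; ring
  rw [e, norm_mul, norm_cexp_I_mul, one_mul]

/-- Lower bound for a wave packet at frequency `N` along its tube. -/
lemma le_norm_schrodinger_packet (γ : ℝ) {N : ℝ} (hN : 1 ≤ N) {F : 𝓢(ℝ, ℂ)}
    (hF : ∀ ξ, F ξ = (freqBump (2 * Real.pi * ξ + (1 - N)) : ℂ)) {z : ℝ × ℝ} (hz1 : |z.1 + 2 * N * z.2| ≤ 1 / 4) (hz2 : |z.2| ≤ 1 / 4) :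
    (5 : ℝ) ^ (-(|γ| / 2)) * N ^ (-γ) * ((2 * Real.pi)⁻¹ * ∫ x, freqBump x) / 2 ≤ ‖schrodinger (besselPotential (-γ) (𝓕⁻ F)) z‖ := by
  have hsupp : ∀ ξ, freqBump (2 * Real.pi * ξ + (1 - N)) ≠ 0 → 0 ≤ 2 * Real.pi * ξ - N ∧ 2 * Real.pi * ξ - N ≤ 1 := fun ξ h => by
    have := freqBump_mem h
    constructor <;> linarith [this.1, this.2]
  obtain ⟨hi, hle⟩ := integral_besselSymbol_freqBump γ hN (a := 2 * Real.pi) (b := 1 - N) (by positivity) (fun ξ h => by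
    have := hsupp ξ h
    exact ⟨by linarith, by linarith⟩)
  refine le_trans ?_ (integral_le_norm_schrodinger γ (ω := cexp (I * (z.1 * N + z.2 * N ^ 2 : ℝ))) (norm_cexp_I_mul _)
    (φ := fun ξ => (z.1 + 2 * N * z.2) * (2 * Real.pi * ξ - N) + z.2 * (2 * Real.pi * ξ - N) ^ 2) (fun ξ => freqBump.nonneg) (fun ξ => ?_) (fun ξ h => ?_) hi)
  · gcongr
  · rw [hF, ← mul_assoc, ← Complex.exp_add, ← Complex.exp_add]
    congr 2
    push_cast; ring
  · obtain ⟨h1, h2⟩ := hsupp ξ h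
    set η := 2 * Real.pi * ξ - N
    calc _ ≤ |z.1 + 2 * N * z.2| * |η| + |z.2| * η ^ 2 := by
          refine (abs_add_le _ _).trans (le_of_eq ?_)
          rw [abs_mul, abs_mul, abs_of_nonneg (sq_nonneg η)]
      _ ≤ 1 / 4 * 1 + 1 / 4 * 1 := by
          gcongr
          · rw [abs_of_nonneg h1]; exact h2
          · exact pow_le_one₀ h1 h2
      _ = _ := by norm_num

/-- The tube of a wave packet. -/
def packetTube (N : ℝ) : Set (ℝ × ℝ) := {z | |z.1 + 2 * N * z.2| ≤ 1 / 4 ∧ z.2 ∈ Icc (0 : ℝ) (1 / 4)}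

lemma measurableSet_packetTube (N : ℝ) : MeasurableSet (packetTube N) :=
  (measurableSet_le (by fun_prop : Continuous fun z : ℝ × ℝ => |z.1 + 2 * N * z.2|).measurable
    (measurable_const (a := (1 / 4 : ℝ)))).inter (measurable_snd (measurableSet_Icc (a := (0 : ℝ)) (b := 1 / 4)))

lemma packetTube_slice (N t : ℝ) : volume {x : ℝ | |x + 2 * N * t| ≤ 1 / 4} = ENNReal.ofReal (1 / 2) := by
  have : {x : ℝ | |x + 2 * N * t| ≤ 1 / 4} = Icc (-(2 * N * t) - 1 / 4) (-(2 * N * t) + 1 / 4) := by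
    ext x; simp only [mem_ofPred_eq, abs_le, mem_Icc]
    constructor <;> rintro ⟨h1, h2⟩ <;> constructor <;> linarith
  rw [this, Real.volume_Icc]; congr 1; ring

lemma volume_packetTube (N : ℝ) : volume (packetTube N) = ENNReal.ofReal (1 / 8) := by
  rw [Measure.volume_eq_prod, Measure.prod_apply_symm (measurableSet_packetTube N)]
  have e : ∀ t : ℝ, volume ((fun x => (x, t)) ⁻¹' packetTube N) = (Icc (0 : ℝ) (1 / 4)).indicator (fun _ => ENNReal.ofReal (1 / 2)) t := by
    intro t
    by_cases ht : t ∈ Icc (0 : ℝ) (1 / 4)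
    · rw [indicator_of_mem ht, ← packetTube_slice N t]
      congr 1; ext x
      exact ⟨fun h => h.1, fun h => ⟨h, ht⟩⟩
    · rw [indicator_of_notMem ht]
      have : (fun x => (x, t)) ⁻¹' packetTube N = ∅ := eq_empty_of_forall_notMem fun x hx => ht hx.2
      rw [this, measure_empty]
  simp_rw [e]
  rw [lintegral_indicator measurableSet_Icc, setLIntegral_const, Real.volume_Icc, ← ENNReal.ofReal_mul (by norm_num)]
  norm_num

/-- A time slice has length at most the smaller of `2ρ` and `1/2`. Since the tube moves with speed
`2N`, it can meet the ball only during a time interval of length `(ρ + 1/4)/N`. -/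
lemma volume_packetTube_inter_le {N : ℝ} (hN : 0 < N) (z : ℝ × ℝ) {ρ : ℝ} (hρ : 0 < ρ) :
    volume (packetTube N ∩ parabolicBall z ρ) ≤ ENNReal.ofReal (min (2 * ρ) (1 / 2) * ((ρ + 1 / 4) / N)) := by
  have hm : MeasurableSet (packetTube N ∩ parabolicBall z ρ) :=
    (measurableSet_packetTube N).inter (measurableSet_Ioo.prod measurableSet_Ioo)
  have h := volume_le_of_slices hm (T := Icc (-z.1 / (2 * N) - (ρ + 1 / 4) / (2 * N)) (-z.1 / (2 * N) + (ρ + 1 / 4) / (2 * N)))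
    (w := ENNReal.ofReal (min (2 * ρ) (1 / 2))) (fun y hy => by
      obtain ⟨⟨h1, -⟩, ⟨h2, -⟩⟩ := hy
      rw [abs_le] at h1
      rw [mem_Icc, ← sub_div, ← add_div, div_le_iff₀ (by positivity), le_div_iff₀ (by positivity)]
      constructor <;> linarith [h1.1, h1.2, h2.1, h2.2]) (fun t => by
      rw [ENNReal.ofReal_min]
      refine le_min ?_ ?_
      · calc _ ≤ volume (Ioo (z.1 - ρ) (z.1 + ρ)) := measure_mono fun x hx => hx.2.1
          _ = _ := by rw [Real.volume_Ioo]; congr 1; ring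
      · rw [← packetTube_slice N t]
        exact measure_mono fun x hx => hx.1.1)
  refine h.trans (le_of_eq ?_)
  rw [Real.volume_Icc, ← ENNReal.ofReal_mul (by positivity)]
  congr 2; ring

/-- The exponent of the packet tube density. -/
noncomputable def packetExp (β : ℝ) : ℝ := if 1 ≤ β then (3 - β) / 2 else β

/-- The intersection has volume at most `4ρ³` and at most `4ρ/N`. For `β ≥ 1` the critical radius is
`N^{-1/2}`, where the two agree. For `β < 1` it is `ρ = N`, where a ball can hold the entire tube of
mass about `N^β`. -/
lemma packet_density_le {β : ℝ} (hβ : β ∈ Icc (0 : ℝ) 3) {N : ℝ} (hN : 1 ≤ N) (z : ℝ × ℝ) {ρ : ℝ} (hρ : 0 < ρ) :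
    ENNReal.ofReal (N ^ packetExp β / 4) * volume (packetTube N ∩ parabolicBall z ρ) ≤ ENNReal.ofReal (ρ ^ β) := by
  have hN0 : 0 < N := by linarith
  have hPe : 0 < N ^ packetExp β := by positivity
  have fin : ∀ v : ℝ, volume (packetTube N ∩ parabolicBall z ρ) ≤ ENNReal.ofReal v → N ^ packetExp β / 4 * v ≤ ρ ^ β →
      ENNReal.ofReal (N ^ packetExp β / 4) * volume (packetTube N ∩ parabolicBall z ρ) ≤ ENNReal.ofReal (ρ ^ β) := by
    intro v h1 h2
    calc _ ≤ ENNReal.ofReal (N ^ packetExp β / 4) * ENNReal.ofReal v := by gcongr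
      _ = ENNReal.ofReal (N ^ packetExp β / 4 * v) := by rw [ENNReal.ofReal_mul (by positivity)]
      _ ≤ _ := ENNReal.ofReal_le_ofReal h2
  have hball : volume (packetTube N ∩ parabolicBall z ρ) ≤ ENNReal.ofReal (4 * ρ ^ 3) :=
    (measure_mono inter_subset_right).trans (volume_parabolicBall z hρ).le
  have hmid := volume_packetTube_inter_le hN0 z hρ
  have hρ3 : ρ ^ 3 = ρ ^ (3 - β) * ρ ^ β := by rw [← Real.rpow_add hρ, ← Real.rpow_natCast]; congr 1; push_cast; ring
  have hmid1 : ρ ≤ 1 → volume (packetTube N ∩ parabolicBall z ρ) ≤ ENNReal.ofReal (4 * (ρ * N⁻¹)) := fun h1 => by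
    refine hmid.trans (ENNReal.ofReal_le_ofReal ?_)
    calc _ ≤ 2 * ρ * ((1 + 1 / 4) / N) := by gcongr; exact min_le_left _ _
      _ ≤ 2 * ρ * (2 / N) := by gcongr; norm_num
      _ = _ := by rw [div_eq_mul_inv]; ring
  have hmid2 : 1 ≤ ρ → volume (packetTube N ∩ parabolicBall z ρ) ≤ ENNReal.ofReal (4 * (ρ * N⁻¹)) := fun h1 => by
    refine hmid.trans (ENNReal.ofReal_le_ofReal ?_)
    calc _ ≤ 1 / 2 * ((ρ + ρ) / N) := by gcongr
                                         · exact min_le_right _ _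
                                         · linarith
      _ = ρ * N⁻¹ := by rw [div_eq_mul_inv]; ring
      _ ≤ _ := by have : 0 < ρ * N⁻¹ := by positivity
                  linarith
  have hmid' : volume (packetTube N ∩ parabolicBall z ρ) ≤ ENNReal.ofReal (4 * (ρ * N⁻¹)) :=
    (le_total ρ 1).elim hmid1 hmid2
  by_cases h1 : 1 ≤ β
  · have hθ : packetExp β = (3 - β) / 2 := if_pos h1
    have hNθ : N ^ packetExp β * N⁻¹ = N ^ ((1 - β) / 2) := by
      rw [hθ, ← Real.rpow_neg_one, ← Real.rpow_add hN0]; congr 1; ring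
    by_cases ha : ρ ^ 2 * N ≤ 1
    · refine fin _ hball ?_
      have e : N ^ packetExp β * ρ ^ (3 - β) ≤ 1 := by
        have : N ^ packetExp β * ρ ^ (3 - β) = (ρ ^ 2 * N) ^ ((3 - β) / 2) := by
          rw [Real.mul_rpow (by positivity) hN0.le, ← Real.rpow_natCast, ← Real.rpow_mul hρ.le, hθ, mul_comm]
          congr 2; push_cast; ring
        rw [this]
        exact Real.rpow_le_one (by positivity) ha (by linarith [hβ.2])
      calc _ = N ^ packetExp β * ρ ^ (3 - β) * ρ ^ β := by rw [hρ3]; ring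
        _ ≤ 1 * ρ ^ β := by gcongr
        _ = _ := one_mul _
    · refine fin _ hmid' ?_
      have hb : N ^ ((1 - β) / 2) ≤ ρ ^ (β - 1) := by
        rcases le_total ρ 1 with hρ1 | hρ1
        · have h3 : N⁻¹ ≤ ρ ^ 2 := by
            rw [inv_le_iff_one_le_mul₀ hN0]; exact (not_le.1 ha).le
          calc N ^ ((1 - β) / 2) = (N⁻¹) ^ ((β - 1) / 2) := by
                rw [Real.inv_rpow hN0.le, ← Real.rpow_neg hN0.le]; congr 1; ring
            _ ≤ (ρ ^ 2) ^ ((β - 1) / 2) := Real.rpow_le_rpow (by positivity) h3 (by linarith)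
            _ = _ := by rw [← Real.rpow_natCast, ← Real.rpow_mul hρ.le]; congr 1; push_cast; ring
        · exact (Real.rpow_le_one_of_one_le_of_nonpos hN (by linarith)).trans (Real.one_le_rpow hρ1 (by linarith))
      calc _ = ρ * (N ^ packetExp β * N⁻¹) := by ring
        _ ≤ ρ * ρ ^ (β - 1) := by rw [hNθ]; gcongr
        _ = _ := by rw [← Real.rpow_one_add' hρ.le (by linarith)]; congr 1; ring
  · have h1' : β ≤ 1 := (not_le.1 h1).le
    have hθ : packetExp β = β := if_neg h1
    have hNθ : N ^ packetExp β * N⁻¹ = N ^ (β - 1) := by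
      rw [hθ, Real.rpow_sub_one hN0.ne']; rfl
    by_cases ha : ρ * N ≤ 1
    · refine fin _ hball ?_
      have hρ1 : ρ ≤ 1 := by nlinarith
      have e : N ^ packetExp β * ρ ^ (3 - β) ≤ 1 := by
        have : N ^ packetExp β * ρ ^ (3 - β) = (ρ * N) ^ β * ρ ^ (3 - 2 * β) := by
          rw [Real.mul_rpow hρ.le hN0.le, hθ, mul_comm (ρ ^ β), mul_assoc, ← Real.rpow_add hρ]
          congr 2; ring
        rw [this]
        exact mul_le_one₀ (Real.rpow_le_one (by positivity) ha hβ.1) (by positivity) (Real.rpow_le_one hρ.le hρ1 (by linarith))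
      calc _ = N ^ packetExp β * ρ ^ (3 - β) * ρ ^ β := by rw [hρ3]; ring
        _ ≤ 1 * ρ ^ β := by gcongr
        _ = _ := one_mul _
    · by_cases hb : N ≤ ρ
      · refine fin (1 / 8) ((measure_mono inter_subset_left).trans (volume_packetTube N).le) ?_
        rw [hθ]
        calc N ^ β / 4 * (1 / 8) ≤ N ^ β := by have : 0 < N ^ β := by positivity
                                               linarith
          _ ≤ _ := Real.rpow_le_rpow hN0.le hb hβ.1
      · refine fin _ hmid' ?_
        have hc : ρ * N ^ (β - 1) ≤ ρ ^ β := by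
          rcases le_total ρ 1 with hρ1 | hρ1
          · have h3 : N⁻¹ ≤ ρ := by
              rw [inv_le_iff_one_le_mul₀ hN0]; exact (not_le.1 ha).le
            calc ρ * N ^ (β - 1) = ρ * (N⁻¹) ^ (1 - β) := by
                  rw [Real.inv_rpow hN0.le, ← Real.rpow_neg hN0.le]; congr 2; ring
              _ ≤ ρ * ρ ^ (1 - β) := by gcongr
              _ = ρ ^ (2 - β) := by rw [← Real.rpow_one_add' hρ.le (by linarith)]; congr 1; ring
              _ ≤ ρ ^ β := Real.rpow_le_rpow_of_exponent_ge hρ hρ1 (by linarith)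
          · calc ρ * N ^ (β - 1) ≤ ρ * ρ ^ (β - 1) := by
                  gcongr ρ * ?_
                  exact Real.rpow_le_rpow_of_nonpos hρ (not_le.1 hb).le (by linarith)
              _ = ρ ^ β := by rw [Real.rpow_sub_one hρ.ne']; field_simp
        calc _ = ρ * (N ^ packetExp β * N⁻¹) := by ring
          _ ≤ _ := by rw [hNθ]; exact hc

/-- Necessity from wave packets. -/
theorem FractalLocalSmoothing.packetExp_le {β p γ : ℝ} (hβ : β ∈ Icc (0 : ℝ) 3) (hp : 1 ≤ p) (h : FractalLocalSmoothing β p γ) :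
    packetExp β / p ≤ γ := by
  obtain ⟨C, hC, ht⟩ := h.test hp
  have hp0 : 0 < p := by linarith
  obtain ⟨g₀, hg₀⟩ := exists_translated_bump
  have hB := integral_freqBump_pos
  set c := (5 : ℝ) ^ (-(|γ| / 2)) * ((2 * Real.pi)⁻¹ * ∫ x, freqBump x) / 2 with hc
  have hc0 : 0 < c := by have := Real.pi_pos; positivity
  have hfin : eLpNorm g₀ (ENNReal.ofReal p) volume ≠ ∞ := (g₀.eLpNorm_lt_top _ _).ne
  have key : packetExp β / p - γ ≤ 0 := by
    -- The solution has size `N^{-γ}` on a tube of mass `N^{packetExp β}/32`, while the norm of the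
    -- datum does not depend on `N`.
    refine exponent_le_of_forall_rpow_le (c := c * (1 / 32) ^ (1 / p)) (C := C * (eLpNorm g₀ (ENNReal.ofReal p) volume).toReal) (by positivity)
      (fun N hN => ?_)
    have hN0 : 0 < N := by linarith
    obtain ⟨F, hF, hn⟩ := hg₀ N
    have h1 := ht (packetTube N) (ENNReal.ofReal (N ^ packetExp β / 4)) (ENNReal.ofReal (c * N ^ (-γ))) (𝓕⁻ F) (measurableSet_packetTube N)
      (fun z hz => ⟨mem_univ _, hz.2.1, hz.2.2.trans (by norm_num)⟩) (fun z ρ hρ => packet_density_le hβ hN z hρ) (fun z hz => by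
        rw [← ofReal_norm]
        apply ENNReal.ofReal_le_ofReal
        refine le_trans (le_of_eq ?_) (le_norm_schrodinger_packet γ hN hF hz.1 (by rw [abs_of_nonneg hz.2.1]; exact hz.2.2))
        rw [hc]; ring)
    rw [volume_packetTube, eLpNorm_congr_norm_ae (.of_forall hn), ← ENNReal.ofReal_mul (by positivity), ENNReal.ofReal_rpow_of_nonneg (by positivity) (by positivity),
      ← ENNReal.ofReal_mul (by positivity), ← ENNReal.ofReal_toReal hfin, ← ENNReal.ofReal_mul hC.le] at h1
    have h2 := (ENNReal.ofReal_le_ofReal_iff (by positivity)).1 h1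
    rw [Real.rpow_zero, mul_one]
    refine le_trans (le_of_eq ?_) h2
    rw [show N ^ packetExp β / 4 * (1 / 8) = (1 / 32) * N ^ packetExp β by ring, Real.mul_rpow (by norm_num) (by positivity), ← Real.rpow_mul hN0.le,
      sub_eq_add_neg, Real.rpow_add hN0, mul_one_div]
    ring
  linarith

/-! ### The focusing example. -/

/-- Young's inequality for the evolution, with the norm on the kernel. -/
lemma lintegral_gaussEvol_rpow_le {A : ℂ} {p : ℝ} (hp : 1 ≤ p) {k : ℝ → ℂ} (hk : Measurable k) :
    ∫⁻ x, ‖gaussEvol A k x‖ₑ ^ p ≤ (∫⁻ y, ‖k y‖ₑ) ^ p * ∫⁻ x, ‖gaussKernel A x‖ₑ ^ p := by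
  have hm : Measurable (gaussKernel A) := (continuous_gaussKernel A).measurable
  have hmx : ∀ x : ℝ, Measurable fun y => ‖gaussKernel A (x - y)‖ₑ := fun x => (hm.comp (by fun_prop)).enorm
  have hmm : Measurable fun w : ℝ × ℝ => ‖k w.2‖ₑ * ‖gaussKernel A (w.1 - w.2)‖ₑ ^ p := by
    have h1 : Measurable fun w : ℝ × ℝ => gaussKernel A (w.1 - w.2) := hm.comp (by fun_prop)
    exact (hk.comp measurable_snd).enorm.mul (h1.enorm.pow_const p)
  calc _ ≤ ∫⁻ x, (∫⁻ y, ‖k y‖ₑ) ^ (p - 1) * ∫⁻ y, ‖k y‖ₑ * ‖gaussKernel A (x - y)‖ₑ ^ p := by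
        refine lintegral_mono fun x => ?_
        refine le_trans ?_ (lintegral_kernel_rpow_le hp hk.enorm.aemeasurable (hmx x).aemeasurable)
        gcongr
        refine (enorm_gaussEvol_le k x).trans (le_of_eq ?_)
        simp_rw [mul_comm]
    _ = (∫⁻ y, ‖k y‖ₑ) ^ (p - 1) * ∫⁻ y, (∫⁻ x, ‖k y‖ₑ * ‖gaussKernel A (x - y)‖ₑ ^ p) := by
        rw [lintegral_const_mul _ hmm.lintegral_prod_right', lintegral_lintegral_swap hmm.aemeasurable]
    _ = (∫⁻ y, ‖k y‖ₑ) ^ (p - 1) * ((∫⁻ y, ‖k y‖ₑ) * ∫⁻ x, ‖gaussKernel A x‖ₑ ^ p) := by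
        congr 1
        rw [← lintegral_mul_const _ hk.enorm]
        refine lintegral_congr fun y => ?_
        rw [lintegral_const_mul' _ _ enorm_ne_top, lintegral_sub_right_eq_self (fun x => ‖gaussKernel A x‖ₑ ^ p)]
    _ = _ := by
        rw [← mul_assoc]
        congr 1
        conv_lhs => rw [← ENNReal.rpow_one (∫⁻ y, ‖k y‖ₑ)]
        rw [← ENNReal.rpow_mul, one_mul, ← ENNReal.rpow_add_of_nonneg _ _ (by linarith) zero_le_one, sub_add_cancel]

/-- At complex time `N⁻² + i/2` the kernel is bounded by `1` and is a Gaussian of width about `N`.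
Being at most `1`, its `p`-th power is below the first power, so the bound is the same for all `p ≥
1`. -/
lemma lintegral_gaussKernel_half_le {p : ℝ} (hp : 1 ≤ p) {N : ℝ} (hN : 1 ≤ N) :
    ∫⁻ x, ‖gaussKernel (cplxTime ((N ^ 2)⁻¹) (-(1 / 2))) x‖ₑ ^ p ≤ ENNReal.ofReal (√(Real.pi * 5) * N) := by
  have hN0 : 0 < N := by linarith
  set r := (N ^ 2)⁻¹ with hr
  have hr0 : 0 < r := by positivity
  have hr1 : r ≤ 1 := inv_le_one_of_one_le₀ (one_le_pow₀ hN)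
  have hle : ∀ x, ‖gaussKernel (cplxTime r (-(1 / 2))) x‖ ≤ Real.exp (-(r / 5) * x ^ 2) := by
    intro x
    rw [norm_gaussKernel_cplxTime]
    have h1 : (2 * Real.pi)⁻¹ * √(Real.pi / √(r ^ 2 + (-(1 / 2)) ^ 2)) ≤ 1 := by
      have h2 : 1 / 2 ≤ √(r ^ 2 + (-(1 / 2)) ^ 2) := Real.le_sqrt_of_sq_le (by nlinarith [sq_nonneg r])
      have h3 : √(Real.pi / √(r ^ 2 + (-(1 / 2)) ^ 2)) ≤ 2 * Real.pi := by
        rw [Real.sqrt_le_left (by positivity)]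
        calc Real.pi / √(r ^ 2 + (-(1 / 2)) ^ 2) ≤ Real.pi / (1 / 2) := by gcongr
          _ ≤ _ := by nlinarith [Real.pi_gt_three]
      rw [inv_mul_le_one₀ (by positivity)]; exact h3
    have h2 : Real.exp (-(r / (4 * (r ^ 2 + (-(1 / 2)) ^ 2))) * x ^ 2) ≤ Real.exp (-(r / 5) * x ^ 2) := by
      apply Real.exp_le_exp.2
      have : r / 5 ≤ r / (4 * (r ^ 2 + (-(1 / 2)) ^ 2)) := by gcongr; nlinarith
      nlinarith [sq_nonneg x]
    calc _ ≤ 1 * Real.exp (-(r / 5) * x ^ 2) := by gcongr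
      _ = _ := one_mul _
  calc _ ≤ ∫⁻ x, ENNReal.ofReal (Real.exp (-(r / 5) * x ^ 2)) := by
        refine lintegral_mono fun x => ?_
        simp only
        have h1 : ‖gaussKernel (cplxTime r (-(1 / 2))) x‖ₑ ≤ ENNReal.ofReal (Real.exp (-(r / 5) * x ^ 2)) := by
          rw [← ofReal_norm]; exact ENNReal.ofReal_le_ofReal (hle x)
        have h2 : ENNReal.ofReal (Real.exp (-(r / 5) * x ^ 2)) ≤ 1 := by
          rw [ENNReal.ofReal_le_one, Real.exp_le_one_iff, neg_mul]
          exact neg_nonpos.2 (by positivity)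
        calc _ ≤ ‖gaussKernel (cplxTime r (-(1 / 2))) x‖ₑ ^ (1 : ℝ) := ENNReal.rpow_le_rpow_of_exponent_ge (h1.trans h2) hp
          _ ≤ _ := by rw [ENNReal.rpow_one]; exact h1
    _ = _ := by
        rw [← ofReal_integral_eq_lintegral_ofReal (integrable_exp_neg_mul_sq (by positivity)) (.of_forall fun _ => (Real.exp_pos _).le), integral_gaussian]
        congr 1
        have : Real.pi / (r / 5) = (Real.pi * 5) * N ^ 2 := by rw [hr]; field_simp
        rw [this, Real.sqrt_mul (by positivity), Real.sqrt_sq hN0.le]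

/-- A chirped bump at frequency scale `N`: its inverse Fourier transform spreads over an interval of length `N`. -/
lemma exists_chirp {p : ℝ} (hp : 1 ≤ p) : ∃ K : ℝ, 0 ≤ K ∧ ∀ N : ℝ, 1 ≤ N → ∃ F : 𝓢(ℝ, ℂ),
    (∀ ξ, F ξ = (freqBump (2 * Real.pi / N * ξ + 0) : ℂ) * cexp (I * (-(1 / 2) * (2 * Real.pi * ξ) ^ 2 : ℝ))) ∧
    ∫⁻ x, ‖(𝓕⁻ F : 𝓢(ℝ, ℂ)) x‖ₑ ^ p ≤ ENNReal.ofReal (K * N) := by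
  -- The factor `e^{(2πξ/N)²}`, harmless on the support of the bump, compensates the damping
  -- `e^{-N⁻²(2πξ)²}`. The chirp then becomes a Gaussian evolution of a profile whose `L¹` norm does
  -- not depend on `N`.
  have hex : ∀ N : ℝ, 0 < N → ∃ Q : 𝓢(ℝ, ℂ), ∀ ξ, Q ξ = (freqBump (2 * Real.pi / N * ξ + 0) : ℂ) * cexp (((2 * Real.pi * ξ / N) ^ 2 : ℝ)) :=
    fun N hN => exists_schwartz_freqBump (by positivity) 0 (by
      have h1 : ContDiff ℝ ((⊤ : ℕ∞) : WithTop ℕ∞) fun ξ : ℝ => (2 * Real.pi * ξ / N) ^ 2 := by fun_prop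
      exact (ofRealCLM.contDiff.comp h1).cexp)
  obtain ⟨Q₁, hQ₁⟩ := hex 1 one_pos
  set k₁ : 𝓢(ℝ, ℂ) := 𝓕⁻ Q₁ with hk₁
  have hfin : ∫⁻ y, ‖k₁ y‖ₑ ≠ ∞ := k₁.integrable.2.ne
  refine ⟨(∫⁻ y, ‖k₁ y‖ₑ).toReal ^ p * √(Real.pi * 5), by positivity, fun N hN => ?_⟩
  have hN0 : 0 < N := by linarith
  obtain ⟨F, hF⟩ := exists_schwartz_freqBump (a := 2 * Real.pi / N) (by positivity) 0
    (e := fun ξ => cexp (I * (-(1 / 2) * (2 * Real.pi * ξ) ^ 2 : ℝ))) (by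
      have h1 : ContDiff ℝ ((⊤ : ℕ∞) : WithTop ℕ∞) fun ξ : ℝ => -(1 / 2) * (2 * Real.pi * ξ) ^ 2 := by fun_prop
      exact (contDiff_const.mul (ofRealCLM.contDiff.comp h1)).cexp)
  obtain ⟨Q, hQ⟩ := hex N hN0
  set k : 𝓢(ℝ, ℂ) := 𝓕⁻ Q with hk
  have hkk : ∀ x, k x = N * k₁ (N * x) := by
    intro x
    rw [hk, hk₁, fourierInv_schwartz_eq, fourierInv_schwartz_eq]
    have h := Measure.integral_comp_mul_left (fun ξ : ℝ => cexp (I * (2 * Real.pi * ξ * (N * x) : ℝ)) * Q₁ ξ) N⁻¹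
    rw [inv_inv, abs_of_pos hN0, Complex.real_smul] at h
    rw [← h]
    congr 1; ext ξ
    rw [hQ, hQ₁]
    rw [show 2 * Real.pi * (N⁻¹ * ξ) * (N * x) = 2 * Real.pi * ξ * x by field_simp,
      show 2 * Real.pi / 1 * (N⁻¹ * ξ) = 2 * Real.pi / N * ξ by ring, show 2 * Real.pi * (N⁻¹ * ξ) / 1 = 2 * Real.pi * ξ / N by ring]
  have hk1 : ∫⁻ y, ‖k y‖ₑ = ∫⁻ y, ‖k₁ y‖ₑ := by
    have h := lintegral_comp_div (f := fun x => ‖k x‖ₑ) k.continuous.measurable.enorm hN0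
    have e : ∀ x, ‖k (x / N)‖ₑ = ENNReal.ofReal N * ‖k₁ x‖ₑ := fun x => by
      rw [hkk, enorm_mul, mul_div_cancel₀ _ hN0.ne', ← ofReal_norm (N : ℂ), norm_real, Real.norm_of_nonneg hN0.le]
    simp_rw [e] at h
    rw [lintegral_const_mul' _ _ ENNReal.ofReal_ne_top] at h
    exact ((ENNReal.mul_right_inj (by rwa [Ne, ENNReal.ofReal_eq_zero, not_le]) ENNReal.ofReal_ne_top).1 h).symm
  have hg : ∀ x, (𝓕⁻ F : 𝓢(ℝ, ℂ)) x = gaussEvol (cplxTime ((N ^ 2)⁻¹) (-(1 / 2))) k x := by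
    intro x
    rw [fourierInv_schwartz_eq, gaussEvol_eq_integral_fourier (by simp; positivity) k.integrable]
    congr 1; ext ξ
    rw [hk, ← SchwartzMap.fourier_coe, FourierTransform.fourier_fourierInv_eq, hF, hQ]
    have e1 : cplxTime ((N ^ 2)⁻¹) (-(1 / 2)) = ((N : ℂ) ^ 2)⁻¹ + 1 / 2 * I := by
      apply Complex.ext
      · simp [← ofReal_pow, ← ofReal_inv]
      · simp [← ofReal_pow, ← ofReal_inv]
    have e2 : cexp (I * (-(1 / 2) * (2 * Real.pi * ξ) ^ 2 : ℝ)) = cexp (((2 * Real.pi * ξ / N) ^ 2 : ℝ)) *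
        cexp (-cplxTime ((N ^ 2)⁻¹) (-(1 / 2)) * ((2 * Real.pi * ξ : ℝ) : ℂ) ^ 2) := by
      rw [← Complex.exp_add, e1]
      congr 1
      push_cast
      field_simp
      ring
    rw [e2]; ring
  refine ⟨F, hF, ?_⟩
  simp_rw [hg]
  refine (lintegral_gaussEvol_rpow_le hp k.continuous.measurable).trans ?_
  rw [hk1, mul_assoc, ENNReal.ofReal_mul (by positivity), ← ENNReal.ofReal_rpow_of_nonneg ENNReal.toReal_nonneg (by linarith), ENNReal.ofReal_toReal hfin]
  gcongr
  exact lintegral_gaussKernel_half_le hp hN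

/-- Lower bound for the focusing chirp at its focus. -/
lemma le_norm_schrodinger_chirp (γ : ℝ) {N : ℝ} (hN : 1 ≤ N) {F : 𝓢(ℝ, ℂ)}
    (hF : ∀ ξ, F ξ = (freqBump (2 * Real.pi / N * ξ + 0) : ℂ) * cexp (I * (-(1 / 2) * (2 * Real.pi * ξ) ^ 2 : ℝ))) {z : ℝ × ℝ}
    (hz1 : |z.1| ≤ 1 / (8 * N)) (hz2 : |z.2 - 1 / 2| ≤ 1 / (16 * N ^ 2)) :
    (5 : ℝ) ^ (-(|γ| / 2)) * N ^ (-γ) * ((2 * Real.pi / N)⁻¹ * ∫ x, freqBump x) / 2 ≤ ‖schrodinger (besselPotential (-γ) (𝓕⁻ F)) z‖ := by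
  have hN0 : 0 < N := by linarith
  have hsupp : ∀ ξ, freqBump (2 * Real.pi / N * ξ + 0) ≠ 0 → 2 * Real.pi * ξ ∈ Icc N (2 * N) := fun ξ h => by
    have h1 := freqBump_mem h
    have h2 : 2 * Real.pi * ξ = (2 * Real.pi / N * ξ + 0) * N := by field_simp; ring
    rw [h2]
    constructor <;> nlinarith [h1.1, h1.2]
  obtain ⟨hi, hle⟩ := integral_besselSymbol_freqBump γ hN (a := 2 * Real.pi / N) (b := 0) (by positivity) hsupp
  refine le_trans ?_ (integral_le_norm_schrodinger γ (ω := 1) (by simp)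
    (φ := fun ξ => z.1 * (2 * Real.pi * ξ) + (z.2 - 1 / 2) * (2 * Real.pi * ξ) ^ 2) (fun ξ => freqBump.nonneg) (fun ξ => ?_) (fun ξ h => ?_) hi)
  · gcongr
  · rw [hF, one_mul, mul_left_comm, ← Complex.exp_add, ← Complex.exp_add, mul_comm]
    congr 2
    push_cast; ring
  · have h1 := hsupp ξ h
    set η := 2 * Real.pi * ξ
    have hη0 : 0 ≤ η := hN0.le.trans h1.1
    calc _ ≤ |z.1| * η + |z.2 - 1 / 2| * η ^ 2 := by
          refine (abs_add_le _ _).trans (le_of_eq ?_)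
          rw [abs_mul z.1 η, abs_mul (z.2 - 1 / 2) (η ^ 2), abs_of_nonneg (sq_nonneg η), abs_of_nonneg hη0]
      _ ≤ 1 / (8 * N) * (2 * N) + 1 / (16 * N ^ 2) * (2 * N) ^ 2 := by
          gcongr
          · exact h1.2
          · exact h1.2
      _ = _ := by field_simp; norm_num

/-- The neighbourhood of the focus. -/
def focusBox (N : ℝ) : Set (ℝ × ℝ) := Icc (-(1 / (8 * N))) (1 / (8 * N)) ×ˢ Icc (1 / 2 - 1 / (16 * N ^ 2)) (1 / 2 + 1 / (16 * N ^ 2))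

lemma volume_focusBox {N : ℝ} (hN : 0 < N) : volume (focusBox N) = ENNReal.ofReal (1 / (32 * N ^ 3)) := by
  rw [focusBox, Measure.volume_eq_prod, Measure.prod_prod, Real.volume_Icc, Real.volume_Icc, ← ENNReal.ofReal_mul (by rw [sub_neg_eq_add]; positivity)]
  congr 1; field_simp; ring

/-- The critical radius is `1/N`, the parabolic scale of the box. Below it the volume `4ρ³` of the
ball suffices; above it the total mass `N^{-β}/128` does. -/
lemma focus_density_le {β : ℝ} (hβ : β ∈ Icc (0 : ℝ) 3) {N : ℝ} (hN : 1 ≤ N) (z : ℝ × ℝ) {ρ : ℝ} (hρ : 0 < ρ) :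
    ENNReal.ofReal (N ^ (3 - β) / 4) * volume (focusBox N ∩ parabolicBall z ρ) ≤ ENNReal.ofReal (ρ ^ β) := by
  have hN0 : 0 < N := by linarith
  have hP : 0 < N ^ (3 - β) := by positivity
  by_cases h : ρ * N ≤ 1
  · calc _ ≤ ENNReal.ofReal (N ^ (3 - β) / 4) * ENNReal.ofReal (4 * ρ ^ 3) := by
          gcongr
          exact (measure_mono inter_subset_right).trans (volume_parabolicBall z hρ).le
      _ = ENNReal.ofReal ((ρ * N) ^ (3 - β) * ρ ^ β) := by
          rw [← ENNReal.ofReal_mul (by positivity)]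
          congr 1
          have hρ3 : ρ ^ 3 = ρ ^ (3 - β) * ρ ^ β := by rw [← Real.rpow_add hρ, ← Real.rpow_natCast]; congr 1; push_cast; ring
          rw [hρ3, Real.mul_rpow hρ.le hN0.le]; ring
      _ ≤ ENNReal.ofReal (1 * ρ ^ β) := by
          gcongr
          exact Real.rpow_le_one (by positivity) h (by linarith [hβ.2])
      _ = _ := by rw [one_mul]
  · calc _ ≤ ENNReal.ofReal (N ^ (3 - β) / 4) * ENNReal.ofReal (1 / (32 * N ^ 3)) := by
          gcongr
          exact (measure_mono inter_subset_left).trans (volume_focusBox hN0).le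
      _ = ENNReal.ofReal (N ^ (-β) / 128) := by
          rw [← ENNReal.ofReal_mul (by positivity)]
          congr 1
          have : N ^ (3 - β) = N ^ 3 * N ^ (-β) := by rw [sub_eq_add_neg, Real.rpow_add hN0]; norm_cast
          rw [this]; field_simp; norm_num
      _ ≤ _ := by
          apply ENNReal.ofReal_le_ofReal
          have h3 : N⁻¹ ≤ ρ := by rw [inv_le_iff_one_le_mul₀ hN0]; exact (not_le.1 h).le
          calc N ^ (-β) / 128 ≤ N ^ (-β) := div_le_self (by positivity) (by norm_num)
            _ = (N⁻¹) ^ β := by rw [Real.inv_rpow hN0.le, Real.rpow_neg hN0.le]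
            _ ≤ ρ ^ β := Real.rpow_le_rpow (by positivity) h3 hβ.1

/-- Necessity from focusing. -/
theorem FractalLocalSmoothing.focus_le {β p γ : ℝ} (hβ : β ∈ Icc (0 : ℝ) 3) (hp : 1 ≤ p) (h : FractalLocalSmoothing β p γ) :
    1 - (β + 1) / p ≤ γ := by
  obtain ⟨C, hC, ht⟩ := h.test hp
  have hp0 : 0 < p := by linarith
  have hpne : ENNReal.ofReal p ≠ 0 := by rwa [Ne, ENNReal.ofReal_eq_zero, not_le]
  obtain ⟨K, hK, hch⟩ := exists_chirp hp
  have hB := integral_freqBump_pos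
  set c := (5 : ℝ) ^ (-(|γ| / 2)) * ((2 * Real.pi)⁻¹ * ∫ x, freqBump x) / 2 with hc
  have hc0 : 0 < c := by have := Real.pi_pos; positivity
  -- At the focus the solution has size `N^{1-γ}` on mass of order `N^{-β}`, while the datum has
  -- `L^p` norm at most of order `N^{1/p}`.
  have key : 1 - γ - β / p ≤ 1 / p := by
    refine exponent_le_of_forall_rpow_le (c := c * (1 / 128) ^ (1 / p)) (C := C * K ^ (1 / p)) (by positivity)
      (fun N hN => ?_)
    have hN0 : 0 < N := by linarith
    obtain ⟨F, hF, hn⟩ := hch N hN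
    have hN2 : 1 / (16 * N ^ 2) ≤ 1 / 16 := by
      apply one_div_le_one_div_of_le (by norm_num)
      nlinarith
    have h1 := ht (focusBox N) (ENNReal.ofReal (N ^ (3 - β) / 4)) (ENNReal.ofReal (c * N ^ (1 - γ))) (𝓕⁻ F) (measurableSet_Icc.prod measurableSet_Icc)
      (fun z hz => ⟨mem_univ _, by linarith [hz.2.1], by linarith [hz.2.2]⟩) (fun z ρ hρ => focus_density_le hβ hN z hρ) (fun z hz => by
        rw [← ofReal_norm]
        apply ENNReal.ofReal_le_ofReal
        refine le_trans (le_of_eq ?_) (le_norm_schrodinger_chirp γ hN hF (abs_le.2 hz.1) (abs_le.2 ⟨by linarith [hz.2.1], by linarith [hz.2.2]⟩))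
        rw [hc, sub_eq_add_neg, Real.rpow_add hN0, Real.rpow_one, inv_div]
        field_simp)
    rw [volume_focusBox hN0, ← ENNReal.ofReal_mul (by positivity), ENNReal.ofReal_rpow_of_nonneg (by positivity) (by positivity),
      ← ENNReal.ofReal_mul (by positivity)] at h1
    have hG : eLpNorm (𝓕⁻ F : 𝓢(ℝ, ℂ)) (ENNReal.ofReal p) volume ≤ ENNReal.ofReal ((K * N) ^ (1 / p)) := by
      rw [eLpNorm_eq_lintegral_rpow_enorm_toReal hpne ENNReal.ofReal_ne_top, ENNReal.toReal_ofReal hp0.le,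
        ← ENNReal.ofReal_rpow_of_nonneg (by positivity) (by positivity)]
      gcongr
    have h2 := h1.trans (mul_le_mul_right hG _)
    rw [← ENNReal.ofReal_mul hC.le] at h2
    have h3 := (ENNReal.ofReal_le_ofReal_iff (by positivity)).1 h2
    rw [Real.mul_rpow hK hN0.le, ← mul_assoc] at h3
    refine le_trans (le_of_eq ?_) h3
    have e : N ^ (3 - β) / 4 * (1 / (32 * N ^ 3)) = (1 / 128) * N ^ (-β) := by
      have : N ^ (3 - β) = N ^ 3 * N ^ (-β) := by rw [sub_eq_add_neg, Real.rpow_add hN0]; norm_cast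
      rw [this]; field_simp; norm_num
    rw [e, Real.mul_rpow (by norm_num) (by positivity), ← Real.rpow_mul hN0.le, show 1 - γ - β / p = (1 - γ) + (-β * (1 / p)) by ring,
      Real.rpow_add hN0]
    ring
  have : (β + 1) / p = β / p + 1 / p := by ring
  linarith

theorem mainTheorem4 :
    (∀ β p γ : ℝ, 2 ≤ p → p ≤ 4 →
      (β ∈ Icc (1 : ℝ) 3 ∧ (3 - β) / 4 < γ ∨
        β ∈ Icc (0 : ℝ) 1 ∧ (2 - β) / 2 - (1 - β) / p < γ) →
      FractalLocalSmoothing β p γ) ∧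
    (∀ β p γ : ℝ, 1 ≤ p → FractalLocalSmoothing β p γ →
      (β ∈ Icc (1 : ℝ) 3 → max (1 - (β + 1) / p) ((3 - β) / (2 * p)) ≤ γ) ∧
      (β ∈ Icc (0 : ℝ) 1 → max (1 - (β + 1) / p) (β / p) ≤ γ)) := by
  refine ⟨fun β p γ hp2 hp4 h => ?_, fun β p γ hp h => ⟨fun hβ => ?_, fun hβ => ?_⟩⟩
  · rcases h with ⟨hβ, hγ⟩ | ⟨hβ, hγ⟩
    · exact fractalLocalSmoothing_of_evolExp_lt ⟨by linarith [hβ.1], hβ.2⟩ hp2 hp4 (evolExp_lt_of_one_le hβ.1 (by linarith) hγ)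
    · exact fractalLocalSmoothing_of_evolExp_lt ⟨hβ.1, by linarith [hβ.2]⟩ hp2 hp4 (evolExp_lt_of_le_one hβ.2 (by linarith) hγ)
  · have hβ' : β ∈ Icc (0 : ℝ) 3 := ⟨by linarith [hβ.1], hβ.2⟩
    refine max_le (h.focus_le hβ' hp) ?_
    have h1 := h.packetExp_le hβ' hp
    rwa [packetExp, if_pos hβ.1, div_div] at h1
  · have hβ' : β ∈ Icc (0 : ℝ) 3 := ⟨hβ.1, by linarith [hβ.2]⟩
    refine max_le (h.focus_le hβ' hp) ?_
    have h1 := h.packetExp_le hβ' hp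
    -- At `β = 1` the exponent `packetExp` takes its first branch, whose value `(3 - 1)/2` agrees
    -- with `β`.
    rcases hβ.2.eq_or_lt with rfl | hlt
    · rw [packetExp, if_pos le_rfl] at h1
      norm_num at h1 ⊢
      exact h1
    · rwa [packetExp, if_neg (not_le.2 hlt)] at h1
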